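/- **Setting.** Let $(Y_i,\mathbf X_i,\varepsilon_i)_{i\ge 1}$, $\mathbf X_i=(X_{i1},\dots,X_{id})$, $d\ge 1$, satisfy the additive model $$Y_i=c+\sum_{\alpha=1}^d m_\alpha(X_{i\alpha})+\sigma(\mathbf X_i)\varepsilon_i,\qquad E\,m_\alpha(X_{i\alpha})=0\quad(\alpha=1,\dots,d),$$ where all $\mathbf X_i$ have the same density $f$ on $[0,1]^d$, with marginal densities $f_\alpha$. Assume: * (A1) $m_1\in C^{(2)}[0,1]$, and there is a constant $C_\infty$ such that $m_2,\dots,m_d$ are Lipschitz on $[0,1]$ with constant $C_\infty$. * (A2) There are $K_0,\lambda_0>0$ with $\alpha(k)\le K_0e^{-\lambda_0k}$ for all $k\ge1$, where, with $\mathbf Z_i=(\mathbf X_i,\varepsilon_i)$, $\alpha(k)=\sup|P(B\cap C)-P(B)P(C)|$ over all $t$, $B\in\sigma\{\mathbf Z_s,s\le t\}$ and $C\in\sigma\{\mathbf Z_s,s\ge t+k\}$. * (A3) $E(\varepsilon_i|\mathbf X_i)=0$, $E(\varepsilon_i^2|\mathbf X_i)=1$, and for some $\delta>1/2$ and $M_\delta<\infty$,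 $E(|\varepsilon_i|^{2+\delta}|\mathbf X_i)<M_\delta$ for all $i$; the noise is white conditionally on the predictors, that is, $E(\varepsilon_i\varepsilon_j|\mathbf X_i,\mathbf X_j)=0$ for $i\ne j$; and $\sigma$ is continuous on $[0,1]^d$ with $0<c_\sigma\le\sigma\le C_\sigma<\infty$ there. * (A4) $f$ is continuous on $[0,1]^d$ with $0<c_f\le f\le C_f<\infty$ there; each $f_\alpha$ is continuously differentiable on $[0,1]$ and satisfies $c_f\le f_\alpha\le C_f$ there. * (A5) $K\ge0$ is symmetric, supported on $[-1,1]$, Lipschitz on $[-1,1]$, and $\int K=1$; the bandwidth $h=h_n$ satisfies $c_hn^{-1/5}\le h\le C_hn^{-1/5}$ for some constants $c_h,C_h>0$ and all large $n$. * (A6) The integer $N=N_n$ satisfies $c_Nn^{2/5}\log n\le N\le C_Nn^{2/5}\log n$ for some constants $c_N,C_N>0$ and all large $n$. **Estimators.** Write $H=1/(N+1)$, $I_J=\mathbf 1_{[JH,(J+1)H)}$ for $J=0,\dots,N$, $\|\varphi\|_{2,\alpha}=\{E\varphi^2(X_{1\alpha})\}^{1/2}$, and for $J=1,\dots,N$ $$b_{J,\alpha}=I_J-\frac{\|I_J\|_{2,\alpha}}{\|I_{J-1}\|_{2,\alpha}}I_{J-1},\qquad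 B_{J,\alpha}=b_{J,\alpha}/\|b_{J,\alpha}\|_{2,\alpha}.$$ Let $\hat\lambda_0,\hat\lambda_{J,\alpha}$ be (any measurable choice of) minimizers of $\sum_{i=1}^n\{Y_i-\lambda_0-\sum_{\alpha=1}^d\sum_{J=1}^N\lambda_{J,\alpha}B_{J,\alpha}(X_{i\alpha})\}^2$, and put $$\hat m_\alpha(x)=\sum_{J=1}^N\hat\lambda_{J,\alpha}B_{J,\alpha}(x)-\frac1n\sum_{i=1}^n\sum_{J=1}^N\hat\lambda_{J,\alpha}B_{J,\alpha}(X_{i\alpha}),\qquad \hat c=\frac1n\sum_{i=1}^nY_i,$$ $$\hat Y_{i1}=Y_i-\hat c-\sum_{\alpha=2}^d\hat m_\alpha(X_{i\alpha}),\qquad Y_{i1}=Y_i-c-\sum_{\alpha=2}^dm_\alpha(X_{i\alpha}).$$ With $K_h(u)=K(u/h)/h$, the spline-backfitted kernel estimator and the oracle smoother are $$\hat m_1^*(x_1)=\frac{\sum_{i=1}^nK_h(X_{i1}-x_1)\hat Y_{i1}}{\sum_{i=1}^nK_h(X_{i1}-x_1)},\qquad \tilde m_1^*(x_1)=\frac{\sum_{i=1}^nK_h(X_{i1}-x_1)Y_{i1}}{\sum_{i=1}^nK_h(X_{i1}-x_1)}.$$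 **Theorem 2.1.** Under (A1)–(A6), as $n\to\infty$, $$\sup_{x_1\in[0,1]}|\hat m_1^*(x_1)-\tilde m_1^*(x_1)|=o_p(n^{-2/5}).$$ Hence, for every fixed $x_1$ that lies in $[h,1-h]$ for all large $n$ (that is, for every $x_1\in(0,1)$), $$\sqrt{nh}\,\{\hat m_1^*(x_1)-m_1(x_1)-b_1(x_1)h^2\}\xrightarrow{D}N\{0,v_1^2(x_1)\},$$ where $$b_1(x_1)=\int u^2K(u)\,du\,\Big\{\tfrac12m_1''(x_1)f_1(x_1)+m_1'(x_1)f_1'(x_1)\Big\}f_1^{-1}(x_1),$$ $$v_1^2(x_1)=\int K^2(u)\,du\;E[\sigma^2(X_1,\dots,X_d)\,|\,X_1=x_1]\,f_1^{-1}(x_1).$$ -/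

import Mathlib

open MeasureTheory ProbabilityTheory Filter Topology Set
open scoped NNReal ENNReal

noncomputable section

namespace SPBK

/-! ### Deterministic ingredients: splines, least squares, kernel smoothing

A sample of size `n` consists of the observations with indices `0, …, n - 1`, and the `d` predictor
coordinates are indexed by `Fin d`, so that `0 : Fin d` is the coordinate of interest. -/

/-- Indicator of the `J`-th (`J = 0, …, N`) of the `N + 1` equally spaced subintervals of `[0, 1]`,
that is, of `[J H, (J + 1) H)` with `H = 1 / (N + 1)`. -/
def bin (N J : ℕ) : ℝ → ℝ :=
  Set.indicator (Set.Ico ((J : ℝ) / ((N : ℝ) + 1)) (((J : ℝ) + 1) / ((N : ℝ) + 1))) (fun _ => 1)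

/-- Theoretical norm `‖φ‖₂ = (E φ²(ξ))^{1/2}`, where `ξ` has law `ν`. -/
def l2Norm (ν : Measure ℝ) (φ : ℝ → ℝ) : ℝ := Real.sqrt (∫ t, φ t ^ 2 ∂ν)

/-- The `N` functions `I_{J+1} - (‖I_{J+1}‖₂ / ‖I_J‖₂) I_J`, where `I_0, …, I_N` are the bin
indicators and `J = 0, …, N - 1`. -/
def centeredSpline (ν : Measure ℝ) (N : ℕ) (J : Fin N) (t : ℝ) : ℝ :=
  bin N (J + 1) t - l2Norm ν (bin N (J + 1)) / l2Norm ν (bin N J) * bin N J t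

/-- The centered splines, standardized to have theoretical norm one. -/
def splineBasis (ν : Measure ℝ) (N : ℕ) (J : Fin N) (t : ℝ) : ℝ :=
  centeredSpline ν N J t / l2Norm ν (centeredSpline ν N J)

/-- Least squares criterion of the additive spline regression of `y` on `x`, for the coefficient
vector `lam = (λ₀, (λ_{J,α}))`, where `B α J` are the basis functions in coordinate `α`. -/
def lsCriterion {d N : ℕ} (B : Fin d → Fin N → ℝ → ℝ) (n : ℕ) (x : ℕ → Fin d → ℝ) (y : ℕ → ℝ)
    (lam : ℝ × (Fin d → Fin N → ℝ)) : ℝ :=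
  ∑ i ∈ Finset.range n, (y i - lam.1 - ∑ α, ∑ J, lam.2 α J * B α J (x i α)) ^ 2

/-- `lam` solves the least squares problem. -/
def IsLeastSquares {d N : ℕ} (B : Fin d → Fin N → ℝ → ℝ) (n : ℕ) (x : ℕ → Fin d → ℝ) (y : ℕ → ℝ)
    (lam : ℝ × (Fin d → Fin N → ℝ)) : Prop :=
  ∀ lam', lsCriterion B n x y lam ≤ lsCriterion B n x y lam'

/-- Pilot spline estimator of the `α`-th component: the empirically centered `α`-th summand of the
fitted additive spline. -/
def pilot {d N : ℕ} (B : Fin d → Fin N → ℝ → ℝ) (n : ℕ) (x : ℕ → Fin d → ℝ)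
    (lam : ℝ × (Fin d → Fin N → ℝ)) (α : Fin d) (t : ℝ) : ℝ :=
  (∑ J, lam.2 α J * B α J t)
    - (n : ℝ)⁻¹ * ∑ i ∈ Finset.range n, ∑ J, lam.2 α J * B α J (x i α)

/-- Pseudo-responses `Ŷ_{i1} = Y_i - Ȳ_n - ∑_{α ≠ 1} m̂_α(X_{iα})`. -/
def pseudoResponse {d N : ℕ} [NeZero d] (B : Fin d → Fin N → ℝ → ℝ) (n : ℕ)
    (x : ℕ → Fin d → ℝ) (y : ℕ → ℝ) (lam : ℝ × (Fin d → Fin N → ℝ)) (i : ℕ) : ℝ :=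
  y i - (n : ℝ)⁻¹ * (∑ k ∈ Finset.range n, y k)
    - ∑ α ∈ Finset.univ.erase (0 : Fin d), pilot B n x lam α (x i α)

/-- Oracle responses `Y_{i1} = Y_i - c - ∑_{α ≠ 1} m_α(X_{iα})`. -/
def oracleResponse {d : ℕ} [NeZero d] (c : ℝ) (m : Fin d → ℝ → ℝ)
    (x : ℕ → Fin d → ℝ) (y : ℕ → ℝ) (i : ℕ) : ℝ :=
  y i - c - ∑ α ∈ Finset.univ.erase (0 : Fin d), m α (x i α)

/-- Rescaled kernel `K_h(u) = K(u / h) / h`. -/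
def scaledKernel (K : ℝ → ℝ) (h u : ℝ) : ℝ := K (u / h) / h

/-- Nadaraya–Watson smoother at `t` of the responses `y` on the scalar predictors `x`. -/
def nadarayaWatson (K : ℝ → ℝ) (h : ℝ) (n : ℕ) (x y : ℕ → ℝ) (t : ℝ) : ℝ :=
  (∑ i ∈ Finset.range n, scaledKernel K h (x i - t) * y i)
    / ∑ i ∈ Finset.range n, scaledKernel K h (x i - t)

/-- The spline-backfitted kernel estimator of the first component, computed from the least squares
coefficients `lam`. -/
def spbk {d N : ℕ} [NeZero d] (K : ℝ → ℝ) (h : ℝ) (B : Fin d → Fin N → ℝ → ℝ) (n : ℕ)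
    (x : ℕ → Fin d → ℝ) (y : ℕ → ℝ) (lam : ℝ × (Fin d → Fin N → ℝ)) (t : ℝ) : ℝ :=
  nadarayaWatson K h n (fun i => x i 0) (pseudoResponse B n x y lam) t

/-- The infeasible oracle smoother of the first component. -/
def oracleSmoother {d : ℕ} [NeZero d] (K : ℝ → ℝ) (h : ℝ) (c : ℝ) (m : Fin d → ℝ → ℝ) (n : ℕ)
    (x : ℕ → Fin d → ℝ) (y : ℕ → ℝ) (t : ℝ) : ℝ :=
  nadarayaWatson K h n (fun i => x i 0) (oracleResponse c m x y) t

/-- `∫_{[0,1]^{d-1}} g(x) dx_{-α}` at `x_α = t`. The integral runs over all of `[0,1]^d`, but the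
integrand does not depend on the `α`-th coordinate, which contributes a factor one. -/
def integrateOthers {d : ℕ} (g : (Fin d → ℝ) → ℝ) (α : Fin d) (t : ℝ) : ℝ :=
  ∫ x in Set.Icc (0 : Fin d → ℝ) 1, g (Function.update x α t)

/-- Marginal density `f_α` of the `α`-th coordinate under the density `f` on `[0,1]^d`. -/
def marginalDensity {d : ℕ} (f : (Fin d → ℝ) → ℝ) (α : Fin d) (t : ℝ) : ℝ :=
  integrateOthers f α t

/-- `E[σ²(X_1, …, X_d) | X_1 = t]` for `X` with density `f` on `[0,1]^d`. -/
def condVariance {d : ℕ} [NeZero d] (f sig : (Fin d → ℝ) → ℝ) (t : ℝ) : ℝ :=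
  integrateOthers (fun x => sig x ^ 2 * f x) 0 t / marginalDensity f 0 t

/-- Asymptotic bias coefficient
`b₁ = ∫ u² K(u) du · (m₁'' f₁ / 2 + m₁' f₁') / f₁`. -/
def biasCoeff (K m₁ f₁ : ℝ → ℝ) (t : ℝ) : ℝ :=
  (∫ u, u ^ 2 * K u) * (deriv (deriv m₁) t * f₁ t / 2 + deriv m₁ t * deriv f₁ t) / f₁ t

/-- Asymptotic variance `v₁² = ∫ K²(u) du · E[σ²(X) | X_1 = t] / f₁(t)`. -/
def asympVar {d : ℕ} [NeZero d] (K : ℝ → ℝ) (f sig : (Fin d → ℝ) → ℝ) (t : ℝ) : ℝ :=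
  (∫ u, K u ^ 2) * condVariance f sig t / marginalDensity f 0 t

/-! ### The assumptions -/

/-- The `k`-th `α`-mixing coefficient of a process `Z`: the supremum of `|P(B ∩ C) - P(B) P(C)|`
over all `t`, all `B ∈ σ(Z_s, s ≤ t)` and all `C ∈ σ(Z_s, s ≥ t + k)`. -/
def alphaMixing {Ω E : Type*} [MeasurableSpace Ω] [MeasurableSpace E] (P : Measure Ω)
    (Z : ℕ → Ω → E) (k : ℕ) : ℝ :=
  sSup {r : ℝ | ∃ (t : ℕ) (B C : Set Ω),
    MeasurableSet[⨆ s ∈ Set.Iic t, MeasurableSpace.comap (Z s) inferInstance] B ∧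
    MeasurableSet[⨆ s ∈ Set.Ici (t + k), MeasurableSpace.comap (Z s) inferInstance] C ∧
    r = |P.real (B ∩ C) - P.real B * P.real C|}

/-- The process of predictors and noise is geometrically `α`-mixing. -/
def GeometricallyMixing {Ω : Type*} [MeasurableSpace Ω] {d : ℕ} (P : Measure Ω)
    (X : ℕ → Ω → Fin d → ℝ) (ε : ℕ → Ω → ℝ) : Prop :=
  ∃ K₀ > (0 : ℝ), ∃ lam₀ > (0 : ℝ), ∀ k : ℕ, 1 ≤ k →
    alphaMixing P (fun i ω => (X i ω, ε i ω)) k ≤ K₀ * Real.exp (-lam₀ * k)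

/-- The additive regression model `Y_i = c + ∑_α m_α(X_{iα}) + σ(X_i) ε_i` with the identifiability
constraints `E m_α(X_{iα}) = 0`. -/
structure AdditiveModel {Ω : Type*} [MeasurableSpace Ω] {d : ℕ} (P : Measure Ω)
    (X : ℕ → Ω → Fin d → ℝ) (Y ε : ℕ → Ω → ℝ) (c : ℝ) (m : Fin d → ℝ → ℝ)
    (sig : (Fin d → ℝ) → ℝ) : Prop where
  response : ∀ i, ∀ᵐ ω ∂P, Y i ω = c + (∑ α, m α (X i ω α)) + sig (X i ω) * ε i ω
  identifiable : ∀ i α, ∫ ω, m α (X i ω α) ∂P = 0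

/-- The first component is twice continuously differentiable on `[0,1]`, the others are Lipschitz
there. -/
structure SmoothComponents {d : ℕ} [NeZero d] (m : Fin d → ℝ → ℝ) : Prop where
  first : ContDiffOn ℝ 2 (m 0) (Set.Icc 0 1)
  others : ∃ C : ℝ≥0, ∀ β : Fin d, β ≠ 0 → LipschitzOnWith C (m β) (Set.Icc 0 1)

/-- Conditions on the noise: centered with unit variance given the predictor vector, with a bounded
conditional moment of order `2 + δ`, and white (serially uncorrelated) conditionally on the
predictor vectors. -/
structure WhiteNoise {Ω : Type*} [MeasurableSpace Ω] {d : ℕ} (P : Measure Ω)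
    (X : ℕ → Ω → Fin d → ℝ) (ε : ℕ → Ω → ℝ) : Prop where
  mean : ∀ i, P[ε i | MeasurableSpace.comap (X i) inferInstance] =ᵐ[P] fun _ => 0
  variance : ∀ i,
    P[fun ω => ε i ω ^ 2 | MeasurableSpace.comap (X i) inferInstance] =ᵐ[P] fun _ => 1
  moment : ∃ δ > (1 / 2 : ℝ), ∃ M > (0 : ℝ), ∀ i,
    Integrable (fun ω => |ε i ω| ^ (2 + δ)) P ∧
    ∀ᵐ ω ∂P,
      (P[fun ω => |ε i ω| ^ (2 + δ) | MeasurableSpace.comap (X i) inferInstance]) ω < M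
  uncorrelated : ∀ i j, i ≠ j →
    P[fun ω => ε i ω * ε j ω |
      MeasurableSpace.comap (fun ω => (X i ω, X j ω)) inferInstance] =ᵐ[P] fun _ => 0

/-- The conditional standard deviation is continuous, bounded and bounded away from zero on
`[0,1]^d`. -/
structure RegularScale {d : ℕ} (sig : (Fin d → ℝ) → ℝ) : Prop where
  continuousOn : ContinuousOn sig (Set.Icc 0 1)
  bounds : ∃ cσ > (0 : ℝ), ∃ Cσ : ℝ, ∀ x ∈ Set.Icc (0 : Fin d → ℝ) 1, cσ ≤ sig x ∧ sig x ≤ Cσ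

/-- Every predictor vector is distributed on `[0,1]^d` with the same density `f`, which is
continuous and bounded between positive constants on `[0,1]^d`; the marginal densities are
continuously differentiable on `[0,1]` and obey the same bounds. -/
structure RegularDensity {Ω : Type*} [MeasurableSpace Ω] {d : ℕ} (P : Measure Ω)
    (X : ℕ → Ω → Fin d → ℝ) (f : (Fin d → ℝ) → ℝ) : Prop where
  law : ∀ i, P.map (X i) =
    (volume.restrict (Set.Icc (0 : Fin d → ℝ) 1)).withDensity (fun x => ENNReal.ofReal (f x))
  continuousOn : ContinuousOn f (Set.Icc 0 1)
  bounds : ∃ cf > (0 : ℝ), ∃ Cf : ℝ,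
    (∀ x ∈ Set.Icc (0 : Fin d → ℝ) 1, cf ≤ f x ∧ f x ≤ Cf) ∧
    ∀ α, ∀ t ∈ Set.Icc (0 : ℝ) 1, cf ≤ marginalDensity f α t ∧ marginalDensity f α t ≤ Cf
  marginal : ∀ α, ContDiffOn ℝ 1 (marginalDensity f α) (Set.Icc 0 1)

/-- `K` is a symmetric probability density supported on `[-1, 1]` and Lipschitz there. -/
structure IsSmoothingKernel (K : ℝ → ℝ) : Prop where
  nonneg : ∀ u, 0 ≤ K u
  symm : ∀ u, K (-u) = K u
  support : ∀ u, u ∉ Set.Icc (-1 : ℝ) 1 → K u = 0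
  lipschitz : ∃ C : ℝ≥0, LipschitzOnWith C K (Set.Icc (-1) 1)
  integral_eq_one : ∫ u, K u = 1

/-- `h_n` is of exact order `n^{-1/5}`. -/
def BandwidthOrder (h : ℕ → ℝ) : Prop :=
  ∃ ch > (0 : ℝ), ∃ Ch : ℝ, ∀ᶠ n : ℕ in atTop,
    ch * (n : ℝ) ^ (-(1 / 5) : ℝ) ≤ h n ∧ h n ≤ Ch * (n : ℝ) ^ (-(1 / 5) : ℝ)

/-- `N_n` is of exact order `n^{2/5} log n`. -/
def KnotOrder (N : ℕ → ℕ) : Prop :=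
  ∃ cN > (0 : ℝ), ∃ CN : ℝ, ∀ᶠ n : ℕ in atTop,
    cN * ((n : ℝ) ^ (2 / 5 : ℝ) * Real.log n) ≤ N n ∧
      (N n : ℝ) ≤ CN * ((n : ℝ) ^ (2 / 5 : ℝ) * Real.log n)

/-! ### Stochastic order -/

/-- `T_n = o_p(a_n)` for nonnegative extended-real valued `T_n`: for every `η > 0`, the (outer)
probability of `T_n > η a_n` tends to zero. -/
def IsLittleOP {Ω : Type*} [MeasurableSpace Ω] (P : Measure Ω) (T : ℕ → Ω → ℝ≥0∞) (a : ℕ → ℝ) :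
    Prop :=
  ∀ η > (0 : ℝ), Tendsto (fun n => P {ω | ENNReal.ofReal (η * a n) < T n ω}) atTop (𝓝 0)

end SPBK

end

/-! Both estimators are kernel averages with the same weights, so their difference is the kernel
average of the error of the pilot fit. Apart from the error of the sample mean and of the empirical
centring, which are easy, this leaves for each coordinate α other than the first the average of
K_h(X_{i1} - x) s_α(X_{iα}), where s_α is the α-th component of the spline error. The fit is
undersmoothed: replacing each component by a step function on N ≈ n^{2/5} log n bins costs O(1/N) =
o(n^{-2/5}). Relative to that step function the error has a coefficient vector θ with ‖θ‖ of order
(N/n)^{1/2}, roughly n^{-3/10}, so bounding the kernel average by ‖θ‖ alone is not enough.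

The gain comes from duality. The mean of a kernel average is a linear functional of θ, and because
the joint density is bounded it is at most Cf ‖K_h‖₁ ‖s_α‖₁, with no loss in h. Hence it is
represented in the theoretical inner product by an additive step function u_x whose norm is bounded
uniformly in x, h and N (`Design.abs_windowFun_le`, `Design.exists_riesz`). The normal equations
tested against u_x turn the functional into an average of the noise in the single direction u_x, of
size n^{-1/2}, plus a bias O(1/N), plus ‖θ‖ times a fluctuation of the empirical Gram matrix
(`Design.exists_fit_error`). Passing from the empirical kernel average to its mean costs ‖θ‖ times
another fluctuation (`Design.abs_emp_window_le`). Each such product is o(n^{-2/5}). Invertibility of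
the Gram form, uniformly in N, is `Design.coercive`: a density bounded below reduces additive
functions to the uniform law, where the coordinates are independent and variances add.

Uniformity in x uses a grid of about n^{0.32} points and an envelope for the kernel between grid
points. Fluctuations of functions of the design are bounded variables, and second or fourth moments
suffice for a union bound. These moments come from the covariance inequality for strong mixing,
after splitting the sample into residue classes modulo a logarithmic lag. The noise admits only
second moment bounds here, and a union bound over the grid would lose. Instead
`exists_sq_bound_of_path` bounds the expected maximum of the squared noise along the path k ↦
u_{x_k} by a multiple of (1 + length)/n. The length is O(1) + o(1/h): freezing the first argument of
the density at the grid point leaves the increment of the kernel mass in [0, 1], which has bounded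
variation in x, and an error governed by the modulus of continuity of the density at scale h. Since
n^{-1} · o(n^{1/5}) = o(n^{-4/5}), mere continuity of the density is just enough.

For the limit law, √(nh) n^{-2/5} is bounded, so the uniform comparison permits replacing the
estimator by the oracle smoother. Its centred error is the sum of a kernel-weighted noise average
and a kernel average of m₁(X_{i1}) - m₁(x) - b₁ h², divided by the kernel density estimate. The
density estimate is consistent. The second term has mean o(h²) by a Taylor expansion and an even
smaller fluctuation. The noise obeys a central limit theorem by the big-block small-block method:
mixing factorises characteristic functions of separated blocks, and a moment of order 5/2 controls
each block. Strict stationarity is not needed, because conditional whiteness together with the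
common law of the predictors gives every block of a given length exactly the same variance. -/

noncomputable section

namespace SPBK

set_option linter.unusedSectionVars false

/-! ### Covariance inequality for strongly mixing processes -/

section Mixing

variable {Ω E : Type*} [mΩ : MeasurableSpace Ω] [MeasurableSpace E] {P : Measure Ω}

/-- Information generated by the process up to time `t`. -/
@[reducible] def past (Z : ℕ → Ω → E) (t : ℕ) : MeasurableSpace Ω :=
  ⨆ s ∈ Iic t, MeasurableSpace.comap (Z s) inferInstance

/-- Information generated by the process from time `t` on. -/
@[reducible] def future (Z : ℕ → Ω → E) (t : ℕ) : MeasurableSpace Ω :=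
  ⨆ s ∈ Ici t, MeasurableSpace.comap (Z s) inferInstance

/-- The mixing coefficient at lag `q` is at most `a`. -/
def MixBound (P : Measure Ω) (Z : ℕ → Ω → E) (q : ℕ) (a : ℝ) : Prop :=
  ∀ (t : ℕ) (B C : Set Ω), MeasurableSet[past Z t] B → MeasurableSet[future Z (t + q)] C →
    |P.real (B ∩ C) - P.real B * P.real C| ≤ a

lemma past_le {Z : ℕ → Ω → E} (hZ : ∀ i, Measurable (Z i)) (t : ℕ) : past Z t ≤ mΩ :=
  iSup₂_le fun s _ => (hZ s).comap_le

lemma future_le {Z : ℕ → Ω → E} (hZ : ∀ i, Measurable (Z i)) (t : ℕ) : future Z t ≤ mΩ :=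
  iSup₂_le fun s _ => (hZ s).comap_le

omit mΩ in
lemma comap_le_past (Z : ℕ → Ω → E) {s t : ℕ} (h : s ≤ t) :
    MeasurableSpace.comap (Z s) inferInstance ≤ past Z t :=
  le_iSup₂_of_le (f := fun s _ => MeasurableSpace.comap (Z s) inferInstance) s h le_rfl

omit mΩ in
lemma comap_le_future (Z : ℕ → Ω → E) {s t : ℕ} (h : t ≤ s) :
    MeasurableSpace.comap (Z s) inferInstance ≤ future Z t :=
  le_iSup₂_of_le (f := fun s _ => MeasurableSpace.comap (Z s) inferInstance) s h le_rfl

lemma mixBound_of_alphaMixing [IsProbabilityMeasure P] {Z : ℕ → Ω → E} {q : ℕ} {a : ℝ}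
    (h : alphaMixing P Z q ≤ a) : MixBound P Z q a := by
  intro t B C hB hC
  unfold alphaMixing at h
  refine le_trans (le_csSup ?_ ?_) h
  swap
  · exact ⟨t, B, C, hB, hC, rfl⟩
  -- The real supremum of an unbounded set would be the default value 0, so boundedness has to be
  -- supplied; it holds because all probabilities lie in [0, 1].
  refine ⟨1, ?_⟩
  rintro r ⟨t, B, C, -, -, rfl⟩
  have h1 := measureReal_nonneg (μ := P) (s := B ∩ C)
  have h2 := measureReal_le_one (μ := P) (s := B ∩ C)
  have h3 := measureReal_nonneg (μ := P) (s := B)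
  have h4 := measureReal_le_one (μ := P) (s := B)
  have h5 := measureReal_nonneg (μ := P) (s := C)
  have h6 := measureReal_le_one (μ := P) (s := C)
  rw [abs_le]
  constructor <;> nlinarith

/-- With W = E[V | m₁] - E V the covariance is E[U W], at most A E|W|. Since W has mean zero, E|W|
is twice the integral of W over {W ≥ 0}, so a bounded weight is never worse, up to the factor 2A,
than the indicator of one event of m₁. -/
lemma exists_cov_le_indicator [IsProbabilityMeasure P] {m₁ : MeasurableSpace Ω} (hm : m₁ ≤ mΩ)
    {U V : Ω → ℝ} (hU : Measurable[m₁] U) {A : ℝ} (hA : ∀ ω, |U ω| ≤ A) (hV : Integrable V P) :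
    ∃ S, MeasurableSet[m₁] S ∧
      |∫ ω, U ω * V ω ∂P - (∫ ω, U ω ∂P) * ∫ ω, V ω ∂P| ≤
        2 * A * |∫ ω in S, V ω ∂P - P.real S * ∫ ω, V ω ∂P| := by
  have hA0 : 0 ≤ A := by
    obtain ⟨ω⟩ := nonempty_of_isProbabilityMeasure P
    exact (abs_nonneg _).trans (hA ω)
  have hUs : StronglyMeasurable[m₁] U := hU.stronglyMeasurable
  have hU' : Measurable[mΩ] U := hU.mono hm le_rfl
  have hUi : Integrable U P := Integrable.of_bound (μ := P) hU'.aestronglyMeasurable A (ae_of_all _ hA)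
  have hUV : Integrable (fun ω => U ω * V ω) P :=
    hV.bdd_mul hU'.aestronglyMeasurable (ae_of_all _ hA)
  set v := ∫ ω, V ω ∂P with hv
  set W : Ω → ℝ := fun ω => (P[V | m₁]) ω - v with hW
  have hWm : Measurable[m₁] W :=
    (stronglyMeasurable_condExp (m := m₁) (f := V) (μ := P)).measurable.sub_const v
  have hWi : Integrable W P := integrable_condExp.sub (integrable_const _)
  have hUW : Integrable (fun ω => U ω * W ω) P :=
    hWi.bdd_mul hU'.aestronglyMeasurable (ae_of_all _ hA)
  have hUc : Integrable (fun ω => U ω * (P[V | m₁]) ω) P :=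
    integrable_condExp.bdd_mul hU'.aestronglyMeasurable (ae_of_all _ hA)
  refine ⟨{ω | 0 ≤ W ω}, hWm measurableSet_Ici, ?_⟩
  set S : Set Ω := {ω | 0 ≤ W ω} with hS
  have hSm : MeasurableSet[m₁] S := hWm measurableSet_Ici
  have e1 : ∫ ω, U ω * V ω ∂P - (∫ ω, U ω ∂P) * v = ∫ ω, U ω * W ω ∂P := by
    have h1 : ∫ ω, U ω * V ω ∂P = ∫ ω, U ω * (P[V | m₁]) ω ∂P := by
      rw [← integral_condExp hm (f := fun ω => U ω * V ω)]
      exact integral_congr_ae (condExp_mul_of_stronglyMeasurable_left hUs hUV hV)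
    simp only [hW, mul_sub]
    rw [integral_sub hUc (hUi.mul_const v), integral_mul_const, h1]
  have e2 : ∫ ω in S, W ω ∂P = ∫ ω in S, V ω ∂P - P.real S * v := by
    simp only [hW]
    rw [integral_sub integrable_condExp.integrableOn (integrable_const _).integrableOn,
      setIntegral_condExp hm hV hSm]
    simp
  have e3 : ∫ ω, W ω ∂P = 0 := by
    simp only [hW]
    rw [integral_sub integrable_condExp (integrable_const _), integral_condExp hm]
    simp [hv]
  have e4 : ∫ ω, |W ω| ∂P = 2 * ∫ ω in S, W ω ∂P := by
    have h1 := integral_add_compl (hm _ hSm) hWi.abs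
    have h2 := integral_add_compl (hm _ hSm) hWi
    have h3 : ∫ ω in S, |W ω| ∂P = ∫ ω in S, W ω ∂P :=
      setIntegral_congr_fun (hm _ hSm) fun ω hω => abs_of_nonneg hω
    have h4 : ∫ ω in Sᶜ, |W ω| ∂P = - ∫ ω in Sᶜ, W ω ∂P := by
      rw [← integral_neg]
      exact setIntegral_congr_fun (hm _ hSm).compl fun ω hω =>
        abs_of_neg (not_le.1 hω)
    linarith
  rw [e1, ← e2]
  calc |∫ ω, U ω * W ω ∂P| ≤ ∫ ω, |U ω * W ω| ∂P := abs_integral_le_integral_abs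
    _ ≤ ∫ ω, A * |W ω| ∂P := by
        refine integral_mono hUW.abs (hWi.abs.const_mul A) fun ω => ?_
        simp only [abs_mul]
        gcongr
        exact hA ω
    _ = 2 * A * ∫ ω in S, W ω ∂P := by rw [integral_const_mul, e4]; ring
    _ ≤ _ := by
        gcongr
        exact le_abs_self _

/-- The reduction to an indicator is applied to U and then, with roles exchanged, to V; each costs a
factor 2, and what remains is the mixing defect of two events. -/
lemma abs_cov_le [IsProbabilityMeasure P] {m₁ m₂ : MeasurableSpace Ω} (h₁ : m₁ ≤ mΩ)
    (h₂ : m₂ ≤ mΩ) {a : ℝ}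
    (hmix : ∀ B C, MeasurableSet[m₁] B → MeasurableSet[m₂] C →
      |P.real (B ∩ C) - P.real B * P.real C| ≤ a)
    {U V : Ω → ℝ} (hU : Measurable[m₁] U) (hV : Measurable[m₂] V) {A B : ℝ}
    (hA : ∀ ω, |U ω| ≤ A) (hB : ∀ ω, |V ω| ≤ B) :
    |∫ ω, U ω * V ω ∂P - (∫ ω, U ω ∂P) * ∫ ω, V ω ∂P| ≤ 4 * A * B * a := by
  obtain ⟨ω₀⟩ := @nonempty_of_isProbabilityMeasure Ω mΩ P _
  have hA0 : 0 ≤ A := (abs_nonneg _).trans (hA ω₀)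
  have hB0 : 0 ≤ B := (abs_nonneg _).trans (hB ω₀)
  have hVi : Integrable V P :=
    Integrable.of_bound (hV.mono h₂ le_rfl).aestronglyMeasurable B (ae_of_all _ hB)
  obtain ⟨S, hS, h⟩ := exists_cov_le_indicator (mΩ := mΩ) h₁ hU hA hVi
  have hSi : Integrable (S.indicator (fun _ => (1 : ℝ))) P :=
    (integrable_const _).indicator (h₁ _ hS)
  obtain ⟨T, hT, h'⟩ := exists_cov_le_indicator (mΩ := mΩ) h₂ hV hB hSi
  have e1 : ∫ ω, V ω * S.indicator (fun _ => (1 : ℝ)) ω ∂P = ∫ ω in S, V ω ∂P := by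
    rw [← integral_indicator (h₁ _ hS)]
    congr 1 with ω
    by_cases hω : ω ∈ S <;> simp [hω]
  have e2 : ∫ ω, S.indicator (fun _ => (1 : ℝ)) ω ∂P = P.real S := by
    rw [integral_indicator (h₁ _ hS)]; simp
  have e3 : ∫ ω in T, S.indicator (fun _ => (1 : ℝ)) ω ∂P = P.real (S ∩ T) := by
    rw [setIntegral_indicator (h₁ _ hS)]; simp [Set.inter_comm]
  rw [e1, e2, e3, mul_comm (P.real T)] at h'
  rw [mul_comm (∫ ω, V ω ∂P)] at h'
  calc _ ≤ _ := h
    _ ≤ 2 * A * (2 * B * a) := by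
        gcongr
        refine h'.trans ?_
        gcongr
        exact hmix S T hS hT
    _ = _ := by ring

lemma MixBound.abs_cov_le [IsProbabilityMeasure P] {Z : ℕ → Ω → E} (hZ : ∀ i, Measurable (Z i))
    {q : ℕ} {a : ℝ} (hmix : MixBound P Z q a) {s t : ℕ} (hst : s + q ≤ t) {U V : Ω → ℝ}
    (hU : Measurable[past Z s] U) (hV : Measurable[future Z t] V) {A B : ℝ}
    (hA : ∀ ω, |U ω| ≤ A) (hB : ∀ ω, |V ω| ≤ B) :
    |∫ ω, U ω * V ω ∂P - (∫ ω, U ω ∂P) * ∫ ω, V ω ∂P| ≤ 4 * A * B * a := by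
  have hle : future Z t ≤ future Z (s + q) :=
    iSup₂_le fun r hr => comap_le_future Z (hst.trans hr)
  exact SPBK.abs_cov_le (past_le hZ s) (future_le hZ (s + q)) (fun B C hB hC => hmix s B C hB hC)
    hU (hV.mono hle le_rfl) hA hB

end Mixing

/-! ### Moments of sums over a mixing process -/

section Moments

variable {Ω E : Type*} [MeasurableSpace Ω] [MeasurableSpace E] {P : Measure Ω}
  [IsProbabilityMeasure P]

/-- Centered bounded functions of the single observations of a process. -/
structure BoundedCentered (P : Measure Ω) (Z : ℕ → Ω → E) (W : ℕ → Ω → ℝ) (M v w : ℝ) :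
    Prop where
  meas : ∀ i, Measurable[MeasurableSpace.comap (Z i) inferInstance] (W i)
  bound : ∀ i ω, |W i ω| ≤ M
  mean : ∀ i, ∫ ω, W i ω ∂P = 0
  second : ∀ i, ∫ ω, W i ω ^ 2 ∂P ≤ v
  fourth : ∀ i, ∫ ω, W i ω ^ 4 ∂P ≤ w

namespace BoundedCentered

variable {Z : ℕ → Ω → E} {W : ℕ → Ω → ℝ} {M v w : ℝ}

lemma bound_nonneg (h : BoundedCentered P Z W M v w) : 0 ≤ M := by
  obtain ⟨ω₀⟩ := nonempty_of_isProbabilityMeasure P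
  exact (abs_nonneg _).trans (h.bound 0 ω₀)

lemma second_nonneg (h : BoundedCentered P Z W M v w) : 0 ≤ v :=
  (integral_nonneg fun _ => by positivity).trans (h.second 0)

lemma fourth_nonneg (h : BoundedCentered P Z W M v w) : 0 ≤ w :=
  (integral_nonneg fun _ => by positivity).trans (h.fourth 0)

lemma truncate (h : BoundedCentered P Z W M v w) (n : ℕ) :
    BoundedCentered P Z (fun i ω => if i < n then W i ω else 0) M v w where
  meas i := by
    by_cases hi : i < n
    · simpa [hi] using h.meas i
    · simp [hi]
  bound i ω := by
    by_cases hi : i < n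
    · simpa [hi] using h.bound i ω
    · simpa [hi] using h.bound_nonneg
  mean i := by
    by_cases hi : i < n
    · simpa [hi] using h.mean i
    · simp [hi]
  second i := by
    by_cases hi : i < n
    · simpa [hi] using h.second i
    · simpa [hi] using h.second_nonneg
  fourth i := by
    by_cases hi : i < n
    · simpa [hi] using h.fourth i
    · simpa [hi] using h.fourth_nonneg

lemma measurable (h : BoundedCentered P Z W M v w) (hZ : ∀ i, Measurable (Z i)) (i : ℕ) :
    Measurable (W i) := (h.meas i).mono (hZ i).comap_le le_rfl

lemma abs_sum_le (h : BoundedCentered P Z W M v w) (r q k : ℕ) (ω : Ω) :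
    |∑ j ∈ Finset.range k, W (r + q * j) ω| ≤ k * M :=
  (Finset.abs_sum_le_sum_abs _ _).trans <| by
    simpa using Finset.sum_le_sum fun j (_ : j ∈ Finset.range k) => h.bound (r + q * j) ω

/-- The last summand is q steps after all the others, so mixed moments factorise up to the
covariance bound. For k = 0 the left sum is empty and its power vanishes only because i ≠ 0. -/
lemma decouple (h : BoundedCentered P Z W M v w) (hZ : ∀ i, Measurable (Z i)) {q : ℕ} {a : ℝ}
    (hmix : MixBound P Z q a) (r k i j : ℕ) (hi : i ≠ 0) :
    |∫ ω, (∑ l ∈ Finset.range k, W (r + q * l) ω) ^ i * W (r + q * k) ω ^ j ∂P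
      - (∫ ω, (∑ l ∈ Finset.range k, W (r + q * l) ω) ^ i ∂P) * ∫ ω, W (r + q * k) ω ^ j ∂P|
      ≤ 4 * (k * M) ^ i * M ^ j * a := by
  have hM := h.bound_nonneg
  rcases k with _ | k
  · simp [hi]
  · refine hmix.abs_cov_le hZ (s := r + q * k) (t := r + q * (k + 1)) (by ring_nf; rfl)
      (U := fun ω => (∑ l ∈ Finset.range (k + 1), W (r + q * l) ω) ^ i)
      (V := fun ω => W (r + q * (k + 1)) ω ^ j) ?_ ?_ (fun ω => ?_) (fun ω => ?_)
    · refine Measurable.pow_const ?_ i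
      refine Finset.measurable_fun_sum _ fun l hl => ?_
      refine (h.meas _).mono (comap_le_past Z ?_) le_rfl
      have : l ≤ k := Nat.lt_succ_iff.1 (Finset.mem_range.1 hl)
      gcongr
    · exact ((h.meas _).mono (comap_le_future Z le_rfl) le_rfl).pow_const j
    · rw [abs_pow]
      gcongr
      exact h.abs_sum_le r q (k + 1) ω
    · rw [abs_pow]
      gcongr
      exact h.bound _ ω

lemma integrable_mul_pow (h : BoundedCentered P Z W M v w) (hZ : ∀ i, Measurable (Z i))
    (r q k i j : ℕ) :
    Integrable (fun ω => (∑ l ∈ Finset.range k, W (r + q * l) ω) ^ i * W (r + q * k) ω ^ j) P := by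
  have hM := h.bound_nonneg
  have hm := h.measurable hZ
  refine Integrable.of_bound (C := (k * M) ^ i * M ^ j)
    (Measurable.aestronglyMeasurable (by fun_prop)) (ae_of_all _ fun ω => ?_)
  rw [Real.norm_eq_abs, abs_mul, abs_pow, abs_pow]
  gcongr
  · exact h.abs_sum_le r q k ω
  · exact h.bound _ ω

lemma separated_mean (h : BoundedCentered P Z W M v w) (hZ : ∀ i, Measurable (Z i)) (r q k : ℕ) :
    ∫ ω, (∑ l ∈ Finset.range k, W (r + q * l) ω) ∂P = 0 := by
  rw [integral_finsetSum]
  · simp [h.mean]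
  · intro i _
    exact Integrable.of_bound (h.measurable hZ _).aestronglyMeasurable M
      (ae_of_all _ (h.bound _))

lemma separated_second (h : BoundedCentered P Z W M v w) (hZ : ∀ i, Measurable (Z i)) {q : ℕ}
    {a : ℝ} (hmix : MixBound P Z q a) (ha : 0 ≤ a) (r k : ℕ) :
    ∫ ω, (∑ l ∈ Finset.range k, W (r + q * l) ω) ^ 2 ∂P ≤ k * v + 8 * k ^ 2 * M ^ 2 * a := by
  have hM := h.bound_nonneg
  induction k with
  | zero => simp
  | succ k ih =>
    have hint := h.integrable_mul_pow hZ r q k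
    have e : ∫ ω, (∑ l ∈ Finset.range (k + 1), W (r + q * l) ω) ^ 2 ∂P
        = ∫ ω, (∑ l ∈ Finset.range k, W (r + q * l) ω) ^ 2 ∂P
          + 2 * ∫ ω, (∑ l ∈ Finset.range k, W (r + q * l) ω) ^ 1 * W (r + q * k) ω ^ 1 ∂P
          + ∫ ω, W (r + q * k) ω ^ 2 ∂P := by
      have h20 := hint 2 0
      have h11 := (hint 1 1).const_mul 2
      have h02 := hint 0 2
      simp only [pow_zero, mul_one, one_mul] at h20 h02
      rw [← integral_const_mul, ← integral_add' h20 h11, ← integral_add' (h20.add h11) h02]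
      congr 1 with ω
      simp only [Finset.sum_range_succ, Pi.add_apply]
      ring
    have d := h.decouple hZ hmix r k 1 1 one_ne_zero
    have hm := h.mean (r + q * k)
    simp only [pow_one] at d e
    rw [hm, mul_zero, sub_zero] at d
    rw [e]
    have h2 := h.second (r + q * k)
    have := (abs_le.1 d).2
    push_cast
    have h0 : 0 ≤ M ^ 2 * a := by positivity
    nlinarith

/-- Induction on the number of summands, expanding the fourth power of the sum. Terms with a first
power of a centred factor are pure covariance errors; the only main term is 6 E S² E W² ≲ 6 k v²,
and these add up to 3 k² v². -/
lemma separated_fourth (h : BoundedCentered P Z W M v w) (hZ : ∀ i, Measurable (Z i)) {q : ℕ}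
    {a : ℝ} (hmix : MixBound P Z q a) (ha : 0 ≤ a) (hv : v ≤ M ^ 2) (r k : ℕ) :
    ∫ ω, (∑ l ∈ Finset.range k, W (r + q * l) ω) ^ 4 ∂P
      ≤ 3 * k ^ 2 * v ^ 2 + k * w + 104 * k ^ 4 * M ^ 4 * a := by
  have hM := h.bound_nonneg
  have hv0 := h.second_nonneg
  induction k with
  | zero => simp
  | succ k ih =>
    have hint := h.integrable_mul_pow hZ r q k
    have e : ∫ ω, (∑ l ∈ Finset.range (k + 1), W (r + q * l) ω) ^ 4 ∂P
        = ∫ ω, (∑ l ∈ Finset.range k, W (r + q * l) ω) ^ 4 ∂P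
          + 4 * ∫ ω, (∑ l ∈ Finset.range k, W (r + q * l) ω) ^ 3 * W (r + q * k) ω ^ 1 ∂P
          + 6 * ∫ ω, (∑ l ∈ Finset.range k, W (r + q * l) ω) ^ 2 * W (r + q * k) ω ^ 2 ∂P
          + 4 * ∫ ω, (∑ l ∈ Finset.range k, W (r + q * l) ω) ^ 1 * W (r + q * k) ω ^ 3 ∂P
          + ∫ ω, W (r + q * k) ω ^ 4 ∂P := by
      have h40 := hint 4 0
      have h31 := (hint 3 1).const_mul 4
      have h22 := (hint 2 2).const_mul 6
      have h13 := (hint 1 3).const_mul 4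
      have h04 := hint 0 4
      simp only [pow_zero, mul_one, one_mul] at h40 h04
      simp only [← integral_const_mul]
      rw [← integral_add' h40 h31, ← integral_add' (h40.add h31) h22,
        ← integral_add' ((h40.add h31).add h22) h13,
        ← integral_add' (((h40.add h31).add h22).add h13) h04]
      congr 1 with ω
      simp only [Finset.sum_range_succ, Pi.add_apply]
      ring
    have d31 := (abs_le.1 (h.decouple hZ hmix r k 3 1 (by norm_num))).2
    have d22 := (abs_le.1 (h.decouple hZ hmix r k 2 2 (by norm_num))).2
    have d13 := (abs_le.1 (h.decouple hZ hmix r k 1 3 (by norm_num))).2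
    have hm := h.mean (r + q * k)
    have hS := h.separated_mean hZ r q k
    have h2 := h.second (r + q * k)
    have h4 := h.fourth (r + q * k)
    have s2 := h.separated_second hZ hmix ha r k
    have n2 : 0 ≤ ∫ ω, W (r + q * k) ω ^ 2 ∂P := integral_nonneg fun _ => by positivity
    simp only [pow_one] at d31 d13 e
    rw [hm, mul_zero, sub_zero] at d31
    rw [hS, zero_mul, sub_zero] at d13
    have p22 : (∫ ω, (∑ l ∈ Finset.range k, W (r + q * l) ω) ^ 2 ∂P)
        * ∫ ω, W (r + q * k) ω ^ 2 ∂P ≤ (k * v + 8 * k ^ 2 * M ^ 2 * a) * v := by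
      gcongr
    have hk0 : (0 : ℝ) ≤ k := Nat.cast_nonneg k
    have p22' : 8 * (k : ℝ) ^ 2 * M ^ 2 * a * v ≤ 8 * k ^ 2 * M ^ 2 * a * M ^ 2 := by gcongr
    rw [e]
    have hX : 0 ≤ M ^ 4 * a := by positivity
    -- The covariance errors of the three mixed moments have coefficients 16, 72 and 16, whose sum
    -- is 104; each of k³, k², k is at most (k + 1)⁴ - k⁴.
    have hk3 : (16 * k ^ 3 + 72 * k ^ 2 + 16 * k : ℝ) * (M ^ 4 * a)
        ≤ (104 * (k + 1) ^ 4 - 104 * k ^ 4) * (M ^ 4 * a) := by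
      gcongr
      nlinarith [pow_nonneg hk0 2, pow_nonneg hk0 3]
    push_cast
    nlinarith [sq_nonneg v]

/-- Indices in one residue class modulo q are q apart, so the bounds for separated sums apply class
by class. The cut-off inside the sum lets all classes run over a common range. -/
lemma sum_eq_sum_classes (f : ℕ → ℝ) {n q : ℕ} (hq : 1 ≤ q) :
    ∑ i ∈ Finset.range n, f i
      = ∑ r ∈ Finset.range q, ∑ j ∈ Finset.range n, (if r + q * j < n then f (r + q * j) else 0) := by
  have key : ∀ (g : ℕ → ℝ) (k : ℕ), ∑ i ∈ Finset.range (q * k), g i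
      = ∑ r ∈ Finset.range q, ∑ j ∈ Finset.range k, g (r + q * j) := by
    intro g k
    induction k with
    | zero => simp
    | succ k ih =>
      rw [Nat.mul_succ, Finset.sum_range_add, ih]
      simp only [Finset.sum_range_succ, Finset.sum_add_distrib]
      simp [add_comm]
  rw [← key (fun i => if i < n then f i else 0) n]
  have hsub : Finset.range n ⊆ Finset.range (q * n) :=
    Finset.range_subset_range.2 (Nat.le_mul_of_pos_left n hq)
  rw [← Finset.sum_subset hsub (f := fun i => if i < n then f i else 0)]
  · exact Finset.sum_congr rfl fun i hi => by simp [Finset.mem_range.1 hi]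
  · intro i _ hi
    simp only [Finset.mem_range] at hi
    simp [hi]

lemma second_moment_le (h : BoundedCentered P Z W M v w) (hZ : ∀ i, Measurable (Z i)) {q : ℕ}
    (hq : 1 ≤ q) {a : ℝ} (hmix : MixBound P Z q a) (ha : 0 ≤ a) (n : ℕ) :
    ∫ ω, (∑ i ∈ Finset.range n, W i ω) ^ 2 ∂P ≤ q ^ 2 * (n * v + 8 * n ^ 2 * M ^ 2 * a) := by
  set W' : ℕ → Ω → ℝ := fun i ω => if i < n then W i ω else 0
  have h' : BoundedCentered P Z W' M v w := h.truncate n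
  have hint : ∀ r, Integrable (fun ω => (∑ l ∈ Finset.range n, W' (r + q * l) ω) ^ 2) P := by
    intro r
    simpa using h'.integrable_mul_pow hZ r q n 2 0
  calc ∫ ω, (∑ i ∈ Finset.range n, W i ω) ^ 2 ∂P
      ≤ ∫ ω, q * ∑ r ∈ Finset.range q, (∑ l ∈ Finset.range n, W' (r + q * l) ω) ^ 2 ∂P := by
        refine integral_mono_of_nonneg (ae_of_all _ fun _ => by positivity)
          ((integrable_finsetSum _ fun r _ => hint r).const_mul _) (ae_of_all _ fun ω => ?_)
        simp only
        rw [sum_eq_sum_classes _ hq]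
        simpa using sq_sum_le_card_mul_sum_sq (s := Finset.range q)
          (f := fun r => ∑ l ∈ Finset.range n, W' (r + q * l) ω)
    _ = q * ∑ r ∈ Finset.range q, ∫ ω, (∑ l ∈ Finset.range n, W' (r + q * l) ω) ^ 2 ∂P := by
        rw [integral_const_mul, integral_finsetSum _ fun r _ => hint r]
    _ ≤ q * ∑ r ∈ Finset.range q, (n * v + 8 * n ^ 2 * M ^ 2 * a) := by
        gcongr with r
        exact h'.separated_second hZ hmix ha r n
    _ = _ := by simp; ring

/-- The power mean inequality over the q residue classes gives a factor q³, and summing over the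
classes one more q. As q is logarithmic in n this loss is harmless. -/
lemma fourth_moment_le (h : BoundedCentered P Z W M v w) (hZ : ∀ i, Measurable (Z i)) {q : ℕ}
    (hq : 1 ≤ q) {a : ℝ} (hmix : MixBound P Z q a) (ha : 0 ≤ a) (hv : v ≤ M ^ 2) (n : ℕ) :
    ∫ ω, (∑ i ∈ Finset.range n, W i ω) ^ 4 ∂P
      ≤ q ^ 4 * (3 * n ^ 2 * v ^ 2 + n * w + 104 * n ^ 4 * M ^ 4 * a) := by
  set W' : ℕ → Ω → ℝ := fun i ω => if i < n then W i ω else 0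
  have h' : BoundedCentered P Z W' M v w := h.truncate n
  have hint : ∀ r, Integrable (fun ω => (∑ l ∈ Finset.range n, W' (r + q * l) ω) ^ 4) P := by
    intro r
    simpa using h'.integrable_mul_pow hZ r q n 4 0
  calc ∫ ω, (∑ i ∈ Finset.range n, W i ω) ^ 4 ∂P
      ≤ ∫ ω, q ^ 3 * ∑ r ∈ Finset.range q, (∑ l ∈ Finset.range n, W' (r + q * l) ω) ^ 4 ∂P := by
        refine integral_mono_of_nonneg (ae_of_all _ fun _ => by positivity)
          ((integrable_finsetSum _ fun r _ => hint r).const_mul _) (ae_of_all _ fun ω => ?_)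
        simp only
        rw [sum_eq_sum_classes _ hq]
        set f : ℕ → ℝ := fun r => ∑ l ∈ Finset.range n, W' (r + q * l) ω
        have h1 := sq_sum_le_card_mul_sum_sq (s := Finset.range q) (f := f)
        have h2 := sq_sum_le_card_mul_sum_sq (s := Finset.range q) (f := fun r => f r ^ 2)
        simp only [Finset.card_range, ← pow_mul] at h1 h2
        calc (∑ r ∈ Finset.range q, f r) ^ 4 = ((∑ r ∈ Finset.range q, f r) ^ 2) ^ 2 := by ring
          _ ≤ (q * ∑ r ∈ Finset.range q, f r ^ 2) ^ 2 := by gcongr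
          _ = q ^ 2 * (∑ r ∈ Finset.range q, f r ^ 2) ^ 2 := by ring
          _ ≤ q ^ 2 * (q * ∑ r ∈ Finset.range q, f r ^ (2 * 2)) := by gcongr
          _ = _ := by ring
    _ = q ^ 3 * ∑ r ∈ Finset.range q, ∫ ω, (∑ l ∈ Finset.range n, W' (r + q * l) ω) ^ 4 ∂P := by
        rw [integral_const_mul, integral_finsetSum _ fun r _ => hint r]
    _ ≤ q ^ 3 * ∑ r ∈ Finset.range q, (3 * n ^ 2 * v ^ 2 + n * w + 104 * n ^ 4 * M ^ 4 * a) := by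
        gcongr with r
        exact h'.separated_fourth hZ hmix ha hv r n
    _ = _ := by simp; ring

end BoundedCentered

end Moments

/-! ### The uniform distribution on the cube -/

section Cube

variable {d : ℕ}

/-- Lebesgue measure on `[0, 1]^d`. -/
def unif (d : ℕ) : Measure (Fin d → ℝ) := volume.restrict (Icc 0 1)

/-- Lebesgue measure on `[0, 1]`. -/
def unifOne : Measure ℝ := volume.restrict (Icc 0 1)

instance : IsProbabilityMeasure unifOne := ⟨by simp [unifOne]⟩

lemma unif_eq_pi : unif d = Measure.pi fun _ => unifOne := by
  unfold unif unifOne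
  rw [← Measure.restrict_pi_pi, ← volume_pi]
  congr 1
  exact (Set.pi_univ_Icc (0 : Fin d → ℝ) 1).symm

instance : IsProbabilityMeasure (unif d) := by
  rw [unif_eq_pi]; infer_instance

lemma measurePreserving_eval_unif (α : Fin d) :
    MeasurePreserving (fun x : Fin d → ℝ => x α) (unif d) unifOne := by
  rw [unif_eq_pi]
  exact measurePreserving_eval (fun _ : Fin d => unifOne) α

lemma measurable_update_pair (α : Fin d) :
    Measurable fun p : ℝ × (Fin d → ℝ) => Function.update p.2 α p.1 := by
  refine measurable_pi_lambda _ fun β => ?_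
  by_cases h : β = α
  · subst h; simpa using measurable_fst
  · simp only [Function.update_of_ne h]; fun_prop

/-- Overwriting one coordinate of a uniform point by an independent uniform variable does not change
its law. This gives Fubini for one coordinate in exactly the form in which `integrateOthers` is
defined. -/
lemma measurePreserving_update (α : Fin d) :
    MeasurePreserving (fun p : ℝ × (Fin d → ℝ) => Function.update p.2 α p.1)
      (unifOne.prod (unif d)) (unif d) := by
  refine ⟨measurable_update_pair α, ?_⟩
  conv_rhs => rw [unif_eq_pi]
  refine (Measure.pi_eq fun s hs => ?_).symm
  rw [Measure.map_apply (measurable_update_pair α) (MeasurableSet.univ_pi hs)]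
  have : (fun p : ℝ × (Fin d → ℝ) => Function.update p.2 α p.1) ⁻¹' Set.univ.pi s
      = s α ×ˢ Set.univ.pi (Function.update s α Set.univ) := by
    ext p
    simp only [Set.mem_preimage, Set.mem_pi, Set.mem_univ, true_imp_iff, Set.mem_prod]
    constructor
    · intro h
      refine ⟨by simpa using h α, fun β => ?_⟩
      by_cases hβ : β = α
      · subst hβ; simp
      · simpa [hβ] using h β
    · rintro ⟨h1, h2⟩ β
      by_cases hβ : β = α
      · subst hβ; simpa using h1
      · simpa [hβ] using h2 β
  rw [this, Measure.prod_prod, unif_eq_pi, Measure.pi_pi]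
  rw [← Finset.mul_prod_erase Finset.univ _ (Finset.mem_univ α),
    ← Finset.mul_prod_erase Finset.univ (fun i => unifOne (s i)) (Finset.mem_univ α)]
  simp only [Function.update_self, measure_univ, one_mul]
  congr 1
  refine Finset.prod_congr rfl fun β hβ => ?_
  rw [Function.update_of_ne (Finset.ne_of_mem_erase hβ)]

lemma integrable_update {F : (Fin d → ℝ) → ℝ} (hF : Integrable F (unif d)) (α : Fin d) :
    Integrable (fun p : ℝ × (Fin d → ℝ) => F (Function.update p.2 α p.1))
      (unifOne.prod (unif d)) :=
  (measurePreserving_update α).integrable_comp_of_integrable hF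

lemma integral_update {F : (Fin d → ℝ) → ℝ} (hF : Integrable F (unif d)) (α : Fin d) :
    ∫ x, F x ∂unif d = ∫ t, ∫ x, F (Function.update x α t) ∂unif d ∂unifOne := by
  have h := measurePreserving_update α
  rw [← integral_prod _ (integrable_update hF α)]
  conv_lhs => rw [← h.map_eq]
  rw [integral_map h.measurable.aemeasurable]
  rw [h.map_eq]; exact hF.aestronglyMeasurable

lemma integral_eval_unif {g : ℝ → ℝ} (hg : AEStronglyMeasurable g unifOne) (α : Fin d) :
    ∫ x, g (x α) ∂unif d = ∫ t, g t ∂unifOne := by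
  have h := measurePreserving_eval_unif α
  rw [← h.map_eq] at hg ⊢
  rw [integral_map h.measurable.aemeasurable hg]

lemma ae_unif_mem : ∀ᵐ x ∂unif d, x ∈ Icc (0 : Fin d → ℝ) 1 :=
  ae_restrict_mem measurableSet_Icc

lemma integral_mul_eval_unif {g : ℝ → ℝ} {G : (Fin d → ℝ) → ℝ} {α : Fin d}
    (hG : ∀ x t, G (Function.update x α t) = G x)
    (hF : Integrable (fun x : Fin d → ℝ => g (x α) * G x) (unif d)) :
    ∫ x, g (x α) * G x ∂unif d = (∫ t, g t ∂unifOne) * ∫ x, G x ∂unif d := by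
  rw [integral_update hF α]
  simp [hG, integral_const_mul, integral_mul_const]

/-- Under the product law the coordinates are independent, so variances add, and a variance is at
most the second moment. This is why additive components can be recovered from their sum. -/
lemma variance_sum_unif {s : Fin d → ℝ → ℝ} (hs : ∀ α, Measurable (s α)) {M : ℝ}
    (hM : ∀ α t, |s α t| ≤ M) :
    ∑ α, (∫ t, s α t ^ 2 ∂unifOne - (∫ t, s α t ∂unifOne) ^ 2)
      ≤ ∫ x, (∑ α, s α (x α)) ^ 2 ∂unif d := by
  have hind : iIndepFun (fun (α : Fin d) (x : Fin d → ℝ) => s α (x α)) (unif d) := by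
    rw [unif_eq_pi]
    exact iIndepFun_pi (X := fun α => s α) fun α => (hs α).aemeasurable
  have hmem : ∀ α, MemLp (fun x : Fin d → ℝ => s α (x α)) 2 (unif d) := fun α =>
    MemLp.of_bound ((hs α).comp (measurable_pi_apply α)).aestronglyMeasurable M
      (ae_of_all _ fun x => hM α _)
  have h := IndepFun.variance_sum (s := Finset.univ) (fun α _ => hmem α)
    (fun α _ β _ hαβ => hind.indepFun hαβ)
  have h1 : ∀ α, Var[fun x : Fin d → ℝ => s α (x α); unif d]
      = ∫ t, s α t ^ 2 ∂unifOne - (∫ t, s α t ∂unifOne) ^ 2 := fun α => by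
    rw [variance_eq_sub (hmem α), integral_eval_unif (hs α).aestronglyMeasurable]
    congr 1
    exact integral_eval_unif (g := fun t => s α t ^ 2) ((hs α).pow_const 2).aestronglyMeasurable α
  simp only [← h1]
  rw [← h, variance_eq_sub (memLp_finsetSum' _ fun α _ => hmem α)]
  simp only [Pi.pow_apply, Finset.sum_apply]
  nlinarith [sq_nonneg (∫ x, ∑ α, s α (x α) ∂unif d)]

end Cube

/-! ### Empirical averages over the design -/

section Empirical

variable {Ω : Type*} [MeasurableSpace Ω] {P : Measure Ω} {d : ℕ}

/-- The design points have a common distribution `μ` which is equivalent to the uniform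
distribution on the cube, with densities between `cf` and `Cf`. -/
structure Design (P : Measure Ω) (X : ℕ → Ω → Fin d → ℝ) (μ : Measure (Fin d → ℝ))
    (cf Cf : ℝ) : Prop where
  meas : ∀ i, Measurable (X i)
  law : ∀ i, P.map (X i) = μ
  pos : 0 < cf
  lower : ∀ g : (Fin d → ℝ) → ℝ≥0∞, Measurable g →
    ENNReal.ofReal cf * ∫⁻ x, g x ∂unif d ≤ ∫⁻ x, g x ∂μ
  upper : ∀ g : (Fin d → ℝ) → ℝ≥0∞, Measurable g →
    ∫⁻ x, g x ∂μ ≤ ENNReal.ofReal Cf * ∫⁻ x, g x ∂unif d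

/-- Empirical average of `g` over the first `n` design points. -/
def emp (X : ℕ → Ω → Fin d → ℝ) (n : ℕ) (g : (Fin d → ℝ) → ℝ) (ω : Ω) : ℝ :=
  (n : ℝ)⁻¹ * ∑ i ∈ Finset.range n, g (X i ω)

/-- Deviation of the empirical average from the theoretical one. -/
def dev (X : ℕ → Ω → Fin d → ℝ) (μ : Measure (Fin d → ℝ)) (n : ℕ) (g : (Fin d → ℝ) → ℝ)
    (ω : Ω) : ℝ :=
  emp X n g ω - ∫ x, g x ∂μ

variable {X : ℕ → Ω → Fin d → ℝ} {μ : Measure (Fin d → ℝ)} {cf Cf : ℝ}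

namespace Design

variable [IsProbabilityMeasure P] (h : Design P X μ cf Cf)
include h

lemma prob : IsProbabilityMeasure μ := by
  rw [← h.law 0]; exact Measure.isProbabilityMeasure_map (h.meas 0).aemeasurable

lemma cf_le_one : cf ≤ 1 := by
  have := h.prob
  have h1 := h.lower 1 measurable_one
  simpa using h1

lemma one_le_Cf : 1 ≤ Cf := by
  have := h.prob
  have h1 := h.upper 1 measurable_one
  simpa using h1

lemma ac : μ ≪ unif d := by
  refine Measure.AbsolutelyContinuous.mk fun s hs h0 => ?_
  have := h.upper (s.indicator 1) (measurable_one.indicator hs)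
  rw [lintegral_indicator_one hs, lintegral_indicator_one hs, h0, mul_zero] at this
  exact le_antisymm this bot_le

lemma ae_mem_cube (i : ℕ) : ∀ᵐ ω ∂P, X i ω ∈ Icc (0 : Fin d → ℝ) 1 := by
  have h1 : ∀ᵐ x ∂μ, x ∈ Icc (0 : Fin d → ℝ) 1 := h.ac.ae_le ae_unif_mem
  rw [← h.law i] at h1
  exact ae_of_ae_map (h.meas i).aemeasurable h1

lemma integral_comp {g : (Fin d → ℝ) → ℝ} (hg : Measurable g) (i : ℕ) :
    ∫ ω, g (X i ω) ∂P = ∫ x, g x ∂μ := by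
  rw [← h.law i, integral_map (h.meas i).aemeasurable hg.aestronglyMeasurable]

lemma integral_le {g : (Fin d → ℝ) → ℝ} (hg : Measurable g) (h0 : ∀ x, 0 ≤ g x)
    (hi : Integrable g (unif d)) : ∫ x, g x ∂μ ≤ Cf * ∫ x, g x ∂unif d := by
  have := h.upper (fun x => ENNReal.ofReal (g x)) hg.ennreal_ofReal
  have hC : 0 ≤ Cf := zero_le_one.trans h.one_le_Cf
  rw [integral_eq_lintegral_of_nonneg_ae (ae_of_all _ h0) hg.aestronglyMeasurable]
  refine ENNReal.toReal_le_of_le_ofReal (mul_nonneg hC (integral_nonneg h0)) (this.trans ?_)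
  rw [ENNReal.ofReal_mul hC, ofReal_integral_eq_lintegral_ofReal hi (ae_of_all _ h0)]

lemma le_integral {g : (Fin d → ℝ) → ℝ} (hg : Measurable g) (h0 : ∀ x, 0 ≤ g x)
    (hi : Integrable g μ) : cf * ∫ x, g x ∂unif d ≤ ∫ x, g x ∂μ := by
  have h1 := h.lower (fun x => ENNReal.ofReal (g x)) hg.ennreal_ofReal
  rw [← ofReal_integral_eq_lintegral_ofReal hi (ae_of_all _ h0)] at h1
  rw [integral_eq_lintegral_of_nonneg_ae (μ := unif d) (ae_of_all _ h0) hg.aestronglyMeasurable]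
  have h2 := ENNReal.toReal_mono ENNReal.ofReal_ne_top h1
  rwa [ENNReal.toReal_mul, ENNReal.toReal_ofReal h.pos.le,
    ENNReal.toReal_ofReal (integral_nonneg h0)] at h2

lemma dev_eq {n : ℕ} (hn : 1 ≤ n) (g : (Fin d → ℝ) → ℝ) (ω : Ω) :
    dev X μ n g ω = (n : ℝ)⁻¹ * ∑ i ∈ Finset.range n, (g (X i ω) - ∫ x, g x ∂μ) := by
  have : (n : ℝ) ≠ 0 := by positivity
  simp only [dev, emp, Finset.sum_sub_distrib, Finset.sum_const, Finset.card_range, nsmul_eq_mul]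
  field_simp

lemma measurable_emp {g : (Fin d → ℝ) → ℝ} (hg : Measurable g) (n : ℕ) :
    Measurable (emp X n g) := by
  have := h.meas
  unfold emp
  fun_prop

lemma measurable_dev {g : (Fin d → ℝ) → ℝ} (hg : Measurable g) (n : ℕ) :
    Measurable (dev X μ n g) := (h.measurable_emp hg n).sub_const _

variable {ε : ℕ → Ω → ℝ} (hε : ∀ i, Measurable (ε i)) {q : ℕ} (hq : 1 ≤ q) {a : ℝ} (ha : 0 ≤ a)
  (hmix : MixBound P (fun i ω => (X i ω, ε i ω)) q a)

/-- The factor 16 comes from (a - b)⁴ ≤ 8a⁴ + 8b⁴ together with Jensen's inequality for the mean. -/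
lemma boundedCentered {g : (Fin d → ℝ) → ℝ} (hg : Measurable g) {M : ℝ} (hM : ∀ x, |g x| ≤ M) :
    BoundedCentered P (fun i ω => (X i ω, ε i ω)) (fun i ω => g (X i ω) - ∫ x, g x ∂μ)
      (2 * M) (∫ x, g x ^ 2 ∂μ) (16 * ∫ x, g x ^ 4 ∂μ) := by
  have := h.prob
  have hM0 : 0 ≤ M := (abs_nonneg _).trans (hM 0)
  have hgi : ∀ k : ℕ, Integrable (fun x => g x ^ k) μ := fun k =>
    Integrable.of_bound (hg.pow_const k).aestronglyMeasurable (M ^ k) (ae_of_all _ fun x => by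
      rw [Real.norm_eq_abs, abs_pow]; gcongr; exact hM x)
  have hg1 : Integrable g μ := by simpa using hgi 1
  set mg := ∫ x, g x ∂μ
  have hmg : |mg| ≤ M := by
    refine (norm_integral_le_of_norm_le_const (f := g) (C := M) (ae_of_all _ hM)).trans ?_
    simp
  refine ⟨fun i => ?_, fun i ω => ?_, fun i => ?_, fun i => ?_, fun i => ?_⟩
  · exact ((hg.comp measurable_fst).sub_const mg).comp (comap_measurable _)
  · calc |g (X i ω) - mg| ≤ |g (X i ω)| + |mg| := abs_sub _ _
      _ ≤ _ := by linarith [hM (X i ω)]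
  · rw [h.integral_comp (hg.sub_const mg), integral_sub hg1 (integrable_const _)]
    simp [mg]
  · rw [h.integral_comp ((hg.sub_const mg).pow_const 2)]
    have e : ∀ x, (g x - mg) ^ 2 = g x ^ 2 - (2 * mg) * g x + mg ^ 2 := fun x => by ring
    simp only [e]
    rw [integral_add (f := fun x => g x ^ 2 - 2 * mg * g x) ((hgi 2).sub (hg1.const_mul _))
        (integrable_const _),
      integral_sub (hgi 2) (hg1.const_mul _), integral_const_mul]
    simp only [integral_const, probReal_univ, one_smul]
    change _ - 2 * mg * mg + _ ≤ _
    nlinarith [sq_nonneg mg]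
  · rw [h.integral_comp ((hg.sub_const mg).pow_const 4)]
    have hmg4 : mg ^ 4 ≤ ∫ x, g x ^ 4 ∂μ := by
      have h1 := (even_two_mul 2).convexOn_pow (𝕜 := ℝ) |>.map_integral_le
        (continuous_pow _).continuousOn isClosed_univ (by simp) hg1 (hgi 4) (μ := μ)
      simpa using h1
    calc ∫ x, (g x - mg) ^ 4 ∂μ ≤ ∫ x, (8 * g x ^ 4 + 8 * mg ^ 4) ∂μ := by
          refine integral_mono_of_nonneg (ae_of_all _ fun x => by positivity)
            (((hgi 4).const_mul _).add (integrable_const _)) (ae_of_all _ fun x => ?_)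
          simp only
          nlinarith [sq_nonneg (g x + mg), sq_nonneg (g x - mg), sq_nonneg (g x ^ 2 - mg ^ 2),
            mul_nonneg (sq_nonneg (g x + mg)) (sq_nonneg (g x + mg)),
            mul_nonneg (sq_nonneg (g x + mg)) (sq_nonneg (g x - mg))]
      _ = 8 * ∫ x, g x ^ 4 ∂μ + 8 * mg ^ 4 := by
          rw [integral_add ((hgi 4).const_mul _) (integrable_const _), integral_const_mul]
          simp
      _ ≤ _ := by linarith

include hε hq ha hmix

lemma dev_second {g : (Fin d → ℝ) → ℝ} (hg : Measurable g) {M : ℝ} (hM : ∀ x, |g x| ≤ M)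
    {n : ℕ} (hn : 1 ≤ n) :
    ∫ ω, dev X μ n g ω ^ 2 ∂P ≤ q ^ 2 * ((∫ x, g x ^ 2 ∂μ) / n + 32 * M ^ 2 * a) := by
  have hb := (h.boundedCentered (ε := ε) hg hM).second_moment_le
    (fun i => (h.meas i).prodMk (hε i)) hq hmix ha n
  have hn0 : (0 : ℝ) < n := by exact_mod_cast hn
  simp only [h.dev_eq hn, mul_pow, integral_const_mul]
  calc ((n : ℝ)⁻¹) ^ 2 * ∫ ω, (∑ i ∈ Finset.range n, (g (X i ω) - ∫ x, g x ∂μ)) ^ 2 ∂P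
      ≤ ((n : ℝ)⁻¹) ^ 2 * (q ^ 2 * (n * (∫ x, g x ^ 2 ∂μ) + 8 * n ^ 2 * (2 * M) ^ 2 * a)) := by
        gcongr
    _ = _ := by field_simp; ring

lemma dev_fourth {g : (Fin d → ℝ) → ℝ} (hg : Measurable g) {M : ℝ} (hM : ∀ x, |g x| ≤ M)
    {n : ℕ} (hn : 1 ≤ n) :
    ∫ ω, dev X μ n g ω ^ 4 ∂P ≤ q ^ 4 * (3 * (∫ x, g x ^ 2 ∂μ) ^ 2 / n ^ 2
      + 16 * (∫ x, g x ^ 4 ∂μ) / n ^ 3 + 1664 * M ^ 4 * a) := by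
  have := h.prob
  have hM0 : 0 ≤ M := (abs_nonneg _).trans (hM 0)
  have hv : ∫ x, g x ^ 2 ∂μ ≤ (2 * M) ^ 2 := by
    have h1 : ∫ x, g x ^ 2 ∂μ ≤ ∫ x, M ^ 2 ∂μ :=
      integral_mono_of_nonneg (ae_of_all _ fun x => by positivity) (integrable_const _)
        (ae_of_all _ fun x => sq_le_sq.2 (by rw [abs_of_nonneg hM0]; exact hM x))
    simp only [integral_const, probReal_univ, one_smul] at h1
    nlinarith [sq_nonneg M]
  have hb := (h.boundedCentered (ε := ε) hg hM).fourth_moment_le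
    (fun i => (h.meas i).prodMk (hε i)) hq hmix ha hv n
  have hn0 : (0 : ℝ) < n := by exact_mod_cast hn
  simp only [h.dev_eq hn, mul_pow, integral_const_mul]
  calc ((n : ℝ)⁻¹) ^ 4 * ∫ ω, (∑ i ∈ Finset.range n, (g (X i ω) - ∫ x, g x ∂μ)) ^ 4 ∂P
      ≤ ((n : ℝ)⁻¹) ^ 4 * (q ^ 4 * (3 * n ^ 2 * (∫ x, g x ^ 2 ∂μ) ^ 2
        + n * (16 * ∫ x, g x ^ 4 ∂μ) + 104 * n ^ 4 * (2 * M) ^ 4 * a)) := by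
        gcongr
    _ = _ := by field_simp; ring

end Design

end Empirical

/-! ### Bins and the feature map of additive step functions -/

section Bins

lemma measurable_bin (N J : ℕ) : Measurable (bin N J) :=
  measurable_const.indicator measurableSet_Ico

lemma bin_eq_zero_or_one (N J : ℕ) (t : ℝ) : bin N J t = 0 ∨ bin N J t = 1 := by
  unfold bin
  by_cases h : t ∈ Ico ((J : ℝ) / ((N : ℝ) + 1)) (((J : ℝ) + 1) / ((N : ℝ) + 1))
  · right; simp [h]
  · left; simp [h]

lemma bin_nonneg (N J : ℕ) (t : ℝ) : 0 ≤ bin N J t := by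
  rcases bin_eq_zero_or_one N J t with h | h <;> simp [h]

lemma bin_le_one (N J : ℕ) (t : ℝ) : bin N J t ≤ 1 := by
  rcases bin_eq_zero_or_one N J t with h | h <;> simp [h]

lemma bin_sq (N J : ℕ) (t : ℝ) : bin N J t ^ 2 = bin N J t := by
  rcases bin_eq_zero_or_one N J t with h | h <;> simp [h]

lemma bin_eq_one_iff {N J : ℕ} {t : ℝ} :
    bin N J t = 1 ↔ (J : ℝ) ≤ t * (N + 1) ∧ t * (N + 1) < J + 1 := by
  have hN : (0 : ℝ) < (N : ℝ) + 1 := by positivity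
  unfold bin
  rw [← div_le_iff₀ hN, ← lt_div_iff₀ hN]
  by_cases h : t ∈ Ico ((J : ℝ) / ((N : ℝ) + 1)) (((J : ℝ) + 1) / ((N : ℝ) + 1))
  · rw [Set.indicator_of_mem h]
    exact ⟨fun _ => h, fun _ => rfl⟩
  · rw [Set.indicator_of_notMem h]
    exact ⟨fun h' => absurd h' zero_ne_one, fun h' => absurd h' h⟩

lemma bin_eq_one_iff_floor {N J : ℕ} {t : ℝ} (ht : 0 ≤ t) :
    bin N J t = 1 ↔ ⌊t * (N + 1)⌋₊ = J := by
  rw [bin_eq_one_iff, Nat.floor_eq_iff (by positivity)]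

lemma bin_mul_bin {N J J' : ℕ} (h : J ≠ J') (t : ℝ) : bin N J t * bin N J' t = 0 := by
  rcases bin_eq_zero_or_one N J t with h1 | h1
  · simp [h1]
  rcases bin_eq_zero_or_one N J' t with h2 | h2
  · simp [h2]
  exfalso
  rw [bin_eq_one_iff] at h1 h2
  have a1 : (J : ℝ) < J' + 1 := by linarith
  have a2 : (J' : ℝ) < J + 1 := by linarith
  norm_cast at a1 a2
  omega

/-- The bins are half-open, so the endpoint 1 belongs to none of them; every exact identity for step
functions is therefore restricted to [0, 1). -/
lemma sum_bin_eq_one {N : ℕ} {t : ℝ} (ht : t ∈ Ico (0 : ℝ) 1) :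
    ∑ J : Fin (N + 1), bin N J t = 1 := by
  have hlt : ⌊t * (N + 1)⌋₊ < N + 1 := by
    rw [Nat.floor_lt (mul_nonneg ht.1 (by positivity))]
    push_cast
    nlinarith [ht.2, (by positivity : (0 : ℝ) < (N : ℝ) + 1)]
  rw [Finset.sum_eq_single ⟨⌊t * (N + 1)⌋₊, hlt⟩]
  · exact (bin_eq_one_iff_floor ht.1).2 rfl
  · intro J _ hJ
    rcases bin_eq_zero_or_one N J t with h | h
    · exact h
    · rw [bin_eq_one_iff_floor ht.1] at h
      exact absurd (Fin.ext h.symm) hJ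
  · simp

/-- Disjointness of the bins makes the sum idempotent, so it is 0 or 1 at every real point. -/
lemma sum_bin_le_one {N : ℕ} (t : ℝ) : ∑ J : Fin (N + 1), bin N J t ≤ 1 := by
  have h : (∑ J : Fin (N + 1), bin N J t) ^ 2 = ∑ J : Fin (N + 1), bin N J t := by
    rw [sq, Finset.sum_mul_sum]
    refine Finset.sum_congr rfl fun J _ => ?_
    rw [Finset.sum_eq_single J]
    · rw [← sq, bin_sq]
    · intro J' _ hJ
      exact bin_mul_bin (fun h => hJ (Fin.ext h.symm)) t
    · simp
  nlinarith

lemma sq_sum_mul_bin {N : ℕ} (v : Fin (N + 1) → ℝ) (t : ℝ) :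
    (∑ J, v J * bin N J t) ^ 2 = ∑ J, v J ^ 2 * bin N J t := by
  rw [sq, Finset.sum_mul_sum]
  refine Finset.sum_congr rfl fun J _ => ?_
  rw [Finset.sum_eq_single J]
  · linear_combination v J ^ 2 * bin_sq N J t
  · intro J' _ hJ
    linear_combination v J * v J' * bin_mul_bin (N := N) (fun h => hJ (Fin.ext h.symm)) t
  · simp

lemma integral_bin {N J : ℕ} (hJ : J ≤ N) : ∫ t, bin N J t ∂unifOne = 1 / ((N : ℝ) + 1) := by
  have hN : (0 : ℝ) < (N : ℝ) + 1 := by positivity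
  have hJ' : (J : ℝ) + 1 ≤ (N : ℝ) + 1 := by exact_mod_cast Nat.succ_le_succ hJ
  unfold bin unifOne
  rw [integral_indicator measurableSet_Ico, Measure.restrict_restrict measurableSet_Ico,
    Set.inter_eq_left.2]
  · simp only [integral_const, smul_eq_mul, mul_one, measureReal_restrict_apply_univ,
      Real.volume_real_Ico]
    rw [max_eq_left]
    · ring
    · rw [sub_nonneg]; gcongr; linarith
  · intro t ht
    refine ⟨le_trans (by positivity) ht.1, ht.2.le.trans ?_⟩
    rw [div_le_one hN]
    exact hJ'

lemma integrable_bin (N J : ℕ) (ν : Measure ℝ) [IsFiniteMeasure ν] : Integrable (bin N J) ν :=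
  Integrable.of_bound (measurable_bin N J).aestronglyMeasurable 1 (ae_of_all _ fun t => by
    rw [Real.norm_eq_abs, abs_of_nonneg (bin_nonneg N J t)]; exact bin_le_one N J t)

end Bins

/-! ### Additive step functions in the redundant bin parametrisation. -/

section Features

variable {d : ℕ}

/-- Index set of the additive step functions: the constant, and one step per coordinate and bin. -/
abbrev Idx (d N : ℕ) := Option (Fin d × Fin (N + 1))

/-- Coefficient vectors of additive step functions. -/
abbrev Coef (d N : ℕ) := EuclideanSpace ℝ (Idx d N)

/-- Probability of the `J`-th bin in coordinate `α`. -/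
def binProb (μ : Measure (Fin d → ℝ)) (N : ℕ) (α : Fin d) (J : ℕ) : ℝ := ∫ x, bin N J (x α) ∂μ

/-- Centered bin indicator, scaled to be of order one in `L²`. -/
def step (μ : Measure (Fin d → ℝ)) (N : ℕ) (α : Fin d) (J : ℕ) (t : ℝ) : ℝ :=
  √((N : ℝ) + 1) * (bin N J t - binProb μ N α J)

/-- The feature map of the additive step functions. -/
def feat (μ : Measure (Fin d → ℝ)) (N : ℕ) (j : Idx d N) (x : Fin d → ℝ) : ℝ :=
  j.elim 1 fun p => step μ N p.1 p.2 (x p.1)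

/-- Component of coordinate `α` of an additive step function. -/
def comp (μ : Measure (Fin d → ℝ)) {N : ℕ} (α : Fin d) (θ : Coef d N) (t : ℝ) : ℝ :=
  ∑ J : Fin (N + 1), θ (some (α, J)) * step μ N α J t

/-- The additive step function with coefficients `θ`. -/
def fit (μ : Measure (Fin d → ℝ)) {N : ℕ} (θ : Coef d N) (x : Fin d → ℝ) : ℝ :=
  ∑ j, θ j * feat μ N j x

variable (μ : Measure (Fin d → ℝ)) {N : ℕ}

lemma sum_idx (g : Idx d N → ℝ) :
    ∑ j, g j = g none + ∑ α : Fin d, ∑ J : Fin (N + 1), g (some (α, J)) := by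
  rw [Fintype.sum_option, Fintype.sum_prod_type]

lemma fit_eq (θ : Coef d N) (x : Fin d → ℝ) :
    fit μ θ x = θ none + ∑ α, comp μ α θ (x α) := by
  rw [fit, sum_idx]
  simp [feat, comp]

lemma norm_sq_coef (θ : Coef d N) :
    ‖θ‖ ^ 2 = θ none ^ 2 + ∑ α : Fin d, ∑ J : Fin (N + 1), θ (some (α, J)) ^ 2 := by
  rw [EuclideanSpace.norm_sq_eq, sum_idx]
  simp

lemma measurable_step (α : Fin d) (J : ℕ) : Measurable (step μ N α J) :=
  ((measurable_bin N J).sub_const _).const_mul _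

lemma measurable_feat (j : Idx d N) : Measurable (feat μ N j) := by
  rcases j with _ | ⟨α, J⟩
  · exact measurable_const
  · exact (measurable_step μ α J).comp (measurable_pi_apply α)

lemma measurable_comp (α : Fin d) (θ : Coef d N) : Measurable (comp μ α θ) := by
  have := fun J => measurable_step μ (N := N) α J
  unfold comp
  fun_prop

lemma measurable_fit (θ : Coef d N) : Measurable (fit μ θ) := by
  have := fun j => measurable_feat μ (N := N) j
  unfold fit
  fun_prop

lemma binProb_nonneg (α : Fin d) (J : ℕ) : 0 ≤ binProb μ N α J :=
  integral_nonneg fun _ => bin_nonneg _ _ _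

variable [IsProbabilityMeasure μ]

lemma integrable_bin_eval (α : Fin d) (J : ℕ) : Integrable (fun x : Fin d → ℝ => bin N J (x α)) μ :=
  Integrable.of_bound ((measurable_bin N J).comp (measurable_pi_apply α)).aestronglyMeasurable 1
    (ae_of_all _ fun t => by
      rw [Real.norm_eq_abs, abs_of_nonneg (bin_nonneg N J _)]; exact bin_le_one N J _)

lemma sum_binProb_le (α : Fin d) : ∑ J : Fin (N + 1), binProb μ N α J ≤ 1 := by
  unfold binProb
  rw [← integral_finsetSum Finset.univ fun (J : Fin (N + 1)) _ => integrable_bin_eval μ α (J : ℕ)]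
  calc ∫ x, ∑ J : Fin (N + 1), bin N J (x α) ∂μ ≤ ∫ x : Fin d → ℝ, (1 : ℝ) ∂μ :=
        integral_mono (integrable_finsetSum _ fun J _ => integrable_bin_eval μ α J)
          (integrable_const _) fun x => sum_bin_le_one _
    _ = 1 := by simp

lemma binProb_le_one (α : Fin d) (J : Fin (N + 1)) : binProb μ N α J ≤ 1 :=
  (Finset.single_le_sum (f := fun J : Fin (N + 1) => binProb μ N α J)
    (fun J _ => binProb_nonneg μ α J) (Finset.mem_univ J)).trans (sum_binProb_le μ α)

/-- At most one bin contains t, so the N + 1 squares together have the order of a single one. This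
saves a factor N whenever variances are summed over all features. -/
lemma sum_step_sq_le (α : Fin d) (t : ℝ) :
    ∑ J : Fin (N + 1), step μ N α J t ^ 2 ≤ 2 * ((N : ℝ) + 1) := by
  have hN : (0 : ℝ) ≤ (N : ℝ) + 1 := by positivity
  calc ∑ J : Fin (N + 1), step μ N α J t ^ 2
      ≤ ∑ J : Fin (N + 1), ((N : ℝ) + 1) * (bin N J t + binProb μ N α J) := by
        refine Finset.sum_le_sum fun J _ => ?_
        unfold step
        rw [mul_pow, Real.sq_sqrt hN]
        gcongr
        have h1 := bin_nonneg N J t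
        have h2 := binProb_nonneg μ (N := N) α J
        have h3 := binProb_le_one μ α J
        have h4 := bin_sq N J t
        nlinarith
    _ = ((N : ℝ) + 1) * (∑ J : Fin (N + 1), bin N J t + ∑ J : Fin (N + 1), binProb μ N α J) := by
        rw [← Finset.mul_sum, Finset.sum_add_distrib]
    _ ≤ ((N : ℝ) + 1) * (1 + 1) := by
        gcongr
        · exact sum_bin_le_one t
        · exact sum_binProb_le μ α
    _ = _ := by ring

lemma sum_feat_sq_le [NeZero d] (x : Fin d → ℝ) :
    ∑ j, feat μ N j x ^ 2 ≤ 3 * d * ((N : ℝ) + 1) := by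
  have hd : (1 : ℝ) ≤ d := by exact_mod_cast NeZero.one_le
  have hN : (1 : ℝ) ≤ (N : ℝ) + 1 := by linarith [(Nat.cast_nonneg N : (0 : ℝ) ≤ N)]
  rw [sum_idx]
  have h : ∑ α : Fin d, ∑ J : Fin (N + 1), feat μ N (some (α, J)) x ^ 2
      ≤ ∑ α : Fin d, 2 * ((N : ℝ) + 1) :=
    Finset.sum_le_sum fun α _ => sum_step_sq_le μ α (x α)
  simp only [Finset.sum_const, Finset.card_univ, Fintype.card_fin, nsmul_eq_mul] at h
  simp only [feat, Option.elim] at h ⊢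
  nlinarith

lemma abs_feat_le [NeZero d] (j : Idx d N) (x : Fin d → ℝ) :
    |feat μ N j x| ≤ √(3 * d * ((N : ℝ) + 1)) := by
  refine Real.abs_le_sqrt (le_trans ?_ (sum_feat_sq_le μ (N := N) x))
  exact Finset.single_le_sum (f := fun j => feat μ N j x ^ 2) (fun _ _ => sq_nonneg _)
    (Finset.mem_univ j)

lemma abs_fit_le [NeZero d] (θ : Coef d N) (x : Fin d → ℝ) :
    |fit μ θ x| ≤ ‖θ‖ * √(3 * d * ((N : ℝ) + 1)) := by
  have h : fit μ θ x ^ 2 ≤ ‖θ‖ ^ 2 * (3 * d * ((N : ℝ) + 1)) := by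
    calc fit μ θ x ^ 2 ≤ (∑ j, θ j ^ 2) * ∑ j, feat μ N j x ^ 2 :=
          Finset.sum_mul_sq_le_sq_mul_sq _ _ _
      _ ≤ _ := by
        rw [EuclideanSpace.norm_sq_eq]
        simp only [Real.norm_eq_abs, sq_abs]
        gcongr
        exact sum_feat_sq_le μ x
  calc |fit μ θ x| ≤ √(‖θ‖ ^ 2 * (3 * d * ((N : ℝ) + 1))) := Real.abs_le_sqrt h
    _ = _ := by rw [Real.sqrt_mul (by positivity), Real.sqrt_sq (norm_nonneg _)]

lemma step_abs_le [NeZero d] (α : Fin d) (J : Fin (N + 1)) (t : ℝ) :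
    |step μ N α J t| ≤ √(3 * d * ((N : ℝ) + 1)) := by
  simpa [feat] using abs_feat_le μ (N := N) (some (α, J)) (fun _ => t)

lemma integral_step (α : Fin d) (J : ℕ) : ∫ x, step μ N α J (x α) ∂μ = 0 := by
  unfold step
  rw [integral_const_mul, integral_sub (integrable_bin_eval μ α J) (integrable_const _)]
  simp [binProb]

lemma integrable_feat [NeZero d] (j : Idx d N) (ν : Measure (Fin d → ℝ)) [IsFiniteMeasure ν] :
    Integrable (feat μ N j) ν :=
  Integrable.of_bound (measurable_feat μ j).aestronglyMeasurable _
    (ae_of_all _ fun x => abs_feat_le μ j x)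

lemma abs_comp_le [NeZero d] (α : Fin d) (θ : Coef d N) (t : ℝ) :
    |comp μ α θ t| ≤ ‖θ‖ * √(3 * d * ((N : ℝ) + 1)) := by
  have h : comp μ α θ t ^ 2 ≤ ‖θ‖ ^ 2 * (3 * d * ((N : ℝ) + 1)) := by
    calc comp μ α θ t ^ 2 ≤ (∑ J : Fin (N + 1), θ (some (α, J)) ^ 2)
          * ∑ J : Fin (N + 1), step μ N α J t ^ 2 := Finset.sum_mul_sq_le_sq_mul_sq _ _ _
      _ ≤ _ := by
        have h1 := sum_feat_sq_le μ (N := N) (fun _ : Fin d => t)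
        rw [sum_idx] at h1
        rw [norm_sq_coef]
        have h2 := Finset.single_le_sum (f := fun α => ∑ J : Fin (N + 1), θ (some (α, J)) ^ 2)
          (fun _ _ => by positivity) (Finset.mem_univ α)
        have h3 := Finset.single_le_sum
          (f := fun α => ∑ J : Fin (N + 1), feat μ N (some (α, J)) (fun _ => t) ^ 2)
          (fun _ _ => by positivity) (Finset.mem_univ α)
        simp only [feat, Option.elim] at h1 h3
        gcongr
        · nlinarith [sq_nonneg (θ none)]
        · linarith
  calc |comp μ α θ t| ≤ √(‖θ‖ ^ 2 * (3 * d * ((N : ℝ) + 1))) := Real.abs_le_sqrt h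
    _ = _ := by rw [Real.sqrt_mul (by positivity), Real.sqrt_sq (norm_nonneg _)]

lemma integrable_comp [NeZero d] (α : Fin d) (θ : Coef d N) (ν : Measure ℝ) [IsFiniteMeasure ν] :
    Integrable (comp μ α θ) ν :=
  Integrable.of_bound (measurable_comp μ α θ).aestronglyMeasurable _
    (ae_of_all _ fun x => abs_comp_le μ α θ x)

lemma integrable_comp_sq [NeZero d] (α : Fin d) (θ : Coef d N) (ν : Measure ℝ)
    [IsFiniteMeasure ν] : Integrable (fun t => comp μ α θ t ^ 2) ν :=
  Integrable.of_bound ((measurable_comp μ α θ).pow_const 2).aestronglyMeasurable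
    ((‖θ‖ * √(3 * d * ((N : ℝ) + 1))) ^ 2)
    (ae_of_all _ fun x => by
      rw [Real.norm_eq_abs, abs_pow]; gcongr; exact abs_comp_le μ α θ x)

/-- The uncentered version of a component. -/
def rawComp {N : ℕ} (α : Fin d) (θ : Coef d N) (t : ℝ) : ℝ :=
  ∑ J : Fin (N + 1), (√((N : ℝ) + 1) * θ (some (α, J))) * bin N J t

lemma measurable_rawComp (α : Fin d) (θ : Coef d N) : Measurable (rawComp α θ) := by
  have := fun J => measurable_bin N J
  unfold rawComp
  fun_prop

lemma rawComp_sq (α : Fin d) (θ : Coef d N) (t : ℝ) :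
    rawComp α θ t ^ 2 = ∑ J : Fin (N + 1), ((N : ℝ) + 1) * θ (some (α, J)) ^ 2 * bin N J t := by
  rw [rawComp, sq_sum_mul_bin]
  refine Finset.sum_congr rfl fun J _ => ?_
  rw [mul_pow, Real.sq_sqrt (by positivity)]

lemma comp_eq_rawComp_sub (α : Fin d) (θ : Coef d N) (t : ℝ) :
    comp μ α θ t = rawComp α θ t
      - ∑ J : Fin (N + 1), (√((N : ℝ) + 1) * θ (some (α, J))) * binProb μ N α J := by
  rw [comp, rawComp, ← Finset.sum_sub_distrib]
  refine Finset.sum_congr rfl fun J _ => ?_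
  rw [step]; ring

lemma integrable_rawComp (α : Fin d) (θ : Coef d N) (ν : Measure ℝ) [IsFiniteMeasure ν] :
    Integrable (rawComp α θ) ν :=
  integrable_finsetSum _ fun J _ => (integrable_bin N J ν).const_mul _

lemma integrable_rawComp_sq (α : Fin d) (θ : Coef d N) (ν : Measure ℝ) [IsFiniteMeasure ν] :
    Integrable (fun t => rawComp α θ t ^ 2) ν := by
  simp only [rawComp_sq]
  exact integrable_finsetSum _ fun J _ => (integrable_bin N J ν).const_mul _

lemma integral_rawComp_sq (α : Fin d) (θ : Coef d N) :
    ∫ t, rawComp α θ t ^ 2 ∂unifOne = ∑ J : Fin (N + 1), θ (some (α, J)) ^ 2 := by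
  simp only [rawComp_sq]
  rw [integral_finsetSum Finset.univ fun (J : Fin (N + 1)) _ =>
    (integrable_bin N (J : ℕ) unifOne).const_mul _]
  refine Finset.sum_congr rfl fun J _ => ?_
  rw [integral_const_mul, integral_bin (Nat.lt_succ_iff.1 J.2)]
  field_simp

lemma integral_rawComp (α : Fin d) (θ : Coef d N) :
    ∫ t, rawComp α θ t ∂unifOne
      = (√((N : ℝ) + 1))⁻¹ * ∑ J : Fin (N + 1), θ (some (α, J)) := by
  unfold rawComp
  rw [integral_finsetSum Finset.univ fun (J : Fin (N + 1)) _ =>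
    (integrable_bin N (J : ℕ) unifOne).const_mul _, Finset.mul_sum]
  refine Finset.sum_congr rfl fun J _ => ?_
  rw [integral_const_mul, integral_bin (Nat.lt_succ_iff.1 J.2)]
  have h : √((N : ℝ) + 1) * √((N : ℝ) + 1) = (N : ℝ) + 1 := Real.mul_self_sqrt (by positivity)
  have h0 : √((N : ℝ) + 1) ≠ 0 := by positivity
  field_simp
  linear_combination θ (some (α, J)) * h

/-- The bins are orthogonal of squared norm 1/(N + 1), so the scaling by √(N + 1) turns the
uncentred component into an isometric image of its coefficients. Taking the variance removes their
projection on the constant vector; the constant subtracted in `step` plays no role. -/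
lemma variance_comp [NeZero d] (α : Fin d) (θ : Coef d N) :
    ∫ t, comp μ α θ t ^ 2 ∂unifOne - (∫ t, comp μ α θ t ∂unifOne) ^ 2
      = ∑ J : Fin (N + 1), θ (some (α, J)) ^ 2
        - (∑ J : Fin (N + 1), θ (some (α, J))) ^ 2 / ((N : ℝ) + 1) := by
  set κ := ∑ J : Fin (N + 1), (√((N : ℝ) + 1) * θ (some (α, J))) * binProb μ N α J
  have h1 := integrable_rawComp α θ unifOne
  have h2 := integrable_rawComp_sq α θ unifOne
  have e1 : ∫ t, comp μ α θ t ∂unifOne = ∫ t, rawComp α θ t ∂unifOne - κ := by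
    simp only [comp_eq_rawComp_sub]
    rw [integral_sub h1 (integrable_const _)]
    simp [κ]
  have e2 : ∫ t, comp μ α θ t ^ 2 ∂unifOne
      = ∫ t, rawComp α θ t ^ 2 ∂unifOne - 2 * κ * ∫ t, rawComp α θ t ∂unifOne + κ ^ 2 := by
    simp only [comp_eq_rawComp_sub]
    have e : ∀ t, (rawComp α θ t - κ) ^ 2
        = rawComp α θ t ^ 2 - 2 * κ * rawComp α θ t + κ ^ 2 := fun t => by ring
    rw [integral_congr_ae (ae_of_all _ e),
      integral_add (f := fun t => rawComp α θ t ^ 2 - 2 * κ * rawComp α θ t)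
        (h2.sub (h1.const_mul _)) (integrable_const _),
      integral_sub h2 (h1.const_mul _), integral_const_mul]
    simp
  rw [e1, e2, integral_rawComp_sq, integral_rawComp]
  have h : √((N : ℝ) + 1) ^ 2 = (N : ℝ) + 1 := Real.sq_sqrt (by positivity)
  have h' : ((√((N : ℝ) + 1))⁻¹ * ∑ J : Fin (N + 1), θ (some (α, J))) ^ 2
      = (∑ J : Fin (N + 1), θ (some (α, J))) ^ 2 / ((N : ℝ) + 1) := by
    rw [mul_pow, inv_pow, h]; field_simp
  rw [← h']; ring

lemma integral_comp_eval [NeZero d] (α : Fin d) (θ : Coef d N) :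
    ∫ x, comp μ α θ (x α) ∂μ = 0 := by
  unfold comp
  rw [integral_finsetSum]
  · simp [integral_const_mul, integral_step]
  · intro J _
    exact (integrable_feat μ (some (α, J)) μ).const_mul _

end Features

/-! ### Upper and lower bounds for the theoretical Gram form, uniform in the number of bins. -/

section Gram

variable {Ω : Type*} [MeasurableSpace Ω] {P : Measure Ω} [IsProbabilityMeasure P] {d : ℕ}
  [NeZero d] {X : ℕ → Ω → Fin d → ℝ} {μ : Measure (Fin d → ℝ)} {cf Cf : ℝ} {N : ℕ}

lemma Design.integral_comp_sq_le (h : Design P X μ cf Cf) (α : Fin d) (θ : Coef d N) :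
    ∫ x, comp μ α θ (x α) ^ 2 ∂μ ≤ Cf * ∑ J : Fin (N + 1), θ (some (α, J)) ^ 2 := by
  have := h.prob
  have hm : Measurable fun x : Fin d → ℝ => x α := measurable_pi_apply α
  have i1 : Integrable (fun x : Fin d → ℝ => rawComp α θ (x α)) μ :=
    integrable_finsetSum _ fun J _ => (integrable_bin_eval μ α (J : ℕ)).const_mul _
  have i2 : Integrable (fun x : Fin d → ℝ => rawComp α θ (x α) ^ 2) μ := by
    simp only [rawComp_sq]
    exact integrable_finsetSum _ fun J _ => (integrable_bin_eval μ α (J : ℕ)).const_mul _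
  set κ := ∑ J : Fin (N + 1), (√((N : ℝ) + 1) * θ (some (α, J))) * binProb μ N α J
  have hκ : ∫ x, rawComp α θ (x α) ∂μ = κ := by
    have := integral_comp_eval μ α θ
    simp only [comp_eq_rawComp_sub] at this
    rw [integral_sub i1 (integrable_const _)] at this
    simp only [integral_const, probReal_univ, one_smul] at this
    linarith
  have e : ∀ x : Fin d → ℝ, comp μ α θ (x α) ^ 2
      = rawComp α θ (x α) ^ 2 - 2 * κ * rawComp α θ (x α) + κ ^ 2 := fun x => by
    rw [comp_eq_rawComp_sub]; ring
  have hsq : ∫ x, comp μ α θ (x α) ^ 2 ∂μ ≤ ∫ x, rawComp α θ (x α) ^ 2 ∂μ := by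
    rw [integral_congr_ae (ae_of_all _ e),
      integral_add (f := fun x : Fin d → ℝ => rawComp α θ (x α) ^ 2 - 2 * κ * rawComp α θ (x α))
        (i2.sub (i1.const_mul _)) (integrable_const _),
      integral_sub i2 (i1.const_mul _), integral_const_mul, hκ]
    simp only [integral_const, probReal_univ, one_smul]
    nlinarith [sq_nonneg κ]
  refine hsq.trans ?_
  rw [← integral_rawComp_sq]
  have hm2 : Measurable fun t => rawComp α θ t ^ 2 := (measurable_rawComp α θ).pow_const 2
  rw [← integral_eval_unif (g := fun t => rawComp α θ t ^ 2) hm2.aestronglyMeasurable α]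
  refine h.integral_le (g := fun x : Fin d → ℝ => rawComp α θ (x α) ^ 2) ?_
    (fun _ => sq_nonneg _) ?_
  · exact ((measurable_rawComp α θ).comp hm).pow_const 2
  · simp only [rawComp_sq]
    exact integrable_finsetSum _ fun J _ => (integrable_bin_eval _ α (J : ℕ)).const_mul _

lemma sum_coef_le (α : Fin d) (θ : Coef d N) :
    ∑ J : Fin (N + 1), θ (some (α, J)) ^ 2 ≤ ‖θ‖ ^ 2 := by
  rw [norm_sq_coef]
  have h2 := Finset.single_le_sum (f := fun α => ∑ J : Fin (N + 1), θ (some (α, J)) ^ 2)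
    (fun _ _ => by positivity) (Finset.mem_univ α)
  nlinarith [sq_nonneg (θ none)]

lemma integrable_comp_eval_sq [IsProbabilityMeasure μ] (α : Fin d) (θ : Coef d N) :
    Integrable (fun x : Fin d → ℝ => comp μ α θ (x α) ^ 2) μ := by
  have hm : Measurable fun x : Fin d → ℝ => x α := measurable_pi_apply α
  exact Integrable.of_bound (((measurable_comp μ α θ).pow_const 2).comp hm).aestronglyMeasurable
    ((‖θ‖ * √(3 * d * ((N : ℝ) + 1))) ^ 2)
    (ae_of_all _ fun x => by
      rw [Real.norm_eq_abs, abs_pow]; gcongr; exact abs_comp_le μ α θ (x α))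

lemma Design.integral_fit_sq_le (h : Design P X μ cf Cf) (θ : Coef d N) :
    ∫ x, fit μ θ x ^ 2 ∂μ ≤ (d + 1) * Cf * ‖θ‖ ^ 2 := by
  have := h.prob
  have hC := h.one_le_Cf
  have hi : Integrable (fun x : Fin d → ℝ => (d + 1 : ℝ) * (θ none ^ 2
      + ∑ α, comp μ α θ (x α) ^ 2)) μ :=
    ((integrable_const _).add (integrable_finsetSum _ fun α _ =>
      integrable_comp_eval_sq α θ)).const_mul _
  calc ∫ x, fit μ θ x ^ 2 ∂μ
      ≤ ∫ x, (d + 1 : ℝ) * (θ none ^ 2 + ∑ α, comp μ α θ (x α) ^ 2) ∂μ := by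
        refine integral_mono_of_nonneg (ae_of_all _ fun _ => sq_nonneg _) hi
          (ae_of_all _ fun x => ?_)
        simp only
        have h1 := sq_sum_le_card_mul_sum_sq (s := Finset.univ)
          (f := fun o : Option (Fin d) => o.elim (θ none) fun α => comp μ α θ (x α))
        simp only [Fintype.sum_option, Option.elim, Finset.card_univ, Fintype.card_option,
          Fintype.card_fin] at h1
        rw [fit_eq]
        exact_mod_cast h1
    _ = (d + 1 : ℝ) * (θ none ^ 2 + ∑ α, ∫ x, comp μ α θ (x α) ^ 2 ∂μ) := by
        rw [integral_const_mul, integral_add (integrable_const _)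
          (integrable_finsetSum _ fun α _ => integrable_comp_eval_sq α θ),
          integral_finsetSum _ fun α _ => integrable_comp_eval_sq α θ]
        simp
    _ ≤ (d + 1 : ℝ) * (Cf * θ none ^ 2
          + ∑ α : Fin d, Cf * ∑ J : Fin (N + 1), θ (some (α, J)) ^ 2) := by
        gcongr with α
        · nlinarith [sq_nonneg (θ none)]
        · exact h.integral_comp_sq_le α θ
    _ = _ := by rw [norm_sq_coef, ← Finset.mul_sum]; ring

/-- Components are centred, so the constant decouples; the lower density bound passes to the uniform
law, where variances of the components add. The features are redundant, since a constant coefficient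
block represents zero on the cube almost surely, and the squared block sums compensate exactly for
that kernel. -/
lemma Design.coercive (h : Design P X μ cf Cf) (θ : Coef d N) :
    cf * ‖θ‖ ^ 2 ≤ ∫ x, fit μ θ x ^ 2 ∂μ
      + ∑ α : Fin d, (∑ J : Fin (N + 1), θ (some (α, J))) ^ 2 := by
  have := h.prob
  have hc := h.cf_le_one
  have hc0 := h.pos
  set S : (Fin d → ℝ) → ℝ := fun x => ∑ α, comp μ α θ (x α) with hS
  have hSm : Measurable S := Finset.measurable_fun_sum _ fun α _ =>
    (measurable_comp μ α θ).comp (measurable_pi_apply α)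
  have hSb : ∀ x, |S x| ≤ d * (‖θ‖ * √(3 * d * ((N : ℝ) + 1))) := fun x => by
    refine (Finset.abs_sum_le_sum_abs _ _).trans ?_
    simpa using Finset.sum_le_sum fun α (_ : α ∈ Finset.univ) => abs_comp_le μ α θ (x α)
  have hSi : Integrable S μ := Integrable.of_bound hSm.aestronglyMeasurable _ (ae_of_all _ hSb)
  have hSi2 : Integrable (fun x => S x ^ 2) μ :=
    Integrable.of_bound (hSm.pow_const 2).aestronglyMeasurable
      ((d * (‖θ‖ * √(3 * d * ((N : ℝ) + 1)))) ^ 2) (ae_of_all _ fun x => by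
        rw [Real.norm_eq_abs, abs_pow]; gcongr; exact hSb x)
  have hS0 : ∫ x, S x ∂μ = 0 := by
    have hm : ∀ α : Fin d, Integrable (fun x : Fin d → ℝ => comp μ α θ (x α)) μ := fun α =>
      Integrable.of_bound ((measurable_comp μ α θ).comp
        (measurable_pi_apply α)).aestronglyMeasurable _ (ae_of_all _ fun x => abs_comp_le μ α θ _)
    rw [hS, integral_finsetSum _ fun α _ => hm α]
    simp [integral_comp_eval]
  have e : ∀ x, fit μ θ x ^ 2 = θ none ^ 2 + 2 * θ none * S x + S x ^ 2 := fun x => by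
    rw [fit_eq]; ring
  have e1 : ∫ x, fit μ θ x ^ 2 ∂μ = θ none ^ 2 + ∫ x, S x ^ 2 ∂μ := by
    rw [integral_congr_ae (ae_of_all _ e),
      integral_add (f := fun x => θ none ^ 2 + 2 * θ none * S x)
        ((integrable_const _).add (hSi.const_mul _)) hSi2,
      integral_add (integrable_const _) (hSi.const_mul _), integral_const_mul, hS0]
    simp
  have h1 := h.le_integral (hSm.pow_const 2) (fun x => sq_nonneg _) hSi2
  have h2 := variance_sum_unif (fun α => measurable_comp μ α θ) (fun α t => abs_comp_le μ α θ t)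
  simp only [variance_comp] at h2
  have hN : (1 : ℝ) ≤ (N : ℝ) + 1 := by linarith [(Nat.cast_nonneg N : (0 : ℝ) ≤ N)]
  -- The variance only loses the squared block sum divided by N + 1. With cf ≤ 1 and N + 1 ≥ 1 this
  -- is covered by the full squared block sum.
  have h3 : ∑ α : Fin d, (cf * ∑ J : Fin (N + 1), θ (some (α, J)) ^ 2
        - (∑ J : Fin (N + 1), θ (some (α, J))) ^ 2)
      ≤ cf * ∑ α : Fin d, (∑ J : Fin (N + 1), θ (some (α, J)) ^ 2
        - (∑ J : Fin (N + 1), θ (some (α, J))) ^ 2 / ((N : ℝ) + 1)) := by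
    rw [Finset.mul_sum]
    refine Finset.sum_le_sum fun α _ => ?_
    have h4 : (∑ J : Fin (N + 1), θ (some (α, J))) ^ 2 / ((N : ℝ) + 1)
        ≤ (∑ J : Fin (N + 1), θ (some (α, J))) ^ 2 := div_le_self (sq_nonneg _) hN
    nlinarith [sq_nonneg (∑ J : Fin (N + 1), θ (some (α, J))),
      div_nonneg (sq_nonneg (∑ J : Fin (N + 1), θ (some (α, J)))) (by linarith : (0:ℝ) ≤ N + 1)]
  rw [Finset.sum_sub_distrib, ← Finset.mul_sum] at h3
  have h5 : cf * ∑ α : Fin d, (∑ J : Fin (N + 1), θ (some (α, J)) ^ 2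
        - (∑ J : Fin (N + 1), θ (some (α, J))) ^ 2 / ((N : ℝ) + 1))
      ≤ cf * ∫ x, S x ^ 2 ∂unif d := by gcongr
  rw [e1, norm_sq_coef]
  nlinarith [sq_nonneg (θ none)]

end Gram

/-! ### The space fitted by least squares -/

section SplineSpan

variable {ν : Measure ℝ} [IsProbabilityMeasure ν] {N : ℕ}

/-- On `[0, 1)` the function `g` is a constant plus a combination of the spline basis. -/
def InSplineSpan (ν : Measure ℝ) (N : ℕ) (g : ℝ → ℝ) : Prop :=
  ∃ (κ : ℝ) (c : Fin N → ℝ), ∀ t ∈ Ico (0 : ℝ) 1, g t = κ + ∑ J, c J * splineBasis ν N J t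

lemma InSplineSpan.add {g g' : ℝ → ℝ} (h : InSplineSpan ν N g) (h' : InSplineSpan ν N g') :
    InSplineSpan ν N fun t => g t + g' t := by
  obtain ⟨κ, c, h⟩ := h
  obtain ⟨κ', c', h'⟩ := h'
  refine ⟨κ + κ', c + c', fun t ht => ?_⟩
  simp only [h t ht, h' t ht, Pi.add_apply, add_mul, Finset.sum_add_distrib]
  ring

lemma InSplineSpan.const_mul {g : ℝ → ℝ} (h : InSplineSpan ν N g) (r : ℝ) :
    InSplineSpan ν N fun t => r * g t := by
  obtain ⟨κ, c, h⟩ := h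
  refine ⟨r * κ, fun J => r * c J, fun t ht => ?_⟩
  simp only [h t ht, mul_add, Finset.mul_sum, mul_assoc]

lemma InSplineSpan.const (r : ℝ) : InSplineSpan ν N fun _ => r := ⟨r, 0, fun t _ => by simp⟩

lemma InSplineSpan.congr {g g' : ℝ → ℝ} (h : InSplineSpan ν N g)
    (e : ∀ t ∈ Ico (0 : ℝ) 1, g' t = g t) : InSplineSpan ν N g' := by
  obtain ⟨κ, c, h⟩ := h
  exact ⟨κ, c, fun t ht => (e t ht).trans (h t ht)⟩

lemma InSplineSpan.sum {ι : Type*} (s : Finset ι) {g : ι → ℝ → ℝ}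
    (h : ∀ i, InSplineSpan ν N (g i)) : InSplineSpan ν N fun t => ∑ i ∈ s, g i t := by
  classical
  induction s using Finset.induction_on with
  | empty => simpa using InSplineSpan.const (ν := ν) (N := N) 0
  | insert i s hi ih => simpa [Finset.sum_insert hi] using (h i).add ih

lemma l2Norm_bin (J : ℕ) : l2Norm ν (bin N J) = √(∫ t, bin N J t ∂ν) := by
  simp [l2Norm, bin_sq]

lemma l2Norm_centeredSpline_pos (hpos : ∀ J ≤ N, 0 < ∫ t, bin N J t ∂ν) (J : Fin N) :
    0 < l2Norm ν (centeredSpline ν N J) := by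
  set r := l2Norm ν (bin N (J + 1)) / l2Norm ν (bin N J) with hr
  have e : ∀ t, centeredSpline ν N J t ^ 2 = bin N (J + 1) t + r ^ 2 * bin N J t := fun t => by
    have h1 := bin_mul_bin (N := N) (Nat.succ_ne_self (J : ℕ)) t
    have h2 := bin_sq N (J + 1) t
    have h3 := bin_sq N J t
    unfold centeredSpline
    rw [← hr]
    linear_combination h2 + r ^ 2 * h3 - 2 * r * h1
  rw [l2Norm]
  refine Real.sqrt_pos.2 ?_
  simp only [e]
  rw [integral_add (integrable_bin N _ ν) ((integrable_bin N _ ν).const_mul _),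
    integral_const_mul]
  have h1 := hpos (J + 1) J.2
  have h2 := hpos J J.2.le
  positivity

lemma inSplineSpan_centeredSpline (hpos : ∀ J ≤ N, 0 < ∫ t, bin N J t ∂ν) (J : Fin N) :
    InSplineSpan ν N (centeredSpline ν N J) := by
  refine ⟨0, Pi.single J (l2Norm ν (centeredSpline ν N J)), fun t _ => ?_⟩
  have h := l2Norm_centeredSpline_pos hpos J
  rw [Finset.sum_eq_single J]
  · simp only [Pi.single_eq_same, splineBasis]
    field_simp
    simp
  · intro J' _ hJ
    simp [hJ]
  · simp

/-- Chaining the relations I_{J+1} - r I_J, all with r > 0, expresses every bin through the first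
one. Positivity of the accumulated factor R is what the next lemma needs. -/
lemma exists_inSplineSpan_bin_sub (hpos : ∀ J ≤ N, 0 < ∫ t, bin N J t ∂ν) (J : ℕ) (hJ : J ≤ N) :
    ∃ R > 0, InSplineSpan ν N fun t => bin N J t - R * bin N 0 t := by
  induction J with
  | zero => exact ⟨1, one_pos, by simpa using InSplineSpan.const 0⟩
  | succ J ih =>
    obtain ⟨R, hR, h⟩ := ih (by omega)
    have hp : 0 < l2Norm ν (bin N (J + 1)) / l2Norm ν (bin N J) := by
      rw [l2Norm_bin, l2Norm_bin]
      have h1 := hpos (J + 1) hJ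
      have h2 := hpos J (by omega)
      positivity
    set r := l2Norm ν (bin N (J + 1)) / l2Norm ν (bin N J) with hr
    refine ⟨r * R, by positivity, ?_⟩
    refine ((inSplineSpan_centeredSpline hpos ⟨J, hJ⟩).add (h.const_mul r)).congr fun t _ => ?_
    simp only [centeredSpline]
    rw [← hr]; ring

/-- Summing I_J - R_J I_0 over all bins gives 1 - (Σ R_J) I_0 on [0, 1), and Σ R_J > 0 permits
solving for I_0. Hence constants and the N standardised splines span all step functions, and least
squares fits the full additive step space. -/
lemma inSplineSpan_bin (hpos : ∀ J ≤ N, 0 < ∫ t, bin N J t ∂ν) (J : Fin (N + 1)) :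
    InSplineSpan ν N (bin N J) := by
  choose R hR h using fun J : Fin (N + 1) =>
    exists_inSplineSpan_bin_sub hpos (J : ℕ) (Nat.lt_succ_iff.1 J.2)
  have hS : 0 < ∑ J, R J := Finset.sum_pos (fun J _ => hR J) Finset.univ_nonempty
  have h0 : InSplineSpan ν N (bin N 0) := by
    refine (((InSplineSpan.const 1).add
      ((InSplineSpan.sum Finset.univ h).const_mul (-1))).const_mul (∑ J, R J)⁻¹).congr
        fun t ht => ?_
    simp only [Finset.sum_sub_distrib, sum_bin_eq_one ht, ← Finset.sum_mul]
    field_simp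
    ring
  exact ((h J).add (h0.const_mul (R J))).congr fun t _ => by ring

lemma exists_bin_repr (c : Fin N → ℝ) :
    ∃ v : Fin (N + 1) → ℝ, ∀ t, ∑ J, c J * splineBasis ν N J t = ∑ J, v J * bin N J t := by
  refine ⟨fun K => ∑ J : Fin N, c J * (l2Norm ν (centeredSpline ν N J))⁻¹ *
    ((if K = J.succ then 1 else 0) - (if K = J.castSucc then
      l2Norm ν (bin N (J + 1)) / l2Norm ν (bin N J) else 0)), fun t => ?_⟩
  simp only [Finset.sum_mul]
  rw [Finset.sum_comm]
  refine Finset.sum_congr rfl fun J _ => ?_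
  have e : ∀ K : Fin (N + 1), c J * (l2Norm ν (centeredSpline ν N J))⁻¹ *
      ((if K = J.succ then 1 else 0) - (if K = J.castSucc then
        l2Norm ν (bin N (J + 1)) / l2Norm ν (bin N J) else 0)) * bin N K t
      = (if K = J.succ then c J * (l2Norm ν (centeredSpline ν N J))⁻¹ * bin N K t else 0)
        - (if K = J.castSucc then c J * (l2Norm ν (centeredSpline ν N J))⁻¹ *
          (l2Norm ν (bin N (J + 1)) / l2Norm ν (bin N J)) * bin N K t else 0) := by
    intro K
    split_ifs <;> ring
  simp only [e, Finset.sum_sub_distrib, Finset.sum_ite_eq', Finset.mem_univ, if_true]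
  simp only [splineBasis, centeredSpline, Fin.val_succ, Fin.val_castSucc]
  ring

end SplineSpan

/-! ### Normal equations of the spline regression, transported to the bin features. -/

section NormalEquations

lemma eq_zero_of_forall_quadratic_nonneg {S Q : ℝ} (h : ∀ t : ℝ, 0 ≤ t ^ 2 * Q - 2 * t * S) :
    S = 0 := by
  by_contra hS
  have hS2 : 0 < S ^ 2 := by positivity
  -- At this t the linear term beats the quadratic one: the value is S² (Q - 2(|Q| + 1)) / (|Q| +
  -- 1)², which is negative if S ≠ 0.
  have h1 := h (S / (|Q| + 1))
  have hQ : 0 < |Q| + 1 := by positivity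
  have h2 : (S / (|Q| + 1)) ^ 2 * Q - 2 * (S / (|Q| + 1)) * S
      = S ^ 2 / (|Q| + 1) ^ 2 * (Q - 2 * (|Q| + 1)) := by
    field_simp
  rw [h2] at h1
  have h3 : Q - 2 * (|Q| + 1) < 0 := by linarith [le_abs_self Q, abs_nonneg Q]
  have h4 : S ^ 2 / (|Q| + 1) ^ 2 * (Q - 2 * (|Q| + 1)) < 0 :=
    mul_neg_of_pos_of_neg (by positivity) h3
  linarith

variable {d N : ℕ}

lemma IsLeastSquares.normal {B : Fin d → Fin N → ℝ → ℝ} {n : ℕ} {x : ℕ → Fin d → ℝ} {y : ℕ → ℝ}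
    {lam : ℝ × (Fin d → Fin N → ℝ)} (h : IsLeastSquares B n x y lam)
    (u : ℝ × (Fin d → Fin N → ℝ)) :
    ∑ i ∈ Finset.range n, (y i - lam.1 - ∑ α, ∑ J, lam.2 α J * B α J (x i α))
      * (u.1 + ∑ α, ∑ J, u.2 α J * B α J (x i α)) = 0 := by
  refine eq_zero_of_forall_quadratic_nonneg
    (Q := ∑ i ∈ Finset.range n, (u.1 + ∑ α, ∑ J, u.2 α J * B α J (x i α)) ^ 2) fun t => ?_
  have h1 := h (lam + t • u)
  unfold lsCriterion at h1
  rw [← sub_nonneg, ← Finset.sum_sub_distrib] at h1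
  refine h1.trans_eq ?_
  rw [Finset.mul_sum, Finset.mul_sum, ← Finset.sum_sub_distrib]
  refine Finset.sum_congr rfl fun i _ => ?_
  have e : ∑ α, ∑ J, (lam + t • u).2 α J * B α J (x i α)
      = ∑ α, ∑ J, lam.2 α J * B α J (x i α) + t * ∑ α, ∑ J, u.2 α J * B α J (x i α) := by
    simp only [Prod.snd_add, Prod.smul_snd, Pi.add_apply, Pi.smul_apply, smul_eq_mul, add_mul,
      Finset.sum_add_distrib, Finset.mul_sum, mul_assoc]
  rw [e]
  simp only [Prod.fst_add, Prod.smul_fst, smul_eq_mul]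
  ring

/-- The least squares fit, recentered at an additive step function, satisfies the normal equations
of the features. -/
lemma exists_coef_of_isLeastSquares {ν : Fin d → Measure ℝ} [∀ α, IsProbabilityMeasure (ν α)]
    (hpos : ∀ α, ∀ J ≤ N, 0 < ∫ t, bin N J t ∂ν α) {n : ℕ} {x : ℕ → Fin d → ℝ} {y : ℕ → ℝ}
    {lam : ℝ × (Fin d → Fin N → ℝ)}
    (h : IsLeastSquares (fun α => splineBasis (ν α) N) n x y lam)
    (hx : ∀ i < n, ∀ α, x i α ∈ Ico (0 : ℝ) 1) (μ : Measure (Fin d → ℝ))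
    (c : ℝ) (g : Fin d → Fin (N + 1) → ℝ) :
    ∃ (θ : Coef d N) (κ : Fin d → ℝ),
      (∀ α, ∑ J : Fin (N + 1), θ (some (α, J)) = 0) ∧
      (∀ α, ∀ t ∈ Ico (0 : ℝ) 1, ∑ J, lam.2 α J * splineBasis (ν α) N J t
        = ∑ J : Fin (N + 1), g α J * bin N J t + comp μ α θ t + κ α) ∧
      ∀ η : Coef d N, ∑ i ∈ Finset.range n,
        (y i - c - ∑ α, ∑ J : Fin (N + 1), g α J * bin N J (x i α) - fit μ θ (x i))
          * fit μ η (x i) = 0 := by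
  choose v hv using fun α => exists_bin_repr (ν := ν α) (lam.2 α)
  set L : ℝ := (N : ℝ) + 1 with hL
  have hL0 : 0 < √L := by positivity
  have hL1 : L ≠ 0 := by positivity
  -- Subtracting the mean of a coefficient block changes the step function on [0, 1) only by a
  -- constant, which is moved into κ. This selects the representative with zero block sums, on which
  -- the penalty in `gramForm` vanishes.
  set mean : Fin d → ℝ := fun α => (∑ J, (v α J - g α J)) / L with hmean
  set w : Fin d → Fin (N + 1) → ℝ := fun α J => v α J - g α J - mean α with hw
  set κ : Fin d → ℝ := fun α => mean α + ∑ J : Fin (N + 1), w α J * binProb μ N α J with hκ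
  set θ : Coef d N := WithLp.toLp 2 fun j =>
    j.elim (lam.1 - c + ∑ α, κ α) fun p => w p.1 p.2 / √L with hθ
  have hcomp : ∀ α t, comp μ α θ t
      = ∑ J : Fin (N + 1), w α J * bin N J t - ∑ J : Fin (N + 1), w α J * binProb μ N α J := by
    intro α t
    rw [comp, ← Finset.sum_sub_distrib]
    refine Finset.sum_congr rfl fun J _ => ?_
    simp only [hθ, Option.elim, step, ← hL]
    field_simp
  have hrep : ∀ α, ∀ t ∈ Ico (0 : ℝ) 1, ∑ J, lam.2 α J * splineBasis (ν α) N J t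
      = ∑ J : Fin (N + 1), g α J * bin N J t + comp μ α θ t + κ α := by
    intro α t ht
    rw [hv α t, hcomp, hκ]
    have h1 := sum_bin_eq_one (N := N) ht
    have h2 : ∑ J : Fin (N + 1), w α J * bin N J t
        = ∑ J : Fin (N + 1), v α J * bin N J t - ∑ J : Fin (N + 1), g α J * bin N J t
          - mean α := by
      simp only [hw, sub_mul, Finset.sum_sub_distrib, ← Finset.mul_sum, h1, mul_one]
    rw [h2]; ring
  refine ⟨θ, κ, fun α => ?_, hrep, fun η => ?_⟩
  · simp only [hθ, Option.elim, ← Finset.sum_div]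
    have : ∑ J, w α J = 0 := by
      simp only [hw, hmean, Finset.sum_sub_distrib, Finset.sum_const, Finset.card_univ,
        Fintype.card_fin, nsmul_eq_mul]
      push_cast
      rw [← hL, mul_div_cancel₀ _ hL1]
      ring
    simp [this]
  -- Any combination of features agrees on [0, 1)^d with an element of the fitted space, so it is an
  -- admissible test function in the normal equations.
  · have hη : ∃ u : ℝ × (Fin d → Fin N → ℝ), ∀ z : Fin d → ℝ, (∀ α, z α ∈ Ico (0 : ℝ) 1) →
        fit μ η z = u.1 + ∑ α, ∑ J, u.2 α J * splineBasis (ν α) N J (z α) := by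
      have hc : ∀ α, InSplineSpan (ν α) N (comp μ α η) := by
        intro α
        unfold comp step
        refine InSplineSpan.sum _ fun J => ?_
        exact ((((inSplineSpan_bin (hpos α) J).add
          (InSplineSpan.const (-(binProb μ N α J)))).const_mul _).const_mul _)
      choose a b hab using hc
      refine ⟨(η none + ∑ α, a α, b), fun z hz => ?_⟩
      rw [fit_eq, Finset.sum_congr rfl fun α _ => hab α (z α) (hz α), Finset.sum_add_distrib]
      ring
    obtain ⟨u, hu⟩ := hη
    rw [← h.normal u]
    refine Finset.sum_congr rfl fun i hi => ?_
    have hxi := hx i (Finset.mem_range.1 hi)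
    rw [hu (x i) hxi, Finset.sum_congr rfl fun α _ => hrep α (x i α) (hxi α), fit_eq]
    simp only [Finset.sum_add_distrib]
    congr 1
    have : θ none = lam.1 - c + ∑ α, κ α := by simp [hθ]
    rw [this]; ring

end NormalEquations

/-! ### Kernels -/

section Kernel

/-- Quantitative form of the kernel conditions. -/
structure KernelBound (K : ℝ → ℝ) (C : ℝ) : Prop where
  one_le : 1 ≤ C
  meas : Measurable K
  nonneg : ∀ u, 0 ≤ K u
  le : ∀ u, K u ≤ C
  symm : ∀ u, K (-u) = K u
  support : ∀ u, u ∉ Icc (-1 : ℝ) 1 → K u = 0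
  lipschitz : ∀ u ∈ Icc (-1 : ℝ) 1, ∀ v ∈ Icc (-1 : ℝ) 1, |K u - K v| ≤ C * |u - v|
  integral_eq_one : ∫ u, K u = 1

lemma IsSmoothingKernel.exists_bound {K : ℝ → ℝ} (hK : IsSmoothingKernel K) :
    ∃ C, KernelBound K C := by
  obtain ⟨L, hL⟩ := hK.lipschitz
  have hcont : ContinuousOn K (Icc (-1) 1) := hL.continuousOn
  obtain ⟨b, hb⟩ := (isCompact_Icc.image_of_continuousOn hcont).bddAbove
  have hb' : ∀ u ∈ Icc (-1 : ℝ) 1, K u ≤ b := fun u hu => hb ⟨u, hu, rfl⟩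
  have hmax : ∀ u, K u ≤ max (max b L) 1 := fun u => by
    by_cases hu : u ∈ Icc (-1 : ℝ) 1
    · exact (hb' u hu).trans (le_max_of_le_left (le_max_left _ _))
    · rw [hK.support u hu]; exact le_max_of_le_right zero_le_one
  refine ⟨max (max b L) 1, le_max_right _ _, ?_, hK.nonneg, hmax, hK.symm, hK.support, ?_,
    hK.integral_eq_one⟩
  · have e : K = Set.indicator (Icc (-1) 1) K := by
      ext u
      by_cases hu : u ∈ Icc (-1 : ℝ) 1
      · rw [Set.indicator_of_mem hu]
      · rw [Set.indicator_of_notMem hu, hK.support u hu]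
    rw [e]
    have h1 : Measurable ((Icc (-1 : ℝ) 1).domRestrict K) :=
      (continuousOn_iff_continuous_domRestrict.1 hcont).measurable
    refine measurable_of_restrict_of_restrict_compl (s := Icc (-1 : ℝ) 1) measurableSet_Icc
      ?_ ?_
    · convert h1 using 1
      ext u; exact Set.indicator_of_mem u.2 K
    · convert measurable_const (a := (0 : ℝ)) using 1
      ext u; exact Set.indicator_of_notMem u.2 K
  · intro u hu v hv
    have h := hL.dist_le_mul u hu v hv
    rw [Real.dist_eq, Real.dist_eq] at h
    refine h.trans ?_
    gcongr
    exact le_max_of_le_left (le_max_right _ _)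

namespace KernelBound

variable {K : ℝ → ℝ} {C : ℝ} (hK : KernelBound K C)
include hK

lemma integrable_mul {F : ℝ → ℝ} (hF : Measurable F) {M : ℝ} (hM : ∀ u ∈ Icc (-1 : ℝ) 1, |F u| ≤ M) :
    Integrable (fun u => F u * K u) := by
  have hM0 : 0 ≤ M := (abs_nonneg _).trans (hM 0 (by norm_num))
  have hi : Integrable (fun u => (M * C) * (Icc (-1 : ℝ) 1).indicator (fun _ => (1 : ℝ)) u) := by
    refine Integrable.const_mul ?_ _
    rw [integrable_indicator_iff measurableSet_Icc]
    exact integrableOn_const (by simp)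
  refine hi.mono' (hF.mul hK.meas).aestronglyMeasurable (ae_of_all _ fun u => ?_)
  rw [Real.norm_eq_abs, abs_mul, abs_of_nonneg (hK.nonneg u)]
  by_cases hu : u ∈ Icc (-1 : ℝ) 1
  · simp only [hu, Set.indicator_of_mem, mul_one]
    exact mul_le_mul (hM u hu) (hK.le u) (hK.nonneg u) hM0
  · simp [hu, hK.support u hu]

lemma integrable : Integrable K := by
  simpa using hK.integrable_mul (F := fun _ => 1) measurable_const (M := 1) (by simp)

lemma measurable_scaled (h x : ℝ) : Measurable fun y => scaledKernel K h (y - x) := by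
  have := hK.meas
  unfold scaledKernel
  fun_prop

lemma scaled_nonneg {h : ℝ} (hh : 0 < h) (u : ℝ) : 0 ≤ scaledKernel K h u :=
  div_nonneg (hK.nonneg _) hh.le

lemma scaled_eq_zero {h : ℝ} (hh : 0 < h) {u : ℝ} (hu : h < |u|) : scaledKernel K h u = 0 := by
  rw [scaledKernel, hK.support, zero_div]
  rw [Set.mem_Icc, ← abs_le, abs_div, abs_of_pos hh, div_le_one hh]
  exact not_le.2 hu

lemma scaled_le {h : ℝ} (hh : 0 < h) (x y : ℝ) :
    scaledKernel K h (y - x)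
      ≤ C / h * (Icc (x - 2 * h) (x + 2 * h)).indicator (fun _ => 1) y := by
  by_cases hy : y ∈ Icc (x - 2 * h) (x + 2 * h)
  · simp only [hy, Set.indicator_of_mem, mul_one, scaledKernel]
    gcongr
    exact hK.le _
  · rw [hK.scaled_eq_zero hh]
    · simp [hy]
    · by_contra hcon
      rw [not_lt, abs_le] at hcon
      exact hy ⟨by linarith, by linarith⟩

omit hK in
lemma integral_mul_scaled (F : ℝ → ℝ) {h : ℝ} (hh : 0 < h) (x : ℝ) :
    ∫ y, F y * scaledKernel K h (y - x) = ∫ v, F (x + h * v) * K v := by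
  have e : ∀ y, F y * scaledKernel K h (y - x)
      = h⁻¹ * ((fun v => F (x + h * v) * K v) ((y - x) / h)) := fun y => by
    simp only [scaledKernel]
    rw [mul_div_cancel₀ _ hh.ne']
    rw [add_sub_cancel]
    ring
  simp only [e]
  rw [integral_const_mul, integral_sub_right_eq_self
    (fun y => (fun v => F (x + h * v) * K v) (y / h)) x,
    Measure.integral_comp_div (fun v => F (x + h * v) * K v)]
  rw [abs_of_pos hh, smul_eq_mul, ← mul_assoc, inv_mul_cancel₀ hh.ne', one_mul]

lemma integral_unifOne_mul_scaled (F : ℝ → ℝ) {h : ℝ} (hh : 0 < h) (x : ℝ) :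
    ∫ y, F y * scaledKernel K h (y - x) ∂unifOne
      = ∫ v, (Icc (0 : ℝ) 1).indicator F (x + h * v) * K v := by
  rw [← integral_mul_scaled _ hh, unifOne, ← integral_indicator measurableSet_Icc]
  congr 1 with y
  by_cases hy : y ∈ Icc (0 : ℝ) 1 <;> simp [hy]

/-- Mass of the kernel to the right of `s`. -/
def upperMass (K : ℝ → ℝ) (s : ℝ) : ℝ := ∫ v, (Ici s).indicator (fun _ => 1) v * K v

lemma integrable_upper (s : ℝ) :
    Integrable fun v => (Ici s).indicator (fun _ => (1 : ℝ)) v * K v :=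
  hK.integrable_mul (measurable_const.indicator measurableSet_Ici) (M := 1) fun u _ => by
    by_cases h : u ∈ Ici s <;> simp [h]

lemma upperMass_antitone : Antitone (upperMass K) := by
  intro s t hst
  refine integral_mono (hK.integrable_upper t) (hK.integrable_upper s) fun v => ?_
  refine mul_le_mul_of_nonneg_right ?_ (hK.nonneg v)
  exact Set.indicator_le_indicator_of_subset (Set.Ici_subset_Ici.2 hst) (fun _ => zero_le_one) v

lemma upperMass_nonneg (s : ℝ) : 0 ≤ upperMass K s :=
  integral_nonneg fun v => mul_nonneg (Set.indicator_nonneg (fun _ _ => zero_le_one) v)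
    (hK.nonneg v)

lemma upperMass_le_one (s : ℝ) : upperMass K s ≤ 1 := by
  rw [← hK.integral_eq_one]
  refine integral_mono (hK.integrable_upper s) hK.integrable fun v => ?_
  have : (Ici s).indicator (fun _ => (1 : ℝ)) v ≤ 1 :=
    Set.indicator_le_self' (fun _ _ => zero_le_one) v
  nlinarith [hK.nonneg v]

lemma upperMass_zero : upperMass K 0 = 1 / 2 := by
  have h1 : upperMass K 0 = ∫ v in Set.Ioi 0, K v := by
    rw [upperMass, ← integral_indicator measurableSet_Ioi]
    refine integral_congr_ae ?_
    filter_upwards [Measure.ae_ne volume (0 : ℝ)] with v hv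
    by_cases h : 0 < v
    · simp [h, h.le]
    · have : ¬ 0 ≤ v := fun h' => h (lt_of_le_of_ne h' (Ne.symm hv))
      simp [h, this]
  have h2 : ∫ v in Iic 0, K v = ∫ v in Set.Ioi 0, K v := by
    have := integral_comp_neg_Iic (0 : ℝ) K
    simp only [hK.symm, neg_zero] at this
    exact this
  have h3 := intervalIntegral.integral_Iic_add_Ioi (b := (0 : ℝ)) hK.integrable.integrableOn
    hK.integrable.integrableOn
  rw [hK.integral_eq_one] at h3
  linarith

lemma integral_scaled_unifOne {h : ℝ} (hh : 0 < h) (x : ℝ) :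
    ∫ y, scaledKernel K h (y - x) ∂unifOne = upperMass K (-x / h) - upperMass K ((1 - x) / h) := by
  have h1 := hK.integral_unifOne_mul_scaled (fun _ => 1) hh x
  simp only [one_mul] at h1
  rw [h1, upperMass, upperMass, ← integral_sub (hK.integrable_upper _) (hK.integrable_upper _)]
  refine integral_congr_ae ?_
  filter_upwards [Measure.ae_ne volume ((1 - x) / h)] with v hv
  rw [← sub_mul]
  congr 1
  have e1 : x + h * v ∈ Icc (0 : ℝ) 1 ↔ -x / h ≤ v ∧ v ≤ (1 - x) / h := by
    rw [div_le_iff₀ hh, le_div_iff₀ hh, Set.mem_Icc]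
    constructor <;> rintro ⟨h1, h2⟩ <;> constructor <;> linarith
  have e2 : -x / h ≤ (1 - x) / h := by gcongr; linarith
  by_cases a1 : -x / h ≤ v
  · by_cases a2 : v ≤ (1 - x) / h
    · have a3 : ¬ (1 - x) / h ≤ v := fun h' => hv (le_antisymm a2 h')
      simp [Set.indicator, e1, a1, a2, a3]
    · simp [Set.indicator, e1, a1, a2, (not_le.1 a2).le]
  · have a3 : ¬ (1 - x) / h ≤ v := fun h' => a1 (e2.trans h')
    simp [Set.indicator, e1, a1, a3]

/-- By symmetry half of the kernel mass lies on each side of x, and for h ≤ 1/2 the side facing the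
farther endpoint stays inside [0, 1]. -/
lemma half_le_integral_scaled {h : ℝ} (hh : 0 < h) (hh2 : h ≤ 1 / 2) {x : ℝ}
    (hx : x ∈ Icc (0 : ℝ) 1) : 1 / 2 ≤ ∫ y, scaledKernel K h (y - x) ∂unifOne := by
  rw [hK.integral_scaled_unifOne hh]
  have hanti := hK.upperMass_antitone
  have h1 : upperMass K 1 = 0 := by
    rw [upperMass]
    refine (integral_congr_ae ?_).trans (integral_zero _ _)
    filter_upwards [Measure.ae_ne volume (1 : ℝ)] with v hv
    by_cases hv' : v ∈ Ici (1 : ℝ)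
    · have : v ∉ Icc (-1 : ℝ) 1 := fun h' => hv (le_antisymm h'.2 hv')
      simp [hK.support v this]
    · simp [Set.indicator_of_notMem hv']
  have hm1 : upperMass K (-1) = 1 := by
    refine Eq.trans ?_ hK.integral_eq_one
    rw [upperMass]
    refine integral_congr_ae (ae_of_all _ fun v => ?_)
    by_cases hv : v ∈ Ici (-1 : ℝ)
    · simp only [Set.indicator_of_mem hv, one_mul]
    · have : v ∉ Icc (-1 : ℝ) 1 := fun h' => hv h'.1
      simp [hK.support v this]
  rcases le_total x (1 / 2) with hx2 | hx2
  · have a1 : upperMass K ((1 - x) / h) ≤ upperMass K 1 :=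
      hanti (by rw [le_div_iff₀ hh]; linarith)
    have a2 : upperMass K 0 ≤ upperMass K (-x / h) :=
      hanti (div_nonpos_of_nonpos_of_nonneg (by linarith [hx.1]) hh.le)
    rw [hK.upperMass_zero] at a2
    linarith
  · have a1 : upperMass K (-1) ≤ upperMass K (-x / h) :=
      hanti (by rw [div_le_iff₀ hh]; linarith)
    have a2 : upperMass K ((1 - x) / h) ≤ upperMass K 0 :=
      hanti (div_nonneg (by linarith [hx.2]) hh.le)
    rw [hK.upperMass_zero] at a2
    linarith

lemma integral_scaled_unifOne_le {h : ℝ} (hh : 0 < h) (x : ℝ) :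
    ∫ y, scaledKernel K h (y - x) ∂unifOne ≤ 1 := by
  rw [hK.integral_scaled_unifOne hh]
  linarith [hK.upperMass_le_one (-x / h), hK.upperMass_nonneg ((1 - x) / h)]

omit hK in
lemma sum_abs_sub_le_of_antitone {g : ℝ → ℝ} (hg : Antitone g) (h0 : ∀ s, 0 ≤ g s)
    (h1 : ∀ s, g s ≤ 1) {x : ℕ → ℝ} (hx : Antitone x) (m : ℕ) :
    ∑ k ∈ Finset.range m, |g (x (k + 1)) - g (x k)| ≤ 1 := by
  have : ∀ k, |g (x (k + 1)) - g (x k)| = g (x (k + 1)) - g (x k) := fun k =>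
    abs_of_nonneg (sub_nonneg.2 (hg (hx (Nat.le_succ k))))
  simp only [this, Finset.sum_range_sub fun k => g (x k)]
  linarith [h0 (x 0), h1 (x m)]

/-- As a function of its centre, the kernel mass inside [0, 1] is a difference of two monotone
functions with values in [0, 1]. Its variation is thus at most 2 for every bandwidth, which keeps
one part of the path of representers short. -/
lemma variation_integral_scaled {h : ℝ} (hh : 0 < h) {x : ℕ → ℝ} (hx : Monotone x) (m : ℕ) :
    ∑ k ∈ Finset.range m, |∫ y, scaledKernel K h (y - x (k + 1)) ∂unifOne
      - ∫ y, scaledKernel K h (y - x k) ∂unifOne| ≤ 2 := by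
  have hb := fun {z : ℕ → ℝ} (hz : Antitone z) => sum_abs_sub_le_of_antitone
    hK.upperMass_antitone hK.upperMass_nonneg hK.upperMass_le_one hz
  have b1 := hb (z := fun k => -x k / h) (fun k l hkl => by
    have := hx hkl; simp only; gcongr) m
  have b2 := hb (z := fun k => (1 - x k) / h) (fun k l hkl => by
    have := hx hkl; simp only; gcongr) m
  calc _ ≤ ∑ k ∈ Finset.range m, (|upperMass K (-x (k + 1) / h) - upperMass K (-x k / h)|
        + |upperMass K ((1 - x (k + 1)) / h) - upperMass K ((1 - x k) / h)|) := by
        refine Finset.sum_le_sum fun k _ => ?_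
        rw [hK.integral_scaled_unifOne hh, hK.integral_scaled_unifOne hh]
        have := abs_sub (upperMass K (-x (k + 1) / h) - upperMass K (-x k / h))
          (upperMass K ((1 - x (k + 1)) / h) - upperMass K ((1 - x k) / h))
        refine le_trans (le_of_eq ?_) this
        congr 1; ring
    _ ≤ 2 := by rw [Finset.sum_add_distrib]; linarith

end KernelBound

/-- Envelope of the difference of the scaled kernels centered at `x` and within distance `D` of
`x`. -/
def envelope (C h D x y : ℝ) : ℝ :=
  C / h * (D / h * (Icc (x - 2 * h) (x + 2 * h)).indicator (fun _ => 1) y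
    + (Icc (x + h - D) (x + h + D)).indicator (fun _ => 1) y
    + (Icc (x - h - D) (x - h + D)).indicator (fun _ => 1) y)

lemma measurable_envelope (C h D x : ℝ) : Measurable (envelope C h D x) := by
  unfold envelope
  have h1 : ∀ a b : ℝ, Measurable ((Icc a b).indicator fun _ : ℝ => (1 : ℝ)) := fun a b =>
    measurable_const.indicator measurableSet_Icc
  exact ((((h1 _ _).const_mul _).add (h1 _ _)).add (h1 _ _)).const_mul _

lemma indicator_one_nonneg (s : Set ℝ) (y : ℝ) : 0 ≤ s.indicator (fun _ => (1 : ℝ)) y :=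
  Set.indicator_nonneg (fun _ _ => zero_le_one) y

lemma indicator_one_le (s : Set ℝ) (y : ℝ) : s.indicator (fun _ => (1 : ℝ)) y ≤ 1 :=
  Set.indicator_le_self' (fun _ _ => zero_le_one) y

lemma envelope_nonneg {C h D : ℝ} (hC : 0 ≤ C) (hh : 0 < h) (hD : 0 ≤ D) (x y : ℝ) :
    0 ≤ envelope C h D x y := by
  unfold envelope
  have := fun s => indicator_one_nonneg s y
  refine mul_nonneg (by positivity) (add_nonneg (add_nonneg (mul_nonneg (by positivity) ?_) ?_) ?_)
  all_goals exact this _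

lemma envelope_le {C h D : ℝ} (hC : 0 ≤ C) (hh : 0 < h) (hDh : D ≤ h) (x y : ℝ) :
    envelope C h D x y
      ≤ 3 * C / h * (Icc (x - 2 * h) (x + 2 * h)).indicator (fun _ => 1) y := by
  unfold envelope
  set I := (Icc (x - 2 * h) (x + 2 * h)).indicator (fun _ => (1 : ℝ)) y
  have h1 : (Icc (x + h - D) (x + h + D)).indicator (fun _ => (1 : ℝ)) y ≤ I :=
    Set.indicator_le_indicator_of_subset (Set.Icc_subset_Icc (by linarith) (by linarith))
      (fun _ => zero_le_one) y
  have h2 : (Icc (x - h - D) (x - h + D)).indicator (fun _ => (1 : ℝ)) y ≤ I :=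
    Set.indicator_le_indicator_of_subset (Set.Icc_subset_Icc (by linarith) (by linarith))
      (fun _ => zero_le_one) y
  have h3 : D / h * I ≤ 1 * I :=
    mul_le_mul_of_nonneg_right ((div_le_one hh).2 hDh) (indicator_one_nonneg _ _)
  calc _ ≤ C / h * (1 * I + I + I) := by gcongr
    _ = _ := by ring

/-- The kernel is Lipschitz on [-1, 1] but may jump at ±1. If both arguments lie in [-1, 1] the
Lipschitz bound applies; if exactly one does, y is within D of x + h or x - h and the trivial bound
C is used; otherwise both values vanish. -/
lemma KernelBound.abs_sub_le_envelope {K : ℝ → ℝ} {C : ℝ} (hK : KernelBound K C) {h D : ℝ}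
    (hh : 0 < h) (hD : 0 ≤ D) {x x' : ℝ} (hx : |x' - x| ≤ D) (y : ℝ) :
    |scaledKernel K h (y - x') - scaledKernel K h (y - x)| ≤ envelope C h D x y := by
  have hC : 0 ≤ C := zero_le_one.trans hK.one_le
  set u := (y - x') / h with hu
  set v := (y - x) / h with hv
  have hyu : y - x' = h * u := by rw [hu]; field_simp
  have hyv : y - x = h * v := by rw [hv]; field_simp
  rw [abs_le] at hx
  have i1 := indicator_one_nonneg (Icc (x - 2 * h) (x + 2 * h)) y
  have i2 := indicator_one_nonneg (Icc (x + h - D) (x + h + D)) y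
  have i3 := indicator_one_nonneg (Icc (x - h - D) (x - h + D)) y
  have e : |scaledKernel K h (y - x') - scaledKernel K h (y - x)| = |K u - K v| / h := by
    rw [scaledKernel, scaledKernel, ← sub_div, abs_div, abs_of_pos hh]
  rw [e, envelope, div_mul_eq_mul_div]
  refine div_le_div_of_nonneg_right ?_ hh.le
  have hDh : 0 ≤ D / h := by positivity
  have hone : ∀ {w w' : ℝ}, |K w - K w'| ≤ C := by
    intro w w'
    rw [abs_le]
    constructor <;> linarith [hK.nonneg w, hK.nonneg w', hK.le w, hK.le w']
  have hgoal : ∀ {A : ℝ}, 1 ≤ A → |K u - K v| ≤ C * A := fun hA =>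
    hone.trans (le_mul_of_one_le_right hC hA)
  by_cases hu1 : u ∈ Icc (-1 : ℝ) 1
  · by_cases hv1 : v ∈ Icc (-1 : ℝ) 1
    · have hy : y ∈ Icc (x - 2 * h) (x + 2 * h) := by
        constructor <;> nlinarith [hv1.1, hv1.2]
      refine (hK.lipschitz u hu1 v hv1).trans ?_
      gcongr
      have : |u - v| ≤ D / h := by
        have h2 : u - v = (x - x') / h := by rw [hu, hv]; ring
        rw [h2, abs_div, abs_of_pos hh]
        gcongr
        rw [abs_le]; constructor <;> linarith
      rw [Set.indicator_of_mem hy]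
      linarith
    · rcases lt_or_ge 1 v with h1 | h1
      · have hy : y ∈ Icc (x + h - D) (x + h + D) := by
          constructor <;> nlinarith [hu1.1, hu1.2]
        refine hgoal ?_
        rw [Set.indicator_of_mem hy]
        nlinarith
      · have h2 : v < -1 := by
          by_contra hcon
          exact hv1 ⟨not_lt.1 hcon, h1⟩
        have hy : y ∈ Icc (x - h - D) (x - h + D) := by
          constructor <;> nlinarith [hu1.1, hu1.2]
        refine hgoal ?_
        rw [Set.indicator_of_mem hy]
        nlinarith
  · by_cases hv1 : v ∈ Icc (-1 : ℝ) 1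
    · rcases lt_or_ge 1 u with h1 | h1
      · have hy : y ∈ Icc (x + h - D) (x + h + D) := by
          constructor <;> nlinarith [hv1.1, hv1.2]
        refine hgoal ?_
        rw [Set.indicator_of_mem hy]
        nlinarith
      · have h2 : u < -1 := by
          by_contra hcon
          exact hu1 ⟨not_lt.1 hcon, h1⟩
        have hy : y ∈ Icc (x - h - D) (x - h + D) := by
          constructor <;> nlinarith [hv1.1, hv1.2]
        refine hgoal ?_
        rw [Set.indicator_of_mem hy]
        nlinarith
    · rw [hK.support u hu1, hK.support v hv1]
      simp only [sub_self, abs_zero]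
      positivity

lemma integral_indicator_unifOne_le (a b : ℝ) (hab : a ≤ b) :
    ∫ y, (Icc a b).indicator (fun _ => (1 : ℝ)) y ∂unifOne ≤ b - a := by
  rw [integral_indicator measurableSet_Icc]
  simp only [integral_const, smul_eq_mul, mul_one, measureReal_restrict_apply_univ]
  unfold unifOne
  calc (volume.restrict (Icc 0 1)).real (Icc a b) ≤ volume.real (Icc a b) :=
        ENNReal.toReal_mono (by simp) (Measure.restrict_apply_le _ _)
    _ = b - a := by rw [Real.volume_real_Icc_of_le hab]

lemma integrable_indicator_Icc (a b : ℝ) (ν : Measure ℝ) [IsFiniteMeasure ν] :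
    Integrable ((Icc a b).indicator fun _ => (1 : ℝ)) ν :=
  (integrable_const _).indicator measurableSet_Icc

lemma integrable_envelope (C h D x : ℝ) (ν : Measure ℝ) [IsFiniteMeasure ν] :
    Integrable (envelope C h D x) ν :=
  ((((integrable_indicator_Icc _ _ ν).const_mul _).add (integrable_indicator_Icc _ _ ν)).add
    (integrable_indicator_Icc _ _ ν)).const_mul _

lemma integral_envelope_le {C h D : ℝ} (hC : 0 ≤ C) (hh : 0 < h) (hD : 0 ≤ D) (x : ℝ) :
    ∫ y, envelope C h D x y ∂unifOne ≤ 8 * C * D / h := by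
  have i1 := integrable_indicator_Icc (x - 2 * h) (x + 2 * h) unifOne
  have i2 := integrable_indicator_Icc (x + h - D) (x + h + D) unifOne
  have i3 := integrable_indicator_Icc (x - h - D) (x - h + D) unifOne
  have b1 := integral_indicator_unifOne_le (x - 2 * h) (x + 2 * h) (by linarith)
  have b2 := integral_indicator_unifOne_le (x + h - D) (x + h + D) (by linarith)
  have b3 := integral_indicator_unifOne_le (x - h - D) (x - h + D) (by linarith)
  unfold envelope
  rw [integral_const_mul, integral_add (f := fun y =>
    D / h * (Icc (x - 2 * h) (x + 2 * h)).indicator (fun _ => (1 : ℝ)) y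
      + (Icc (x + h - D) (x + h + D)).indicator (fun _ => (1 : ℝ)) y)
    ((i1.const_mul _).add i2) i3, integral_add (i1.const_mul _) i2, integral_const_mul]
  calc _ ≤ C / h * (D / h * (x + 2 * h - (x - 2 * h)) + (x + h + D - (x + h - D))
        + (x - h + D - (x - h - D))) := by gcongr
    _ = _ := by field_simp; ring

end Kernel

/-! ### Representation of linear functionals in the theoretical inner product -/

section Riesz

variable {d N : ℕ} (μ : Measure (Fin d → ℝ))

lemma fit_add (u v : Coef d N) (x : Fin d → ℝ) : fit μ (u + v) x = fit μ u x + fit μ v x := by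
  simp [fit, add_mul, Finset.sum_add_distrib]

lemma fit_smul (c : ℝ) (u : Coef d N) (x : Fin d → ℝ) : fit μ (c • u) x = c * fit μ u x := by
  simp only [fit, PiLp.smul_apply, smul_eq_mul, Finset.mul_sum, mul_assoc]

lemma fit_sub (u v : Coef d N) (x : Fin d → ℝ) : fit μ (u - v) x = fit μ u x - fit μ v x := by
  simp [fit, sub_mul, Finset.sum_sub_distrib]

lemma comp_add (α : Fin d) (u v : Coef d N) (t : ℝ) :
    comp μ α (u + v) t = comp μ α u t + comp μ α v t := by
  simp [comp, add_mul, Finset.sum_add_distrib]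

lemma comp_smul (α : Fin d) (c : ℝ) (u : Coef d N) (t : ℝ) :
    comp μ α (c • u) t = c * comp μ α u t := by
  simp [comp, Finset.mul_sum, mul_assoc]

/-- Sum of the coefficients of one coordinate. -/
def blockSum (α : Fin d) (θ : Coef d N) : ℝ := ∑ J : Fin (N + 1), θ (some (α, J))

lemma blockSum_add (α : Fin d) (u v : Coef d N) :
    blockSum α (u + v) = blockSum α u + blockSum α v := by
  simp [blockSum, Finset.sum_add_distrib]

lemma blockSum_smul (α : Fin d) (c : ℝ) (u : Coef d N) :
    blockSum α (c • u) = c * blockSum α u := by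
  simp [blockSum, Finset.mul_sum]

/-- Theoretical inner product of the additive step functions, plus a penalty on the coefficient
vectors which represent zero. -/
def gramForm (u v : Coef d N) : ℝ :=
  ∫ x, fit μ u x * fit μ v x ∂μ + ∑ α, blockSum α u * blockSum α v

variable [IsProbabilityMeasure μ] [NeZero d]

lemma integrable_fit_mul_fit (u v : Coef d N) :
    Integrable (fun x => fit μ u x * fit μ v x) μ :=
  Integrable.of_bound ((measurable_fit μ u).mul (measurable_fit μ v)).aestronglyMeasurable
    ((‖u‖ * √(3 * d * ((N : ℝ) + 1))) * (‖v‖ * √(3 * d * ((N : ℝ) + 1)))) (ae_of_all _ fun x => by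
      rw [Real.norm_eq_abs, abs_mul]
      exact mul_le_mul (abs_fit_le μ u x) (abs_fit_le μ v x) (abs_nonneg _) (by positivity))

lemma gramForm_add_left (u u' v : Coef d N) :
    gramForm μ (u + u') v = gramForm μ u v + gramForm μ u' v := by
  unfold gramForm
  simp only [fit_add, blockSum_add, add_mul, Finset.sum_add_distrib]
  rw [integral_add (integrable_fit_mul_fit μ u v) (integrable_fit_mul_fit μ u' v)]
  ring

lemma gramForm_smul_left (c : ℝ) (u v : Coef d N) :
    gramForm μ (c • u) v = c * gramForm μ u v := by
  unfold gramForm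
  simp only [fit_smul, blockSum_smul, mul_assoc, integral_const_mul, ← Finset.mul_sum]
  ring

lemma gramForm_comm (u v : Coef d N) : gramForm μ u v = gramForm μ v u := by
  unfold gramForm
  simp only [mul_comm]

/-- The bilinear map underlying `gramForm`. -/
def gramMap : Coef d N →ₗ[ℝ] Coef d N →ₗ[ℝ] ℝ :=
  LinearMap.mk₂ ℝ (gramForm μ) (gramForm_add_left μ) (gramForm_smul_left μ)
    (fun u v v' => by simp only [gramForm_comm μ u, gramForm_add_left])
    (fun c u v => by simp only [gramForm_comm μ u, gramForm_smul_left, smul_eq_mul])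

variable {Ω : Type*} [MeasurableSpace Ω] {P : Measure Ω} [IsProbabilityMeasure P]
  {X : ℕ → Ω → Fin d → ℝ} {μ} {cf Cf : ℝ}

lemma Design.gramForm_self_ge (h : Design P X μ cf Cf) (θ : Coef d N) :
    cf * ‖θ‖ ^ 2 ≤ gramForm μ θ θ := by
  have := h.coercive θ
  simpa [gramForm, blockSum, sq] using this

/-- Coercivity makes the form nondegenerate despite the redundancy of the features, thanks to the
penalty, and in finite dimension every functional is then represented. -/
lemma Design.exists_riesz (h : Design P X μ cf Cf) (ℓ : Coef d N →ₗ[ℝ] ℝ) :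
    ∃ u : Coef d N, ∀ θ, gramForm μ u θ = ℓ θ := by
  have hinj : Function.Injective (gramMap μ (d := d) (N := N)) := by
    rw [injective_iff_map_eq_zero]
    intro u hu
    have h1 : gramForm μ u u = 0 := by
      have := congrArg (fun f => f u) hu
      simpa [gramMap] using this
    have h2 := h.gramForm_self_ge u
    rw [h1] at h2
    have h3 := h.pos
    have h4 : ‖u‖ ^ 2 ≤ 0 := by
      by_contra hcon
      have := mul_pos h3 (not_le.1 hcon)
      linarith
    have h5 : ‖u‖ = 0 := by nlinarith [norm_nonneg u]
    exact norm_eq_zero.1 h5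
  have hsurj : Function.Surjective (gramMap μ (d := d) (N := N)) :=
    (LinearMap.injective_iff_surjective_of_finrank_eq_finrank
      (Subspace.dual_finrank_eq (K := ℝ) (V := Coef d N)).symm).1 hinj
  obtain ⟨u, hu⟩ := hsurj ℓ
  exact ⟨u, fun θ => by rw [← hu]; rfl⟩

/-- Energy estimate: the norm of a representer is at most the norm of its functional divided by the
coercivity constant. -/
lemma Design.norm_le_of_gramForm_le (h : Design P X μ cf Cf) {u : Coef d N} {A : ℝ} (hA0 : 0 ≤ A)
    (hA : gramForm μ u u ≤ A * ‖u‖) : ‖u‖ ≤ A / cf := by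
  have h1 := h.gramForm_self_ge u
  have h3 := h.pos
  rw [le_div_iff₀ h3]
  rcases (norm_nonneg u).eq_or_lt with h0 | h0
  · rw [← h0]; simpa using hA0
  · nlinarith

/-- The functional `θ ↦ E g(X₁) s_α(X_α)`, where `s_α` is the component in coordinate `α` of the
additive step function with coefficients `θ`. -/
def windowFun (μ : Measure (Fin d → ℝ)) (g : ℝ → ℝ) (α : Fin d) (θ : Coef d N) : ℝ :=
  ∫ x, g (x 0) * comp μ α θ (x α) ∂μ

lemma integrable_window {g : ℝ → ℝ} (hg : Measurable g) {M : ℝ} (hM : ∀ t, |g t| ≤ M)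
    (α : Fin d) (θ : Coef d N) (ν : Measure (Fin d → ℝ)) [IsFiniteMeasure ν] :
    Integrable (fun x => g (x 0) * comp μ α θ (x α)) ν :=
  Integrable.of_bound ((hg.comp (measurable_pi_apply 0)).mul
    ((measurable_comp μ α θ).comp (measurable_pi_apply α))).aestronglyMeasurable
    (M * (‖θ‖ * √(3 * d * ((N : ℝ) + 1)))) (ae_of_all _ fun x => by
      rw [Real.norm_eq_abs, abs_mul]
      exact mul_le_mul (hM _) (abs_comp_le μ α θ _) (abs_nonneg _) ((abs_nonneg _).trans (hM 0)))

/-- `windowFun` as a linear map. -/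
def windowMap (μ : Measure (Fin d → ℝ)) [IsProbabilityMeasure μ] {g : ℝ → ℝ} (hg : Measurable g)
    {M : ℝ} (hM : ∀ t, |g t| ≤ M) (α : Fin d) : Coef d N →ₗ[ℝ] ℝ where
  toFun := windowFun μ g α
  map_add' u v := by
    simp only [windowFun, comp_add, mul_add]
    exact integral_add (integrable_window hg hM α u μ) (integrable_window hg hM α v μ)
  map_smul' c u := by
    simp only [windowFun, comp_smul, RingHom.id_apply, smul_eq_mul, ← integral_const_mul]
    congr 1 with x
    ring

lemma integral_abs_comp_le (h : Design P X μ cf Cf) (α : Fin d) (θ : Coef d N) :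
    ∫ t, |comp μ α θ t| ∂unifOne ≤ √(Cf / cf) * ‖θ‖ := by
  have hcf := h.pos
  have hCf := h.one_le_Cf
  have h1 : (∫ t, |comp μ α θ t| ∂unifOne) ^ 2 ≤ ∫ t, comp μ α θ t ^ 2 ∂unifOne := by
    have h2 := (even_two_mul 1).convexOn_pow (𝕜 := ℝ) |>.map_integral_le
      (continuous_pow _).continuousOn isClosed_univ (by simp) (integrable_comp μ α θ unifOne).abs
      (by simpa [Function.comp_def] using integrable_comp_sq μ α θ unifOne) (μ := unifOne)
    simpa using h2
  have h3 : cf * ∫ t, comp μ α θ t ^ 2 ∂unifOne ≤ Cf * ‖θ‖ ^ 2 := by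
    have hm2 : Measurable fun t => comp μ α θ t ^ 2 := (measurable_comp μ α θ).pow_const 2
    rw [← integral_eval_unif (g := fun t => comp μ α θ t ^ 2) hm2.aestronglyMeasurable α]
    refine (h.le_integral (g := fun x : Fin d → ℝ => comp μ α θ (x α) ^ 2)
      (hm2.comp (measurable_pi_apply α)) (fun _ => sq_nonneg _)
      (integrable_comp_eval_sq α θ)).trans ((h.integral_comp_sq_le α θ).trans ?_)
    gcongr
    exact sum_coef_le α θ
  have h4 : (∫ t, |comp μ α θ t| ∂unifOne) ^ 2 ≤ Cf / cf * ‖θ‖ ^ 2 := by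
    refine h1.trans ?_
    rw [div_mul_eq_mul_div, le_div_iff₀ hcf]
    linarith
  calc ∫ t, |comp μ α θ t| ∂unifOne ≤ √(Cf / cf * ‖θ‖ ^ 2) := Real.le_sqrt_of_sq_le h4
    _ = _ := by rw [Real.sqrt_mul (by positivity), Real.sqrt_sq (norm_nonneg _)]

lemma integral_window_unif {g s : ℝ → ℝ} (hg : Measurable g) (hs : Measurable s) {M M' : ℝ}
    (hM : ∀ t, |g t| ≤ M) (hM' : ∀ t, |s t| ≤ M') {α : Fin d} (hα : α ≠ 0) :
    ∫ x, g (x 0) * s (x α) ∂unif d = (∫ t, g t ∂unifOne) * ∫ t, s t ∂unifOne := by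
  rw [integral_mul_eval_unif (α := 0) (G := fun x => s (x α)),
    integral_eval_unif hs.aestronglyMeasurable]
  · intro x t
    rw [Function.update_of_ne hα]
  · exact Integrable.of_bound ((hg.comp (measurable_pi_apply 0)).mul
      (hs.comp (measurable_pi_apply α))).aestronglyMeasurable (M * M') (ae_of_all _ fun x => by
        rw [Real.norm_eq_abs, abs_mul]
        exact mul_le_mul (hM _) (hM' _) (abs_nonneg _) ((abs_nonneg _).trans (hM 0)))

lemma Design.integral_window_le (h : Design P X μ cf Cf) {g s : ℝ → ℝ} (hg : Measurable g)
    (hs : Measurable s) {M M' : ℝ} (hM : ∀ t, |g t| ≤ M) (hM' : ∀ t, |s t| ≤ M') (hg0 : ∀ t, 0 ≤ g t)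
    (hs0 : ∀ t, 0 ≤ s t) {α : Fin d} (hα : α ≠ 0) :
    ∫ x, g (x 0) * s (x α) ∂μ ≤ Cf * ((∫ t, g t ∂unifOne) * ∫ t, s t ∂unifOne) := by
  rw [← integral_window_unif hg hs hM hM' hα]
  have hm : Measurable fun x : Fin d → ℝ => g (x 0) * s (x α) :=
    (hg.comp (measurable_pi_apply 0)).mul (hs.comp (measurable_pi_apply α))
  refine h.integral_le hm (fun x => mul_nonneg (hg0 _) (hs0 _)) ?_
  exact Integrable.of_bound hm.aestronglyMeasurable (M * M') (ae_of_all _ fun x => by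
    rw [Real.norm_eq_abs, abs_mul]
    exact mul_le_mul (hM _) (hM' _) (abs_nonneg _) ((abs_nonneg _).trans (hM 0)))

/-- Because g and the component depend on different coordinates and the joint density is bounded,
only the L¹ norm of g enters. For a kernel window this is at most 1, whereas Cauchy–Schwarz would
give h^{-1/2}; this is the source of representers bounded uniformly in the bandwidth. -/
lemma Design.abs_windowFun_le (h : Design P X μ cf Cf) {g : ℝ → ℝ} (hg : Measurable g)
    {M : ℝ} (hM : ∀ t, |g t| ≤ M) {α : Fin d} (hα : α ≠ 0) (θ : Coef d N) :
    |windowFun μ g α θ| ≤ Cf * √(Cf / cf) * (∫ t, |g t| ∂unifOne) * ‖θ‖ := by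
  have hCf := h.one_le_Cf
  have h1 : ∫ x, |g (x 0)| * |comp μ α θ (x α)| ∂μ
      ≤ Cf * ((∫ t, |g t| ∂unifOne) * ∫ t, |comp μ α θ t| ∂unifOne) :=
    h.integral_window_le (g := fun t => |g t|) (s := fun t => |comp μ α θ t|)
      (continuous_abs.measurable.comp hg) (continuous_abs.measurable.comp (measurable_comp μ α θ))
      (fun t => by rw [abs_abs]; exact hM t) (fun t => by rw [abs_abs]; exact abs_comp_le μ α θ t)
      (fun _ => abs_nonneg _) (fun _ => abs_nonneg _) hα
  have h2 := integral_abs_comp_le h α θ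
  have h3 : 0 ≤ ∫ t, |g t| ∂unifOne := integral_nonneg fun _ => abs_nonneg _
  calc |windowFun μ g α θ| ≤ ∫ x, |g (x 0) * comp μ α θ (x α)| ∂μ := abs_integral_le_integral_abs
    _ = ∫ x, |g (x 0)| * |comp μ α θ (x α)| ∂μ := by simp only [abs_mul]
    _ ≤ _ := h1
    _ ≤ Cf * ((∫ t, |g t| ∂unifOne) * (√(Cf / cf) * ‖θ‖)) := by gcongr
    _ = _ := by ring

/-- Sharper bound for oscillating windows, in terms of the modulus of continuity of the density in
the first coordinate. -/
lemma Design.abs_windowFun_le_of_density (h : Design P X μ cf Cf) {f : (Fin d → ℝ) → ℝ}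
    (hf : Measurable f) (hμ : μ = (unif d).withDensity fun x => ENNReal.ofReal (f x))
    (hf0 : ∀ x, 0 ≤ f x) (hf1 : ∀ x, f x ≤ Cf) {t₀ η : ℝ} {g : ℝ → ℝ} (hg : Measurable g)
    {M : ℝ} (hM : ∀ t, |g t| ≤ M)
    (hη : ∀ x ∈ Icc (0 : Fin d → ℝ) 1, g (x 0) ≠ 0 → |f x - f (Function.update x 0 t₀)| ≤ η)
    {α : Fin d} (hα : α ≠ 0) (θ : Coef d N) :
    |windowFun μ g α θ|
      ≤ √(Cf / cf) * (η * (∫ t, |g t| ∂unifOne) + Cf * |∫ t, g t ∂unifOne|) * ‖θ‖ := by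
  have hCf := h.one_le_Cf
  have hcm := measurable_comp μ α θ
  have hcb := abs_comp_le μ α θ
  set s := comp μ α θ with hs
  have hM0 : 0 ≤ M := (abs_nonneg _).trans (hM 0)
  -- The density with its first argument frozen at t₀. Against it the integral factorises into ∫ g
  -- times an integral over the other coordinates, so cancellation in g is exploited; the error is
  -- controlled by η.
  set f₀ : (Fin d → ℝ) → ℝ := fun x => f (Function.update x 0 t₀) with hf₀
  have hf₀m : Measurable f₀ := hf.comp <| measurable_pi_lambda _ fun β => by
    by_cases hβ : β = 0
    · subst hβ; simp
    · simp only [Function.update_of_ne hβ]; fun_prop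
  have hgm : Measurable fun x : Fin d → ℝ => g (x 0) := hg.comp (measurable_pi_apply 0)
  have hsm : Measurable fun x : Fin d → ℝ => s (x α) := hcm.comp (measurable_pi_apply α)
  set B := ‖θ‖ * √(3 * d * ((N : ℝ) + 1)) with hB
  have hB0 : 0 ≤ B := by positivity
  have hfa : ∀ x, |f x| ≤ Cf := fun x => by rw [abs_of_nonneg (hf0 x)]; exact hf1 x
  have i0 : Integrable (fun x : Fin d → ℝ => |g (x 0)| * |s (x α)|) (unif d) :=
    Integrable.of_bound (by fun_prop) (M * B) (ae_of_all _ fun x => by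
      rw [Real.norm_eq_abs, abs_mul, abs_abs, abs_abs]
      exact mul_le_mul (hM _) (hcb _) (abs_nonneg _) hM0)
  have hib : ∀ F : (Fin d → ℝ) → ℝ, Measurable F → (∀ x, |F x| ≤ Cf) →
      Integrable (fun x : Fin d → ℝ => g (x 0) * (s (x α) * F x)) (unif d) := by
    intro F hF hFb
    refine Integrable.of_bound (by fun_prop) (M * (B * Cf)) (ae_of_all _ fun x => ?_)
    rw [Real.norm_eq_abs, abs_mul, abs_mul]
    exact mul_le_mul (hM _) (mul_le_mul (hcb _) (hFb _) (abs_nonneg _) hB0) (by positivity) hM0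
  have i1 := hib f hf hfa
  have i2 := hib f₀ hf₀m fun x => hfa _
  have e1 : windowFun μ g α θ = ∫ x, g (x 0) * (s (x α) * f x) ∂unif d := by
    have hμ' : windowFun μ g α θ
        = ∫ x, g (x 0) * s (x α) ∂(unif d).withDensity fun x => ENNReal.ofReal (f x) := by
      rw [windowFun, ← hs, ← hμ]
    rw [hμ', integral_withDensity_eq_integral_toReal_smul hf.ennreal_ofReal (by simp)]
    refine integral_congr_ae (ae_of_all _ fun x => ?_)
    simp only [ENNReal.toReal_ofReal (hf0 x), smul_eq_mul]
    ring
  have e2 : ∫ x, g (x 0) * (s (x α) * f₀ x) ∂unif d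
      = (∫ t, g t ∂unifOne) * ∫ x, s (x α) * f₀ x ∂unif d := by
    refine integral_mul_eval_unif (α := 0) (G := fun x => s (x α) * f₀ x) (fun x t => ?_) i2
    simp only [hf₀, Function.update_of_ne hα, Function.update_idem]
  have hint : ∫ x : Fin d → ℝ, |s (x α)| ∂unif d ≤ √(Cf / cf) * ‖θ‖ := by
    rw [integral_eval_unif (g := fun t => |s t|) (by fun_prop)]
    exact integral_abs_comp_le h α θ
  have b1 : |∫ x, s (x α) * f₀ x ∂unif d| ≤ Cf * (√(Cf / cf) * ‖θ‖) := by
    calc |∫ x, s (x α) * f₀ x ∂unif d| ≤ ∫ x, |s (x α) * f₀ x| ∂unif d :=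
          abs_integral_le_integral_abs
      _ ≤ ∫ x, Cf * |s (x α)| ∂unif d := by
          refine integral_mono_of_nonneg (ae_of_all _ fun _ => abs_nonneg _) ?_
            (ae_of_all _ fun x => ?_)
          · refine Integrable.const_mul (Integrable.of_bound hsm.abs.aestronglyMeasurable B
              (ae_of_all _ fun x => ?_)) _
            rw [Real.norm_eq_abs, abs_abs]; exact hcb _
          · simp only [abs_mul, mul_comm Cf]
            gcongr
            exact hfa _
      _ ≤ _ := by rw [integral_const_mul]; gcongr
  have b2 : |∫ x, g (x 0) * (s (x α) * f x) ∂unif d - ∫ x, g (x 0) * (s (x α) * f₀ x) ∂unif d|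
      ≤ η * ((∫ t, |g t| ∂unifOne) * (√(Cf / cf) * ‖θ‖)) := by
    rw [← integral_sub i1 i2]
    have hη0 : ∀ x ∈ Icc (0 : Fin d → ℝ) 1,
        |g (x 0)| * |f x - f₀ x| ≤ |g (x 0)| * η := by
      intro x hx
      by_cases h0 : g (x 0) = 0
      · simp [h0]
      · gcongr; exact hη x hx h0
    have h5 : ∫ x, |g (x 0)| * |s (x α)| ∂unif d = (∫ t, |g t| ∂unifOne) * ∫ t, |s t| ∂unifOne :=
      integral_window_unif (g := fun t => |g t|) (s := fun t => |s t|) (by fun_prop) (by fun_prop)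
        (M := M) (M' := B) (fun t => by rw [abs_abs]; exact hM t)
        (fun t => by rw [abs_abs]; exact hcb t) hα
    have hgi : 0 ≤ ∫ t, |g t| ∂unifOne := integral_nonneg fun _ => abs_nonneg _
    have hle : |∫ x, (g (x 0) * (s (x α) * f x) - g (x 0) * (s (x α) * f₀ x)) ∂unif d|
        ≤ η * ∫ x, |g (x 0)| * |s (x α)| ∂unif d := by
      rw [← integral_const_mul]
      refine abs_integral_le_integral_abs.trans ?_
      refine integral_mono_ae (i1.sub i2).abs (i0.const_mul _) ?_
      filter_upwards [ae_unif_mem] with x hx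
      have e : |g (x 0) * (s (x α) * f x) - g (x 0) * (s (x α) * f₀ x)|
          = |s (x α)| * (|g (x 0)| * |f x - f₀ x|) := by
        rw [← abs_mul, ← abs_mul]; congr 1; ring
      simp only [e]
      calc _ ≤ |s (x α)| * (|g (x 0)| * η) :=
            mul_le_mul_of_nonneg_left (hη0 x hx) (abs_nonneg _)
        _ = _ := by ring
    refine hle.trans ?_
    rw [h5]
    -- A negative η is allowed by the statement: the hypothesis then forces g to vanish at the first
    -- coordinate of almost every point of the cube, and both sides are zero.
    rcases le_or_gt 0 η with hη' | hη'
    · gcongr; exact integral_abs_comp_le h α θ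
    · have hg0 : ∫ t, |g t| ∂unifOne = 0 := by
        refine le_antisymm ?_ hgi
        have h6 : ∫ x : Fin d → ℝ, |g (x 0)| ∂unif d ≤ ∫ x : Fin d → ℝ, (0 : ℝ) ∂unif d := by
          refine integral_mono_ae (Integrable.of_bound hgm.abs.aestronglyMeasurable M (ae_of_all _ fun x => by
            rw [Real.norm_eq_abs, abs_abs]; exact hM _)) (integrable_const _) ?_
          filter_upwards [ae_unif_mem] with x hx
          by_contra hcon
          have h0 : g (x 0) ≠ 0 := fun h0 => hcon (by simp [h0])
          have := (abs_nonneg _).trans (hη x hx h0)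
          linarith
        rw [integral_eval_unif (g := fun t => |g t|) (by fun_prop)] at h6
        simpa using h6
      rw [hg0]; simp
  rw [e1]
  have b3 : |∫ x, g (x 0) * (s (x α) * f₀ x) ∂unif d|
      ≤ |∫ t, g t ∂unifOne| * (Cf * (√(Cf / cf) * ‖θ‖)) := by
    rw [e2, abs_mul]; gcongr
  have h7 := abs_sub_abs_le_abs_sub (∫ x, g (x 0) * (s (x α) * f x) ∂unif d)
    (∫ x, g (x 0) * (s (x α) * f₀ x) ∂unif d)
  calc _ ≤ η * ((∫ t, |g t| ∂unifOne) * (√(Cf / cf) * ‖θ‖))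
        + |∫ t, g t ∂unifOne| * (Cf * (√(Cf / cf) * ‖θ‖)) := by linarith
    _ = _ := by ring

end Riesz

/-! ### Moment bounds for the empirical Gram matrix, the windows and the noise -/

section MomentBounds

variable {Ω : Type*} [MeasurableSpace Ω] {P : Measure Ω} [IsProbabilityMeasure P] {d : ℕ}
  [NeZero d] {X : ℕ → Ω → Fin d → ℝ} {μ : Measure (Fin d → ℝ)} {cf Cf : ℝ} {N : ℕ}

lemma dev_sum {ι : Type*} (s : Finset ι) (c : ι → ℝ) {g : ι → (Fin d → ℝ) → ℝ}
    (hg : ∀ j, Integrable (g j) μ) (n : ℕ) (ω : Ω) :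
    dev X μ n (fun x => ∑ j ∈ s, c j * g j x) ω = ∑ j ∈ s, c j * dev X μ n (g j) ω := by
  unfold dev emp
  rw [integral_finsetSum _ fun j _ => (hg j).const_mul _, Finset.sum_comm, Finset.mul_sum,
    ← Finset.sum_sub_distrib]
  refine Finset.sum_congr rfl fun j _ => ?_
  rw [integral_const_mul, ← Finset.mul_sum]
  ring

/-- The dimension constant `3 d (N + 1)` which bounds the squared norm of the feature vector. -/
def featBound (d N : ℕ) : ℝ := 3 * d * ((N : ℝ) + 1)

lemma one_le_featBound : 1 ≤ featBound d N := by
  have hd : (1 : ℝ) ≤ d := by exact_mod_cast NeZero.one_le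
  have hN : (0 : ℝ) ≤ N := Nat.cast_nonneg N
  unfold featBound
  nlinarith

lemma card_idx_le : (Fintype.card (Idx d N) : ℝ) ≤ featBound d N := by
  have hd : (1 : ℝ) ≤ d := by exact_mod_cast NeZero.one_le
  have hN : (0 : ℝ) ≤ N := Nat.cast_nonneg N
  simp only [Fintype.card_option, Fintype.card_prod, Fintype.card_fin]
  push_cast
  unfold featBound
  nlinarith

lemma norm_sq_eq_sum (θ : Coef d N) : ‖θ‖ ^ 2 = ∑ j, θ j ^ 2 := by
  rw [EuclideanSpace.norm_sq_eq]; simp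

/-- Squared Frobenius norm of the difference of the empirical and theoretical Gram matrices. -/
def gramDev (X : ℕ → Ω → Fin d → ℝ) (μ : Measure (Fin d → ℝ)) (n N : ℕ) (ω : Ω) : ℝ :=
  ∑ j : Idx d N, ∑ k : Idx d N, dev X μ n (fun x => feat μ N j x * feat μ N k x) ω ^ 2

/-- Squared norm of the difference of the empirical and theoretical Gram matrices, applied to
`u`. -/
def gramDevAt (X : ℕ → Ω → Fin d → ℝ) (μ : Measure (Fin d → ℝ)) (n : ℕ) {N : ℕ} (u : Coef d N)
    (ω : Ω) : ℝ :=
  ∑ j : Idx d N, dev X μ n (fun x => fit μ u x * feat μ N j x) ω ^ 2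

lemma abs_feat_mul_feat_le [IsProbabilityMeasure μ] (j k : Idx d N) (x : Fin d → ℝ) :
    |feat μ N j x * feat μ N k x| ≤ featBound d N := by
  rw [abs_mul]
  have h1 := abs_feat_le μ j x
  have h2 := abs_feat_le μ k x
  have h3 : (0 : ℝ) ≤ 3 * d * ((N : ℝ) + 1) := by positivity
  calc _ ≤ √(3 * d * ((N : ℝ) + 1)) * √(3 * d * ((N : ℝ) + 1)) := by gcongr
    _ = _ := Real.mul_self_sqrt h3

lemma abs_fit_mul_feat_le [IsProbabilityMeasure μ] (u : Coef d N) (k : Idx d N) (x : Fin d → ℝ) :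
    |fit μ u x * feat μ N k x| ≤ ‖u‖ * featBound d N := by
  rw [abs_mul]
  have h1 := abs_fit_le μ u x
  have h2 := abs_feat_le μ k x
  have h3 : (0 : ℝ) ≤ 3 * d * ((N : ℝ) + 1) := by positivity
  calc _ ≤ (‖u‖ * √(3 * d * ((N : ℝ) + 1))) * √(3 * d * ((N : ℝ) + 1)) := by gcongr
    _ = _ := by rw [mul_assoc, Real.mul_self_sqrt h3]; rfl

lemma integrable_feat_mul_feat [IsProbabilityMeasure μ] (j k : Idx d N) :
    Integrable (fun x => feat μ N j x * feat μ N k x) μ :=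
  Integrable.of_bound ((measurable_feat μ j).mul (measurable_feat μ k)).aestronglyMeasurable _
    (ae_of_all _ fun x => abs_feat_mul_feat_le j k x)

lemma integrable_fit_mul_feat [IsProbabilityMeasure μ] (u : Coef d N) (k : Idx d N) :
    Integrable (fun x => fit μ u x * feat μ N k x) μ :=
  Integrable.of_bound ((measurable_fit μ u).mul (measurable_feat μ k)).aestronglyMeasurable _
    (ae_of_all _ fun x => abs_fit_mul_feat_le u k x)

/-- Cauchy–Schwarz in v alone. For a fixed direction u this needs a single sum over features, and
its expectation is smaller by a factor N than that of the full Frobenius norm `gramDev`. -/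
lemma dev_fit_mul_fit_sq_le_gramDevAt [IsProbabilityMeasure μ] (u v : Coef d N) (n : ℕ) (ω : Ω) :
    dev X μ n (fun x => fit μ u x * fit μ v x) ω ^ 2 ≤ gramDevAt X μ n u ω * ‖v‖ ^ 2 := by
  have e : (fun x => fit μ u x * fit μ v x)
      = fun x => ∑ j, v j * (fit μ u x * feat μ N j x) := by
    ext x
    rw [fit.eq_1 μ v, Finset.mul_sum]
    exact Finset.sum_congr rfl fun j _ => by ring
  rw [e, dev_sum _ _ (fun j => integrable_fit_mul_feat u j), norm_sq_eq_sum, mul_comm]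
  exact Finset.sum_mul_sq_le_sq_mul_sq _ _ _

lemma gramDevAt_le [IsProbabilityMeasure μ] (u : Coef d N) (n : ℕ) (ω : Ω) :
    gramDevAt X μ n u ω ≤ ‖u‖ ^ 2 * gramDev X μ n N ω := by
  unfold gramDevAt gramDev
  rw [Finset.sum_comm, Finset.mul_sum]
  refine Finset.sum_le_sum fun j _ => ?_
  have e : (fun x => fit μ u x * feat μ N j x)
      = fun x => ∑ k, u k * (feat μ N k x * feat μ N j x) := by
    ext x
    rw [fit, Finset.sum_mul]
    exact Finset.sum_congr rfl fun k _ => by ring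
  rw [e, dev_sum _ _ (fun k => integrable_feat_mul_feat k j), norm_sq_eq_sum]
  exact Finset.sum_mul_sq_le_sq_mul_sq _ _ _

lemma dev_fit_mul_fit_sq_le_gramDev [IsProbabilityMeasure μ] (u v : Coef d N) (n : ℕ) (ω : Ω) :
    dev X μ n (fun x => fit μ u x * fit μ v x) ω ^ 2
      ≤ gramDev X μ n N ω * (‖u‖ ^ 2 * ‖v‖ ^ 2) := by
  refine (dev_fit_mul_fit_sq_le_gramDevAt u v n ω).trans ?_
  have := gramDevAt_le (X := X) (μ := μ) u n ω
  calc _ ≤ (‖u‖ ^ 2 * gramDev X μ n N ω) * ‖v‖ ^ 2 := by gcongr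
    _ = _ := by ring

/-- Squared norm of the vector of deviations of the windows `g(x₁) φ_J(x_α)`. -/
def windowDev (X : ℕ → Ω → Fin d → ℝ) (μ : Measure (Fin d → ℝ)) (n : ℕ) {N : ℕ} (g : ℝ → ℝ)
    (α : Fin d) (φ : Fin (N + 1) → ℝ → ℝ) (ω : Ω) : ℝ :=
  ∑ J : Fin (N + 1), dev X μ n (fun x => g (x 0) * φ J (x α)) ω ^ 2

lemma integrable_window_step [IsProbabilityMeasure μ] {g : ℝ → ℝ} (hg : Measurable g) {M : ℝ}
    (hM : ∀ t, |g t| ≤ M) (α : Fin d) (J : Fin (N + 1)) :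
    Integrable (fun x => g (x 0) * step μ N α J (x α)) μ := by
  refine Integrable.of_bound ((hg.comp (measurable_pi_apply 0)).mul
    ((measurable_step μ α J).comp (measurable_pi_apply α))).aestronglyMeasurable
    (M * √(featBound d N)) (ae_of_all _ fun x => ?_)
  rw [Real.norm_eq_abs, abs_mul]
  exact mul_le_mul (hM _) (step_abs_le μ α J _) (abs_nonneg _) ((abs_nonneg _).trans (hM 0))

lemma dev_window_comp_sq_le [IsProbabilityMeasure μ] {g : ℝ → ℝ} (hg : Measurable g) {M : ℝ}
    (hM : ∀ t, |g t| ≤ M) (α : Fin d) (θ : Coef d N) (n : ℕ) (ω : Ω) :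
    dev X μ n (fun x => g (x 0) * comp μ α θ (x α)) ω ^ 2
      ≤ windowDev X μ n g α (fun J : Fin (N + 1) => step μ N α J) ω * ‖θ‖ ^ 2 := by
  have e : (fun x : Fin d → ℝ => g (x 0) * comp μ α θ (x α))
      = fun x => ∑ J : Fin (N + 1), θ (some (α, J)) * (g (x 0) * step μ N α J (x α)) := by
    ext x
    rw [comp, Finset.mul_sum]
    exact Finset.sum_congr rfl fun k _ => by ring
  rw [e, dev_sum _ _ (fun J => integrable_window_step hg hM α J), mul_comm]
  refine (Finset.sum_mul_sq_le_sq_mul_sq _ _ _).trans ?_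
  unfold windowDev
  gcongr
  exact sum_coef_le α θ

lemma dev_bounded_integrable (h : Design P X μ cf Cf) {g : (Fin d → ℝ) → ℝ} (hg : Measurable g)
    {M : ℝ} (hM : ∀ x, |g x| ≤ M) (n k : ℕ) :
    Integrable (fun ω => dev X μ n g ω ^ k) P := by
  have hM0 : 0 ≤ M := (abs_nonneg _).trans (hM 0)
  refine Integrable.of_bound ((h.measurable_dev hg n).pow_const k).aestronglyMeasurable
    ((M + |∫ x, g x ∂μ|) ^ k) (ae_of_all _ fun ω => ?_)
  rw [Real.norm_eq_abs, abs_pow]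
  gcongr
  refine (abs_sub _ _).trans ?_
  gcongr
  unfold emp
  rw [abs_mul, abs_of_nonneg (by positivity)]
  rcases Nat.eq_zero_or_pos n with rfl | hn
  · simpa using hM0
  · have hn0 : (0 : ℝ) < n := by exact_mod_cast hn
    rw [inv_mul_le_iff₀ hn0]
    refine (Finset.abs_sum_le_sum_abs _ _).trans ?_
    simpa using Finset.sum_le_sum fun i (_ : i ∈ Finset.range n) => hM (X i ω)

variable (h : Design P X μ cf Cf) {ε : ℕ → Ω → ℝ} (hε : ∀ i, Measurable (ε i)) {q : ℕ}
  (hq : 1 ≤ q) {a : ℝ} (ha : 0 ≤ a) (hmix : MixBound P (fun i ω => (X i ω, ε i ω)) q a)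
include h hε hq ha hmix

/-- The variances are summed under the integral, where the squared features add up to at most
`featBound` pointwise. So the N-dependence of the main term is of first order rather than of second
order. -/
lemma Design.integral_gramDevAt_le (u : Coef d N) {n : ℕ} (hn : 1 ≤ n) :
    ∫ ω, gramDevAt X μ n u ω ∂P
      ≤ q ^ 2 * ‖u‖ ^ 2 * ((d + 1) * Cf * featBound d N / n + 32 * featBound d N ^ 3 * a) := by
  have := h.prob
  have hm : ∀ j : Idx d N, Measurable fun x => fit μ u x * feat μ N j x := fun j =>
    (measurable_fit μ u).mul (measurable_feat μ j)
  have hb := fun j : Idx d N => abs_fit_mul_feat_le (μ := μ) u j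
  have hn0 : (0 : ℝ) < n := by exact_mod_cast hn
  have hF : 0 ≤ featBound d N := zero_le_one.trans one_le_featBound
  unfold gramDevAt
  rw [integral_finsetSum _ fun j _ => dev_bounded_integrable h (hm j) (hb j) n 2]
  have hsq : ∀ j : Idx d N, Integrable (fun x => (fit μ u x * feat μ N j x) ^ 2) μ := fun j =>
    Integrable.of_bound ((hm j).pow_const 2).aestronglyMeasurable ((‖u‖ * featBound d N) ^ 2)
      (ae_of_all _ fun x => by rw [Real.norm_eq_abs, abs_pow]; gcongr; exact hb j x)
  have hsum : ∑ j : Idx d N, ∫ x, (fit μ u x * feat μ N j x) ^ 2 ∂μ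
      ≤ featBound d N * ((d + 1) * Cf * ‖u‖ ^ 2) := by
    rw [← integral_finsetSum _ fun j _ => hsq j]
    calc ∫ x, ∑ j : Idx d N, (fit μ u x * feat μ N j x) ^ 2 ∂μ
        ≤ ∫ x, featBound d N * (fit μ u x * fit μ u x) ∂μ := by
          refine integral_mono (integrable_finsetSum _ fun j _ => hsq j)
            ((integrable_fit_mul_fit μ u u).const_mul _) fun x => ?_
          simp only [mul_pow, ← Finset.mul_sum, ← sq]
          rw [mul_comm]
          gcongr
          exact sum_feat_sq_le μ x
      _ ≤ _ := by
          rw [integral_const_mul]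
          gcongr
          simpa [sq] using h.integral_fit_sq_le u
  calc ∑ j : Idx d N, ∫ ω, dev X μ n (fun x => fit μ u x * feat μ N j x) ω ^ 2 ∂P
      ≤ ∑ j : Idx d N, q ^ 2 * ((∫ x, (fit μ u x * feat μ N j x) ^ 2 ∂μ) / n
          + 32 * (‖u‖ * featBound d N) ^ 2 * a) :=
        Finset.sum_le_sum fun j _ => h.dev_second hε hq ha hmix (hm j) (hb j) hn
    _ = q ^ 2 * ((∑ j : Idx d N, ∫ x, (fit μ u x * feat μ N j x) ^ 2 ∂μ) / n
          + Fintype.card (Idx d N) * (32 * (‖u‖ * featBound d N) ^ 2 * a)) := by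
        rw [← Finset.mul_sum, Finset.sum_add_distrib, Finset.sum_div]
        simp only [Finset.sum_const, Finset.card_univ, nsmul_eq_mul]
    _ ≤ q ^ 2 * ((featBound d N * ((d + 1) * Cf * ‖u‖ ^ 2)) / n
          + featBound d N * (32 * (‖u‖ * featBound d N) ^ 2 * a)) := by
        gcongr
        exact card_idx_le
    _ = _ := by ring

lemma Design.integral_gramDev_le {n : ℕ} (hn : 1 ≤ n) :
    ∫ ω, gramDev X μ n N ω ∂P
      ≤ q ^ 2 * (featBound d N ^ 2 / n + 32 * featBound d N ^ 4 * a) := by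
  have := h.prob
  have hm : ∀ j k : Idx d N, Measurable fun x => feat μ N j x * feat μ N k x := fun j k =>
    (measurable_feat μ j).mul (measurable_feat μ k)
  have hb := fun j k : Idx d N => abs_feat_mul_feat_le (μ := μ) j k
  have hn0 : (0 : ℝ) < n := by exact_mod_cast hn
  have hF : 0 ≤ featBound d N := zero_le_one.trans one_le_featBound
  unfold gramDev
  have hi := fun j k => dev_bounded_integrable h (hm j k) (hb j k) n 2
  rw [integral_finsetSum _ fun j _ => integrable_finsetSum _ fun k _ => hi j k]
  simp only [integral_finsetSum _ fun k _ => hi _ k]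
  have hsq : ∀ j k : Idx d N, Integrable (fun x => (feat μ N j x * feat μ N k x) ^ 2) μ :=
    fun j k =>
    Integrable.of_bound ((hm j k).pow_const 2).aestronglyMeasurable (featBound d N ^ 2)
      (ae_of_all _ fun x => by rw [Real.norm_eq_abs, abs_pow]; gcongr; exact hb j k x)
  have hsum : ∑ j : Idx d N, ∑ k : Idx d N, ∫ x, (feat μ N j x * feat μ N k x) ^ 2 ∂μ
      ≤ featBound d N ^ 2 := by
    simp only [← integral_finsetSum _ fun k _ => hsq _ k]
    rw [← integral_finsetSum _ fun j _ => integrable_finsetSum _ fun k _ => hsq j k]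
    calc _ ≤ ∫ x : Fin d → ℝ, featBound d N ^ 2 ∂μ := by
          refine integral_mono (integrable_finsetSum _ fun j _ => integrable_finsetSum _ fun k _ =>
            hsq j k) (integrable_const _) fun x => ?_
          have h1 := sum_feat_sq_le μ (N := N) x
          have h0 : 0 ≤ ∑ j : Idx d N, feat μ N j x ^ 2 := by positivity
          simp only [mul_pow, ← Finset.mul_sum, ← Finset.sum_mul]
          rw [← sq]
          exact pow_le_pow_left₀ h0 h1 2
      _ = _ := by simp
  calc ∑ j : Idx d N, ∑ k : Idx d N,
        ∫ ω, dev X μ n (fun x => feat μ N j x * feat μ N k x) ω ^ 2 ∂P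
      ≤ ∑ j : Idx d N, ∑ k : Idx d N, q ^ 2 * ((∫ x, (feat μ N j x * feat μ N k x) ^ 2 ∂μ) / n
          + 32 * featBound d N ^ 2 * a) :=
        Finset.sum_le_sum fun j _ => Finset.sum_le_sum fun k _ =>
          h.dev_second hε hq ha hmix (hm j k) (hb j k) hn
    _ = q ^ 2 * ((∑ j : Idx d N, ∑ k : Idx d N, ∫ x, (feat μ N j x * feat μ N k x) ^ 2 ∂μ) / n
          + Fintype.card (Idx d N) ^ 2 * (32 * featBound d N ^ 2 * a)) := by
        simp only [← Finset.mul_sum, Finset.sum_add_distrib, ← Finset.sum_div]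
        simp only [Finset.sum_const, Finset.card_univ, nsmul_eq_mul]
        ring
    _ ≤ q ^ 2 * (featBound d N ^ 2 / n
          + featBound d N ^ 2 * (32 * featBound d N ^ 2 * a)) := by
        gcongr
        exact card_idx_le
    _ = _ := by ring

omit hε hq ha hmix in
lemma Design.binProb_le (α : Fin d) (J : Fin (N + 1)) :
    binProb μ N α J ≤ Cf / ((N : ℝ) + 1) := by
  have := h.prob
  have h1 := h.integral_le (g := fun x : Fin d → ℝ => bin N J (x α))
    ((measurable_bin N J).comp (measurable_pi_apply α)) (fun x => bin_nonneg _ _ _)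
    (integrable_bin_eval _ α J)
  rw [integral_eval_unif (measurable_bin N J).aestronglyMeasurable,
    integral_bin (Nat.lt_succ_iff.1 J.2)] at h1
  simpa [binProb, div_eq_mul_inv] using h1

omit hε hq ha hmix in
lemma Design.le_binProb (α : Fin d) {J : ℕ} (hJ : J ≤ N) :
    cf / ((N : ℝ) + 1) ≤ binProb μ N α J := by
  have := h.prob
  have h1 := h.le_integral (g := fun x : Fin d → ℝ => bin N J (x α))
    ((measurable_bin N J).comp (measurable_pi_apply α)) (fun x => bin_nonneg _ _ _)
    (integrable_bin_eval _ α J)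
  rw [integral_eval_unif (measurable_bin N J).aestronglyMeasurable, integral_bin hJ] at h1
  simpa [binProb, div_eq_mul_inv] using h1

omit hε hq ha hmix in
lemma Design.integral_step_sq_le (α : Fin d) (J : Fin (N + 1)) :
    ∫ t, step μ N α J t ^ 2 ∂unifOne ≤ 2 * Cf := by
  have := h.prob
  have hN : (0 : ℝ) < (N : ℝ) + 1 := by positivity
  have hC := h.one_le_Cf
  have hp := h.binProb_le (N := N) α J
  have hp0 := binProb_nonneg μ (N := N) α J
  have hp1 := binProb_le_one μ α J
  calc ∫ t, step μ N α J t ^ 2 ∂unifOne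
      ≤ ∫ t, ((N : ℝ) + 1) * (bin N J t + binProb μ N α J) ∂unifOne := by
        refine integral_mono_of_nonneg (ae_of_all _ fun _ => sq_nonneg _)
          (((integrable_bin N J unifOne).add (integrable_const _)).const_mul _)
          (ae_of_all _ fun t => ?_)
        simp only [step]
        rw [mul_pow, Real.sq_sqrt hN.le]
        gcongr
        have h1 := bin_nonneg N J t
        have h4 := bin_sq N J t
        nlinarith
    _ = 1 + ((N : ℝ) + 1) * binProb μ N α J := by
        rw [integral_const_mul, integral_add (integrable_bin N J unifOne) (integrable_const _),
          integral_bin (Nat.lt_succ_iff.1 J.2)]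
        simp
        field_simp
    _ ≤ 1 + ((N : ℝ) + 1) * (Cf / ((N : ℝ) + 1)) := by gcongr
    _ ≤ _ := by rw [mul_div_cancel₀ _ hN.ne']; linarith

omit h hε hq ha hmix in
lemma integral_pow_window_le {g : ℝ → ℝ} {A x₀ r : ℝ} (hr : 0 ≤ r)
    (hA : 0 ≤ A) (hg0 : ∀ t, 0 ≤ g t)
    (hgA : ∀ t, g t ≤ A * (Icc (x₀ - r) (x₀ + r)).indicator (fun _ => 1) t) (k : ℕ)
    (hk : k ≠ 0) : ∫ t, g t ^ k ∂unifOne ≤ A ^ k * (2 * r) := by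
  have i := integrable_indicator_Icc (x₀ - r) (x₀ + r) unifOne
  calc ∫ t, g t ^ k ∂unifOne
      ≤ ∫ t, A ^ k * (Icc (x₀ - r) (x₀ + r)).indicator (fun _ => (1 : ℝ)) t ∂unifOne := by
        refine integral_mono_of_nonneg (ae_of_all _ fun t => pow_nonneg (hg0 t) k)
          (i.const_mul _) (ae_of_all _ fun t => ?_)
        refine (pow_le_pow_left₀ (hg0 t) (hgA t) k).trans_eq ?_
        rw [mul_pow]
        congr 1
        by_cases ht : t ∈ Icc (x₀ - r) (x₀ + r) <;> simp [ht, hk]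
    _ ≤ _ := by
        rw [integral_const_mul]
        gcongr
        exact (integral_indicator_unifOne_le _ _ (by linarith)).trans_eq (by ring)

/-- Fourth moments of the single deviations, combined by the power mean inequality over the bins.
Second moments would not survive the union bound over the grid. Only |φ_J| matters, so that the
result covers both the centred bins and their absolute values, the latter occurring with the
envelope. -/
lemma Design.integral_windowDev_sq_le {g : ℝ → ℝ} (hg : Measurable g) {A x₀ r : ℝ} (hr : 0 ≤ r)
    (hA : 0 ≤ A) (hg0 : ∀ t, 0 ≤ g t)
    (hgA : ∀ t, g t ≤ A * (Icc (x₀ - r) (x₀ + r)).indicator (fun _ => 1) t)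
    {α : Fin d} (hα : α ≠ 0) {φ : Fin (N + 1) → ℝ → ℝ} (hφ : ∀ J, Measurable (φ J))
    (hφs : ∀ J t, |φ J t| = |step μ N α J t|) {n : ℕ} (hn : 1 ≤ n) :
    ∫ ω, windowDev X μ n g α φ ω ^ 2 ∂P ≤ q ^ 4 * featBound d N ^ 2 *
      (48 * Cf ^ 4 * A ^ 4 * r ^ 2 / n ^ 2 + 64 * Cf ^ 2 * A ^ 4 * r * featBound d N / n ^ 3
        + 1664 * A ^ 4 * featBound d N ^ 2 * a) := by
  have := h.prob
  have hC := h.one_le_Cf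
  have hn0 : (0 : ℝ) < n := by exact_mod_cast hn
  have hF := one_le_featBound (d := d) (N := N)
  have hF0 : 0 ≤ featBound d N := zero_le_one.trans hF
  have hgb : ∀ t, |g t| ≤ A := fun t => by
    rw [abs_of_nonneg (hg0 t)]
    refine (hgA t).trans ?_
    nlinarith [indicator_one_le (Icc (x₀ - r) (x₀ + r)) t]
  have hφb : ∀ J t, |φ J t| ≤ √(featBound d N) := fun J t => by
    rw [hφs]; exact step_abs_le μ α J t
  have hm : ∀ J, Measurable fun x : Fin d → ℝ => g (x 0) * φ J (x α) := fun J =>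
    (hg.comp (measurable_pi_apply 0)).mul ((hφ J).comp (measurable_pi_apply α))
  have hb : ∀ J, ∀ x : Fin d → ℝ, |g (x 0) * φ J (x α)| ≤ A * √(featBound d N) := fun J x => by
    rw [abs_mul]
    exact mul_le_mul (hgb _) (hφb _ _) (abs_nonneg _) hA
  have hi := fun J => dev_bounded_integrable h (hm J) (hb J) n 4
  have hφ2 : ∀ J t, φ J t ^ 2 = step μ N α J t ^ 2 := fun J t => by
    rw [← sq_abs, hφs, sq_abs]
  have hs2 : ∀ J, ∫ t, φ J t ^ 2 ∂unifOne ≤ 2 * Cf := fun J => by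
    simp only [hφ2]; exact h.integral_step_sq_le α J
  have hpowb : ∀ {k : ℕ} (t), |g t ^ k| ≤ A ^ k := fun {k} t => by
    rw [abs_pow]; gcongr; exact hgb t
  have hφpb : ∀ {k : ℕ} (J t), |φ J t ^ k| ≤ √(featBound d N) ^ k := fun {k} J t => by
    rw [abs_pow]; gcongr; exact hφb J t
  have v : ∀ J, ∫ x, (g (x 0) * φ J (x α)) ^ 2 ∂μ ≤ 4 * Cf ^ 2 * A ^ 2 * r := fun J => by
    simp only [mul_pow]
    have h1 := h.integral_window_le (g := fun t => g t ^ 2) (s := fun t => φ J t ^ 2)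
      (hg.pow_const 2) ((hφ J).pow_const 2) hpowb (hφpb J) (fun _ => sq_nonneg _)
      (fun _ => sq_nonneg _) hα
    have h2 := integral_pow_window_le hr hA hg0 hgA 2 two_ne_zero
    have h3 : 0 ≤ ∫ t, φ J t ^ 2 ∂unifOne := integral_nonneg fun _ => sq_nonneg _
    calc _ ≤ _ := h1
      _ ≤ Cf * ((A ^ 2 * (2 * r)) * (2 * Cf)) := by gcongr; exact hs2 J
      _ = _ := by ring
  have w : ∀ J, ∫ x, (g (x 0) * φ J (x α)) ^ 4 ∂μ ≤ 4 * Cf ^ 2 * A ^ 4 * r * featBound d N :=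
    fun J => by
    simp only [mul_pow]
    have h1 := h.integral_window_le (g := fun t => g t ^ 4) (s := fun t => φ J t ^ 4)
      (hg.pow_const 4) ((hφ J).pow_const 4) hpowb (hφpb J) (fun _ => by positivity)
      (fun _ => by positivity) hα
    have h2 := integral_pow_window_le hr hA hg0 hgA 4 four_ne_zero
    have h3 : 0 ≤ ∫ t, φ J t ^ 4 ∂unifOne := integral_nonneg fun _ => by positivity
    have h4 : ∫ t, φ J t ^ 4 ∂unifOne ≤ featBound d N * (2 * Cf) := by
      calc ∫ t, φ J t ^ 4 ∂unifOne ≤ ∫ t, featBound d N * φ J t ^ 2 ∂unifOne := by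
            refine integral_mono_of_nonneg (ae_of_all _ fun _ => by positivity)
              (Integrable.const_mul (Integrable.of_bound
                ((hφ J).pow_const 2).aestronglyMeasurable _ (ae_of_all _ (hφpb J))) _)
              (ae_of_all _ fun t => ?_)
            have h5 := hφpb (k := 2) J t
            rw [Real.sq_sqrt hF0, abs_of_nonneg (sq_nonneg _)] at h5
            calc φ J t ^ 4 = φ J t ^ 2 * φ J t ^ 2 := by ring
              _ ≤ featBound d N * φ J t ^ 2 := by gcongr
        _ ≤ _ := by rw [integral_const_mul]; gcongr; exact hs2 J
    calc _ ≤ _ := h1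
      _ ≤ Cf * ((A ^ 4 * (2 * r)) * (featBound d N * (2 * Cf))) := by gcongr
      _ = _ := by ring
  have hcard : ((N : ℝ) + 1) ≤ featBound d N := by
    have hd : (1 : ℝ) ≤ d := by exact_mod_cast NeZero.one_le
    unfold featBound
    nlinarith [(Nat.cast_nonneg N : (0 : ℝ) ≤ N)]
  calc ∫ ω, windowDev X μ n g α φ ω ^ 2 ∂P
      ≤ ∫ ω, ((N : ℝ) + 1) * ∑ J, dev X μ n (fun x => g (x 0) * φ J (x α)) ω ^ 4 ∂P := by
        refine integral_mono_of_nonneg (ae_of_all _ fun _ => sq_nonneg _)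
          ((integrable_finsetSum _ fun J _ => hi J).const_mul _) (ae_of_all _ fun ω => ?_)
        simp only [windowDev]
        have h1 := sq_sum_le_card_mul_sum_sq (s := (Finset.univ : Finset (Fin (N + 1))))
          (f := fun J => dev X μ n (fun x => g (x 0) * φ J (x α)) ω ^ 2)
        simp only [Finset.card_univ, Fintype.card_fin, ← pow_mul] at h1
        exact_mod_cast h1
    _ = ((N : ℝ) + 1) * ∑ J, ∫ ω, dev X μ n (fun x => g (x 0) * φ J (x α)) ω ^ 4 ∂P := by
        rw [integral_const_mul, integral_finsetSum _ fun J _ => hi J]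
    _ ≤ ((N : ℝ) + 1) * ∑ J : Fin (N + 1), q ^ 4 * (3 * (4 * Cf ^ 2 * A ^ 2 * r) ^ 2 / n ^ 2
          + 16 * (4 * Cf ^ 2 * A ^ 4 * r * featBound d N) / n ^ 3
          + 1664 * (A * √(featBound d N)) ^ 4 * a) := by
        gcongr with J
        refine (h.dev_fourth hε hq ha hmix (hm J) (hb J) hn).trans ?_
        gcongr
        · exact v J
        · exact w J
    _ = ((N : ℝ) + 1) ^ 2 * (q ^ 4 * (48 * Cf ^ 4 * A ^ 4 * r ^ 2 / n ^ 2
          + 64 * Cf ^ 2 * A ^ 4 * r * featBound d N / n ^ 3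
          + 1664 * A ^ 4 * featBound d N ^ 2 * a)) := by
        have h6 : √(featBound d N) ^ 4 = featBound d N ^ 2 := by
          calc √(featBound d N) ^ 4 = (√(featBound d N) ^ 2) ^ 2 := by ring
            _ = _ := by rw [Real.sq_sqrt hF0]
        rw [mul_pow A, h6]
        simp only [Finset.sum_const, Finset.card_univ, Fintype.card_fin, nsmul_eq_mul]
        push_cast
        ring
    _ ≤ featBound d N ^ 2 * (q ^ 4 * (48 * Cf ^ 4 * A ^ 4 * r ^ 2 / n ^ 2
          + 64 * Cf ^ 2 * A ^ 4 * r * featBound d N / n ^ 3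
          + 1664 * A ^ 4 * featBound d N ^ 2 * a)) := by gcongr
    _ = _ := by ring

end MomentBounds

/-! ### Second order calculus of the weighted noise. -/

section Noise

variable {Ω : Type*} [MeasurableSpace Ω] {P : Measure Ω} [IsProbabilityMeasure P] {d : ℕ}
  {X : ℕ → Ω → Fin d → ℝ} {μ : Measure (Fin d → ℝ)} {cf Cf : ℝ} {N : ℕ} {ε : ℕ → Ω → ℝ}

/-- Second order properties of the noise: square integrable, with unit conditional variance and
conditionally white. -/
structure SecondOrderNoise (P : Measure Ω) (X : ℕ → Ω → Fin d → ℝ) (μ : Measure (Fin d → ℝ))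
    (ε : ℕ → Ω → ℝ) : Prop where
  memLp : ∀ i, MemLp (ε i) 2 P
  mean : ∀ i (g : (Fin d → ℝ) → ℝ), Measurable g → (∃ M, ∀ x, |g x| ≤ M) →
    ∫ ω, g (X i ω) * ε i ω ∂P = 0
  variance : ∀ i (g : (Fin d → ℝ) → ℝ), Measurable g → (∃ M, ∀ x, |g x| ≤ M) →
    ∫ ω, g (X i ω) * ε i ω ^ 2 ∂P = ∫ x, g x ∂μ
  white : ∀ i j, i ≠ j → ∀ g : (Fin d → ℝ) → ℝ, Measurable g → (∃ M, ∀ x, |g x| ≤ M) →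
    ∫ ω, (g (X i ω) * ε i ω) * (g (X j ω) * ε j ω) ∂P = 0

/-- Empirical average of the weighted noise. -/
def noiseAvg (X : ℕ → Ω → Fin d → ℝ) (ε : ℕ → Ω → ℝ) (n : ℕ) (g : (Fin d → ℝ) → ℝ) (ω : Ω) : ℝ :=
  (n : ℝ)⁻¹ * ∑ i ∈ Finset.range n, g (X i ω) * ε i ω

lemma SecondOrderNoise.memLp_mul (hN : SecondOrderNoise P X μ ε) (hX : ∀ i, Measurable (X i))
    {g : (Fin d → ℝ) → ℝ} (hg : Measurable g) {M : ℝ} (hM : ∀ x, |g x| ≤ M) (i : ℕ) :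
    MemLp (fun ω => g (X i ω) * ε i ω) 2 P := by
  refine MemLp.of_le_mul (c := M) (hN.memLp i)
    ((hg.comp (hX i)).aestronglyMeasurable.mul (hN.memLp i).aestronglyMeasurable)
    (ae_of_all _ fun ω => ?_)
  rw [norm_mul]
  gcongr
  exact hM _

/-- Conditional whiteness kills every cross term, so the variance is exact and additive over
arbitrary index sets. Neither mixing nor stationarity of the joint laws enters. -/
lemma SecondOrderNoise.integral_sum_sq (hN : SecondOrderNoise P X μ ε)
    (hX : ∀ i, Measurable (X i)) {g : (Fin d → ℝ) → ℝ} (hg : Measurable g) {M : ℝ}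
    (hM : ∀ x, |g x| ≤ M) (s : Finset ℕ) :
    ∫ ω, (∑ i ∈ s, g (X i ω) * ε i ω) ^ 2 ∂P = s.card * ∫ x, g x ^ 2 ∂μ := by
  have hL := hN.memLp_mul hX hg hM
  have hij : ∀ i j, Integrable (fun ω => (g (X i ω) * ε i ω) * (g (X j ω) * ε j ω)) P :=
    fun i j => (hL i).integrable_mul (hL j)
  simp only [sq, Finset.sum_mul_sum]
  rw [integral_finsetSum _ fun i _ => integrable_finsetSum _ fun j _ => hij i j]
  have : ∀ i ∈ s, ∫ ω, ∑ j ∈ s, (g (X i ω) * ε i ω) * (g (X j ω) * ε j ω) ∂P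
      = ∫ x, g x ^ 2 ∂μ := by
    intro i hi
    rw [integral_finsetSum _ fun j _ => hij i j, Finset.sum_eq_single i]
    · rw [← hN.variance i (fun x => g x ^ 2) (hg.pow_const 2)
        ⟨M ^ 2, fun x => by rw [abs_pow]; gcongr; exact hM x⟩]
      congr 1 with ω
      ring
    · intro j _ hji
      exact hN.white i j hji.symm g hg ⟨M, hM⟩
    · exact fun h => absurd hi h
  rw [Finset.sum_congr rfl this]
  simp [sq]

lemma SecondOrderNoise.integral_noiseAvg_sq (hN : SecondOrderNoise P X μ ε)
    (hX : ∀ i, Measurable (X i)) {g : (Fin d → ℝ) → ℝ} (hg : Measurable g) {M : ℝ}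
    (hM : ∀ x, |g x| ≤ M) {n : ℕ} (hn : 1 ≤ n) :
    ∫ ω, noiseAvg X ε n g ω ^ 2 ∂P = (∫ x, g x ^ 2 ∂μ) / n := by
  have hn0 : (n : ℝ) ≠ 0 := by positivity
  simp only [noiseAvg, mul_pow, integral_const_mul]
  rw [hN.integral_sum_sq hX hg hM, Finset.card_range]
  field_simp

lemma SecondOrderNoise.memLp_noiseAvg (hN : SecondOrderNoise P X μ ε)
    (hX : ∀ i, Measurable (X i)) {g : (Fin d → ℝ) → ℝ} (hg : Measurable g) {M : ℝ}
    (hM : ∀ x, |g x| ≤ M) (n : ℕ) : MemLp (noiseAvg X ε n g) 2 P :=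
  (memLp_finsetSum _ fun i _ => hN.memLp_mul hX hg hM i).const_mul _

end Noise

/-! ### Deterministic bounds for the error of the pilot spline fit -/

section FitError

variable {Ω : Type*} [MeasurableSpace Ω] {P : Measure Ω} [IsProbabilityMeasure P] {d : ℕ}
  [NeZero d] {X : ℕ → Ω → Fin d → ℝ} {μ : Measure (Fin d → ℝ)} {cf Cf : ℝ} {N : ℕ}
  {ε : ℕ → Ω → ℝ} {s : (Fin d → ℝ) → ℝ}

/-- Squared norm of the noise projected on the features. -/
def noiseNormSq (X : ℕ → Ω → Fin d → ℝ) (ε : ℕ → Ω → ℝ) (s : (Fin d → ℝ) → ℝ)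
    (μ : Measure (Fin d → ℝ)) (n N : ℕ) (ω : Ω) : ℝ :=
  ∑ j : Idx d N, noiseAvg X ε n (fun x => s x * feat μ N j x) ω ^ 2

/-- Noise contribution to the fit in direction `u`. -/
def noiseFun (X : ℕ → Ω → Fin d → ℝ) (ε : ℕ → Ω → ℝ) (s : (Fin d → ℝ) → ℝ)
    (μ : Measure (Fin d → ℝ)) (n : ℕ) {N : ℕ} (u : Coef d N) (ω : Ω) : ℝ :=
  noiseAvg X ε n (fun x => s x * fit μ u x) ω

lemma noiseFun_sq_le (u : Coef d N) (n : ℕ) (ω : Ω) :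
    noiseFun X ε s μ n u ω ^ 2 ≤ noiseNormSq X ε s μ n N ω * ‖u‖ ^ 2 := by
  have e : noiseFun X ε s μ n u ω
      = ∑ j, u j * noiseAvg X ε n (fun x => s x * feat μ N j x) ω := by
    unfold noiseFun noiseAvg fit
    simp only [Finset.mul_sum, Finset.sum_mul]
    rw [Finset.sum_comm]
    refine Finset.sum_congr rfl fun j _ => Finset.sum_congr rfl fun i _ => ?_
    ring
  rw [e, norm_sq_eq_sum, mul_comm]
  exact Finset.sum_mul_sq_le_sq_mul_sq _ _ _

lemma abs_sub_step_le {m : ℝ → ℝ} {Λ : ℝ} (hΛ : ∀ t ∈ Icc (0 : ℝ) 1, ∀ t' ∈ Icc (0 : ℝ) 1,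
    |m t - m t'| ≤ Λ * |t - t'|) {t : ℝ} (ht : t ∈ Ico (0 : ℝ) 1) :
    |m t - ∑ J : Fin (N + 1), m ((J : ℝ) / ((N : ℝ) + 1)) * bin N J t| ≤ Λ / ((N : ℝ) + 1) := by
  have hN : (0 : ℝ) < (N : ℝ) + 1 := by positivity
  have h1 := sum_bin_eq_one (N := N) ht
  have hΛ0 : 0 ≤ Λ := by
    have := hΛ 0 (by norm_num) 1 (by norm_num)
    norm_num at this
    exact (abs_nonneg _).trans this
  have e : m t - ∑ J : Fin (N + 1), m ((J : ℝ) / ((N : ℝ) + 1)) * bin N J t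
      = ∑ J : Fin (N + 1), (m t - m ((J : ℝ) / ((N : ℝ) + 1))) * bin N J t := by
    simp only [sub_mul, Finset.sum_sub_distrib, ← Finset.mul_sum, h1, mul_one]
  rw [e]
  refine (Finset.abs_sum_le_sum_abs _ _).trans ?_
  calc ∑ J : Fin (N + 1), |(m t - m ((J : ℝ) / ((N : ℝ) + 1))) * bin N J t|
      ≤ ∑ J : Fin (N + 1), Λ / ((N : ℝ) + 1) * bin N J t := by
        refine Finset.sum_le_sum fun J _ => ?_
        rw [abs_mul, abs_of_nonneg (bin_nonneg N J t)]
        rcases bin_eq_zero_or_one N J t with h0 | h0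
        · simp [h0]
        · rw [h0, mul_one, mul_one]
          rw [bin_eq_one_iff] at h0
          have hJ : ((J : ℕ) : ℝ) ≤ N := by exact_mod_cast Nat.lt_succ_iff.1 J.2
          have hJ1 : (J : ℝ) / ((N : ℝ) + 1) ∈ Icc (0 : ℝ) 1 :=
            ⟨by positivity, by rw [div_le_one hN]; linarith⟩
          refine (hΛ t ⟨ht.1, ht.2.le⟩ _ hJ1).trans ?_
          rw [div_eq_mul_one_div Λ]
          gcongr
          have h2 : (J : ℝ) / ((N : ℝ) + 1) ≤ t := by rw [div_le_iff₀ hN]; exact h0.1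
          rw [abs_of_nonneg (sub_nonneg.2 h2), sub_le_iff_le_add, ← add_div, le_div_iff₀ hN]
          linarith [h0.2]
    _ = _ := by rw [← Finset.mul_sum, h1, mul_one]

lemma emp_eq_dev_add (n : ℕ) (g : (Fin d → ℝ) → ℝ) (ω : Ω) :
    emp X n g ω = dev X μ n g ω + ∫ x, g x ∂μ := by
  unfold dev; ring

lemma abs_emp_le {n : ℕ} {g : (Fin d → ℝ) → ℝ} {ω : Ω} {B : ℝ} (hB : 0 ≤ B)
    (hg : ∀ i < n, |g (X i ω)| ≤ B) : |emp X n g ω| ≤ B := by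
  unfold emp
  rw [abs_mul, abs_of_nonneg (by positivity)]
  rcases Nat.eq_zero_or_pos n with rfl | hn
  · simpa using hB
  · have hn0 : (0 : ℝ) < n := by exact_mod_cast hn
    rw [inv_mul_le_iff₀ hn0]
    refine (Finset.abs_sum_le_sum_abs _ _).trans ?_
    simpa using Finset.sum_le_sum fun i (hi : i ∈ Finset.range n) => hg i (Finset.mem_range.1 hi)

lemma abs_inv_mul_sum_mul_le {n : ℕ} {x r : ℕ → ℝ} {B : ℝ} (hB : 0 ≤ B)
    (hr : ∀ i < n, |r i| ≤ B) :
    |(n : ℝ)⁻¹ * ∑ i ∈ Finset.range n, r i * x i|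
      ≤ B * √((n : ℝ)⁻¹ * ∑ i ∈ Finset.range n, x i ^ 2) := by
  rcases Nat.eq_zero_or_pos n with rfl | hn
  · simp
  have hn0 : (0 : ℝ) < n := by exact_mod_cast hn
  rw [← Real.sqrt_sq hB, ← Real.sqrt_mul (sq_nonneg B)]
  refine Real.abs_le_sqrt ?_
  rw [mul_pow]
  have h1 := Finset.sum_mul_sq_le_sq_mul_sq (Finset.range n) r x
  have h2 : ∑ i ∈ Finset.range n, r i ^ 2 ≤ n * B ^ 2 := by
    calc ∑ i ∈ Finset.range n, r i ^ 2 ≤ ∑ i ∈ Finset.range n, B ^ 2 := by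
          refine Finset.sum_le_sum fun i hi => ?_
          rw [← sq_abs]
          gcongr
          exact hr i (Finset.mem_range.1 hi)
      _ = _ := by simp
  have h3 : 0 ≤ ∑ i ∈ Finset.range n, x i ^ 2 := by positivity
  calc _ ≤ ((n : ℝ)⁻¹) ^ 2 * ((n * B ^ 2) * ∑ i ∈ Finset.range n, x i ^ 2) := by
        gcongr
        exact h1.trans (by gcongr)
    _ = _ := by field_simp

/-- The error of the least squares fit relative to the step approximation of the regression
function. -/
lemma Design.exists_fit_error (h : Design P X μ cf Cf) {ν : Fin d → Measure ℝ}
    [∀ α, IsProbabilityMeasure (ν α)] (hpos : ∀ α, ∀ J ≤ N, 0 < ∫ t, bin N J t ∂ν α)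
    {n : ℕ} {ω : Ω} {y : ℕ → ℝ} {lam : ℝ × (Fin d → Fin N → ℝ)}
    (hls : IsLeastSquares (fun α => splineBasis (ν α) N) n (fun i => X i ω) y lam)
    (hx : ∀ i < n, ∀ α, X i ω α ∈ Ico (0 : ℝ) 1) {c : ℝ} {m : Fin d → ℝ → ℝ} {Λ : ℝ}
    (hΛ : ∀ α, ∀ t ∈ Icc (0 : ℝ) 1, ∀ t' ∈ Icc (0 : ℝ) 1,
      |m α t - m α t'| ≤ Λ * |t - t'|)
    (hy : ∀ i < n, y i = c + ∑ α, m α (X i ω α) + s (X i ω) * ε i ω)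
    (hD : gramDev X μ n N ω ≤ (cf / 2) ^ 2) :
    ∃ (θ : Coef d N) (κ : Fin d → ℝ),
      (∀ α, blockSum α θ = 0) ∧
      (∀ α, ∀ t ∈ Ico (0 : ℝ) 1, ∑ J, lam.2 α J * splineBasis (ν α) N J t
        = ∑ J : Fin (N + 1), m α ((J : ℝ) / ((N : ℝ) + 1)) * bin N J t + comp μ α θ t + κ α) ∧
      ‖θ‖ ≤ 2 / cf * (√(noiseNormSq X ε s μ n N ω)
        + d * Λ * √((d + 2) * Cf) / ((N : ℝ) + 1)) ∧
      ∀ u : Coef d N, |∫ x, fit μ u x * fit μ θ x ∂μ|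
        ≤ |noiseFun X ε s μ n u ω| + d * Λ * √((d + 2) * Cf) / ((N : ℝ) + 1) * ‖u‖
          + √(gramDevAt X μ n u ω) * ‖θ‖ := by
  have := h.prob
  have hcf := h.pos
  have hcf1 := h.cf_le_one
  have hCf := h.one_le_Cf
  have hN : (0 : ℝ) < (N : ℝ) + 1 := by positivity
  have hΛ0 : 0 ≤ Λ := by
    have := hΛ 0 0 (by norm_num) 1 (by norm_num)
    norm_num at this
    exact (abs_nonneg _).trans this
  obtain ⟨θ, κ, hθ0, hrep, hnorm⟩ := exists_coef_of_isLeastSquares hpos hls hx μ c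
    (fun α J => m α ((J : ℝ) / ((N : ℝ) + 1)))
  set r : ℕ → ℝ := fun i => ∑ α, (m α (X i ω α)
    - ∑ J : Fin (N + 1), m α ((J : ℝ) / ((N : ℝ) + 1)) * bin N J (X i ω α)) with hr
  have hrb : ∀ i < n, |r i| ≤ d * Λ / ((N : ℝ) + 1) := by
    intro i hi
    refine (Finset.abs_sum_le_sum_abs _ _).trans ?_
    calc _ ≤ ∑ α : Fin d, Λ / ((N : ℝ) + 1) :=
          Finset.sum_le_sum fun α _ => abs_sub_step_le (hΛ α) (hx i hi α)
      _ = _ := by simp; ring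
  -- Normal equations tested with η: the empirical inner product with θ equals the noise in
  -- direction η plus the contribution of the step approximation error r.
  have heq : ∀ η : Coef d N, emp X n (fun x => fit μ η x * fit μ θ x) ω
      = noiseFun X ε s μ n η ω
        + (n : ℝ)⁻¹ * ∑ i ∈ Finset.range n, r i * fit μ η (X i ω) := by
    intro η
    have h1 := hnorm η
    have h2 : ∑ i ∈ Finset.range n, (s (X i ω) * ε i ω + r i - fit μ θ (X i ω))
        * fit μ η (X i ω) = 0 := by
      rw [← h1]
      refine Finset.sum_congr rfl fun i hi => ?_
      rw [hy i (Finset.mem_range.1 hi)]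
      congr 1
      simp only [hr, Finset.sum_sub_distrib]
      ring
    unfold emp noiseFun noiseAvg
    rw [← mul_add, ← Finset.sum_add_distrib]
    congr 1
    rw [← sub_eq_zero, ← Finset.sum_sub_distrib, ← neg_eq_zero, ← Finset.sum_neg_distrib, ← h2]
    refine Finset.sum_congr rfl fun i _ => ?_
    ring
  -- On the event assumed for `gramDev` the empirical form differs from the theoretical one by at
  -- most cf/2, half the coercivity constant. It therefore remains coercive on vectors with zero
  -- block sums, which gives the bound for θ.
  have hdev : ∀ u v : Coef d N, |dev X μ n (fun x => fit μ u x * fit μ v x) ω|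
      ≤ cf / 2 * (‖u‖ * ‖v‖) := by
    intro u v
    refine abs_le_of_sq_le_sq ((dev_fit_mul_fit_sq_le_gramDev u v n ω).trans ?_) (by positivity)
    rw [mul_pow, mul_pow]
    gcongr
  have hempsq : ∀ u : Coef d N, emp X n (fun x => fit μ u x * fit μ u x) ω
      ≤ (d + 2) * Cf * ‖u‖ ^ 2 := by
    intro u
    rw [emp_eq_dev_add (μ := μ)]
    have h1 := (abs_le.1 (hdev u u)).2
    have h2 := h.integral_fit_sq_le u
    simp only [sq (fit μ u _)] at h2
    nlinarith [sq_nonneg ‖u‖]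
  -- The approximation error is uniformly O(1/N), and Cauchy–Schwarz pairs it with the empirical
  -- norm of the test function, so it contributes O(1/N) ‖η‖ without any factor √N.
  have hρ : ∀ η : Coef d N, |(n : ℝ)⁻¹ * ∑ i ∈ Finset.range n, r i * fit μ η (X i ω)|
      ≤ d * Λ * √((d + 2) * Cf) / ((N : ℝ) + 1) * ‖η‖ := by
    intro η
    refine (abs_inv_mul_sum_mul_le (by positivity) hrb).trans ?_
    have h1 : √((n : ℝ)⁻¹ * ∑ i ∈ Finset.range n, fit μ η (X i ω) ^ 2)
        ≤ √((d + 2) * Cf) * ‖η‖ := by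
      rw [← Real.sqrt_sq (norm_nonneg η), ← Real.sqrt_mul (by positivity)]
      refine Real.sqrt_le_sqrt ?_
      have := hempsq η
      simp only [emp, ← sq] at this
      exact this
    calc _ ≤ d * Λ / ((N : ℝ) + 1) * (√((d + 2) * Cf) * ‖η‖) := by gcongr
      _ = _ := by ring
  have hnoise : ∀ η : Coef d N, |noiseFun X ε s μ n η ω|
      ≤ √(noiseNormSq X ε s μ n N ω) * ‖η‖ := by
    intro η
    have h0 : 0 ≤ noiseNormSq X ε s μ n N ω := Finset.sum_nonneg fun _ _ => sq_nonneg _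
    refine abs_le_of_sq_le_sq ((noiseFun_sq_le η n ω).trans_eq ?_) (by positivity)
    rw [mul_pow, Real.sq_sqrt h0]
  refine ⟨θ, κ, hθ0, hrep, ?_, fun u => ?_⟩
  · have h1 := h.coercive θ
    have hb0 : ∑ α : Fin d, (∑ J : Fin (N + 1), θ (some (α, J))) ^ 2 = 0 := by
      simp [hθ0]
    rw [hb0, add_zero] at h1
    have h2 := heq θ
    rw [emp_eq_dev_add (μ := μ)] at h2
    simp only [sq (fit μ θ _)] at h1
    have h3 := (abs_le.1 (hdev θ θ)).1
    have h4 := (abs_le.1 (hρ θ)).2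
    have h5 := (abs_le.1 (hnoise θ)).2
    have h6 : cf / 2 * ‖θ‖ * ‖θ‖ ≤ (√(noiseNormSq X ε s μ n N ω)
        + d * Λ * √((d + 2) * Cf) / ((N : ℝ) + 1)) * ‖θ‖ := by nlinarith
    rcases (norm_nonneg θ).eq_or_lt with h0 | h0
    · rw [← h0]; positivity
    · have h7 := le_of_mul_le_mul_right h6 h0
      rw [div_mul_eq_mul_div, le_div_iff₀ hcf]
      linarith
  · have h2 := heq u
    rw [emp_eq_dev_add (μ := μ)] at h2
    have h3 : |dev X μ n (fun x => fit μ u x * fit μ θ x) ω| ≤ √(gramDevAt X μ n u ω) * ‖θ‖ := by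
      have h0 : 0 ≤ gramDevAt X μ n u ω := Finset.sum_nonneg fun _ _ => sq_nonneg _
      refine abs_le_of_sq_le_sq ((dev_fit_mul_fit_sq_le_gramDevAt u θ n ω).trans_eq ?_)
        (by positivity)
      rw [mul_pow, Real.sq_sqrt h0]
    have h4 := hρ u
    -- Replacing the empirical by the theoretical inner product costs only a Gram fluctuation in the
    -- fixed direction u, multiplied by ‖θ‖.
    have e : ∫ x, fit μ u x * fit μ θ x ∂μ = noiseFun X ε s μ n u ω
        + (n : ℝ)⁻¹ * ∑ i ∈ Finset.range n, r i * fit μ u (X i ω)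
        - dev X μ n (fun x => fit μ u x * fit μ θ x) ω := by linarith
    rw [e]
    refine (abs_sub _ _).trans (add_le_add ((abs_add_le _ _).trans (add_le_add le_rfl h4)) h3)

lemma Design.integral_abs_step_le (h : Design P X μ cf Cf) (α : Fin d) (J : Fin (N + 1)) :
    ∫ t, |step μ N α J t| ∂unifOne ≤ 2 * Cf / √((N : ℝ) + 1) := by
  have := h.prob
  have hN : (0 : ℝ) < (N : ℝ) + 1 := by positivity
  have hp := h.binProb_le (N := N) α J
  have hp0 := binProb_nonneg μ (N := N) α J
  have hC := h.one_le_Cf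
  calc ∫ t, |step μ N α J t| ∂unifOne
      ≤ ∫ t, √((N : ℝ) + 1) * (bin N J t + binProb μ N α J) ∂unifOne := by
        refine integral_mono_of_nonneg (ae_of_all _ fun _ => abs_nonneg _)
          (((integrable_bin N J unifOne).add (integrable_const _)).const_mul _)
          (ae_of_all _ fun t => ?_)
        simp only [step]
        rw [abs_mul, abs_of_nonneg (Real.sqrt_nonneg _)]
        gcongr
        refine (abs_sub _ _).trans ?_
        rw [abs_of_nonneg (bin_nonneg N J t), abs_of_nonneg hp0]
    _ = √((N : ℝ) + 1) * (1 / ((N : ℝ) + 1) + binProb μ N α J) := by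
        rw [integral_const_mul, integral_add (integrable_bin N J unifOne) (integrable_const _),
          integral_bin (Nat.lt_succ_iff.1 J.2)]
        simp
    _ ≤ √((N : ℝ) + 1) * (Cf / ((N : ℝ) + 1) + Cf / ((N : ℝ) + 1)) := by gcongr
    _ = _ := by
        have h1 : √((N : ℝ) + 1) * √((N : ℝ) + 1) = (N : ℝ) + 1 := Real.mul_self_sqrt hN.le
        have h2 : √((N : ℝ) + 1) ≠ 0 := by positivity
        rw [← add_div, ← mul_div_assoc, div_eq_div_iff hN.ne' h2]
        linear_combination (2 * Cf) * h1

/-- Bound for the smoothed component error, uniform over the points within distance `D` of a grid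
point `x₀`. -/
lemma Design.abs_emp_window_le (h : Design P X μ cf Cf) {K : ℝ → ℝ} {C : ℝ} (hK : KernelBound K C)
    {b D : ℝ} (hb : 0 < b) (hD : 0 ≤ D) {x₀ x : ℝ} (hx : |x - x₀| ≤ D) {α : Fin d} (hα : α ≠ 0)
    {u θ : Coef d N} (hθ : ∀ α, blockSum α θ = 0)
    (hu : ∀ v, gramForm μ u v = windowFun μ (fun y => scaledKernel K b (y - x₀)) α v)
    (n : ℕ) (ω : Ω) :
    |emp X n (fun z => scaledKernel K b (z 0 - x) * comp μ α θ (z α)) ω|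
      ≤ |∫ x, fit μ u x * fit μ θ x ∂μ|
        + (√(windowDev X μ n (fun y => scaledKernel K b (y - x₀)) α
            (fun J : Fin (N + 1) => step μ N α J) ω)
          + √(windowDev X μ n (envelope C b D x₀) α
            (fun J : Fin (N + 1) => fun t => |step μ N α J t|) ω)
          + 16 * Cf ^ 2 * C * D / b) * ‖θ‖ := by
  have := h.prob
  have hC := h.one_le_Cf
  have hC0 : 0 ≤ C := zero_le_one.trans hK.one_le
  have hN : (0 : ℝ) < (N : ℝ) + 1 := by positivity
  have hwd : ∀ (g : ℝ → ℝ) (φ : Fin (N + 1) → ℝ → ℝ), 0 ≤ windowDev X μ n g α φ ω := fun g φ =>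
    Finset.sum_nonneg fun _ _ => sq_nonneg _
  set k₀ : ℝ → ℝ := fun y => scaledKernel K b (y - x₀) with hk₀
  have hk₀m : Measurable k₀ := hK.measurable_scaled b x₀
  have hk₀b : ∀ y, |k₀ y| ≤ C / b := fun y => by
    rw [abs_of_nonneg (hK.scaled_nonneg hb _)]
    exact div_le_div_of_nonneg_right (hK.le _) hb.le
  set R := envelope C b D x₀ with hR
  have hRm : Measurable R := measurable_envelope C b D x₀
  have hR0 : ∀ y, 0 ≤ R y := fun y => envelope_nonneg hC0 hb hD x₀ y
  have hRb : ∀ y, |R y| ≤ C / b * (D / b + 1 + 1) := fun y => by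
    rw [abs_of_nonneg (hR0 y), hR, envelope]
    have hi := fun s => indicator_one_le s y
    have hDb : D / b * (Icc (x₀ - 2 * b) (x₀ + 2 * b)).indicator (fun _ => (1 : ℝ)) y
        ≤ D / b := mul_le_of_le_one_right (by positivity) (hi _)
    gcongr
    · exact hi _
    · exact hi _
  -- The average at x is split into the one at the grid point, treated by duality, and a difference
  -- of kernels, treated by the envelope.
  have e1 : emp X n (fun z => scaledKernel K b (z 0 - x) * comp μ α θ (z α)) ω
      = emp X n (fun z => k₀ (z 0) * comp μ α θ (z α)) ω
        + emp X n (fun z => (scaledKernel K b (z 0 - x) - k₀ (z 0)) * comp μ α θ (z α)) ω := by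
    unfold emp
    rw [← mul_add, ← Finset.sum_add_distrib]
    congr 1
    exact Finset.sum_congr rfl fun i _ => by ring
  -- Zero block sums remove the penalty from `gramForm`, so the mean of this window is exactly the
  -- theoretical inner product of u and θ.
  have b1 : |emp X n (fun z => k₀ (z 0) * comp μ α θ (z α)) ω|
      ≤ |∫ x, fit μ u x * fit μ θ x ∂μ| + √(windowDev X μ n k₀ α
            (fun J : Fin (N + 1) => step μ N α J) ω) * ‖θ‖ := by
    rw [emp_eq_dev_add (μ := μ), add_comm]
    refine (abs_add_le _ _).trans (add_le_add (le_of_eq ?_) ?_)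
    · congr 1
      have := hu θ
      simp only [gramForm, hθ, mul_zero, Finset.sum_const_zero, add_zero] at this
      rw [this, windowFun]
    · refine abs_le_of_sq_le_sq ((dev_window_comp_sq_le hk₀m hk₀b α θ n ω).trans_eq ?_)
        (by positivity)
      rw [mul_pow, Real.sq_sqrt (hwd _ _)]
  set A : Fin (N + 1) → ℝ := fun J => emp X n (fun z => R (z 0) * |step μ N α J (z α)|) ω with hA
  -- The kernel difference has no definite sign and is only dominated by the envelope, so absolute
  -- values are taken inside the sum over bins. The resulting weights A J have a nonzero mean of
  -- order D/(b √N), bounded in `hint`; summed against θ it costs D/b times ‖θ‖.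
  have b2 : |emp X n (fun z => (scaledKernel K b (z 0 - x) - k₀ (z 0)) * comp μ α θ (z α)) ω|
      ≤ ∑ J : Fin (N + 1), |θ (some (α, J))| * A J := by
    have e2 : ∑ J : Fin (N + 1), |θ (some (α, J))| * A J = (n : ℝ)⁻¹ * ∑ i ∈ Finset.range n,
        R (X i ω 0) * ∑ J : Fin (N + 1), |θ (some (α, J))| * |step μ N α J (X i ω α)| := by
      simp only [hA, emp, Finset.mul_sum]
      rw [Finset.sum_comm]
      refine Finset.sum_congr rfl fun i _ => Finset.sum_congr rfl fun J _ => by ring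
    rw [e2, emp, abs_mul, abs_of_nonneg (by positivity)]
    gcongr
    refine (Finset.abs_sum_le_sum_abs _ _).trans (Finset.sum_le_sum fun i _ => ?_)
    rw [abs_mul]
    refine mul_le_mul (hK.abs_sub_le_envelope hb hD hx _) ?_ (abs_nonneg _) (hR0 _)
    refine (Finset.abs_sum_le_sum_abs _ _).trans_eq ?_
    simp only [abs_mul]
  have hint : ∀ J : Fin (N + 1), |∫ z, R (z 0) * |step μ N α J (z α)| ∂μ|
      ≤ 16 * Cf ^ 2 * C * D / b / √((N : ℝ) + 1) := by
    intro J
    have hnn : 0 ≤ ∫ z, R (z 0) * |step μ N α J (z α)| ∂μ :=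
      integral_nonneg fun z => mul_nonneg (hR0 _) (abs_nonneg _)
    rw [abs_of_nonneg hnn]
    have h1 := h.integral_window_le (g := R) (s := fun t => |step μ N α J t|) hRm
      (measurable_step μ α J).abs hRb (fun t => by rw [abs_abs]; exact step_abs_le μ α J t)
      hR0 (fun _ => abs_nonneg _) hα
    have h2 := integral_envelope_le hC0 hb hD x₀
    have h3 := h.integral_abs_step_le (N := N) α J
    have h4 : 0 ≤ ∫ t, |step μ N α J t| ∂unifOne := integral_nonneg fun _ => abs_nonneg _
    calc _ ≤ _ := h1
      _ ≤ Cf * ((8 * C * D / b) * (2 * Cf / √((N : ℝ) + 1))) := by gcongr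
      _ = _ := by ring
  have b3 : ∑ J : Fin (N + 1), |θ (some (α, J))| * A J
      ≤ (√(windowDev X μ n R α (fun J : Fin (N + 1) => fun t => |step μ N α J t|) ω)
          + 16 * Cf ^ 2 * C * D / b) * ‖θ‖ := by
    have e3 : ∀ J, A J = dev X μ n (fun z => R (z 0) * |step μ N α J (z α)|) ω
        + ∫ z, R (z 0) * |step μ N α J (z α)| ∂μ := fun J => emp_eq_dev_add _ _ _
    have hθn : ∑ J : Fin (N + 1), |θ (some (α, J))| ^ 2 ≤ ‖θ‖ ^ 2 := by
      simp only [sq_abs]; exact sum_coef_le α θ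
    simp only [e3, mul_add, Finset.sum_add_distrib, add_mul]
    refine add_le_add ?_ ?_
    · refine le_of_abs_le (abs_le_of_sq_le_sq ((Finset.sum_mul_sq_le_sq_mul_sq _ _ _).trans ?_)
        (by positivity))
      rw [mul_pow, Real.sq_sqrt (hwd _ _), mul_comm]
      unfold windowDev
      gcongr
    · refine le_of_abs_le (abs_le_of_sq_le_sq ((Finset.sum_mul_sq_le_sq_mul_sq _ _ _).trans ?_)
        (by positivity))
      rw [mul_pow, mul_comm]
      gcongr
      calc ∑ J : Fin (N + 1), (∫ z, R (z 0) * |step μ N α J (z α)| ∂μ) ^ 2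
          ≤ ∑ J : Fin (N + 1), (16 * Cf ^ 2 * C * D / b / √((N : ℝ) + 1)) ^ 2 := by
            refine Finset.sum_le_sum fun J _ => ?_
            rw [← sq_abs (∫ z, R (z 0) * |step μ N α J (z α)| ∂μ)]
            have := hint J
            gcongr
        _ = _ := by
            rw [div_pow _ √((N : ℝ) + 1), Real.sq_sqrt hN.le]
            simp only [Finset.sum_const, Finset.card_univ, Fintype.card_fin, nsmul_eq_mul]
            push_cast
            field_simp
  rw [e1]
  calc _ ≤ _ := abs_add_le _ _
    _ ≤ _ := add_le_add b1 (b2.trans b3)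
    _ = _ := by ring

end FitError

/-! ### Deterministic comparison of the backfitted estimator with the oracle smoother -/

section Comparison

variable {Ω : Type*} [MeasurableSpace Ω] {P : Measure Ω} [IsProbabilityMeasure P] {d : ℕ}
  [NeZero d] {X : ℕ → Ω → Fin d → ℝ} {μ : Measure (Fin d → ℝ)} {cf Cf : ℝ} {N : ℕ}
  {ε : ℕ → Ω → ℝ} {s : (Fin d → ℝ) → ℝ}

/-- Coefficients of the constant function one. -/
def constCoef (d N : ℕ) : Coef d N := EuclideanSpace.single none 1

lemma fit_constCoef (x : Fin d → ℝ) : fit μ (constCoef d N) x = 1 := by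
  rw [fit_eq]
  simp [constCoef, comp]

lemma norm_constCoef : ‖constCoef d N‖ = 1 := by
  simp [constCoef]

/-- The deviations of the features themselves are among the entries of the Gram deviation applied to
the constant function, so the empirical centring needs no separate moment bound. -/
lemma dev_comp_sq_le [IsProbabilityMeasure μ] (α : Fin d) (θ : Coef d N) (n : ℕ) (ω : Ω) :
    dev X μ n (fun z => comp μ α θ (z α)) ω ^ 2
      ≤ gramDevAt X μ n (constCoef d N) ω * ‖θ‖ ^ 2 := by
  have e : dev X μ n (fun z => comp μ α θ (z α)) ω
      = ∑ J : Fin (N + 1), θ (some (α, J)) * dev X μ n (feat μ N (some (α, J))) ω := by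
    rw [← dev_sum _ _ fun J => integrable_feat μ _ μ]
    rfl
  rw [e]
  refine (Finset.sum_mul_sq_le_sq_mul_sq _ _ _).trans ?_
  rw [mul_comm]
  refine mul_le_mul ?_ (sum_coef_le α θ) (Finset.sum_nonneg fun _ _ => sq_nonneg _)
    (Finset.sum_nonneg fun _ _ => sq_nonneg _)
  unfold gramDevAt
  simp only [fit_constCoef, one_mul]
  rw [sum_idx]
  refine le_add_of_nonneg_of_le (sq_nonneg _) ?_
  exact Finset.single_le_sum (f := fun α : Fin d => ∑ J : Fin (N + 1),
    dev X μ n (fun x => feat μ N (some (α, J)) x) ω ^ 2)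
    (fun _ _ => Finset.sum_nonneg fun _ _ => sq_nonneg _) (Finset.mem_univ α)

lemma abs_emp_comp_le [IsProbabilityMeasure μ] (α : Fin d) (θ : Coef d N) (n : ℕ) (ω : Ω) :
    |emp X n (fun z => comp μ α θ (z α)) ω| ≤ √(gramDevAt X μ n (constCoef d N) ω) * ‖θ‖ := by
  have h0 : 0 ≤ gramDevAt X μ n (constCoef d N) ω := Finset.sum_nonneg fun _ _ => sq_nonneg _
  rw [emp_eq_dev_add (μ := μ), integral_comp_eval, add_zero]
  refine abs_le_of_sq_le_sq ((dev_comp_sq_le α θ n ω).trans_eq ?_) (by positivity)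
  rw [mul_pow, Real.sq_sqrt h0]

lemma emp_add (n : ℕ) (g g' : (Fin d → ℝ) → ℝ) (ω : Ω) :
    emp X n (fun x => g x + g' x) ω = emp X n g ω + emp X n g' ω := by
  unfold emp
  rw [Finset.sum_add_distrib, mul_add]

lemma emp_sub (n : ℕ) (g g' : (Fin d → ℝ) → ℝ) (ω : Ω) :
    emp X n (fun x => g x - g' x) ω = emp X n g ω - emp X n g' ω := by
  unfold emp
  rw [Finset.sum_sub_distrib, mul_sub]

lemma emp_sum {ι : Type*} (t : Finset ι) (n : ℕ) (g : ι → (Fin d → ℝ) → ℝ) (ω : Ω) :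
    emp X n (fun x => ∑ j ∈ t, g j x) ω = ∑ j ∈ t, emp X n (g j) ω := by
  unfold emp
  rw [Finset.sum_comm, Finset.mul_sum]

lemma emp_const {n : ℕ} (hn : 1 ≤ n) (r : ℝ) (ω : Ω) : emp X n (fun _ => r) ω = r := by
  have : (n : ℝ) ≠ 0 := by exact_mod_cast (by omega : n ≠ 0)
  simp only [emp, Finset.sum_const, Finset.card_range, nsmul_eq_mul]
  field_simp

/-- The difference between the backfitted estimator and the oracle smoother in terms of the error
of the spline fit. -/
lemma abs_spbk_sub_oracleSmoother_le [IsProbabilityMeasure μ] {ν : Fin d → Measure ℝ}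
    {n : ℕ} {ω : Ω} {y : ℕ → ℝ} {lam : ℝ × (Fin d → Fin N → ℝ)}
    (hx : ∀ i < n, ∀ α, X i ω α ∈ Ico (0 : ℝ) 1) {c : ℝ} {m : Fin d → ℝ → ℝ} {Λ : ℝ}
    (hΛ : ∀ α, ∀ t ∈ Icc (0 : ℝ) 1, ∀ t' ∈ Icc (0 : ℝ) 1,
      |m α t - m α t'| ≤ Λ * |t - t'|)
    (hy : ∀ i < n, y i = c + ∑ α, m α (X i ω α) + s (X i ω) * ε i ω)
    {θ : Coef d N} {κ : Fin d → ℝ}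
    (hrep : ∀ α, ∀ t ∈ Ico (0 : ℝ) 1, ∑ J, lam.2 α J * splineBasis (ν α) N J t
        = ∑ J : Fin (N + 1), m α ((J : ℝ) / ((N : ℝ) + 1)) * bin N J t + comp μ α θ t + κ α)
    {K : ℝ → ℝ} (hK : ∀ u, 0 ≤ K u) {b : ℝ} (hb : 0 < b) {x c₁ T : ℝ} (hc₁ : 0 < c₁)
    (hc : c₁ ≤ emp X n (fun z => scaledKernel K b (z 0 - x)) ω) (hT0 : 0 ≤ T)
    (hT : ∀ α, α ≠ 0 →
      |emp X n (fun z => scaledKernel K b (z 0 - x) * comp μ α θ (z α)) ω| ≤ T) :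
    |spbk K b (fun α => splineBasis (ν α) N) n (fun i => X i ω) y lam x
        - oracleSmoother K b c m n (fun i => X i ω) y x|
      ≤ 2 * (∑ α, |emp X n (fun z => m α (z α)) ω|) + |noiseAvg X ε n s ω|
        + 2 * d * Λ / ((N : ℝ) + 1) + d * (√(gramDevAt X μ n (constCoef d N) ω) * ‖θ‖)
        + d * T / c₁ := by
  have hN : (0 : ℝ) < (N : ℝ) + 1 := by positivity
  have hn : 1 ≤ n := by
    by_contra hn
    obtain rfl : n = 0 := by omega
    simp [emp] at hc
    linarith
  have hn0 : (0 : ℝ) < n := by exact_mod_cast hn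
  have hΛ0 : 0 ≤ Λ := by
    have := hΛ 0 0 (by norm_num) 1 (by norm_num)
    norm_num at this
    exact (abs_nonneg _).trans this
  set g : Fin d → ℝ → ℝ := fun α t =>
    ∑ J : Fin (N + 1), m α ((J : ℝ) / ((N : ℝ) + 1)) * bin N J t with hg
  set G := √(gramDevAt X μ n (constCoef d N) ω) * ‖θ‖ with hG
  have hG0 : 0 ≤ G := by positivity
  have hgm : ∀ α, ∀ i < n, |m α (X i ω α) - g α (X i ω α)| ≤ Λ / ((N : ℝ) + 1) :=
    fun α i hi => abs_sub_step_le (hΛ α) (hx i hi α)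
  set w : ℕ → ℝ := fun i => scaledKernel K b (X i ω 0 - x) with hw
  have hw0 : ∀ i, 0 ≤ w i := fun i => div_nonneg (hK _) hb.le
  -- The constants κ α disappear because the pilot estimator subtracts its own empirical mean.
  have hpil : ∀ α, ∀ i < n, pilot (fun α => splineBasis (ν α) N) n (fun i => X i ω) lam α (X i ω α)
      = g α (X i ω α) + comp μ α θ (X i ω α) - emp X n (fun z => g α (z α)) ω
        - emp X n (fun z => comp μ α θ (z α)) ω := by
    intro α i hi
    have e : (n : ℝ)⁻¹ * ∑ i ∈ Finset.range n, ∑ J, lam.2 α J * splineBasis (ν α) N J (X i ω α)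
        = emp X n (fun z => g α (z α)) ω + emp X n (fun z => comp μ α θ (z α)) ω + κ α := by
      rw [← emp_add, ← emp_const (X := X) hn (κ α) ω, ← emp_add]
      unfold emp
      congr 1
      exact Finset.sum_congr rfl fun i hi => by
        rw [hrep α _ (hx i (Finset.mem_range.1 hi) α)]
    simp only [pilot]
    rw [e, hrep α _ (hx i hi α)]
    ring
  set ybar : ℝ := (n : ℝ)⁻¹ * ∑ k ∈ Finset.range n, y k with hybar
  have hyb : |c - ybar| ≤ (∑ α, |emp X n (fun z => m α (z α)) ω|) + |noiseAvg X ε n s ω| := by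
    have e : ybar = c + (∑ α, emp X n (fun z => m α (z α)) ω) + noiseAvg X ε n s ω := by
      rw [← emp_sum]
      nth_rewrite 1 [← emp_const (X := X) hn c ω]
      rw [← emp_add]
      unfold emp noiseAvg
      rw [← mul_add, ← Finset.sum_add_distrib, hybar]
      congr 1
      exact Finset.sum_congr rfl fun i hi => hy i (Finset.mem_range.1 hi)
    rw [e, show c - (c + (∑ α, emp X n (fun z => m α (z α)) ω) + noiseAvg X ε n s ω)
      = -((∑ α, emp X n (fun z => m α (z α)) ω) + noiseAvg X ε n s ω) by ring, abs_neg]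
    exact (abs_add_le _ _).trans (add_le_add (Finset.abs_sum_le_sum_abs _ _) le_rfl)
  set S := Finset.univ.erase (0 : Fin d) with hS
  have hScard : (S.card : ℝ) ≤ d := by
    exact_mod_cast (Finset.card_le_univ _).trans_eq (Fintype.card_fin d)
  -- Everything in the difference of responses except the fluctuating components. It is bounded
  -- uniformly in i by B, so its kernel average is at most B whatever the weights.
  set e : ℕ → ℝ := fun i => c - ybar + ∑ α ∈ S, (m α (X i ω α) - g α (X i ω α)
    + emp X n (fun z => g α (z α)) ω + emp X n (fun z => comp μ α θ (z α)) ω) with he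
  set B := 2 * (∑ α, |emp X n (fun z => m α (z α)) ω|) + |noiseAvg X ε n s ω|
        + 2 * d * Λ / ((N : ℝ) + 1) + d * G with hB
  have heB : ∀ i < n, |e i| ≤ B := by
    intro i hi
    have h1 : ∀ α ∈ S, |m α (X i ω α) - g α (X i ω α)
        + emp X n (fun z => g α (z α)) ω + emp X n (fun z => comp μ α θ (z α)) ω|
        ≤ |emp X n (fun z => m α (z α)) ω| + (2 * Λ / ((N : ℝ) + 1) + G) := by
      intro α _
      have a1 := abs_le.1 (hgm α i hi)
      have a2 := abs_le.1 (abs_emp_comp_le (X := X) (μ := μ) α θ n ω)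
      have a3 : |emp X n (fun z => m α (z α) - g α (z α)) ω| ≤ Λ / ((N : ℝ) + 1) :=
        abs_emp_le (by positivity) (hgm α)
      rw [emp_sub] at a3
      have a4 := abs_le.1 a3
      have a5 := neg_abs_le (emp X n (fun z => m α (z α)) ω)
      have a6 := le_abs_self (emp X n (fun z => m α (z α)) ω)
      have a7 : 2 * Λ / ((N : ℝ) + 1) = Λ / ((N : ℝ) + 1) + Λ / ((N : ℝ) + 1) := by ring
      rw [abs_le, a7]
      constructor <;> linarith [a1.1, a1.2, a2.1, a2.2, a4.1, a4.2]
    have h2 : |∑ α ∈ S, (m α (X i ω α) - g α (X i ω α)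
        + emp X n (fun z => g α (z α)) ω + emp X n (fun z => comp μ α θ (z α)) ω)|
        ≤ (∑ α, |emp X n (fun z => m α (z α)) ω|) + d * (2 * Λ / ((N : ℝ) + 1) + G) := by
      refine (Finset.abs_sum_le_sum_abs _ _).trans ((Finset.sum_le_sum h1).trans ?_)
      rw [Finset.sum_add_distrib]
      refine add_le_add (Finset.sum_le_sum_of_subset_of_nonneg (Finset.subset_univ _)
        fun _ _ _ => abs_nonneg _) ?_
      rw [Finset.sum_const, nsmul_eq_mul]
      gcongr
    calc |e i| ≤ _ := abs_add_le _ _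
      _ ≤ _ := add_le_add hyb h2
      _ = B := by rw [hB]; ring
  have hδ : ∀ i ∈ Finset.range n, w i * pseudoResponse (fun α => splineBasis (ν α) N) n
        (fun i => X i ω) y lam i
      - w i * oracleResponse c m (fun i => X i ω) y i
      = w i * e i - ∑ α ∈ S, w i * comp μ α θ (X i ω α) := by
    intro i hi
    simp only [pseudoResponse, oracleResponse, he]
    rw [Finset.sum_congr rfl fun α _ => hpil α i (Finset.mem_range.1 hi)]
    simp only [Finset.sum_sub_distrib, Finset.sum_add_distrib, ← Finset.mul_sum, hybar]
    ring
  have hsum : emp X n (fun z => scaledKernel K b (z 0 - x)) ω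
      = (n : ℝ)⁻¹ * ∑ i ∈ Finset.range n, w i := rfl
  set W := ∑ i ∈ Finset.range n, w i with hW
  have hWpos : n * c₁ ≤ W := by
    rw [hsum] at hc
    calc n * c₁ ≤ n * ((n : ℝ)⁻¹ * W) := by gcongr
      _ = W := by field_simp
  have hW0 : 0 < W := lt_of_lt_of_le (by positivity) hWpos
  have hcomp : |∑ i ∈ Finset.range n, ∑ α ∈ S, w i * comp μ α θ (X i ω α)| ≤ n * (d * T) := by
    rw [Finset.sum_comm]
    refine (Finset.abs_sum_le_sum_abs _ _).trans ?_
    calc _ ≤ ∑ α ∈ S, n * T := by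
          refine Finset.sum_le_sum fun α hα => ?_
          have := hT α (Finset.ne_of_mem_erase hα)
          unfold emp at this
          rw [abs_mul, abs_of_pos (by positivity), inv_mul_le_iff₀ hn0] at this
          exact this
      _ = S.card * (n * T) := by rw [Finset.sum_const, nsmul_eq_mul]
      _ ≤ d * (n * T) := by gcongr
      _ = _ := by ring
  have hwe : |∑ i ∈ Finset.range n, w i * e i| ≤ B * W := by
    refine (Finset.abs_sum_le_sum_abs _ _).trans ?_
    rw [hW, Finset.mul_sum]
    refine Finset.sum_le_sum fun i hi => ?_
    rw [abs_mul, abs_of_nonneg (hw0 i), mul_comm]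
    exact mul_le_mul_of_nonneg_right (heB i (Finset.mem_range.1 hi)) (hw0 i)
  unfold spbk oracleSmoother nadarayaWatson
  rw [← sub_div, ← Finset.sum_sub_distrib, Finset.sum_congr rfl hδ, Finset.sum_sub_distrib,
    abs_div, abs_of_pos hW0, div_le_iff₀ hW0]
  refine (abs_sub _ _).trans ((add_le_add hwe hcomp).trans ?_)
  have e3 : (B + d * T / c₁) * W = B * W + d * T / c₁ * W := by ring
  refine (add_le_add_right ?_ _).trans_eq e3.symm
  calc n * (d * T) = d * T / c₁ * (n * c₁) := by field_simp
    _ ≤ d * T / c₁ * W := by gcongr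

end Comparison

/-! ### Chaining along the representers of the kernel windows -/

section Chain

variable {Ω : Type*} [MeasurableSpace Ω] {P : Measure Ω} [IsProbabilityMeasure P]

/-- A path with small increments in `L²` has a square-integrable maximum. -/
lemma exists_sq_bound_of_path {F : ℕ → Ω → ℝ} {M : ℕ} (hF : ∀ k, MemLp (F k) 2 P) {V C : ℝ}
    (h0 : ∀ k ≤ M, ∫ ω, F k ω ^ 2 ∂P ≤ V * C ^ 2) {ρ : ℕ → ℝ} (hρ : ∀ k, 0 < ρ k)
    (h1 : ∀ k < M, ∫ ω, (F (k + 1) ω - F k ω) ^ 2 ∂P ≤ V * ρ k ^ 2) :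
    ∃ G : Ω → ℝ, Integrable G P ∧ (∀ k ≤ M, ∀ ω, F k ω ^ 2 ≤ G ω) ∧
      ∫ ω, G ω ∂P ≤ V * (C ^ 2 + (1 + C ^ 2) * ∑ k ∈ Finset.range M, ρ k) := by
  set g : ℕ → Ω → ℝ := fun k ω => (F (k + 1) ω - F k ω) ^ 2 / ρ k
    + ρ k / 2 * (F k ω ^ 2 + F (k + 1) ω ^ 2) with hg
  have hi : ∀ k, Integrable (fun ω => F k ω ^ 2) P := fun k => (hF k).integrable_sq
  have hd : ∀ k, Integrable (fun ω => (F (k + 1) ω - F k ω) ^ 2) P := fun k =>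
    ((hF (k + 1)).sub (hF k)).integrable_sq
  have hs : ∀ k, Integrable (fun ω => ρ k / 2 * (F k ω ^ 2 + F (k + 1) ω ^ 2)) P := fun k =>
    ((hi k).add (hi (k + 1))).const_mul _
  have hgi : ∀ k, Integrable (g k) P := fun k => ((hd k).div_const _).add (hs k)
  have hg0 : ∀ k ω, 0 ≤ g k ω := fun k ω => by have := hρ k; positivity
  -- Writing Δ for the increment, F_{k+1}² - F_k² = Δ (F_k + F_{k+1}) is at most Δ²/ρ plus ρ/4 times
  -- (F_k + F_{k+1})². With ρ the step length, each step costs V ρ (1 + C²) in expectation, so the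
  -- maximum is governed by the length of the path and not by the number of its points.
  have hstep : ∀ k ω, F (k + 1) ω ^ 2 ≤ F k ω ^ 2 + g k ω := by
    intro k ω
    have hk := hρ k
    have e : F k ω ^ 2 + g k ω - F (k + 1) ω ^ 2
        = ((F (k + 1) ω - F k ω) - ρ k / 2 * (F (k + 1) ω + F k ω)) ^ 2 / ρ k
          + ρ k / 4 * (F (k + 1) ω - F k ω) ^ 2 := by
      simp only [hg]
      field_simp
      ring
    have : 0 ≤ ((F (k + 1) ω - F k ω) - ρ k / 2 * (F (k + 1) ω + F k ω)) ^ 2 / ρ k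
          + ρ k / 4 * (F (k + 1) ω - F k ω) ^ 2 := by positivity
    linarith
  have hle : ∀ k ω, F k ω ^ 2 ≤ F 0 ω ^ 2 + ∑ j ∈ Finset.range k, g j ω := by
    intro k ω
    induction k with
    | zero => simp
    | succ k ih =>
      rw [Finset.sum_range_succ]
      linarith [hstep k ω]
  refine ⟨fun ω => F 0 ω ^ 2 + ∑ j ∈ Finset.range M, g j ω,
    (hi 0).add (integrable_finsetSum _ fun j _ => hgi j), fun k hk ω => ?_, ?_⟩
  · refine (hle k ω).trans (add_le_add le_rfl ?_)
    exact Finset.sum_le_sum_of_subset_of_nonneg (Finset.range_subset_range.2 hk) fun j _ _ => hg0 j ω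
  · rw [integral_add (hi 0) (integrable_finsetSum _ fun j _ => hgi j),
      integral_finsetSum _ fun j _ => hgi j, mul_add, mul_left_comm, ← mul_assoc, Finset.mul_sum]
    refine add_le_add (h0 0 (Nat.zero_le _)) (Finset.sum_le_sum fun k hk => ?_)
    have hk := Finset.mem_range.1 hk
    have hk0 := hρ k
    simp only [hg]
    rw [integral_add ((hd k).div_const _) (hs k), integral_div, integral_const_mul,
      integral_add (hi k) (hi (k + 1))]
    calc _ ≤ V * ρ k ^ 2 / ρ k + ρ k / 2 * (V * C ^ 2 + V * C ^ 2) := by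
          gcongr
          · exact h1 k hk
          · exact h0 k hk.le
          · exact h0 (k + 1) hk
      _ = _ := by field_simp; ring

variable {d : ℕ}
  [NeZero d] {X : ℕ → Ω → Fin d → ℝ} {μ : Measure (Fin d → ℝ)} {cf Cf : ℝ} {N : ℕ}
  {ε : ℕ → Ω → ℝ} {s : (Fin d → ℝ) → ℝ}

lemma measurable_mul_fit (hs : Measurable s) (u : Coef d N) :
    Measurable fun x => s x * fit μ u x := hs.mul (measurable_fit μ u)

lemma abs_mul_fit_le [IsProbabilityMeasure μ] {S : ℝ} (hS : ∀ x, |s x| ≤ S) (u : Coef d N)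
    (x : Fin d → ℝ) : |s x * fit μ u x| ≤ S * (‖u‖ * √(3 * d * ((N : ℝ) + 1))) := by
  rw [abs_mul]
  exact mul_le_mul (hS x) (abs_fit_le μ u x) (abs_nonneg _) ((abs_nonneg _).trans (hS x))

lemma memLp_noiseFun (h : Design P X μ cf Cf) (hε : SecondOrderNoise P X μ ε) (hs : Measurable s)
    {S : ℝ} (hS : ∀ x, |s x| ≤ S) (n : ℕ) (u : Coef d N) :
    MemLp (noiseFun X ε s μ n u) 2 P := by
  have := h.prob
  exact hε.memLp_noiseAvg h.meas (measurable_mul_fit hs u) (abs_mul_fit_le hS u) n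

lemma noiseFun_sub (n : ℕ) (u v : Coef d N) (ω : Ω) :
    noiseFun X ε s μ n (u - v) ω = noiseFun X ε s μ n u ω - noiseFun X ε s μ n v ω := by
  unfold noiseFun noiseAvg
  rw [← mul_sub, ← Finset.sum_sub_distrib]
  congr 1
  exact Finset.sum_congr rfl fun i _ => by simp only [fit_sub]; ring

lemma integral_noiseFun_sq_le (h : Design P X μ cf Cf) (hε : SecondOrderNoise P X μ ε)
    (hs : Measurable s) {S : ℝ} (hS : ∀ x, |s x| ≤ S) {n : ℕ} (hn : 1 ≤ n) (u : Coef d N) :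
    ∫ ω, noiseFun X ε s μ n u ω ^ 2 ∂P ≤ S ^ 2 * (d + 1) * Cf / n * ‖u‖ ^ 2 := by
  have := h.prob
  unfold noiseFun
  rw [hε.integral_noiseAvg_sq h.meas (measurable_mul_fit hs u) (abs_mul_fit_le hS u) hn]
  have h1 : ∫ x, (s x * fit μ u x) ^ 2 ∂μ ≤ S ^ 2 * ((d + 1) * Cf * ‖u‖ ^ 2) := by
    calc _ ≤ ∫ x, S ^ 2 * fit μ u x ^ 2 ∂μ := by
          refine integral_mono_of_nonneg (ae_of_all _ fun x => sq_nonneg _) ?_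
            (ae_of_all _ fun x => ?_)
          · have := integrable_fit_mul_fit μ u u
            simp only [← sq] at this
            exact this.const_mul _
          · simp only [mul_pow]
            refine mul_le_mul_of_nonneg_right ?_ (sq_nonneg _)
            rw [← sq_abs]
            exact pow_le_pow_left₀ (abs_nonneg _) (hS x) 2
      _ ≤ _ := by
        rw [integral_const_mul]
        gcongr
        exact h.integral_fit_sq_le u
  calc _ ≤ S ^ 2 * ((d + 1) * Cf * ‖u‖ ^ 2) / n := by gcongr
    _ = _ := by ring

lemma integrable_noiseNormSq (h : Design P X μ cf Cf) (hε : SecondOrderNoise P X μ ε)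
    (hs : Measurable s) {S : ℝ} (hS : ∀ x, |s x| ≤ S) (n : ℕ) :
    Integrable (noiseNormSq X ε s μ n N) P := by
  have := h.prob
  refine integrable_finsetSum _ fun j _ => MemLp.integrable_sq ?_
  refine hε.memLp_noiseAvg h.meas (g := fun x => s x * feat μ N j x) (hs.mul (measurable_feat μ j))
    (M := S * √(3 * d * ((N : ℝ) + 1))) (fun x => ?_) n
  rw [abs_mul]
  exact mul_le_mul (hS x) (abs_feat_le μ j x) (abs_nonneg _) ((abs_nonneg _).trans (hS x))

lemma integral_noiseNormSq_le (h : Design P X μ cf Cf) (hε : SecondOrderNoise P X μ ε)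
    (hs : Measurable s) {S : ℝ} (hS : ∀ x, |s x| ≤ S) {n : ℕ} (hn : 1 ≤ n) :
    ∫ ω, noiseNormSq X ε s μ n N ω ∂P ≤ S ^ 2 * featBound d N / n := by
  have := h.prob
  have hm : ∀ j : Idx d N, Measurable fun x => s x * feat μ N j x := fun j =>
    hs.mul (measurable_feat μ j)
  have hb : ∀ (j : Idx d N) (x : Fin d → ℝ), |s x * feat μ N j x|
      ≤ S * √(3 * d * ((N : ℝ) + 1)) := fun j x => by
    rw [abs_mul]
    exact mul_le_mul (hS x) (abs_feat_le μ j x) (abs_nonneg _) ((abs_nonneg _).trans (hS x))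
  have hi : ∀ j : Idx d N, Integrable (fun x => (s x * feat μ N j x) ^ 2) μ := fun j =>
    Integrable.of_bound ((hm j).pow_const 2).aestronglyMeasurable
      ((S * √(3 * d * ((N : ℝ) + 1))) ^ 2) (ae_of_all _ fun x => by
        rw [Real.norm_eq_abs, abs_pow]
        exact pow_le_pow_left₀ (abs_nonneg _) (hb j x) 2)
  unfold noiseNormSq
  rw [integral_finsetSum _ fun j _ =>
    (hε.memLp_noiseAvg h.meas (hm j) (hb j) n).integrable_sq]
  simp only [fun j => hε.integral_noiseAvg_sq h.meas (hm j) (hb j) hn]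
  rw [← Finset.sum_div, ← integral_finsetSum _ fun j _ => hi j]
  gcongr
  calc _ ≤ ∫ x : Fin d → ℝ, S ^ 2 * featBound d N ∂μ := by
        refine integral_mono (integrable_finsetSum _ fun j _ => hi j) (integrable_const _)
          fun x => ?_
        simp only [mul_pow, ← Finset.mul_sum]
        refine mul_le_mul ?_ (sum_feat_sq_le μ x) (Finset.sum_nonneg fun _ _ => sq_nonneg _)
          (sq_nonneg _)
        rw [← sq_abs]
        exact pow_le_pow_left₀ (abs_nonneg _) (hS x) 2
    _ = _ := by simp

/-- Bound for the norms of the representers of the kernel windows. -/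
def rieszBound (cf Cf : ℝ) : ℝ := Cf * √(Cf / cf) / cf

/-- Representers of the kernel windows along an equally spaced grid. -/
lemma Design.exists_riesz_grid (h : Design P X μ cf Cf) {f : (Fin d → ℝ) → ℝ}
    (hf : Measurable f) (hμ : μ = (unif d).withDensity fun x => ENNReal.ofReal (f x))
    (hf0 : ∀ x, 0 ≤ f x) (hf1 : ∀ x, f x ≤ Cf) {K : ℝ → ℝ} {C : ℝ} (hK : KernelBound K C)
    {b : ℝ} (hb : 0 < b) {D : ℝ} (hD : 0 < D) (hDb : D ≤ b) {M : ℕ} (hM : M * D = 1)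
    {η : ℝ} (hη0 : 0 ≤ η)
    (hη : ∀ x ∈ Icc (0 : Fin d → ℝ) 1, ∀ t ∈ Icc (0 : ℝ) 1, |x 0 - t| ≤ 2 * b →
      |f x - f (Function.update x 0 t)| ≤ η)
    {α : Fin d} (hα : α ≠ 0) (N : ℕ) :
    ∃ u : ℕ → Coef d N,
      (∀ k v, gramForm μ (u k) v = windowFun μ (fun y => scaledKernel K b (y - k * D)) α v) ∧
      (∀ k, ‖u k‖ ≤ rieszBound cf Cf) ∧
      ∃ ρ : ℕ → ℝ, (∀ k, 0 < ρ k) ∧ (∀ k < M, ‖u (k + 1) - u k‖ ≤ ρ k) ∧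
        ∑ k ∈ Finset.range M, ρ k ≤ 1 + √(Cf / cf) / cf * (8 * C * η / b + 2 * Cf) := by
  have := h.prob
  have hcf := h.pos
  have hC := h.one_le_Cf
  have hC0 : 0 ≤ C := zero_le_one.trans hK.one_le
  have hM0 : M ≠ 0 := by rintro rfl; simp at hM
  have hMpos : (0 : ℝ) < M := by exact_mod_cast Nat.pos_of_ne_zero hM0
  set g : ℕ → ℝ → ℝ := fun k y => scaledKernel K b (y - k * D) with hg
  have hgm : ∀ k, Measurable (g k) := fun k => hK.measurable_scaled b _
  have hgb : ∀ k y, |g k y| ≤ C / b := fun k y => by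
    rw [abs_of_nonneg (hK.scaled_nonneg hb _)]
    exact div_le_div_of_nonneg_right (hK.le _) hb.le
  have hgi : ∀ k, Integrable (g k) unifOne := fun k =>
    Integrable.of_bound (hgm k).aestronglyMeasurable (C / b) (ae_of_all _ fun y => hgb k y)
  choose u hu using fun k => h.exists_riesz (windowMap μ (hgm k) (hgb k) α : Coef d N →ₗ[ℝ] ℝ)
  replace hu : ∀ k v, gramForm μ (u k) v = windowFun μ (g k) α v := hu
  set I : ℕ → ℝ := fun k => ∫ y, g k y ∂unifOne with hI
  -- The summand 1/M only makes the step lengths strictly positive, as required for dividing by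
  -- them; over the whole grid it adds 1.
  set ρ : ℕ → ℝ := fun k => 1 / M + √(Cf / cf) / cf * (η * (8 * C * D / b)
    + Cf * |I (k + 1) - I k|) with hρ
  refine ⟨u, hu, fun k => ?_, ρ, fun k => by positivity, fun k hk => ?_, ?_⟩
  · refine h.norm_le_of_gramForm_le (by positivity) ?_
    rw [hu]
    refine (le_abs_self _).trans ((h.abs_windowFun_le (hgm k) (hgb k) hα (u k)).trans ?_)
    refine mul_le_mul_of_nonneg_right ?_ (norm_nonneg _)
    have h1 : ∫ y, |g k y| ∂unifOne ≤ 1 := by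
      simp only [hg, abs_of_nonneg (hK.scaled_nonneg hb _)]
      exact hK.integral_scaled_unifOne_le hb _
    calc _ ≤ Cf * √(Cf / cf) * 1 := by gcongr
      _ = _ := mul_one _
  · have hsub : ∀ v, gramForm μ (u (k + 1) - u k) v
        = windowFun μ (fun y => g (k + 1) y - g k y) α v := by
      intro v
      have e1 : gramForm μ (u (k + 1) - u k) v = gramForm μ (u (k + 1)) v - gramForm μ (u k) v := by
        rw [sub_eq_add_neg, ← neg_one_smul ℝ (u k), gramForm_add_left, gramForm_smul_left]
        ring
      rw [e1, hu, hu, windowFun, windowFun, windowFun,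
        ← integral_sub (integrable_window (hgm _) (hgb _) α v μ)
          (integrable_window (hgm _) (hgb _) α v μ)]
      congr 1 with x
      ring
    have hkD : ((k + 1 : ℕ) : ℝ) * D = k * D + D := by push_cast; ring
    have hk1 : (k : ℝ) * D ∈ Icc (0 : ℝ) 1 := by
      refine ⟨by positivity, ?_⟩
      rw [← hM]
      gcongr
    have henv : ∀ y, |g (k + 1) y - g k y| ≤ envelope C b D (k * D) y := fun y =>
      hK.abs_sub_le_envelope hb hD.le (by rw [hkD, add_sub_cancel_left, abs_of_pos hD]) y
    have hbd : ∀ y, |g (k + 1) y - g k y| ≤ C / b + C / b := fun y =>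
      (abs_sub _ _).trans (add_le_add (hgb _ _) (hgb _ _))
    -- The density is frozen at the grid point kD. The increment of the kernel is supported within
    -- 2b of it, so η bounds the resulting change of the density.
    have h2 := h.abs_windowFun_le_of_density hf hμ hf0 hf1 (t₀ := k * D) (η := η)
      (g := fun y => g (k + 1) y - g k y)
      ((hgm (k + 1)).sub (hgm k)) hbd (fun x hx hne => hη x hx _ hk1 (by
        by_contra hcon
        rw [not_le] at hcon
        refine hne ?_
        have h3 := (henv (x 0)).trans (envelope_le hC0 hb hDb _ _)
        rw [Set.indicator_of_notMem, mul_zero] at h3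
        · exact abs_nonpos_iff.1 h3
        · rintro ⟨a1, a2⟩
          rw [lt_abs] at hcon
          rcases hcon with hcon | hcon <;> linarith)) hα (u (k + 1) - u k)
    have h4 : ∫ y, |g (k + 1) y - g k y| ∂unifOne ≤ 8 * C * D / b :=
      (integral_mono_of_nonneg (ae_of_all _ fun y => abs_nonneg _)
        (integrable_envelope _ _ _ _ _) (ae_of_all _ henv)).trans
        (integral_envelope_le hC0 hb hD.le _)
    have h5 : ∫ y, (g (k + 1) y - g k y) ∂unifOne = I (k + 1) - I k := integral_sub (hgi _) (hgi _)
    have h6 : ‖u (k + 1) - u k‖ ≤ √(Cf / cf) * (η * (8 * C * D / b)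
        + Cf * |I (k + 1) - I k|) / cf := by
      refine h.norm_le_of_gramForm_le (by positivity) ?_
      rw [hsub]
      refine (le_abs_self _).trans (h2.trans ?_)
      rw [h5]
      gcongr
    refine h6.trans ?_
    have h7 : (0 : ℝ) ≤ 1 / M := by positivity
    calc _ = 0 + √(Cf / cf) / cf * (η * (8 * C * D / b) + Cf * |I (k + 1) - I k|) := by ring
      _ ≤ ρ k := add_le_add h7 le_rfl
  · have hvar : ∑ k ∈ Finset.range M, |I (k + 1) - I k| ≤ 2 :=
      hK.variation_integral_scaled hb (x := fun k : ℕ => k * D) (fun k l hkl => by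
        have : (k : ℝ) ≤ l := by exact_mod_cast hkl
        simp only; gcongr) M
    simp only [hρ, Finset.sum_add_distrib, ← Finset.mul_sum, Finset.sum_const, Finset.card_range,
      nsmul_eq_mul]
    -- The M increments of L¹ size D/b add up to 1/b because M D = 1, so this part of the length is
    -- proportional to η/b; the other part is the bounded variation `hvar`.
    have e : η * ((M : ℝ) * (8 * C * D / b)) = 8 * C * η / b := by
      calc _ = 8 * C * η / b * (M * D) := by ring
        _ = _ := by rw [hM, mul_one]
    rw [e, mul_one_div_cancel hMpos.ne']
    rw [mul_comm 2 Cf]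
    gcongr

end Chain

/-! ### Simultaneous control of all stochastic terms at a fixed sample size -/

section Control

variable {Ω : Type*} [MeasurableSpace Ω]

/-- The regression model, with all functions extended to bounded measurable functions on the whole
space. -/
structure BoundedModel {d : ℕ} [NeZero d] (P : Measure Ω) (X : ℕ → Ω → Fin d → ℝ)
    (ε : ℕ → Ω → ℝ) (μ : Measure (Fin d → ℝ)) (f s : (Fin d → ℝ) → ℝ) (m : Fin d → ℝ → ℝ)
    (K : ℝ → ℝ) (cf Cf S Λ B C : ℝ) : Prop where
  design : Design P X μ cf Cf
  noise_meas : ∀ i, Measurable (ε i)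
  noise : SecondOrderNoise P X μ ε
  density_meas : Measurable f
  law_eq : μ = (unif d).withDensity fun x => ENNReal.ofReal (f x)
  density_nonneg : ∀ x, 0 ≤ f x
  density_le : ∀ x, f x ≤ Cf
  scale_meas : Measurable s
  scale_le : ∀ x, |s x| ≤ S
  comp_meas : ∀ α, Measurable (m α)
  comp_le : ∀ α t, |m α t| ≤ B
  lipschitz : ∀ α, ∀ t ∈ Icc (0 : ℝ) 1, ∀ t' ∈ Icc (0 : ℝ) 1,
    |m α t - m α t'| ≤ Λ * |t - t'|
  centered : ∀ α, ∫ x, m α (x α) ∂μ = 0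
  kernel : KernelBound K C

variable {P : Measure Ω} [IsProbabilityMeasure P] {d : ℕ} [NeZero d] {X : ℕ → Ω → Fin d → ℝ}
  {ε : ℕ → Ω → ℝ} {μ : Measure (Fin d → ℝ)} {f s : (Fin d → ℝ) → ℝ} {m : Fin d → ℝ → ℝ}
  {K : ℝ → ℝ} {cf Cf S Λ B C : ℝ} {N : ℕ}

lemma Design.integrable_gramDevAt (h : Design P X μ cf Cf) (n : ℕ) (u : Coef d N) :
    Integrable (gramDevAt X μ n u) P := by
  have := h.prob
  exact integrable_finsetSum _ fun j _ => dev_bounded_integrable h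
    ((measurable_fit μ u).mul (measurable_feat μ j)) (abs_fit_mul_feat_le u j) n 2

lemma Design.integrable_gramDev (h : Design P X μ cf Cf) (n N : ℕ) :
    Integrable (gramDev X μ n N) P := by
  have := h.prob
  exact integrable_finsetSum _ fun j _ => integrable_finsetSum _ fun k _ =>
    dev_bounded_integrable h ((measurable_feat μ j).mul (measurable_feat μ k))
    (abs_feat_mul_feat_le j k) n 2

lemma Design.integrable_windowDev_sq (h : Design P X μ cf Cf) (n : ℕ) {g : ℝ → ℝ}
    (hg : Measurable g) {A : ℝ} (hA : ∀ t, |g t| ≤ A) (α : Fin d) {φ : Fin (N + 1) → ℝ → ℝ}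
    (hφ : ∀ J, Measurable (φ J)) (hφs : ∀ J t, |φ J t| = |step μ N α J t|) :
    Integrable (fun ω => windowDev X μ n g α φ ω ^ 2) P := by
  have := h.prob
  have hm : ∀ J, Measurable fun x : Fin d → ℝ => g (x 0) * φ J (x α) := fun J =>
    (hg.comp (measurable_pi_apply 0)).mul ((hφ J).comp (measurable_pi_apply α))
  have hb : ∀ J (x : Fin d → ℝ), |g (x 0) * φ J (x α)| ≤ A * √(3 * d * ((N : ℝ) + 1)) :=
    fun J x => by
      rw [abs_mul, hφs]
      exact mul_le_mul (hA _) (step_abs_le μ α J _) (abs_nonneg _) ((abs_nonneg _).trans (hA 0))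
  have hi : ∀ k J, Integrable (fun ω => dev X μ n (fun x => g (x 0) * φ J (x α)) ω ^ k) P :=
    fun k J => dev_bounded_integrable h (hm J) (hb J) n k
  refine (((integrable_finsetSum Finset.univ fun J _ => hi 4 J)).const_mul ((N : ℝ) + 1)).mono'
    ((integrable_finsetSum Finset.univ fun J _ => hi 2 J).aestronglyMeasurable.pow 2)
    (ae_of_all _ fun ω => ?_)
  rw [Real.norm_eq_abs, abs_of_nonneg (sq_nonneg _)]
  have h1 := sq_sum_le_card_mul_sum_sq (s := (Finset.univ : Finset (Fin (N + 1))))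
    (f := fun J => dev X μ n (fun x => g (x 0) * φ J (x α)) ω ^ 2)
  simp only [Finset.card_univ, Fintype.card_fin, ← pow_mul] at h1
  exact_mod_cast h1

/-- Second moment of the deviation of a window function of the first coordinate. -/
lemma Design.integral_dev_window_sq_le (hd : Design P X μ cf Cf)
    (hε : ∀ i, Measurable (ε i)) {q : ℕ}
    (hq : 1 ≤ q) {a : ℝ} (ha : 0 ≤ a) (hmix : MixBound P (fun i ω => (X i ω, ε i ω)) q a)
    {g : ℝ → ℝ} (hg : Measurable g) {A x₀ r : ℝ} (hr : 0 ≤ r) (hA : 0 ≤ A)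
    (hgA : ∀ t, |g t| ≤ A * (Icc (x₀ - r) (x₀ + r)).indicator (fun _ => 1) t)
    {n : ℕ} (hn : 1 ≤ n) :
    ∫ ω, dev X μ n (fun z => g (z 0)) ω ^ 2 ∂P
      ≤ q ^ 2 * (Cf * (A ^ 2 * (2 * r)) / n + 32 * A ^ 2 * a) := by
  have := hd.prob
  have hgb : ∀ t, |g t| ≤ A := fun t =>
    (hgA t).trans (mul_le_of_le_one_right hA (indicator_one_le _ _))
  have hgm : Measurable fun z : Fin d → ℝ => g (z 0) := hg.comp (measurable_pi_apply 0)
  refine (hd.dev_second hε hq ha hmix hgm (fun x => hgb _) hn).trans ?_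
  have h1 : ∫ x, g (x 0) ^ 2 ∂μ ≤ Cf * (A ^ 2 * (2 * r)) := by
    refine (hd.integral_le (hgm.pow_const 2) (fun _ => sq_nonneg _) ?_).trans ?_
    · exact Integrable.of_bound (hgm.pow_const 2).aestronglyMeasurable (A ^ 2)
        (ae_of_all _ fun x => by
          rw [Real.norm_eq_abs, abs_pow]; exact pow_le_pow_left₀ (abs_nonneg _) (hgb _) 2)
    · refine mul_le_mul_of_nonneg_left ?_ (zero_le_one.trans hd.one_le_Cf)
      rw [integral_eval_unif (g := fun t => g t ^ 2) (hg.pow_const 2).aestronglyMeasurable]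
      have := integral_pow_window_le (g := fun t => |g t|) hr hA (fun t => abs_nonneg _) hgA 2
        two_ne_zero
      simpa only [sq_abs] using this
  gcongr

lemma Design.integral_binPos (h : Design P X μ cf Cf) (α : Fin d) {J : ℕ} (hJ : J ≤ N) :
    0 < ∫ t, bin N J t ∂(P.map fun ω => X 0 ω α) := by
  have e : ∫ t, bin N J t ∂(P.map fun ω => X 0 ω α) = binProb μ N α J := by
    rw [integral_map (φ := fun ω => X 0 ω α)
      ((measurable_pi_apply α).comp (h.meas 0)).aemeasurable
      (measurable_bin N J).aestronglyMeasurable]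
    exact h.integral_comp (g := fun x => bin N J (x α))
      ((measurable_bin N J).comp (measurable_pi_apply α)) 0
  rw [e]
  exact lt_of_lt_of_le (by have := h.pos; positivity) (h.le_binProb α hJ)

lemma exists_grid_point {D : ℝ} (hD : 0 < D) {M : ℕ} (hM : M * D = 1) {x : ℝ}
    (hx : x ∈ Icc (0 : ℝ) 1) : ∃ k ≤ M, |x - k * D| ≤ D ∧ (k : ℝ) * D ∈ Icc (0 : ℝ) 1 := by
  have h1 : (⌊x / D⌋₊ : ℝ) * D ≤ x := by
    rw [← le_div_iff₀ hD]; exact Nat.floor_le (div_nonneg hx.1 hD.le)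
  have h2 : x < ((⌊x / D⌋₊ : ℝ) + 1) * D := by
    rw [← div_lt_iff₀ hD]; exact Nat.lt_floor_add_one _
  refine ⟨⌊x / D⌋₊, ?_, ?_, by positivity, h1.trans hx.2⟩
  · refine Nat.floor_le_of_le ?_
    rw [div_le_iff₀ hD, hM]
    exact hx.2
  · rw [abs_of_nonneg (by linarith)]
    linarith

/-- Uniform lower bound for the kernel density estimator. -/
lemma BoundedModel.le_emp_kernel (h : BoundedModel P X ε μ f s m K cf Cf S Λ B C) {b D : ℝ}
    (hb : 0 < b) (hb2 : b ≤ 1 / 2) (hD : 0 ≤ D) {x₀ x : ℝ} (hx₀ : x₀ ∈ Icc (0 : ℝ) 1)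
    (hx : |x - x₀| ≤ D) {n : ℕ} {ω : Ω} {t : ℝ} (ht : 0 ≤ t)
    (h1 : dev X μ n (fun z => scaledKernel K b (z 0 - x₀)) ω ^ 2 ≤ t ^ 2)
    (h2 : dev X μ n (fun z => envelope C b D x₀ (z 0)) ω ^ 2 ≤ t ^ 2)
    (hsmall : 2 * t + Cf * (8 * C * D / b) ≤ cf / 4) :
    cf / 4 ≤ emp X n (fun z => scaledKernel K b (z 0 - x)) ω := by
  have hd := h.design
  have := hd.prob
  have hK := h.kernel
  have hC0 : 0 ≤ C := zero_le_one.trans hK.one_le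
  have hCf := hd.one_le_Cf
  have hcf := hd.pos
  -- Between grid points the density estimator drops by at most the empirical mean of the envelope.
  have e1 : emp X n (fun z => scaledKernel K b (z 0 - x₀)) ω
      - emp X n (fun z => envelope C b D x₀ (z 0)) ω
      ≤ emp X n (fun z => scaledKernel K b (z 0 - x)) ω := by
    rw [← emp_sub]
    unfold emp
    gcongr with i
    have := (abs_le.1 (hK.abs_sub_le_envelope hb hD hx (X i ω 0))).1
    linarith
  have hkm : Measurable fun z : Fin d → ℝ => scaledKernel K b (z 0 - x₀) :=
    (hK.measurable_scaled b x₀).comp (measurable_pi_apply 0)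
  have hem : Measurable fun z : Fin d → ℝ => envelope C b D x₀ (z 0) :=
    (measurable_envelope C b D x₀).comp (measurable_pi_apply 0)
  -- The mean at the grid point is at least cf/2, also near the boundary. Two fluctuations and the
  -- mean of the envelope take away at most cf/4.
  have e2 : cf * (1 / 2) ≤ ∫ z, scaledKernel K b (z 0 - x₀) ∂μ := by
    refine le_trans ?_ (hd.le_integral hkm (fun z => hK.scaled_nonneg hb _) ?_)
    · rw [integral_eval_unif (g := fun y => scaledKernel K b (y - x₀))
        (hK.measurable_scaled b x₀).aestronglyMeasurable]
      gcongr
      exact hK.half_le_integral_scaled hb hb2 hx₀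
    · exact Integrable.of_bound hkm.aestronglyMeasurable (C / b) (ae_of_all _ fun z => by
        rw [Real.norm_eq_abs, abs_of_nonneg (hK.scaled_nonneg hb _)]
        exact div_le_div_of_nonneg_right (hK.le _) hb.le)
  have e3 : ∫ z, envelope C b D x₀ (z 0) ∂μ ≤ Cf * (8 * C * D / b) := by
    have hi : Integrable (fun z : Fin d → ℝ => envelope C b D x₀ (z 0)) (unif d) :=
      (measurePreserving_eval_unif 0).integrable_comp_of_integrable
        (integrable_envelope C b D x₀ unifOne)
    refine (hd.integral_le hem (fun z => envelope_nonneg hC0 hb hD _ _) hi).trans ?_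
    rw [integral_eval_unif (g := fun y => envelope C b D x₀ y)
        (measurable_envelope C b D x₀).aestronglyMeasurable]
    gcongr
    exact integral_envelope_le hC0 hb hD x₀
  have a1 := (abs_le.1 (abs_le_of_sq_le_sq h1 ht)).1
  have a2 := (abs_le.1 (abs_le_of_sq_le_sq h2 ht)).2
  rw [emp_eq_dev_add (μ := μ), emp_eq_dev_add (μ := μ)] at e1
  linarith

end Control

/-! ### Bounds for outer probabilities of failure. -/

section FailureProbability

variable {Ω : Type*} [MeasurableSpace Ω] {P : Measure Ω}

/-- The property `p` fails with (outer) probability at most `δ`. -/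
def FailsWithProbLE (P : Measure Ω) (δ : ℝ) (p : Ω → Prop) : Prop :=
  P {ω | ¬ p ω} ≤ ENNReal.ofReal δ

lemma FailsWithProbLE.and {δ δ' : ℝ} {p p' : Ω → Prop} (hδ : 0 ≤ δ) (hδ' : 0 ≤ δ')
    (h : FailsWithProbLE P δ p) (h' : FailsWithProbLE P δ' p') :
    FailsWithProbLE P (δ + δ') fun ω => p ω ∧ p' ω := by
  unfold FailsWithProbLE
  rw [ENNReal.ofReal_add hδ hδ']
  refine (measure_mono ?_).trans ((measure_union_le _ _).trans (add_le_add h h'))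
  intro ω hω
  simp only [Set.mem_ofPred_eq, Set.mem_union] at hω ⊢
  tauto

lemma FailsWithProbLE.mono {δ : ℝ} {p p' : Ω → Prop} (h : FailsWithProbLE P δ p)
    (hp : ∀ ω, p ω → p' ω) : FailsWithProbLE P δ p' := by
  refine (measure_mono ?_).trans h
  intro ω hω
  simp only [Set.mem_ofPred_eq] at hω ⊢
  exact fun hpω => hω (hp ω hpω)

lemma failsWithProbLE_of_ae {p : Ω → Prop} (h : ∀ᵐ ω ∂P, p ω) : FailsWithProbLE P 0 p := by
  unfold FailsWithProbLE
  rw [ae_iff.1 h]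
  exact zero_le

lemma failsWithProbLE_of_integral_le [IsProbabilityMeasure P] {R : Ω → ℝ} (hR : Integrable R P)
    (h0 : ∀ ω, 0 ≤ R ω) {τ δ : ℝ} (hτ : 0 < τ) (hle : ∫ ω, R ω ∂P ≤ δ * τ) :
    FailsWithProbLE P δ fun ω => R ω ≤ τ := by
  have h1 := mul_meas_ge_le_integral_of_nonneg (ae_of_all _ h0) hR τ
  have h2 : P.real {ω | τ ≤ R ω} ≤ δ := by
    have h3 : τ * P.real {ω | τ ≤ R ω} ≤ τ * δ := by linarith [mul_comm δ τ]
    exact le_of_mul_le_mul_left h3 hτ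
  unfold FailsWithProbLE
  refine (measure_mono (t := {ω | τ ≤ R ω}) fun ω hω => (not_le.1 hω).le).trans ?_
  rw [← ofReal_measureReal]
  exact ENNReal.ofReal_le_ofReal h2

lemma failsWithProbLE_forall {ι : Type*} (t : Finset ι) {p : ι → Ω → Prop} {δ : ℝ}
    (h : ∀ i ∈ t, FailsWithProbLE P δ (p i)) :
    FailsWithProbLE P (t.card * δ) fun ω => ∀ i ∈ t, p i ω := by
  unfold FailsWithProbLE
  rw [ENNReal.ofReal_mul (Nat.cast_nonneg _), ENNReal.ofReal_natCast, ← nsmul_eq_mul,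
    ← Finset.sum_const]
  refine (measure_mono (t := ⋃ i ∈ t, {ω | ¬ p i ω}) fun ω hω => ?_).trans
    ((measure_biUnion_finset_le _ _).trans (Finset.sum_le_sum h))
  simp only [Set.mem_ofPred_eq, not_forall] at hω
  obtain ⟨i, hi, hp⟩ := hω
  exact Set.mem_biUnion hi hp

/-- Union bound for finitely many nonnegative variables. -/
lemma failsWithProbLE_finset [IsProbabilityMeasure P] {ι : Type*} (t : Finset ι) {R : ι → Ω → ℝ}
    (hR : ∀ i ∈ t, Integrable (R i) P) (h0 : ∀ i ∈ t, ∀ ω, 0 ≤ R i ω) {τ δ r n : ℝ} (hτ : 0 < τ)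
    (hr : ∀ i ∈ t, ∫ ω, R i ω ∂P ≤ r) (hr0 : 0 ≤ r) (hn : (t.card : ℝ) ≤ n) (hle : n * r ≤ δ * τ) :
    FailsWithProbLE P δ fun ω => ∀ i ∈ t, R i ω ≤ τ := by
  have h1 := failsWithProbLE_of_integral_le (R := fun ω => ∑ i ∈ t, R i ω) (P := P)
    (integrable_finsetSum _ hR) (fun ω => Finset.sum_nonneg fun i hi => h0 i hi ω) hτ
    (δ := δ) (by
      rw [integral_finsetSum _ hR]
      refine (Finset.sum_le_sum hr).trans (le_trans ?_ hle)
      rw [Finset.sum_const, nsmul_eq_mul]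
      gcongr)
  exact h1.mono fun ω hω i hi =>
    (Finset.single_le_sum (f := fun i => R i ω) (fun i hi => h0 i hi ω) hi).trans hω

end FailureProbability

/-! ### The stochastic terms attached to one coordinate, over the whole grid. -/

section Control

variable {Ω : Type*} [MeasurableSpace Ω]
variable {P : Measure Ω} [IsProbabilityMeasure P] {d : ℕ} [NeZero d] {X : ℕ → Ω → Fin d → ℝ}
  {ε : ℕ → Ω → ℝ} {μ : Measure (Fin d → ℝ)} {f s : (Fin d → ℝ) → ℝ} {m : Fin d → ℝ → ℝ}
  {K : ℝ → ℝ} {cf Cf S Λ B C : ℝ} {N : ℕ}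

/-- The stochastic terms in direction of the coordinate `α`. -/
lemma BoundedModel.fails_direction (h : BoundedModel P X ε μ f s m K cf Cf S Λ B C) {b D : ℝ}
    (hb : 0 < b) (hD : 0 < D) (hDb : D ≤ b) {M : ℕ} (hM : M * D = 1)
    {η : ℝ} (hη0 : 0 ≤ η)
    (hη : ∀ x ∈ Icc (0 : Fin d → ℝ) 1, ∀ t ∈ Icc (0 : ℝ) 1, |x 0 - t| ≤ 2 * b →
      |f x - f (Function.update x 0 t)| ≤ η)
    {q : ℕ} (hq : 1 ≤ q) {a : ℝ} (ha : 0 ≤ a)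
    (hmix : MixBound P (fun i ω => (X i ω, ε i ω)) q a) {n : ℕ} (hn : 1 ≤ n) (N : ℕ)
    {t₃ t₄ t₅ δ : ℝ} (ht₃ : 0 < t₃) (ht₄ : 0 < t₄) (ht₅ : 0 < t₅) (hδ : 0 ≤ δ)
    (h3 : S ^ 2 * (d + 1) * Cf / n * (rieszBound cf Cf ^ 2 + (1 + rieszBound cf Cf ^ 2)
      * (1 + √(Cf / cf) / cf * (8 * C * η / b + 2 * Cf))) ≤ δ * t₃ ^ 2)
    (h4 : (M + 1) * (q ^ 2 * rieszBound cf Cf ^ 2 * ((d + 1) * Cf * featBound d N / n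
      + 32 * featBound d N ^ 3 * a)) ≤ δ * t₄ ^ 2)
    (h5 : (M + 1) * (q ^ 4 * featBound d N ^ 2 *
      (48 * Cf ^ 4 * (3 * C / b) ^ 4 * (2 * b) ^ 2 / n ^ 2
        + 64 * Cf ^ 2 * (3 * C / b) ^ 4 * (2 * b) * featBound d N / n ^ 3
        + 1664 * (3 * C / b) ^ 4 * featBound d N ^ 2 * a)) ≤ δ * t₅ ^ 4)
    {α : Fin d} (hα : α ≠ 0) :
    ∃ u : ℕ → Coef d N,
      (∀ k v, gramForm μ (u k) v = windowFun μ (fun y => scaledKernel K b (y - k * D)) α v) ∧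
      (∀ k, ‖u k‖ ≤ rieszBound cf Cf) ∧
      FailsWithProbLE P (4 * δ) fun ω => ∀ k ≤ M,
        noiseFun X ε s μ n (u k) ω ^ 2 ≤ t₃ ^ 2 ∧ gramDevAt X μ n (u k) ω ≤ t₄ ^ 2 ∧
        windowDev X μ n (fun y => scaledKernel K b (y - k * D)) α
          (fun J : Fin (N + 1) => step μ N α J) ω ^ 2 ≤ t₅ ^ 4 ∧
        windowDev X μ n (envelope C b D (k * D)) α
          (fun J : Fin (N + 1) => fun t => |step μ N α J t|) ω ^ 2 ≤ t₅ ^ 4 := by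
  have hd := h.design
  have := hd.prob
  have hK := h.kernel
  have hC0 : 0 ≤ C := zero_le_one.trans hK.one_le
  have hCf := hd.one_le_Cf
  have hcf := hd.pos
  have hF : 0 ≤ featBound d N := zero_le_one.trans one_le_featBound
  obtain ⟨u, hu, hun, ρ, hρ0, hρ, hρs⟩ := hd.exists_riesz_grid h.density_meas h.law_eq
    h.density_nonneg h.density_le hK hb hD hDb hM hη0 hη hα N
  refine ⟨u, hu, hun, ?_⟩
  -- A single Markov bound for the majorant G of the squared noise along the path replaces a union
  -- bound over the grid, which second moments could not afford.
  obtain ⟨G, hGi, hG, hGle⟩ := exists_sq_bound_of_path (P := P)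
    (F := fun k => noiseFun X ε s μ n (u k)) (M := M)
    (fun k => memLp_noiseFun hd h.noise h.scale_meas h.scale_le n (u k))
    (V := S ^ 2 * (d + 1) * Cf / n) (C := rieszBound cf Cf)
    (fun k _ => (integral_noiseFun_sq_le hd h.noise h.scale_meas h.scale_le hn (u k)).trans (by
      gcongr; exact hun k)) hρ0
    (fun k hk => by
      simp only [← noiseFun_sub]
      refine (integral_noiseFun_sq_le hd h.noise h.scale_meas h.scale_le hn _).trans ?_
      gcongr
      exact hρ k hk)
  have c3 : FailsWithProbLE P δ fun ω => G ω ≤ t₃ ^ 2 := by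
    refine failsWithProbLE_of_integral_le hGi (fun ω => (sq_nonneg _).trans (hG 0 (Nat.zero_le _) ω))
      (by positivity) (hGle.trans (le_trans ?_ h3))
    gcongr
  have hcard : ((Finset.range (M + 1)).card : ℝ) ≤ M + 1 := by simp
  -- For fluctuations of the design the union bound is affordable; it accounts for the factor M + 1
  -- in the hypotheses.
  have c4 : FailsWithProbLE P δ fun ω => ∀ k ∈ Finset.range (M + 1),
      gramDevAt X μ n (u k) ω ≤ t₄ ^ 2 := by
    refine failsWithProbLE_finset _ (fun k _ => hd.integrable_gramDevAt n (u k))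
      (fun k _ ω => Finset.sum_nonneg fun _ _ => sq_nonneg _) (by positivity) (fun k _ =>
        (hd.integral_gramDevAt_le h.noise_meas hq ha hmix (u k) hn).trans ?_)
        (by positivity) hcard h4
    gcongr
    exact hun k
  have hA0 : 0 ≤ 3 * C / b := by positivity
  have hk0 : ∀ k : ℕ, ∀ y, scaledKernel K b (y - k * D) ≤ 3 * C / b *
      (Icc (k * D - 2 * b) (k * D + 2 * b)).indicator (fun _ => 1) y := fun k y => by
    refine (hK.scaled_le hb _ y).trans ?_
    have := indicator_one_nonneg (Icc (k * D - 2 * b) (k * D + 2 * b)) y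
    gcongr
    linarith
  have he0 : ∀ k : ℕ, ∀ y, envelope C b D (k * D) y ≤ 3 * C / b *
      (Icc (k * D - 2 * b) (k * D + 2 * b)).indicator (fun _ => 1) y := fun k y =>
    envelope_le hC0 hb hDb _ y
  have hab : ∀ {g : ℝ → ℝ} {x₀ : ℝ}, (∀ y, 0 ≤ g y) → (∀ y, g y ≤ 3 * C / b *
      (Icc (x₀ - 2 * b) (x₀ + 2 * b)).indicator (fun _ => 1) y) → ∀ y, |g y| ≤ 3 * C / b :=
    fun h0 h1 y => by
      rw [abs_of_nonneg (h0 y)]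
      exact (h1 y).trans (mul_le_of_le_one_right hA0 (indicator_one_le _ _))
  have c5 : FailsWithProbLE P δ fun ω => ∀ k ∈ Finset.range (M + 1),
      windowDev X μ n (fun y => scaledKernel K b (y - k * D)) α
          (fun J : Fin (N + 1) => step μ N α J) ω ^ 2 ≤ t₅ ^ 4 :=
    failsWithProbLE_finset _ (fun k _ => hd.integrable_windowDev_sq n (hK.measurable_scaled b _)
        (hab (fun y => hK.scaled_nonneg hb _) (hk0 k)) α (fun J => measurable_step μ α J)
        fun J t => rfl)
      (fun k _ ω => sq_nonneg _) (by positivity) (fun k _ =>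
        (hd.integral_windowDev_sq_le h.noise_meas hq ha hmix (hK.measurable_scaled b _)
          (by positivity) hA0 (fun y => hK.scaled_nonneg hb _) (hk0 k) hα
          (fun J => measurable_step μ α J) (fun J t => rfl) hn))
      (by positivity) hcard h5
  have c6 : FailsWithProbLE P δ fun ω => ∀ k ∈ Finset.range (M + 1),
      windowDev X μ n (envelope C b D (k * D)) α
          (fun J : Fin (N + 1) => fun t => |step μ N α J t|) ω ^ 2 ≤ t₅ ^ 4 :=
    failsWithProbLE_finset _ (fun k _ => hd.integrable_windowDev_sq n (measurable_envelope _ _ _ _)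
        (hab (fun y => envelope_nonneg hC0 hb hD.le _ _) (he0 k)) α
        (fun J => (measurable_step μ α J).abs) fun J t => abs_abs _)
      (fun k _ ω => sq_nonneg _) (by positivity) (fun k _ =>
        (hd.integral_windowDev_sq_le h.noise_meas hq ha hmix (measurable_envelope _ _ _ _)
          (by positivity) hA0 (fun y => envelope_nonneg hC0 hb hD.le _ _) (he0 k) hα
          (fun J => (measurable_step μ α J).abs) (fun J t => abs_abs _) hn))
      (by positivity) hcard h5
  have call := ((c3.and hδ hδ c4).and (by positivity) hδ c5).and (by positivity) hδ c6
  rw [show δ + δ + δ + δ = 4 * δ by ring] at call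
  refine call.mono fun ω hω k hk => ?_
  have hk' : k ∈ Finset.range (M + 1) := Finset.mem_range.2 (Nat.lt_succ_of_le hk)
  exact ⟨(hG k hk ω).trans hω.1.1.1, hω.1.1.2 k hk', hω.1.2 k hk', hω.2 k hk'⟩

end Control

/-! ### Nonasymptotic uniform comparison with the oracle. -/

section UniformComparison

variable {Ω : Type*} [MeasurableSpace Ω]
variable {P : Measure Ω} [IsProbabilityMeasure P] {d : ℕ} [NeZero d] {X : ℕ → Ω → Fin d → ℝ}
  {ε : ℕ → Ω → ℝ} {μ : Measure (Fin d → ℝ)} {f s : (Fin d → ℝ) → ℝ} {m : Fin d → ℝ → ℝ}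
  {K : ℝ → ℝ} {cf Cf S Λ B C : ℝ} {N : ℕ}

/-- Bound for the coefficient error. -/
def coefBound (d : ℕ) (cf Cf Λ : ℝ) (N : ℕ) (t₂ : ℝ) : ℝ :=
  2 / cf * (t₂ + d * Λ * √((d + 2) * Cf) / ((N : ℝ) + 1))

/-- Bound for the smoothed component error. -/
def windowBound (d : ℕ) (cf Cf Λ C b D : ℝ) (N : ℕ) (t₂ t₃ t₄ t₅ : ℝ) : ℝ :=
  t₃ + d * Λ * √((d + 2) * Cf) / ((N : ℝ) + 1) * rieszBound cf Cf
    + (t₄ + (2 * t₅ + 16 * Cf ^ 2 * C * D / b)) * coefBound d cf Cf Λ N t₂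

/-- Nonasymptotic uniform comparison of the backfitted estimator with the oracle smoother. -/
lemma BoundedModel.fails_uniform (h : BoundedModel P X ε μ f s m K cf Cf S Λ B C) {b D : ℝ}
    (hb : 0 < b) (hb2 : b ≤ 1 / 2) (hD : 0 < D) (hDb : D ≤ b) {M : ℕ} (hM : M * D = 1)
    {η : ℝ} (hη0 : 0 ≤ η)
    (hη : ∀ x ∈ Icc (0 : Fin d → ℝ) 1, ∀ t ∈ Icc (0 : ℝ) 1, |x 0 - t| ≤ 2 * b →
      |f x - f (Function.update x 0 t)| ≤ η)
    {q : ℕ} (hq : 1 ≤ q) {a : ℝ} (ha : 0 ≤ a)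
    (hmix : MixBound P (fun i ω => (X i ω, ε i ω)) q a) {n : ℕ} (hn : 1 ≤ n) (N : ℕ)
    {t₂ t₃ t₄ t₅ t₆ t₇ t₈ δ : ℝ} (ht₂ : 0 < t₂) (ht₃ : 0 < t₃) (ht₄ : 0 < t₄) (ht₅ : 0 < t₅)
    (ht₆ : 0 < t₆) (ht₇ : 0 < t₇) (ht₈ : 0 < t₈) (hδ : 0 ≤ δ)
    (h1 : q ^ 2 * (featBound d N ^ 2 / n + 32 * featBound d N ^ 4 * a) ≤ δ * (cf / 2) ^ 2)
    (h2 : S ^ 2 * featBound d N / n ≤ δ * t₂ ^ 2)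
    (h3 : S ^ 2 * (d + 1) * Cf / n * (rieszBound cf Cf ^ 2 + (1 + rieszBound cf Cf ^ 2)
      * (1 + √(Cf / cf) / cf * (8 * C * η / b + 2 * Cf))) ≤ δ * t₃ ^ 2)
    (h4 : (M + 1) * (q ^ 2 * rieszBound cf Cf ^ 2 * ((d + 1) * Cf * featBound d N / n
      + 32 * featBound d N ^ 3 * a)) ≤ δ * t₄ ^ 2)
    (h5 : (M + 1) * (q ^ 4 * featBound d N ^ 2 *
      (48 * Cf ^ 4 * (3 * C / b) ^ 4 * (2 * b) ^ 2 / n ^ 2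
        + 64 * Cf ^ 2 * (3 * C / b) ^ 4 * (2 * b) * featBound d N / n ^ 3
        + 1664 * (3 * C / b) ^ 4 * featBound d N ^ 2 * a)) ≤ δ * t₅ ^ 4)
    (h6 : d * (q ^ 2 * (B ^ 2 / n + 32 * B ^ 2 * a)) ≤ δ * t₆ ^ 2)
    (h6' : S ^ 2 / n ≤ δ * t₆ ^ 2)
    (h7 : q ^ 2 * ((d + 1) * Cf * featBound d N / n + 32 * featBound d N ^ 3 * a) ≤ δ * t₇ ^ 2)
    (h8 : (M + 1) * (q ^ 2 * (Cf * ((3 * C / b) ^ 2 * (2 * (2 * b))) / n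
      + 32 * (3 * C / b) ^ 2 * a)) ≤ δ * t₈ ^ 2)
    (hsmall : 2 * t₈ + Cf * (8 * C * D / b) ≤ cf / 4) :
    FailsWithProbLE P ((4 * d + 7) * δ) fun ω => ∀ (c : ℝ) (y : ℕ → ℝ)
      (lam : ℝ × (Fin d → Fin N → ℝ)),
      IsLeastSquares (fun α => splineBasis (P.map fun ω => X 0 ω α) N) n (fun i => X i ω) y lam →
      (∀ i < n, ∀ α, X i ω α ∈ Ico (0 : ℝ) 1) →
      (∀ i < n, y i = c + ∑ α, m α (X i ω α) + s (X i ω) * ε i ω) →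
      ∀ x ∈ Icc (0 : ℝ) 1,
        |spbk K b (fun α => splineBasis (P.map fun ω => X 0 ω α) N) n (fun i => X i ω) y lam x
          - oracleSmoother K b c m n (fun i => X i ω) y x|
        ≤ (2 * d + 1) * t₆ + 2 * d * Λ / ((N : ℝ) + 1) + d * (t₇ * coefBound d cf Cf Λ N t₂)
          + d * windowBound d cf Cf Λ C b D N t₂ t₃ t₄ t₅ / (cf / 4) := by
  have hd := h.design
  have := hd.prob
  have hK := h.kernel
  have hC0 : 0 ≤ C := zero_le_one.trans hK.one_le
  have hCf := hd.one_le_Cf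
  have hcf := hd.pos
  have hF : 0 ≤ featBound d N := zero_le_one.trans one_le_featBound
  have hS0 : 0 ≤ S := (abs_nonneg _).trans (h.scale_le 0)
  have hB0 : 0 ≤ B := (abs_nonneg _).trans (h.comp_le 0 0)
  have hN : (0 : ℝ) < (N : ℝ) + 1 := by positivity
  have hΛ0 : 0 ≤ Λ := by
    have := h.lipschitz 0 0 (by norm_num) 1 (by norm_num)
    norm_num at this
    exact (abs_nonneg _).trans this
  have hcardd : ((Finset.univ : Finset (Fin d)).card : ℝ) = d := by simp
  have hcard : ((Finset.range (M + 1)).card : ℝ) ≤ M + 1 := by simp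
  -- Representers exist only for α ≠ 0; for the first coordinate u is the arbitrary value 0 and
  -- nothing is claimed.
  have : ∀ α : Fin d, ∃ u : ℕ → Coef d N, α ≠ 0 →
      (∀ k v, gramForm μ (u k) v = windowFun μ (fun y => scaledKernel K b (y - k * D)) α v) ∧
      (∀ k, ‖u k‖ ≤ rieszBound cf Cf) ∧
      FailsWithProbLE P (4 * δ) fun ω => ∀ k ≤ M,
        noiseFun X ε s μ n (u k) ω ^ 2 ≤ t₃ ^ 2 ∧ gramDevAt X μ n (u k) ω ≤ t₄ ^ 2 ∧
        windowDev X μ n (fun y => scaledKernel K b (y - k * D)) α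
          (fun J : Fin (N + 1) => step μ N α J) ω ^ 2 ≤ t₅ ^ 4 ∧
        windowDev X μ n (envelope C b D (k * D)) α
          (fun J : Fin (N + 1) => fun t => |step μ N α J t|) ω ^ 2 ≤ t₅ ^ 4 := by
    intro α
    by_cases hα : α = 0
    · exact ⟨0, fun h => absurd hα h⟩
    · obtain ⟨u, hu⟩ := h.fails_direction hb hD hDb hM hη0 hη hq ha hmix hn N ht₃ ht₄ ht₅ hδ h3 h4
        h5 hα
      exact ⟨u, fun _ => hu⟩
  choose u hu using this
  have cdir : FailsWithProbLE P ((Finset.univ : Finset (Fin d)).card * (4 * δ)) fun ω =>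
      ∀ α ∈ Finset.univ, α ≠ 0 → ∀ k ≤ M,
        noiseFun X ε s μ n (u α k) ω ^ 2 ≤ t₃ ^ 2 ∧ gramDevAt X μ n (u α k) ω ≤ t₄ ^ 2 ∧
        windowDev X μ n (fun y => scaledKernel K b (y - k * D)) α
          (fun J : Fin (N + 1) => step μ N α J) ω ^ 2 ≤ t₅ ^ 4 ∧
        windowDev X μ n (envelope C b D (k * D)) α
          (fun J : Fin (N + 1) => fun t => |step μ N α J t|) ω ^ 2 ≤ t₅ ^ 4 := by
    refine failsWithProbLE_forall _ fun α _ => ?_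
    by_cases hα : α = 0
    · exact (failsWithProbLE_of_ae (ae_of_all _ fun ω hα' => absurd hα hα')).trans
        (ENNReal.ofReal_le_ofReal (by positivity))
    · exact (hu α hα).2.2.mono fun ω hω _ => hω
  have c1 : FailsWithProbLE P δ fun ω => gramDev X μ n N ω ≤ (cf / 2) ^ 2 :=
    failsWithProbLE_of_integral_le (hd.integrable_gramDev n N)
      (fun ω => Finset.sum_nonneg fun _ _ => Finset.sum_nonneg fun _ _ => sq_nonneg _)
      (by positivity) ((hd.integral_gramDev_le h.noise_meas hq ha hmix hn).trans h1)
  have c2 : FailsWithProbLE P δ fun ω => noiseNormSq X ε s μ n N ω ≤ t₂ ^ 2 :=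
    failsWithProbLE_of_integral_le (integrable_noiseNormSq hd h.noise h.scale_meas h.scale_le n)
      (fun ω => Finset.sum_nonneg fun _ _ => sq_nonneg _)
      (by positivity) ((integral_noiseNormSq_le hd h.noise h.scale_meas h.scale_le hn).trans h2)
  have hmm : ∀ α, Measurable fun x : Fin d → ℝ => m α (x α) := fun α =>
    (h.comp_meas α).comp (measurable_pi_apply α)
  have c6 : FailsWithProbLE P δ fun ω => ∀ α ∈ Finset.univ,
      dev X μ n (fun z => m α (z α)) ω ^ 2 ≤ t₆ ^ 2 := by
    refine failsWithProbLE_finset _ (fun α _ => dev_bounded_integrable hd (hmm α)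
      (fun x => h.comp_le α _) n 2) (fun _ _ _ => sq_nonneg _) (by positivity)
      (fun α _ => (hd.dev_second h.noise_meas hq ha hmix (hmm α) (fun x => h.comp_le α _) hn).trans
        ?_) (by positivity) hcardd.le h6
    gcongr
    calc ∫ x, m α (x α) ^ 2 ∂μ ≤ ∫ x : Fin d → ℝ, B ^ 2 ∂μ := by
          refine integral_mono_of_nonneg (ae_of_all _ fun _ => sq_nonneg _) (integrable_const _)
            (ae_of_all _ fun x => ?_)
          exact sq_le_sq.2 ((h.comp_le _ _).trans (le_abs_self _))
      _ = _ := by simp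
  have c6' : FailsWithProbLE P δ fun ω => noiseAvg X ε n s ω ^ 2 ≤ t₆ ^ 2 := by
    refine failsWithProbLE_of_integral_le
      (h.noise.memLp_noiseAvg hd.meas h.scale_meas h.scale_le n).integrable_sq
      (fun ω => sq_nonneg _) (by positivity) ?_
    rw [h.noise.integral_noiseAvg_sq hd.meas h.scale_meas h.scale_le hn]
    refine le_trans ?_ h6'
    gcongr
    calc ∫ x, s x ^ 2 ∂μ ≤ ∫ x : Fin d → ℝ, S ^ 2 ∂μ := by
          refine integral_mono_of_nonneg (ae_of_all _ fun _ => sq_nonneg _) (integrable_const _)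
            (ae_of_all _ fun x => ?_)
          exact sq_le_sq.2 ((h.scale_le _).trans (le_abs_self _))
      _ = _ := by simp
  have c7 : FailsWithProbLE P δ fun ω => gramDevAt X μ n (constCoef d N) ω ≤ t₇ ^ 2 := by
    refine failsWithProbLE_of_integral_le (hd.integrable_gramDevAt n _)
      (fun ω => Finset.sum_nonneg fun _ _ => sq_nonneg _) (by positivity)
      ((hd.integral_gramDevAt_le h.noise_meas hq ha hmix _ hn).trans ?_)
    rw [norm_constCoef, one_pow, mul_one]
    exact h7
  have hA0 : 0 ≤ 3 * C / b := by positivity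
  have hk0 : ∀ k : ℕ, ∀ y, scaledKernel K b (y - k * D) ≤ 3 * C / b *
      (Icc (k * D - 2 * b) (k * D + 2 * b)).indicator (fun _ => 1) y := fun k y => by
    refine (hK.scaled_le hb _ y).trans ?_
    have := indicator_one_nonneg (Icc (k * D - 2 * b) (k * D + 2 * b)) y
    gcongr
    linarith
  have he0 : ∀ k : ℕ, ∀ y, envelope C b D (k * D) y ≤ 3 * C / b *
      (Icc (k * D - 2 * b) (k * D + 2 * b)).indicator (fun _ => 1) y := fun k y =>
    envelope_le hC0 hb hDb _ y
  have cwin : ∀ g : ℕ → ℝ → ℝ, (∀ k, Measurable (g k)) → (∀ k y, 0 ≤ g k y) →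
      (∀ (k : ℕ) y, g k y ≤ 3 * C / b *
        (Icc (k * D - 2 * b) (k * D + 2 * b)).indicator (fun _ => 1) y) →
      FailsWithProbLE P δ fun ω => ∀ k ∈ Finset.range (M + 1),
        dev X μ n (fun z => g k (z 0)) ω ^ 2 ≤ t₈ ^ 2 := fun g hgm hg0 hg =>
    failsWithProbLE_finset _ (fun k _ => dev_bounded_integrable hd
        (g := fun z : Fin d → ℝ => g k (z 0)) ((hgm k).comp (measurable_pi_apply 0))
        (M := 3 * C / b) (fun z => by
          rw [abs_of_nonneg (hg0 k _)]
          exact (hg k _).trans (mul_le_of_le_one_right hA0 (indicator_one_le _ _))) n 2)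
      (fun _ _ _ => sq_nonneg _) (by positivity)
      (fun k _ => hd.integral_dev_window_sq_le h.noise_meas hq ha hmix (hgm k)
        (by positivity) hA0 (fun t => (abs_of_nonneg (hg0 k t)).trans_le (hg k t)) hn) (by positivity) hcard h8
  have c8 := cwin (fun k y => scaledKernel K b (y - k * D)) (fun k => hK.measurable_scaled b _)
    (fun k y => hK.scaled_nonneg hb _) hk0
  have c9 := cwin (fun k y => envelope C b D (k * D) y) (fun k => measurable_envelope _ _ _ _)
    (fun k y => envelope_nonneg hC0 hb hD.le _ _) he0
  have call := (((((((cdir.and (by positivity) hδ c1).and (by positivity) hδ c2).and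
    (by positivity) hδ c6).and (by positivity) hδ c6').and (by positivity) hδ c7).and
    (by positivity) hδ c8).and (by positivity) hδ c9)
  -- Four events for each of the d coordinates and seven further ones, each failing with probability
  -- at most δ.
  rw [hcardd, show (d : ℝ) * (4 * δ) + δ + δ + δ + δ + δ + δ + δ = (4 * d + 7) * δ by ring] at call
  refine call.mono ?_
  rintro ω ⟨⟨⟨⟨⟨⟨⟨gdir, g1⟩, g2⟩, g6⟩, g6'⟩, g7⟩, g8⟩, g9⟩ c y lam hls hx hy x hx01
  obtain ⟨k, hkM, hkx, hk01⟩ := exists_grid_point hD hM hx01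
  have hkr : k ∈ Finset.range (M + 1) := Finset.mem_range.2 (Nat.lt_succ_of_le hkM)
  have hprob : ∀ α : Fin d, IsProbabilityMeasure (P.map fun ω => X 0 ω α) := fun α =>
    Measure.isProbabilityMeasure_map ((measurable_pi_apply α).comp (hd.meas 0)).aemeasurable
  obtain ⟨θ, κ, hθ0, hrep, hθn, hθu⟩ := hd.exists_fit_error (ν := fun α => P.map fun ω => X 0 ω α)
    (fun α J hJ => hd.integral_binPos α hJ) hls hx h.lipschitz hy g1
  have hθb : ‖θ‖ ≤ coefBound d cf Cf Λ N t₂ := by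
    refine hθn.trans ?_
    unfold coefBound
    gcongr
    exact Real.sqrt_le_iff.2 ⟨ht₂.le, g2⟩
  have hΘ0 : 0 ≤ coefBound d cf Cf Λ N t₂ := (norm_nonneg _).trans hθb
  have hcx := h.le_emp_kernel hb hb2 hD.le hk01 hkx ht₈.le (g8 k hkr) (g9 k hkr) hsmall
  have hT : ∀ α, α ≠ 0 → |emp X n (fun z => scaledKernel K b (z 0 - x) * comp μ α θ (z α)) ω|
      ≤ windowBound d cf Cf Λ C b D N t₂ t₃ t₄ t₅ := by
    intro α hα
    obtain ⟨hu1, hu2, -⟩ := hu α hα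
    obtain ⟨w1, w2, w3, w4⟩ := gdir α (Finset.mem_univ α) hα k hkM
    -- `windowDev` is already a squared norm, so the fourth moment method bounds its square by t₅⁴
    -- and its root by t₅.
    have hsq : ∀ {w : ℝ}, w ^ 2 ≤ t₅ ^ 4 → √w ≤ t₅ := fun {w} hw => by
      refine Real.sqrt_le_iff.2 ⟨ht₅.le, ?_⟩
      refine le_of_abs_le (abs_le_of_sq_le_sq (hw.trans_eq ?_) (by positivity))
      ring
    refine (hd.abs_emp_window_le hK hb hD.le hkx hα hθ0 (hu1 k) n ω).trans ?_
    have b1 := hθu (u α k)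
    have b2 : |noiseFun X ε s μ n (u α k) ω| ≤ t₃ := abs_le_of_sq_le_sq w1 ht₃.le
    have b3 : √(gramDevAt X μ n (u α k) ω) ≤ t₄ := Real.sqrt_le_iff.2 ⟨ht₄.le, w2⟩
    have b4 := hsq w3
    have b5 := hsq w4
    have hr0 : 0 ≤ d * Λ * √((d + 2) * Cf) / ((N : ℝ) + 1) := by positivity
    unfold windowBound
    calc _ ≤ (t₃ + d * Λ * √((d + 2) * Cf) / ((N : ℝ) + 1) * rieszBound cf Cf
          + t₄ * coefBound d cf Cf Λ N t₂)
          + (t₅ + t₅ + 16 * Cf ^ 2 * C * D / b) * coefBound d cf Cf Λ N t₂ := by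
          refine add_le_add (b1.trans ?_) ?_
          · gcongr
            exact hu2 k
          · gcongr
      _ = _ := by ring
  have hR0 : 0 ≤ rieszBound cf Cf := by unfold rieszBound; positivity
  have hW0 : 0 ≤ windowBound d cf Cf Λ C b D N t₂ t₃ t₄ t₅ := by
    unfold windowBound
    positivity
  refine (abs_spbk_sub_oracleSmoother_le (ν := fun α => P.map fun ω => X 0 ω α) hx h.lipschitz hy
    hrep hK.nonneg hb (by positivity) hcx hW0 hT).trans ?_
  have b6 : ∑ α, |emp X n (fun z => m α (z α)) ω| ≤ d * t₆ := by
    refine (Finset.sum_le_sum (g := fun _ => t₆) fun α _ => ?_).trans_eq (by simp)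
    rw [emp_eq_dev_add (μ := μ), h.centered α, add_zero]
    exact abs_le_of_sq_le_sq (g6 α (Finset.mem_univ α)) ht₆.le
  have b7 : |noiseAvg X ε n s ω| ≤ t₆ := abs_le_of_sq_le_sq g6' ht₆.le
  have b8 : √(gramDevAt X μ n (constCoef d N) ω) ≤ t₇ := Real.sqrt_le_iff.2 ⟨ht₇.le, g7⟩
  gcongr
  linarith

end UniformComparison

/-! ### Rates -/

section Rates

/-- The unit `n^{1/500}` in which rates are measured. -/
def rate (n : ℕ) : ℝ := (n : ℝ) ^ (1 / 500 : ℝ)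

lemma rate_nonneg (n : ℕ) : 0 ≤ rate n := Real.rpow_nonneg (Nat.cast_nonneg n) _

lemma one_le_rate {n : ℕ} (hn : 1 ≤ n) : 1 ≤ rate n :=
  Real.one_le_rpow (by exact_mod_cast hn) (by norm_num)

/-- In the unit n^{1/500} every power of n that occurs has an integer exponent, so comparing rates
becomes comparing integers; logarithms and constants are absorbed by a spare unit. -/
lemma rate_pow (n k : ℕ) : rate n ^ k = (n : ℝ) ^ ((k : ℝ) / 500) := by
  rw [rate, ← Real.rpow_natCast, ← Real.rpow_mul (Nat.cast_nonneg n)]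
  congr 1
  ring

lemma rate_inv_pow (n k : ℕ) : (rate n)⁻¹ ^ k = (n : ℝ) ^ (-((k : ℝ) / 500)) := by
  rw [inv_pow, rate_pow, Real.rpow_neg (Nat.cast_nonneg n)]

lemma tendsto_rate : Tendsto rate atTop atTop :=
  (tendsto_rpow_atTop (by norm_num)).comp tendsto_natCast_atTop_atTop

lemma tendsto_rate_inv : Tendsto (fun n => (rate n)⁻¹) atTop (𝓝 0) :=
  tendsto_inv_atTop_zero.comp tendsto_rate

lemma eventually_mul_rate_inv_le (A : ℝ) {r : ℝ} (hr : 0 < r) :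
    ∀ᶠ n in atTop, (rate n)⁻¹ * A ≤ r := by
  have h := tendsto_rate_inv.mul_const A
  rw [zero_mul] at h
  exact (h.eventually (gt_mem_nhds hr)).mono fun n hn => hn.le

lemma eventually_mul_log_add_le_rate (A A' : ℝ) :
    ∀ᶠ n : ℕ in atTop, A * Real.log n + A' ≤ rate n := by
  have h : (fun x : ℝ => A * Real.log x + A') =o[atTop] fun x : ℝ => x ^ (1 / 500 : ℝ) := by
    refine ((isLittleO_log_rpow_atTop (by norm_num)).const_mul_left A).add ?_
    rw [Asymptotics.isLittleO_const_left]
    right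
    exact tendsto_norm_atTop_atTop.comp (tendsto_rpow_atTop (by norm_num))
  have h2 := (h.comp_tendsto tendsto_natCast_atTop_atTop).bound (c := 1) one_pos
  filter_upwards [h2] with n hn
  have : A * Real.log n + A' ≤ 1 * ‖rate n‖ := (le_abs_self _).trans hn
  rwa [one_mul, Real.norm_of_nonneg (rate_nonneg n)] at this

/-- Of the 201 units, 200 stand for n^{2/5} and the last one absorbs the logarithm and all
constants. -/
lemma KnotOrder.eventually_le {N : ℕ → ℕ} (h : KnotOrder N) (d : ℕ) :
    ∀ᶠ n in atTop, featBound d (N n) ≤ rate n ^ 201 := by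
  obtain ⟨cN, -, CN, hN⟩ := h
  filter_upwards [hN, eventually_mul_log_add_le_rate (3 * d * CN) (3 * d), eventually_ge_atTop 1]
    with n hn hlog hn1
  have h1 := one_le_rate hn1
  have h2 : (n : ℝ) ^ (2 / 5 : ℝ) = rate n ^ 200 := by rw [rate_pow]; norm_num
  have h3 : 1 ≤ rate n ^ 200 := one_le_pow₀ h1
  rw [h2] at hn
  unfold featBound
  calc (3 : ℝ) * d * ((N n : ℝ) + 1) ≤ 3 * d * (CN * (rate n ^ 200 * Real.log n) + rate n ^ 200) := by
        gcongr
        exact hn.2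
    _ = rate n ^ 200 * (3 * d * CN * Real.log n + 3 * d) := by ring
    _ ≤ rate n ^ 200 * rate n := by gcongr
    _ = _ := by ring

/-- The logarithm in the number of knots makes the constant r arbitrarily small: this undersmoothing
turns the spline bias from O(n^{-2/5}) into o(n^{-2/5}). -/
lemma KnotOrder.eventually_inv_le {N : ℕ → ℕ} (h : KnotOrder N) {r : ℝ} (hr : 0 < r) :
    ∀ᶠ n in atTop, ((N n : ℝ) + 1)⁻¹ ≤ r * (rate n)⁻¹ ^ 200 := by
  obtain ⟨cN, hcN, CN, hN⟩ := h
  have hlog : Tendsto (fun n : ℕ => Real.log n) atTop atTop :=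
    Real.tendsto_log_atTop.comp tendsto_natCast_atTop_atTop
  filter_upwards [hN, hlog.eventually_ge_atTop (r⁻¹ / cN), eventually_ge_atTop 1] with n hn hl hn1
  have h1 := one_le_rate hn1
  have h2 : (n : ℝ) ^ (2 / 5 : ℝ) = rate n ^ 200 := by rw [rate_pow]; norm_num
  have h3 : 0 < rate n ^ 200 := by positivity
  rw [h2] at hn
  rw [inv_pow, ← inv_inv r, ← mul_inv]
  refine inv_anti₀ (by positivity) ?_
  rw [div_le_iff₀ hcN] at hl
  calc r⁻¹ * rate n ^ 200 ≤ Real.log n * cN * rate n ^ 200 := by gcongr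
    _ = cN * (rate n ^ 200 * Real.log n) := by ring
    _ ≤ (N n : ℝ) := hn.1
    _ ≤ _ := by linarith

/-- The exponents 99 and 101 trade constants for a margin of one unit. The last bound keeps the
exact order 100 with its constant, because the path of the noise leaves no margin. -/
lemma BandwidthOrder.eventually_bounds {h : ℕ → ℝ} (hh : BandwidthOrder h) :
    ∃ κ > (0 : ℝ), ∀ᶠ n in atTop, 0 < h n ∧ h n ≤ (rate n)⁻¹ ^ 99 ∧ (h n)⁻¹ ≤ rate n ^ 101 ∧
      (h n)⁻¹ ≤ κ * rate n ^ 100 := by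
  obtain ⟨ch, hch, Ch, hb⟩ := hh
  refine ⟨ch⁻¹, by positivity, ?_⟩
  filter_upwards [hb, eventually_mul_rate_inv_le Ch one_pos,
    eventually_mul_rate_inv_le ch⁻¹ one_pos, eventually_ge_atTop 1] with n hn h1 h2 hn1
  have hr := one_le_rate hn1
  have hr0 : 0 < rate n := by linarith
  have e : (n : ℝ) ^ (-(1 / 5) : ℝ) = (rate n)⁻¹ ^ 100 := by rw [rate_inv_pow]; norm_num
  rw [e] at hn
  have hpos : 0 < ch * (rate n)⁻¹ ^ 100 := by positivity
  have h3 : (h n)⁻¹ ≤ ch⁻¹ * rate n ^ 100 := by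
    have := inv_anti₀ hpos hn.1
    rwa [mul_inv, ← inv_pow, inv_inv] at this
  refine ⟨hpos.trans_le hn.1, hn.2.trans ?_, h3.trans ?_, h3⟩
  · calc Ch * (rate n)⁻¹ ^ 100 = (rate n)⁻¹ ^ 99 * ((rate n)⁻¹ * Ch) := by ring
      _ ≤ (rate n)⁻¹ ^ 99 * 1 := by gcongr
      _ = _ := mul_one _
  · rw [inv_mul_le_iff₀ hr0, mul_one] at h2
    calc ch⁻¹ * rate n ^ 100 ≤ rate n * rate n ^ 100 := by gcongr
      _ = _ := by ring

/-- A lag that grows logarithmically at which the mixing coefficient is negligible. -/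
lemma GeometricallyMixing.exists_lag {Ω : Type*} [MeasurableSpace Ω] {d : ℕ} {P : Measure Ω}
    [IsProbabilityMeasure P] {X : ℕ → Ω → Fin d → ℝ} {ε : ℕ → Ω → ℝ}
    (h : GeometricallyMixing P X ε) :
    ∃ (q : ℕ → ℕ) (a : ℕ → ℝ), ∀ᶠ n in atTop, 1 ≤ q n ∧ (q n : ℝ) ≤ rate n ∧ 0 ≤ a n ∧
      a n ≤ (rate n)⁻¹ ^ 5000 ∧ MixBound P (fun i ω => (X i ω, ε i ω)) (q n) (a n) := by
  obtain ⟨K₀, hK, l, hl, hmix⟩ := h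
  -- With this lag the exponential factor is at most n^{-20}, that is 10000 units, and the
  -- coefficient is below n^{-10}, enough to beat every polynomial factor multiplying it. The lag
  -- itself is logarithmic, hence below one unit.
  refine ⟨fun n => ⌈20 / l * Real.log n⌉₊ + 1, fun n => K₀ * Real.exp (-l *
    ((⌈20 / l * Real.log n⌉₊ + 1 : ℕ) : ℝ)), ?_⟩
  filter_upwards [eventually_mul_log_add_le_rate (20 / l) 2, eventually_mul_rate_inv_le K₀ one_pos,
    eventually_ge_atTop 1] with n h1 h2 hn1
  have hlog : 0 ≤ Real.log n := Real.log_natCast_nonneg n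
  have hr := one_le_rate hn1
  have hr0 : 0 < rate n := by linarith
  have hn0 : (0 : ℝ) < n := by exact_mod_cast hn1
  refine ⟨by omega, ?_, by positivity, ?_, mixBound_of_alphaMixing (hmix _ (by omega))⟩
  · push_cast
    have := Nat.ceil_lt_add_one (a := 20 / l * Real.log n) (by positivity)
    linarith
  · have h3 : Real.exp (-l * ((⌈20 / l * Real.log n⌉₊ + 1 : ℕ) : ℝ)) ≤ (rate n)⁻¹ ^ 10000 := by
      have e : (rate n)⁻¹ ^ 10000 = Real.exp (-(20 * Real.log n)) := by
        rw [rate_inv_pow, Real.rpow_def_of_pos hn0]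
        congr 1
        norm_num
        ring
      rw [e, Real.exp_le_exp, neg_mul, neg_le_neg_iff]
      have := Nat.le_ceil (20 / l * Real.log n)
      push_cast
      calc 20 * Real.log n = l * (20 / l * Real.log n) := by field_simp
        _ ≤ l * (⌈20 / l * Real.log n⌉₊ + 1) := by gcongr; linarith
    have h4 : (rate n)⁻¹ ≤ 1 := inv_le_one_of_one_le₀ hr
    calc _ ≤ K₀ * (rate n)⁻¹ ^ 10000 := by gcongr
      _ = (rate n)⁻¹ ^ 9999 * ((rate n)⁻¹ * K₀) := by ring
      _ ≤ (rate n)⁻¹ ^ 9999 * 1 := by gcongr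
      _ ≤ (rate n)⁻¹ ^ 5000 := by
        rw [mul_one]
        exact pow_le_pow_of_le_one (by positivity) h4 (by norm_num)

end Rates

/-! ### Verification that all remainders are of smaller order than n^{-2/5}. -/

section UniformRate

variable {Ω : Type*} [MeasurableSpace Ω]
variable {P : Measure Ω} [IsProbabilityMeasure P] {d : ℕ} [NeZero d] {X : ℕ → Ω → Fin d → ℝ}
  {ε : ℕ → Ω → ℝ} {μ : Measure (Fin d → ℝ)} {f s : (Fin d → ℝ) → ℝ} {m : Fin d → ℝ → ℝ}
  {K : ℝ → ℝ} {cf Cf S Λ B C : ℝ} {N : ℕ}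

lemma mul_pow_inv_pow {y : ℝ} (hy : 0 < y) (k j : ℕ) : y ^ k * y⁻¹ ^ (k + j) = y⁻¹ ^ j := by
  rw [pow_add, ← mul_assoc, ← mul_pow, mul_inv_cancel₀ hy.ne', one_pow, one_mul]

/-- One surplus power of y⁻¹ absorbs the constant A, which is why a strict inequality of exponents
suffices in all later comparisons. -/
lemma mul_inv_pow_le {y A r : ℝ} (hy : 1 ≤ y) (hr : 0 ≤ r) (hA : y⁻¹ * A ≤ r) {i j : ℕ}
    (hij : i < j) : A * y⁻¹ ^ j ≤ r * y⁻¹ ^ i := by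
  have hz1 : y⁻¹ ≤ 1 := inv_le_one_of_one_le₀ hy
  have hz0 : 0 ≤ y⁻¹ := by positivity
  obtain ⟨k, rfl⟩ := Nat.exists_eq_add_of_lt hij
  calc A * y⁻¹ ^ (i + k + 1) = (y⁻¹ * A) * y⁻¹ ^ (i + k) := by ring
    _ ≤ r * y⁻¹ ^ (i + k) := by gcongr
    _ ≤ r * y⁻¹ ^ i := by
      gcongr ?_ * ?_
      exact pow_le_pow_of_le_one hz0 hz1 (by omega)

set_option maxHeartbeats 2000000 in
/-- The backfitted estimator is uniformly within `o(n^{-2/5})` of the oracle smoother. -/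
lemma BoundedModel.eventually_fails_uniform (h : BoundedModel P X ε μ f s m K cf Cf S Λ B C)
    (hf : ∀ η > (0 : ℝ), ∃ r > (0 : ℝ), ∀ x ∈ Icc (0 : Fin d → ℝ) 1, ∀ t ∈ Icc (0 : ℝ) 1,
      |x 0 - t| ≤ r → |f x - f (Function.update x 0 t)| ≤ η)
    (hmix : GeometricallyMixing P X ε) {bw : ℕ → ℝ} (hbw : BandwidthOrder bw) {N : ℕ → ℕ}
    (hN : KnotOrder N) {τ : ℝ} (hτ : 0 < τ) {δ : ℝ} (hδ : 0 < δ) :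
    ∀ᶠ n in atTop, FailsWithProbLE P ((4 * d + 7) * δ) fun ω => ∀ (c : ℝ) (y : ℕ → ℝ)
      (lam : ℝ × (Fin d → Fin (N n) → ℝ)),
      IsLeastSquares (fun α => splineBasis (P.map fun ω => X 0 ω α) (N n)) n
        (fun i => X i ω) y lam →
      (∀ i < n, ∀ α, X i ω α ∈ Ico (0 : ℝ) 1) →
      (∀ i < n, y i = c + ∑ α, m α (X i ω α) + s (X i ω) * ε i ω) →
      ∀ x ∈ Icc (0 : ℝ) 1,
        |spbk K (bw n) (fun α => splineBasis (P.map fun ω => X 0 ω α) (N n)) n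
            (fun i => X i ω) y lam x
          - oracleSmoother K (bw n) c m n (fun i => X i ω) y x| ≤ τ * (n : ℝ) ^ (-(2 / 5) : ℝ) := by
  have hd := h.design
  have := hd.prob
  have hK := h.kernel
  have hC0 : 0 < C := zero_lt_one.trans_le hK.one_le
  have hCf := hd.one_le_Cf
  have hCf0 : 0 < Cf := by linarith
  have hcf := hd.pos
  have hS0 : 0 ≤ S := (abs_nonneg _).trans (h.scale_le 0)
  have hB0 : 0 ≤ B := (abs_nonneg _).trans (h.comp_le 0 0)
  have hd1 : (1 : ℝ) ≤ d := by exact_mod_cast NeZero.one_le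
  have hΛ0 : 0 ≤ Λ := by
    have := h.lipschitz 0 0 (by norm_num) 1 (by norm_num)
    norm_num at this
    exact (abs_nonneg _).trans this
  set RB := rieszBound cf Cf with hRB
  have hRB0 : 0 ≤ RB := by rw [hRB]; unfold rieszBound; positivity
  obtain ⟨κ, hκ, hbw⟩ := hbw.eventually_bounds
  obtain ⟨q, a, hqa⟩ := hmix.exists_lag
  -- thresholds
  set τ₀ := τ / (2 * d + 1 + 2 * d + d + 16 * d / cf) with hτ₀
  have hτ₀0 : 0 < τ₀ := by positivity
  set E := S ^ 2 * (d + 1) * Cf with hE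
  have hE0 : 0 ≤ E := by positivity
  set A3 := E * (1 + RB ^ 2) * (√(Cf / cf) / cf * (8 * C)) * κ with hA3
  have hA30 : 0 ≤ A3 := by positivity
  -- Chosen so that the part of the expected noise maximum proportional to η/b uses at most half of
  -- the budget δ τ₀². Continuity of the density then makes η admissible once the bandwidth is
  -- small.
  set η := δ * τ₀ ^ 2 / 2 / (A3 + 1) with hη
  have hη0 : 0 < η := by positivity
  obtain ⟨r, hr0, hr⟩ := hf η hη0
  set A3' := E * (RB ^ 2 + (1 + RB ^ 2) * (1 + √(Cf / cf) / cf * (2 * Cf))) with hA3'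
  set Q := √((d + 2) * Cf) with hQ
  have hQ0 : 0 ≤ Q := Real.sqrt_nonneg _
  set A9 := d * Λ * Q * RB + Λ + d * Λ * Q with hA9
  have hA90 : 0 ≤ A9 := by positivity
  have hτ1 : 0 < min τ₀ 1 / (A9 + 1) := by positivity
  have ev := fun (A : ℝ) {r : ℝ} (hr : 0 < r) => eventually_mul_rate_inv_le A hr
  filter_upwards [hbw, hqa, hN.eventually_le d, hN.eventually_inv_le hτ1, eventually_ge_atTop 1,
    ev 33 (r := δ * (cf / 2) ^ 2) (by positivity), ev (S ^ 2) hδ,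
    ev A3' (r := δ * τ₀ ^ 2 / 2) (by positivity),
    ev (RB ^ 2 * ((d + 1) * Cf + 32)) hδ,
    ev (48 * Cf ^ 4 * (3 * C) ^ 4 * 4 + 64 * Cf ^ 2 * (3 * C) ^ 4 * 2 + 1664 * (3 * C) ^ 4) hδ,
    ev (d * (B ^ 2 + 32 * B ^ 2)) (r := δ * τ₀ ^ 2) (by positivity), ev ((d + 1) * Cf + 32) hδ,
    ev (Cf * ((3 * C) ^ 2 * 4) + 32 * (3 * C) ^ 2) hδ,
    ev (2 + Cf * (8 * C)) (r := cf / 4) (by positivity),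
    ev (2 / cf * 2) one_pos, ev (3 + 16 * Cf ^ 2 * C) hτ₀0, ev 1 (r := r / 2) (by positivity),
    ev 1 (r := (1 : ℝ) / 2) (by positivity), ev 3 one_pos, ev 1 hτ₀0, ev (S ^ 2) (r := δ * τ₀ ^ 2) (by positivity)]
    with n hbn hqn hF hL hn1 e1 e2 e3 e4 e5 e6 e7 e8 e9 e10 e11 e12 e13 e14 e15 e16
  obtain ⟨hb0, hb1, hb2, hb3⟩ := hbn
  obtain ⟨hq1, hq2, ha0, ha1, hmx⟩ := hqn
  set y := rate n with hy
  have hy1 : 1 ≤ y := one_le_rate hn1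
  have hy0 : 0 < y := by linarith
  set z := y⁻¹ with hz
  have hz0 : 0 < z := by positivity
  have hz1 : z ≤ 1 := inv_le_one_of_one_le₀ hy1
  have hyz : ∀ k j : ℕ, y ^ k * z ^ (k + j) = z ^ j := mul_pow_inv_pow hy0
  have hle : ∀ {A r : ℝ} {i j : ℕ}, 0 ≤ r → z * A ≤ r → i < j → A * z ^ j ≤ r * z ^ i :=
    fun hr hA hij => mul_inv_pow_le hy1 hr hA hij
  have hzle : ∀ {i j : ℕ}, i ≤ j → z ^ j ≤ z ^ i := fun hij =>
    pow_le_pow_of_le_one hz0.le hz1 hij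
  have hnz : ∀ k : ℕ, (1 : ℝ) / (n : ℝ) ^ k = z ^ (500 * k) := fun k => by
    rw [hz, inv_pow, pow_mul, hy, rate_pow]
    norm_num
  have hn500 : ∀ A : ℝ, A / n = A * z ^ 500 := fun A => by
    have := hnz 1
    rw [pow_one, mul_one] at this
    rw [← this, mul_one_div]
  have hn1000 : ∀ A : ℝ, A / (n : ℝ) ^ 2 = A * z ^ 1000 := fun A => by
    rw [← hnz 2, mul_one_div]
  have hn1500 : ∀ A : ℝ, A / (n : ℝ) ^ 3 = A * z ^ 1500 := fun A => by
    rw [← hnz 3, mul_one_div]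
  set F := featBound d (N n) with hFdef
  have hF1 : 1 ≤ F := one_le_featBound
  have hF0 : 0 ≤ F := by linarith
  -- A mesh of n^{-0.32}. It is fine enough that D/b times ‖θ‖ is at most 59 + 147 = 206 units
  -- small, beyond the target 200, and coarse enough for the union bounds over M + 1 ≤ y^161 points.
  set M := ⌈y ^ 160⌉₊ with hM
  have hM1 : y ^ 160 ≤ M := Nat.le_ceil _
  have hM2 : (M : ℝ) + 1 ≤ y ^ 161 := by
    have h1 : (M : ℝ) < y ^ 160 + 1 := Nat.ceil_lt_add_one (by positivity)
    have h2 : 3 ≤ y := by rwa [hz, inv_mul_le_iff₀ hy0, mul_one] at e14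
    have h3 : 1 ≤ y ^ 160 := one_le_pow₀ hy1
    calc (M : ℝ) + 1 ≤ y ^ 160 * 3 := by linarith
      _ ≤ y ^ 160 * y := by gcongr
      _ = _ := by ring
  have hM0 : (0 : ℝ) < M := lt_of_lt_of_le (by positivity) hM1
  set D := 1 / (M : ℝ) with hD
  have hD0 : 0 < D := by positivity
  have hD1 : D ≤ z ^ 160 := by
    rw [hD, hz, inv_pow, one_div]
    exact inv_anti₀ (by positivity) hM1
  have hMD : M * D = 1 := by rw [hD]; field_simp
  have hzb : z ^ 101 ≤ bw n := by
    rw [hz, inv_pow]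
    exact inv_le_of_inv_le₀ hb0 hb2
  have hDb : D ≤ bw n := hD1.trans ((hzle (by norm_num)).trans hzb)
  have hL0 : (0 : ℝ) < (N n : ℝ) + 1 := by positivity
  have hbz : bw n ≤ z := hb1.trans ((hzle (i := 1) (by norm_num)).trans_eq (pow_one z))
  have hbi : ∀ A : ℝ, A / bw n = A * (bw n)⁻¹ := fun A => div_eq_mul_inv _ _
  have hcoef : coefBound d cf Cf Λ (N n) (z ^ 148) ≤ z ^ 147 := by
    have h1 : d * Λ * Q / ((N n : ℝ) + 1) ≤ z ^ 200 := by
      rw [div_eq_mul_inv]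
      calc d * Λ * Q * ((N n : ℝ) + 1)⁻¹ ≤ A9 * (min τ₀ 1 / (A9 + 1) * z ^ 200) := by
            gcongr
            rw [hA9]
            have : 0 ≤ d * Λ * Q * RB := by positivity
            linarith
        _ ≤ A9 * (1 / (A9 + 1) * z ^ 200) := by gcongr; exact min_le_right _ _
        _ = A9 / (A9 + 1) * z ^ 200 := by ring
        _ ≤ 1 * z ^ 200 := by
          gcongr
          rw [div_le_one (by positivity)]
          linarith
        _ = _ := one_mul _
    have h2 : z ^ 200 ≤ z ^ 148 := hzle (by norm_num)
    have h3 := hle (i := 147) (j := 148) zero_le_one e10 (by norm_num)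
    unfold coefBound
    calc _ ≤ 2 / cf * (z ^ 148 + z ^ 148) := by gcongr; exact h1.trans h2
      _ = 2 / cf * 2 * z ^ 148 := by ring
      _ ≤ _ := h3.trans_eq (one_mul _)
  have hcoef0 : 0 ≤ coefBound d cf Cf Λ (N n) (z ^ 148) := by unfold coefBound; positivity
  have hLL : ∀ A : ℝ, 0 ≤ A → A ≤ A9 → A / ((N n : ℝ) + 1) ≤ τ₀ * z ^ 200 := fun A hA0 hA => by
    rw [div_eq_mul_inv]
    calc A * ((N n : ℝ) + 1)⁻¹ ≤ A9 * (min τ₀ 1 / (A9 + 1) * z ^ 200) := by gcongr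
      _ ≤ A9 * (τ₀ / (A9 + 1) * z ^ 200) := by gcongr; exact min_le_left _ _
      _ = A9 / (A9 + 1) * (τ₀ * z ^ 200) := by ring
      _ ≤ 1 * (τ₀ * z ^ 200) := by
        gcongr
        rw [div_le_one (by positivity)]
        linarith
      _ = _ := one_mul _
  have hDbz : D / bw n ≤ z ^ 59 := by
    rw [hbi]
    calc D * (bw n)⁻¹ ≤ z ^ 160 * y ^ 101 := by gcongr
      _ = y ^ 101 * z ^ (101 + 59) := by ring
      _ = _ := hyz _ _
  -- The noise and the spline bias are exactly of order 200 with small constants. The products with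
  -- the coefficient bound have exponents at least 57 + 147 = 204, so a surplus absorbs their
  -- constants.
  have hwin : windowBound d cf Cf Λ C (bw n) D (N n) (z ^ 148) (τ₀ * z ^ 200) (z ^ 67) (z ^ 57)
      ≤ 3 * τ₀ * z ^ 200 := by
    have h1 : d * Λ * Q / ((N n : ℝ) + 1) * RB ≤ τ₀ * z ^ 200 := by
      rw [div_mul_eq_mul_div]
      refine hLL _ (by positivity) ?_
      rw [hA9]
      have : 0 ≤ d * Λ * Q := by positivity
      linarith
    have h2 := hle (i := 200) (j := 204) hτ₀0.le e11 (by norm_num)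
    have h3 : z ^ 67 ≤ z ^ 57 := hzle (by norm_num)
    have h4 : z ^ 59 ≤ z ^ 57 := hzle (by norm_num)
    unfold windowBound
    calc _ ≤ τ₀ * z ^ 200 + τ₀ * z ^ 200
          + (z ^ 57 + (2 * z ^ 57 + 16 * Cf ^ 2 * C * z ^ 57)) * z ^ 147 := by
          gcongr
          rw [mul_div_assoc]
          gcongr
          exact hDbz.trans h4
      _ = τ₀ * z ^ 200 + τ₀ * z ^ 200 + (3 + 16 * Cf ^ 2 * C) * z ^ 204 := by ring
      _ ≤ _ := by linarith
  -- The thresholds are set just above the sizes allowed by the moment bounds; the two with the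
  -- factor τ₀ sit exactly at the target order n^{-2/5}.
  refine (h.fails_uniform hb0 (by linarith) hD0 hDb hMD hη0.le
    (fun x hx t ht hxt => hr x hx t ht (by linarith)) hq1 ha0 hmx hn1 (N n)
    (t₂ := z ^ 148) (t₃ := τ₀ * z ^ 200) (t₄ := z ^ 67) (t₅ := z ^ 57) (t₆ := τ₀ * z ^ 200)
    (t₇ := z ^ 100) (t₈ := z ^ 10) (by positivity) (by positivity) (by positivity) (by positivity)
    (by positivity) (by positivity) (by positivity) hδ.le
    ?_ ?_ ?_ ?_ ?_ ?_ ?_ ?_ ?_ ?_).mono ?_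
  · rw [hn500]
    have h1 := hle (i := 0) (j := 96) (by positivity) e1 (by norm_num)
    have h2 : z ^ 4194 ≤ z ^ 96 := hzle (by norm_num)
    calc _ ≤ y ^ 2 * ((y ^ 201) ^ 2 * z ^ 500 + 32 * (y ^ 201) ^ 4 * z ^ 5000) := by gcongr
      _ = y ^ 404 * z ^ (404 + 96) + 32 * (y ^ 806 * z ^ (806 + 4194)) := by ring
      _ = z ^ 96 + 32 * z ^ 4194 := by rw [hyz, hyz]
      _ ≤ 33 * z ^ 96 := by linarith
      _ ≤ _ := h1.trans_eq (by ring)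
  · rw [hn500]
    have h1 := hle (i := 296) (j := 299) hδ.le e2 (by norm_num)
    calc _ ≤ S ^ 2 * y ^ 201 * z ^ 500 := by gcongr
      _ = S ^ 2 * (y ^ 201 * z ^ (201 + 299)) := by ring
      _ = S ^ 2 * z ^ 299 := by rw [hyz]
      _ ≤ _ := h1.trans_eq (by ring)
  · rw [hn500]
    have h1 := hle (i := 400) (j := 500) (by positivity) e3 (by norm_num)
    -- This is the only comparison without spare exponent: n^{-1} times the path length η/b has
    -- exactly the order n^{-4/5} of the squared threshold, and it is small only because η is.
    have h2 : A3 * η ≤ δ * τ₀ ^ 2 / 2 := by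
      rw [hη, ← mul_div_assoc, div_le_iff₀ (by positivity)]
      have : 0 ≤ δ * τ₀ ^ 2 / 2 := by positivity
      linarith
    calc _ = A3' * z ^ 500 + E * (1 + RB ^ 2) * (√(Cf / cf) / cf * (8 * C)) * η
            * ((bw n)⁻¹ * z ^ 500) := by
          rw [hbi, hA3']; ring
      _ ≤ A3' * z ^ 500 + E * (1 + RB ^ 2) * (√(Cf / cf) / cf * (8 * C)) * η
            * ((κ * y ^ 100) * z ^ 500) := by gcongr
      _ = A3' * z ^ 500 + A3 * η * (y ^ 100 * z ^ (100 + 400)) := by rw [hA3]; ring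
      _ = A3' * z ^ 500 + A3 * η * z ^ 400 := by rw [hyz]
      _ ≤ δ * τ₀ ^ 2 / 2 * z ^ 400 + δ * τ₀ ^ 2 / 2 * z ^ 400 := by gcongr
      _ = _ := by ring
  · rw [hn500]
    -- 161 units for the grid, 2 for the lag and 201 for the features against 500 from 1/n leave
    -- 136, above twice the threshold exponent 67.
    have h1 := hle (i := 134) (j := 136) hδ.le e4 (by norm_num)
    have h2 : z ^ 4234 ≤ z ^ 136 := hzle (by norm_num)
    calc _ ≤ y ^ 161 * (y ^ 2 * RB ^ 2 * ((d + 1) * Cf * y ^ 201 * z ^ 500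
            + 32 * (y ^ 201) ^ 3 * z ^ 5000)) := by gcongr
      _ = RB ^ 2 * ((d + 1) * Cf * (y ^ 364 * z ^ (364 + 136))
            + 32 * (y ^ 766 * z ^ (766 + 4234))) := by ring
      _ = RB ^ 2 * ((d + 1) * Cf * z ^ 136 + 32 * z ^ 4234) := by rw [hyz, hyz]
      _ ≤ RB ^ 2 * ((d + 1) * Cf * z ^ 136 + 32 * z ^ 136) := by gcongr
      _ = RB ^ 2 * ((d + 1) * Cf + 32) * z ^ 136 := by ring
      _ ≤ _ := h1.trans_eq (by ring)
  -- Fourth moments bring n^{-2}: 161 + 4 + 402 + 202 units against 1000 leave 231, above four times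
  -- 57. The third moment type term and the mixing term are smaller still.
  · rw [hn1000, hn1500]
    have h1 := hle (i := 228) (j := 231) hδ.le e5 (by norm_num)
    have h2 : z ^ 429 ≤ z ^ 231 := hzle (by norm_num)
    have h3 : z ^ 3627 ≤ z ^ 231 := hzle (by norm_num)
    have hbb : bw n * (bw n)⁻¹ = 1 := mul_inv_cancel₀ hb0.ne'
    have g1 : (3 * C / bw n) ^ 4 * (2 * bw n) ^ 2 = (3 * C) ^ 4 * 4 * (bw n)⁻¹ ^ 2 := by
      field_simp; ring
    have g2 : (3 * C / bw n) ^ 4 * (2 * bw n) = (3 * C) ^ 4 * 2 * (bw n)⁻¹ ^ 3 := by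
      field_simp
    have g3 : (3 * C / bw n) ^ 4 = (3 * C) ^ 4 * (bw n)⁻¹ ^ 4 := by
      field_simp
    have e17 : 48 * Cf ^ 4 * (3 * C / bw n) ^ 4 * (2 * bw n) ^ 2
        = 48 * Cf ^ 4 * ((3 * C) ^ 4 * 4 * (bw n)⁻¹ ^ 2) := by rw [← g1]; ring
    have e18 : 64 * Cf ^ 2 * (3 * C / bw n) ^ 4 * (2 * bw n)
        = 64 * Cf ^ 2 * ((3 * C) ^ 4 * 2 * (bw n)⁻¹ ^ 3) := by rw [← g2]; ring
    rw [e17, e18, g3]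
    calc _ ≤ y ^ 161 * (y ^ 4 * (y ^ 201) ^ 2 *
          (48 * Cf ^ 4 * ((3 * C) ^ 4 * 4 * (y ^ 101) ^ 2) * z ^ 1000
          + 64 * Cf ^ 2 * ((3 * C) ^ 4 * 2 * (y ^ 101) ^ 3) * y ^ 201 * z ^ 1500
          + 1664 * ((3 * C) ^ 4 * (y ^ 101) ^ 4) * (y ^ 201) ^ 2 * z ^ 5000)) := by gcongr
      _ = 48 * Cf ^ 4 * (3 * C) ^ 4 * 4 * (y ^ 769 * z ^ (769 + 231))
          + 64 * Cf ^ 2 * (3 * C) ^ 4 * 2 * (y ^ 1071 * z ^ (1071 + 429))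
          + 1664 * (3 * C) ^ 4 * (y ^ 1373 * z ^ (1373 + 3627)) := by ring
      _ ≤ 48 * Cf ^ 4 * (3 * C) ^ 4 * 4 * z ^ 231
          + 64 * Cf ^ 2 * (3 * C) ^ 4 * 2 * z ^ 231
          + 1664 * (3 * C) ^ 4 * z ^ 231 := by rw [hyz, hyz, hyz]; gcongr
      _ = (48 * Cf ^ 4 * (3 * C) ^ 4 * 4 + 64 * Cf ^ 2 * (3 * C) ^ 4 * 2
          + 1664 * (3 * C) ^ 4) * z ^ 231 := by ring
      _ ≤ _ := h1.trans_eq (by ring)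
  · rw [hn500]
    have h1 := hle (i := 400) (j := 498) (by positivity) e6 (by norm_num)
    have h2 : z ^ 4998 ≤ z ^ 498 := hzle (by norm_num)
    calc _ ≤ d * (y ^ 2 * (B ^ 2 * z ^ 500 + 32 * B ^ 2 * z ^ 5000)) := by gcongr
      _ = d * (B ^ 2 * (y ^ 2 * z ^ (2 + 498)) + 32 * B ^ 2 * (y ^ 2 * z ^ (2 + 4998))) := by ring
      _ ≤ d * (B ^ 2 * z ^ 498 + 32 * B ^ 2 * z ^ 498) := by rw [hyz, hyz]; gcongr
      _ = d * (B ^ 2 + 32 * B ^ 2) * z ^ 498 := by ring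
      _ ≤ _ := h1.trans_eq (by ring)
  · rw [hn500]
    exact (hle (i := 400) (j := 500) (by positivity) e16 (by norm_num)).trans_eq (by ring)
  · rw [hn500]
    have h1 := hle (i := 200) (j := 297) hδ.le e7 (by norm_num)
    have h2 : z ^ 4395 ≤ z ^ 297 := hzle (by norm_num)
    calc _ ≤ y ^ 2 * ((d + 1) * Cf * y ^ 201 * z ^ 500 + 32 * (y ^ 201) ^ 3 * z ^ 5000) := by gcongr
      _ = (d + 1) * Cf * (y ^ 203 * z ^ (203 + 297)) + 32 * (y ^ 605 * z ^ (605 + 4395)) := by ring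
      _ ≤ (d + 1) * Cf * z ^ 297 + 32 * z ^ 297 := by rw [hyz, hyz]; gcongr
      _ = ((d + 1) * Cf + 32) * z ^ 297 := by ring
      _ ≤ _ := h1.trans_eq (by ring)
  · rw [hn500]
    have h1 := hle (i := 20) (j := 236) hδ.le e8 (by norm_num)
    have h2 : z ^ 4635 ≤ z ^ 236 := hzle (by norm_num)
    have g1 : (3 * C / bw n) ^ 2 * (2 * (2 * bw n)) = (3 * C) ^ 2 * 4 * (bw n)⁻¹ := by
      field_simp; ring
    have g2 : (3 * C / bw n) ^ 2 = (3 * C) ^ 2 * (bw n)⁻¹ ^ 2 := by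
      field_simp
    rw [g1, g2]
    calc _ ≤ y ^ 161 * (y ^ 2 * (Cf * ((3 * C) ^ 2 * 4 * y ^ 101) * z ^ 500
            + 32 * ((3 * C) ^ 2 * (y ^ 101) ^ 2) * z ^ 5000)) := by gcongr
      _ = Cf * ((3 * C) ^ 2 * 4) * (y ^ 264 * z ^ (264 + 236))
            + 32 * (3 * C) ^ 2 * (y ^ 365 * z ^ (365 + 4635)) := by ring
      _ ≤ Cf * ((3 * C) ^ 2 * 4) * z ^ 236 + 32 * (3 * C) ^ 2 * z ^ 236 := by
          rw [hyz, hyz]; gcongr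
      _ = (Cf * ((3 * C) ^ 2 * 4) + 32 * (3 * C) ^ 2) * z ^ 236 := by ring
      _ ≤ _ := h1.trans_eq (by ring)
  · have h1 := hle (i := 0) (j := 10) (by positivity) e9 (by norm_num)
    have h2 : z ^ 59 ≤ z ^ 10 := hzle (by norm_num)
    rw [mul_div_assoc (8 * C)]
    calc _ ≤ 2 * z ^ 10 + Cf * (8 * C * z ^ 10) := by gcongr; exact hDbz.trans h2
      _ = (2 + Cf * (8 * C)) * z ^ 10 := by ring
      _ ≤ _ := h1.trans_eq (by ring)
  · intro ω hω c y' lam hls hx hy' x hx01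
    refine (hω c y' lam hls hx hy' x hx01).trans ?_
    have e : (n : ℝ) ^ (-(2 / 5) : ℝ) = z ^ 200 := by
      rw [hz, hy, rate_inv_pow]; norm_num
    rw [e]
    have h1 := hle (i := 200) (j := 247) hτ₀0.le e15 (by norm_num)
    have h2 : 2 * d * Λ / ((N n : ℝ) + 1) ≤ 2 * d * (τ₀ * z ^ 200) := by
      rw [mul_div_assoc]
      gcongr
      refine hLL Λ hΛ0 ?_
      rw [hA9]
      have : 0 ≤ d * Λ * Q * RB := by positivity
      have : 0 ≤ d * Λ * Q := by positivity
      linarith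
    have h3 : z ^ 100 * coefBound d cf Cf Λ (N n) (z ^ 148) ≤ τ₀ * z ^ 200 := by
      calc _ ≤ z ^ 100 * z ^ 147 := by gcongr
        _ = 1 * z ^ 247 := by ring
        _ ≤ _ := h1
    have h4 : d * windowBound d cf Cf Λ C (bw n) D (N n) (z ^ 148) (τ₀ * z ^ 200) (z ^ 67) (z ^ 57)
        / (cf / 4) ≤ d * (3 * τ₀ * z ^ 200) / (cf / 4) := by gcongr
    have h5 : τ = τ₀ * (2 * d + 1 + 2 * d + d + 16 * d / cf) := by
      rw [hτ₀]; field_simp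
    have h6 : 0 ≤ d * τ₀ * z ^ 200 / cf := by positivity
    have h7 : d * (3 * τ₀ * z ^ 200) / (cf / 4) = 12 * (d * τ₀ * z ^ 200 / cf) := by
      field_simp; ring
    have h8 : τ * z ^ 200 = (2 * d + 1) * (τ₀ * z ^ 200) + 2 * d * (τ₀ * z ^ 200)
        + d * (τ₀ * z ^ 200) + 16 * (d * τ₀ * z ^ 200 / cf) := by
      rw [h5]; ring
    have h9 : d * (z ^ 100 * coefBound d cf Cf Λ (N n) (z ^ 148)) ≤ d * (τ₀ * z ^ 200) := by
      gcongr
    linarith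

end UniformRate

/-! ### From the assumptions of the theorem to the bounded model -/

section Clamp

/-- Projection of the line on the unit interval. -/
def clampOne (t : ℝ) : ℝ := max 0 (min 1 t)

/-- Projection of the space on the unit cube. -/
def clamp {d : ℕ} (x : Fin d → ℝ) : Fin d → ℝ := fun α => clampOne (x α)

lemma continuous_clampOne : Continuous clampOne := by unfold clampOne; fun_prop

lemma clampOne_mem (t : ℝ) : clampOne t ∈ Icc (0 : ℝ) 1 :=
  ⟨le_max_left _ _, max_le zero_le_one (min_le_left _ _)⟩

lemma clampOne_eq {t : ℝ} (ht : t ∈ Icc (0 : ℝ) 1) : clampOne t = t := by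
  rw [clampOne, min_eq_right ht.2, max_eq_right ht.1]

lemma continuous_clamp {d : ℕ} : Continuous (clamp : (Fin d → ℝ) → Fin d → ℝ) :=
  continuous_pi fun α => continuous_clampOne.comp (continuous_apply α)

lemma clamp_mem {d : ℕ} (x : Fin d → ℝ) : clamp x ∈ Icc (0 : Fin d → ℝ) 1 :=
  ⟨fun α => (clampOne_mem (x α)).1, fun α => (clampOne_mem (x α)).2⟩

lemma clamp_eq {d : ℕ} {x : Fin d → ℝ} (hx : x ∈ Icc (0 : Fin d → ℝ) 1) : clamp x = x :=
  funext fun α => clampOne_eq ⟨hx.1 α, hx.2 α⟩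

/-- The hypotheses restrict the functions to the cube only. Projecting the argument produces global
continuous, hence measurable and bounded, versions which agree with the originals at almost every
design point. -/
lemma continuous_comp_clamp {d : ℕ} {f : (Fin d → ℝ) → ℝ} (hf : ContinuousOn f (Icc 0 1)) :
    Continuous fun x => f (clamp x) :=
  hf.comp_continuous continuous_clamp clamp_mem

lemma update_mem_cube {d : ℕ} {x : Fin d → ℝ} (hx : x ∈ Icc (0 : Fin d → ℝ) 1) (α : Fin d)
    {t : ℝ} (ht : t ∈ Icc (0 : ℝ) 1) :
    Function.update x α t ∈ Icc (0 : Fin d → ℝ) 1 := by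
  refine ⟨fun β => ?_, fun β => ?_⟩
  · by_cases h : β = α
    · subst h; simpa using ht.1
    · simpa [Function.update_of_ne h] using hx.1 β
  · by_cases h : β = α
    · subst h; simpa using ht.2
    · simpa [Function.update_of_ne h] using hx.2 β

end Clamp

/-! ### Reduction of the hypotheses to the bounded model, and the uniform comparison. -/

section Bridge

variable {Ω : Type*} [mΩ : MeasurableSpace Ω] {P : Measure Ω} [IsProbabilityMeasure P] {d : ℕ}
  {X : ℕ → Ω → Fin d → ℝ} {ε : ℕ → Ω → ℝ} {f : (Fin d → ℝ) → ℝ}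

/-- Law with density `f` on the cube. -/
def designLaw (f : (Fin d → ℝ) → ℝ) : Measure (Fin d → ℝ) :=
  (unif d).withDensity fun x => ENNReal.ofReal (f (clamp x))

lemma RegularDensity.exists_design (hX : ∀ i, Measurable (X i)) (h : RegularDensity P X f) :
    ∃ cf Cf : ℝ, Design P X (designLaw f) cf Cf ∧
      (∀ x ∈ Icc (0 : Fin d → ℝ) 1, cf ≤ f x ∧ f x ≤ Cf) ∧
      ∀ α, ∀ t ∈ Icc (0 : ℝ) 1, cf ≤ marginalDensity f α t ∧ marginalDensity f α t ≤ Cf := by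
  obtain ⟨cf, hcf, Cf, hb, hmar⟩ := h.bounds
  have hm : Measurable fun x => ENNReal.ofReal (f (clamp x)) :=
    (continuous_comp_clamp h.continuousOn).measurable.ennreal_ofReal
  refine ⟨cf, Cf, ⟨hX, fun i => ?_, hcf, fun g hg => ?_, fun g hg => ?_⟩, hb, hmar⟩
  · rw [h.law i]
    refine withDensity_congr_ae ?_
    filter_upwards [ae_unif_mem (d := d)] with x hx
    rw [clamp_eq hx]
  · rw [designLaw, lintegral_withDensity_eq_lintegral_mul _ hm hg, ← lintegral_const_mul _ hg]
    refine lintegral_mono fun x => ?_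
    simp only [Pi.mul_apply]
    gcongr
    exact (hb _ (clamp_mem x)).1
  · rw [designLaw, lintegral_withDensity_eq_lintegral_mul _ hm hg, ← lintegral_const_mul _ hg]
    refine lintegral_mono fun x => ?_
    simp only [Pi.mul_apply]
    gcongr
    exact (hb _ (clamp_mem x)).2

lemma RegularDensity.modulus [NeZero d] (h : RegularDensity P X f) : ∀ η > (0 : ℝ), ∃ r > (0 : ℝ),
    ∀ x ∈ Icc (0 : Fin d → ℝ) 1, ∀ t ∈ Icc (0 : ℝ) 1,
      |x 0 - t| ≤ r → |f (clamp x) - f (clamp (Function.update x 0 t))| ≤ η := by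
  intro η hη
  have hu := isCompact_Icc.uniformContinuousOn_of_continuous h.continuousOn
  obtain ⟨r, hr, hf⟩ := Metric.uniformContinuousOn_iff.1 hu η hη
  refine ⟨r / 2, by positivity, fun x hx t ht hxt => ?_⟩
  have hx' := update_mem_cube hx 0 ht
  rw [clamp_eq hx, clamp_eq hx', ← Real.dist_eq]
  refine (hf x hx _ hx' ?_).le
  refine lt_of_le_of_lt ((dist_pi_le_iff (by positivity : 0 ≤ r / 2)).2 fun β => ?_)
    (half_lt_self hr)
  by_cases hβ : β = 0
  · subst hβ; simpa [Real.dist_eq] using hxt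
  · simp only [Function.update_of_ne hβ, dist_self]; positivity

/-- Integral of a product with a bounded function of the conditioning variable. -/
lemma integral_mul_condExp {E : Type*} [mE : MeasurableSpace E] {W : Ω → E} (hW : Measurable W)
    {g : E → ℝ} (hg : Measurable g) {M : ℝ} (hM : ∀ x, |g x| ≤ M) {Z : Ω → ℝ}
    (hZ : Integrable Z P) :
    ∫ ω, g (W ω) * Z ω ∂P
      = ∫ ω, g (W ω) * (P[Z | MeasurableSpace.comap W inferInstance]) ω ∂P := by
  have hs : StronglyMeasurable[MeasurableSpace.comap W inferInstance] fun ω => g (W ω) :=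
    (hg.comp (comap_measurable W)).stronglyMeasurable
  have h1 := condExp_stronglyMeasurable_mul_of_bound hW.comap_le hs hZ M
    (ae_of_all _ fun ω => hM (W ω))
  have h2 := integral_condExp (μ := P) (f := (fun ω => g (W ω)) * Z) hW.comap_le
  calc ∫ ω, g (W ω) * Z ω ∂P
      = ∫ ω, (P[(fun ω => g (W ω)) * Z | MeasurableSpace.comap W inferInstance]) ω ∂P := h2.symm
    _ = _ := integral_congr_ae h1

lemma WhiteNoise.secondOrderNoise (h : WhiteNoise P X ε) (hX : ∀ i, Measurable (X i))
    (hε : ∀ i, Measurable (ε i)) {μ : Measure (Fin d → ℝ)} (hμ : ∀ i, P.map (X i) = μ) :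
    SecondOrderNoise P X μ ε := by
  -- If ε² were not integrable, its conditional expectation would be the default value 0,
  -- contradicting unit conditional variance.
  have hsq : ∀ i, Integrable (fun ω => ε i ω ^ 2) P := by
    intro i
    by_contra hcon
    have h1 := h.variance i
    rw [condExp_of_not_integrable hcon] at h1
    have h2 : ∀ᵐ ω ∂P, False := by
      filter_upwards [h1] with ω hω
      exact zero_ne_one hω
    exact (ae_iff.1 h2).not_gt (by simp)
  have hL : ∀ i, MemLp (ε i) 2 P := fun i =>
    (memLp_two_iff_integrable_sq (hε i).aestronglyMeasurable).2 (hsq i)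
  refine ⟨hL, ?_, ?_, ?_⟩
  · rintro i g hg ⟨M, hM⟩
    rw [integral_mul_condExp (hX i) hg hM ((hL i).integrable one_le_two)]
    refine (integral_congr_ae ?_).trans (integral_zero Ω ℝ)
    filter_upwards [h.mean i] with ω hω
    rw [hω, mul_zero]
  · rintro i g hg ⟨M, hM⟩
    rw [integral_mul_condExp (hX i) hg hM (hsq i), ← hμ i,
      integral_map (hX i).aemeasurable hg.aestronglyMeasurable]
    refine integral_congr_ae ?_
    filter_upwards [h.variance i] with ω hω
    rw [hω, mul_one]
  · rintro i j hij g hg ⟨M, hM⟩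
    have hM0 : 0 ≤ M := (abs_nonneg _).trans (hM 0)
    have h1 := integral_mul_condExp (P := P) ((hX i).prodMk (hX j))
      (g := fun p : (Fin d → ℝ) × (Fin d → ℝ) => g p.1 * g p.2)
      ((hg.comp measurable_fst).mul (hg.comp measurable_snd)) (M := M * M)
      (fun p => by
        rw [abs_mul]
        exact mul_le_mul (hM _) (hM _) (abs_nonneg _) hM0) (Z := fun ω => ε i ω * ε j ω)
      ((hL i).integrable_mul (hL j))
    calc _ = ∫ ω, g (X i ω) * g (X j ω) * (ε i ω * ε j ω) ∂P := by
          congr 1 with ω; ring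
      _ = _ := h1
      _ = 0 := by
        refine (integral_congr_ae ?_).trans (integral_zero Ω ℝ)
        filter_upwards [h.uncorrelated i j hij] with ω hω
        rw [hω, mul_zero]

lemma SmoothComponents.exists_lipschitz [NeZero d] {m : Fin d → ℝ → ℝ} (h : SmoothComponents m) :
    ∃ Λ : ℝ, ∀ α, ∀ t ∈ Icc (0 : ℝ) 1, ∀ t' ∈ Icc (0 : ℝ) 1,
      |m α t - m α t'| ≤ Λ * |t - t'| := by
  obtain ⟨C, hC⟩ := h.others
  obtain ⟨C', hC'⟩ := h.first.exists_lipschitzOnWith two_ne_zero (convex_Icc 0 1) isCompact_Icc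
  refine ⟨max C C', fun α t ht t' ht' => ?_⟩
  by_cases hα : α = 0
  · subst hα
    refine (hC'.dist_le_mul t ht t' ht').trans ?_
    rw [Real.dist_eq]
    gcongr
    exact le_max_right _ _
  · refine ((hC α hα).dist_le_mul t ht t' ht').trans ?_
    rw [Real.dist_eq]
    gcongr
    exact le_max_left _ _

/-- The law of the design has a density, so almost surely no coordinate equals the endpoint 1, the
one point of [0, 1] lying in no bin. -/
lemma Design.ae_mem_Ico {μ : Measure (Fin d → ℝ)} {cf Cf : ℝ} (h : Design P X μ cf Cf) :
    ∀ᵐ ω ∂P, ∀ i α, X i ω α ∈ Ico (0 : ℝ) 1 := by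
  rw [ae_all_iff]
  intro i
  have h0 : ∀ᵐ x ∂unif d, ∀ α : Fin d, x α ∈ Ico (0 : ℝ) 1 := by
    rw [ae_all_iff]
    intro α
    have h2 : ∀ᵐ t ∂unifOne, t ≠ 1 := by
      unfold unifOne
      exact ae_restrict_of_ae (Measure.ae_ne volume (1 : ℝ))
    have h3 := (measurePreserving_eval_unif α).quasiMeasurePreserving.ae h2
    filter_upwards [ae_unif_mem (d := d), h3] with x hx hx1
    exact ⟨hx.1 α, lt_of_le_of_ne (hx.2 α) hx1⟩
  have h1 : ∀ᵐ x ∂μ, ∀ α : Fin d, x α ∈ Ico (0 : ℝ) 1 := h.ac.ae_le h0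
  rw [← h.law i] at h1
  exact ae_of_ae_map (h.meas i).aemeasurable h1

/-- The assumptions of the theorem imply the bounded model. -/
lemma exists_boundedModel [NeZero d] {Y : ℕ → Ω → ℝ} (hX : ∀ i, Measurable (X i))
    (hε : ∀ i, Measurable (ε i)) {c : ℝ} {m : Fin d → ℝ → ℝ} {sig : (Fin d → ℝ) → ℝ} {K : ℝ → ℝ}
    (hmodel : AdditiveModel P X Y ε c m sig) (hsmooth : SmoothComponents m)
    (hnoise : WhiteNoise P X ε) (hscale : RegularScale sig) (hdensity : RegularDensity P X f)
    (hkernel : IsSmoothingKernel K) :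
    ∃ cf Cf S Λ B C : ℝ, BoundedModel P X ε (designLaw f) (fun x => f (clamp x))
      (fun x => sig (clamp x)) (fun α t => m α (clampOne t)) K cf Cf S Λ B C ∧
      ∀ α, ∀ t ∈ Icc (0 : ℝ) 1, cf ≤ marginalDensity f α t ∧ marginalDensity f α t ≤ Cf := by
  obtain ⟨cf, Cf, hd, hfb, hmar⟩ := hdensity.exists_design hX
  obtain ⟨cσ, hcσ, Cσ, hσ⟩ := hscale.bounds
  obtain ⟨Λ, hΛ⟩ := hsmooth.exists_lipschitz
  obtain ⟨C, hC⟩ := hkernel.exists_bound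
  have hcont : ∀ α, ContinuousOn (m α) (Icc 0 1) := fun α => by
    refine LipschitzOnWith.continuousOn (K := Λ.toNNReal) (LipschitzOnWith.of_dist_le_mul
      fun t ht t' ht' => ?_)
    rw [Real.dist_eq, Real.dist_eq]
    refine (hΛ α t ht t' ht').trans ?_
    gcongr
    exact Real.le_coe_toNNReal Λ
  have hmm : ∀ α, Measurable fun t => m α (clampOne t) := fun α =>
    ((hcont α).comp_continuous continuous_clampOne clampOne_mem).measurable
  have hbd : ∀ α t, |m α (clampOne t)| ≤ (∑ β, |m β 0|) + |Λ| := fun α t => by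
    have h1 := hΛ α (clampOne t) (clampOne_mem t) 0 (by norm_num)
    have h2 : |clampOne t - 0| ≤ 1 := by
      rw [sub_zero, abs_of_nonneg (clampOne_mem t).1]; exact (clampOne_mem t).2
    have h3 : |m α 0| ≤ ∑ β, |m β 0| :=
      Finset.single_le_sum (f := fun β => |m β 0|) (fun _ _ => abs_nonneg _) (Finset.mem_univ α)
    have h4 : Λ * |clampOne t - 0| ≤ |Λ| * 1 :=
      mul_le_mul (le_abs_self Λ) h2 (abs_nonneg _) (abs_nonneg _)
    calc |m α (clampOne t)| = |m α (clampOne t) - m α 0 + m α 0| := by rw [sub_add_cancel]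
      _ ≤ _ := (abs_add_le _ _).trans (by linarith)
  refine ⟨cf, Cf, Cσ, Λ, (∑ β, |m β 0|) + |Λ|, C, ⟨hd, hε, hnoise.secondOrderNoise hX hε hd.law,
    (continuous_comp_clamp hdensity.continuousOn).measurable, rfl,
    fun x => hd.pos.le.trans (hfb _ (clamp_mem x)).1, fun x => (hfb _ (clamp_mem x)).2,
    (continuous_comp_clamp hscale.continuousOn).measurable, fun x => ?_, hmm, hbd, ?_, ?_, hC⟩,
    hmar⟩
  · have := hσ _ (clamp_mem x)
    rw [abs_of_nonneg (hcσ.le.trans this.1)]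
    exact this.2
  · intro α t ht t' ht'
    simp only [clampOne_eq ht, clampOne_eq ht']
    exact hΛ α t ht t' ht'
  · intro α
    rw [← hd.integral_comp (g := fun x => m α (clampOne (x α)))
      ((hmm α).comp (measurable_pi_apply α)) 0, ← hmodel.identifiable 0 α]
    refine integral_congr_ae ?_
    filter_upwards [hd.ae_mem_cube 0] with ω hω
    rw [clampOne_eq ⟨hω.1 α, hω.2 α⟩]

/-- Uniform closeness of the backfitted estimator and the oracle smoother. -/
theorem isLittleOP_spbk_sub_oracleSmoother [NeZero d] {Y : ℕ → Ω → ℝ} (hX : ∀ i, Measurable (X i))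
    (hε : ∀ i, Measurable (ε i)) {c : ℝ} {m : Fin d → ℝ → ℝ} {sig : (Fin d → ℝ) → ℝ} {K : ℝ → ℝ}
    {h : ℕ → ℝ} {N : ℕ → ℕ}
    (hmodel : AdditiveModel P X Y ε c m sig) (hsmooth : SmoothComponents m)
    (hmixing : GeometricallyMixing P X ε)
    (hnoise : WhiteNoise P X ε) (hscale : RegularScale sig) (hdensity : RegularDensity P X f)
    (hkernel : IsSmoothingKernel K) (hbandwidth : BandwidthOrder h) (hknots : KnotOrder N)
    {lam : (n : ℕ) → Ω → ℝ × (Fin d → Fin (N n) → ℝ)}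
    (hlam : ∀ n ω, IsLeastSquares (fun α => splineBasis (P.map fun ω => X 0 ω α) (N n)) n
      (fun i => X i ω) (fun i => Y i ω) (lam n ω)) :
    IsLittleOP P
      (fun n ω => ⨆ x₁ ∈ Icc (0 : ℝ) 1, ENNReal.ofReal
        |spbk K (h n) (fun α => splineBasis (P.map fun ω => X 0 ω α) (N n)) n (fun i => X i ω)
            (fun i => Y i ω) (lam n ω) x₁
          - oracleSmoother K (h n) c m n (fun i => X i ω) (fun i => Y i ω) x₁|)
      (fun n => (n : ℝ) ^ (-(2 / 5) : ℝ)) := by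
  obtain ⟨cf, Cf, S, Λ, B, C, hb, -⟩ := exists_boundedModel hX hε hmodel hsmooth hnoise hscale
    hdensity hkernel
  intro τ hτ
  rw [ENNReal.tendsto_nhds_zero]
  intro e he
  obtain ⟨e', he', he'e⟩ : ∃ e' : ℝ, 0 < e' ∧ ENNReal.ofReal e' ≤ e := by
    rcases eq_or_ne e ⊤ with rfl | htop
    · exact ⟨1, one_pos, le_top⟩
    · exact ⟨e.toReal, ENNReal.toReal_pos he.ne' htop, (ENNReal.ofReal_toReal htop).le⟩
  have hd0 : (0 : ℝ) < 4 * d + 7 := by positivity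
  have key := hb.eventually_fails_uniform hdensity.modulus hmixing hbandwidth hknots hτ
    (δ := e' / (4 * d + 7)) (by positivity)
  have hresp : ∀ᵐ ω ∂P, ∀ i, Y i ω = c + (∑ α, m α (X i ω α)) + sig (X i ω) * ε i ω :=
    ae_all_iff.2 hmodel.response
  have hIco := hb.design.ae_mem_Ico
  filter_upwards [key] with n hn
  refine le_trans ?_ he'e
  rw [mul_div_cancel₀ _ hd0.ne'] at hn
  -- The event involves an uncountable supremum and need not be measurable; an almost sure inclusion
  -- suffices for outer probabilities.
  refine le_trans (measure_mono_ae ?_) hn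
  filter_upwards [hresp, hIco] with ω hω hI hbad
  have hcube : ∀ i, X i ω ∈ Icc (0 : Fin d → ℝ) 1 := fun i =>
    ⟨fun α => (hI i α).1, fun α => (hI i α).2.le⟩
  have hc1 : ∀ i α, clampOne (X i ω α) = X i ω α := fun i α =>
    clampOne_eq ⟨(hI i α).1, (hI i α).2.le⟩
  intro hgood
  refine absurd hbad (not_lt.2 (iSup₂_le fun x hx => ENNReal.ofReal_le_ofReal ?_))
  have := hgood c (fun i => Y i ω) (lam n ω) (hlam n ω) (fun i _ α => hI i α)
    (fun i _ => by simp only [hc1, clamp_eq (hcube i)]; exact hω i) x hx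
  have e1 : oracleSmoother K (h n) c (fun α t => m α (clampOne t)) n (fun i => X i ω)
      (fun i => Y i ω) x = oracleSmoother K (h n) c m n (fun i => X i ω) (fun i => Y i ω) x := by
    unfold oracleSmoother oracleResponse
    simp only [hc1]
  rwa [e1] at this

end Bridge

/-! ### Characteristic functions of sums of mixing blocks -/

section CharBlocks

variable {Ω E : Type*} [mΩ : MeasurableSpace Ω] [MeasurableSpace E] {P : Measure Ω}
  [IsProbabilityMeasure P]

/-- The characteristic function of `W` at one. -/
def charOne (P : Measure Ω) (W : Ω → ℝ) : ℂ := ∫ ω, Complex.exp (Complex.I * W ω) ∂P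

omit mΩ in
lemma norm_exp_I_mul (u : ℝ) : ‖Complex.exp (Complex.I * u)‖ = 1 := by
  rw [mul_comm, Complex.norm_exp_ofReal_mul_I]

lemma integrable_exp_I_mul {W : Ω → ℝ} (hW : Measurable W) :
    Integrable (fun ω => Complex.exp (Complex.I * W ω)) P :=
  Integrable.of_bound (μ := P) (by fun_prop : Measurable fun ω => Complex.exp (Complex.I * W ω)).aestronglyMeasurable
    1 (ae_of_all _ fun ω => (norm_exp_I_mul _).le)

lemma norm_charOne_le (W : Ω → ℝ) : ‖charOne P W‖ ≤ 1 := by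
  refine (norm_integral_le_integral_norm _).trans ?_
  simp

lemma integrable_cos {W : Ω → ℝ} (hW : Measurable W) : Integrable (fun ω => Real.cos (W ω)) P :=
  Integrable.of_bound (μ := P) (Real.measurable_cos.comp hW).aestronglyMeasurable 1
    (ae_of_all _ fun _ => Real.abs_cos_le_one _)

lemma integrable_sin {W : Ω → ℝ} (hW : Measurable W) : Integrable (fun ω => Real.sin (W ω)) P :=
  Integrable.of_bound (μ := P) (Real.measurable_sin.comp hW).aestronglyMeasurable 1
    (ae_of_all _ fun _ => Real.abs_sin_le_one _)

lemma charOne_eq {W : Ω → ℝ} (hW : Measurable W) :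
    charOne P W = (∫ ω, Real.cos (W ω) ∂P : ℝ) + (∫ ω, Real.sin (W ω) ∂P : ℝ) * Complex.I := by
  have e : ∀ ω, Complex.exp (Complex.I * W ω)
      = ((Real.cos (W ω) : ℝ) : ℂ) + ((Real.sin (W ω) : ℝ) : ℂ) * Complex.I := fun ω => by
    rw [mul_comm, Complex.exp_mul_I, Complex.ofReal_cos, Complex.ofReal_sin]
  simp only [charOne, e]
  rw [integral_add (integrable_cos hW).ofReal ((integrable_sin hW).ofReal.mul_const _),
    integral_mul_const, integral_complex_ofReal, integral_complex_ofReal]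

/-- Expanding into sines and cosines leaves four covariances of functions bounded by one, each at
most 4a. -/
lemma MixBound.norm_charOne_add_sub_le {Z : ℕ → Ω → E} (hZ : ∀ i, Measurable (Z i))
    {q : ℕ} {a : ℝ} (hmix : MixBound P Z q a) {s t : ℕ} (hst : s + q ≤ t) {U V : Ω → ℝ}
    (hU : Measurable[past Z s] U) (hV : Measurable[future Z t] V) :
    ‖charOne P (fun ω => U ω + V ω) - charOne P U * charOne P V‖ ≤ 16 * a := by
  have hU' : Measurable U := hU.mono (past_le hZ s) le_rfl
  have hV' : Measurable V := hV.mono (future_le hZ t) le_rfl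
  have cov : ∀ u v : ℝ → ℝ, Measurable u → Measurable v → (∀ x, |u x| ≤ 1) → (∀ x, |v x| ≤ 1) →
      |∫ ω, u (U ω) * v (V ω) ∂P - (∫ ω, u (U ω) ∂P) * ∫ ω, v (V ω) ∂P| ≤ 4 * a := by
    intro u v hu hv hu1 hv1
    have := hmix.abs_cov_le hZ hst (hu.comp hU) (hv.comp hV) (A := 1) (B := 1)
      (fun ω => hu1 _) (fun ω => hv1 _)
    simpa using this
  have c1 := cov _ _ Real.measurable_cos Real.measurable_cos Real.abs_cos_le_one
    Real.abs_cos_le_one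
  have c2 := cov _ _ Real.measurable_sin Real.measurable_sin Real.abs_sin_le_one
    Real.abs_sin_le_one
  have c3 := cov _ _ Real.measurable_sin Real.measurable_cos Real.abs_sin_le_one
    Real.abs_cos_le_one
  have c4 := cov _ _ Real.measurable_cos Real.measurable_sin Real.abs_cos_le_one
    Real.abs_sin_le_one
  have int : ∀ u v : ℝ → ℝ, Measurable u → Measurable v → (∀ x, |u x| ≤ 1) → (∀ x, |v x| ≤ 1) →
      Integrable (fun ω => u (U ω) * v (V ω)) P := by
    intro u v hu hv hu1 hv1
    refine Integrable.of_bound (μ := P) ((hu.comp hU').mul (hv.comp hV')).aestronglyMeasurable 1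
      (ae_of_all _ fun ω => ?_)
    rw [norm_mul]
    exact mul_le_one₀ (hu1 _) (norm_nonneg _) (hv1 _)
  have i1 := int _ _ Real.measurable_cos Real.measurable_cos Real.abs_cos_le_one
    Real.abs_cos_le_one
  have i2 := int _ _ Real.measurable_sin Real.measurable_sin Real.abs_sin_le_one
    Real.abs_sin_le_one
  have i3 := int _ _ Real.measurable_sin Real.measurable_cos Real.abs_sin_le_one
    Real.abs_cos_le_one
  have i4 := int _ _ Real.measurable_cos Real.measurable_sin Real.abs_cos_le_one
    Real.abs_sin_le_one
  rw [charOne_eq (W := fun ω => U ω + V ω) (hU'.add hV'), charOne_eq hU', charOne_eq hV']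
  simp only [Real.cos_add, Real.sin_add]
  rw [integral_sub i1 i2, integral_add i3 i4]
  set cc := ∫ ω, Real.cos (U ω) * Real.cos (V ω) ∂P
  set ss := ∫ ω, Real.sin (U ω) * Real.sin (V ω) ∂P
  set sc := ∫ ω, Real.sin (U ω) * Real.cos (V ω) ∂P
  set cs := ∫ ω, Real.cos (U ω) * Real.sin (V ω) ∂P
  set cu := ∫ ω, Real.cos (U ω) ∂P
  set su := ∫ ω, Real.sin (U ω) ∂P
  set cv := ∫ ω, Real.cos (V ω) ∂P
  set sv := ∫ ω, Real.sin (V ω) ∂P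
  have e : ((cc - ss : ℝ) : ℂ) + ((sc + cs : ℝ) : ℂ) * Complex.I
      - ((cu : ℂ) + (su : ℂ) * Complex.I) * ((cv : ℂ) + (sv : ℂ) * Complex.I)
      = (((cc - cu * cv) - (ss - su * sv) : ℝ) : ℂ)
        + (((sc - su * cv) + (cs - cu * sv) : ℝ) : ℂ) * Complex.I := by
    push_cast
    linear_combination (-(su : ℂ) * sv) * Complex.I_sq
  rw [e]
  refine (norm_add_le _ _).trans ?_
  rw [norm_mul, Complex.norm_I, mul_one, Complex.norm_real, Complex.norm_real, Real.norm_eq_abs,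
    Real.norm_eq_abs]
  have h1 := abs_sub (cc - cu * cv) (ss - su * sv)
  have h2 := abs_add_le (sc - su * cv) (cs - cu * sv)
  linarith

/-- The characteristic function of a sum of separated blocks is close to a power. -/
lemma MixBound.norm_charOne_sum_sub_pow_le {Z : ℕ → Ω → E} (hZ : ∀ i, Measurable (Z i))
    {q : ℕ} {a : ℝ} (ha : 0 ≤ a) (hmix : MixBound P Z q a) {W : ℕ → Ω → ℝ} {u v : ℕ → ℕ}
    (hv : Monotone v) (huv : ∀ j, v j + q ≤ u (j + 1))
    (hWp : ∀ j, Measurable[past Z (v j)] (W j)) (hWf : ∀ j, Measurable[future Z (u j)] (W j))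
    {z : ℂ} (hz : ‖z‖ ≤ 1) {b : ℝ} (hb : ∀ j, ‖charOne P (W j) - z‖ ≤ b) (k : ℕ) :
    ‖charOne P (fun ω => ∑ j ∈ Finset.range k, W j ω) - z ^ k‖ ≤ k * (16 * a + b) := by
  have hb0 : 0 ≤ b := (norm_nonneg _).trans (hb 0)
  induction k with
  | zero => simp [charOne]
  | succ k ih =>
    simp only [Finset.sum_range_succ]
    set S : Ω → ℝ := fun ω => ∑ j ∈ Finset.range k, W j ω with hS
    -- Before the first block the sum is empty with characteristic function one, and nothing has to
    -- be factorised; afterwards all earlier blocks end at least q steps before the new one.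
    have h1 : ‖charOne P (fun ω => S ω + W k ω) - charOne P S * charOne P (W k)‖ ≤ 16 * a := by
      rcases k with - | k
      · simp [hS, charOne]
        positivity
      · refine hmix.norm_charOne_add_sub_le hZ (huv k) ?_ (hWf (k + 1))
        refine Finset.measurable_fun_sum _ fun j hj => (hWp j).mono ?_ le_rfl
        exact iSup₂_le fun r hr => comap_le_past Z
          (le_trans hr (hv (by have := Finset.mem_range.1 hj; omega)))
    have h2 : ‖charOne P S * (charOne P (W k) - z)‖ ≤ b := by
      rw [norm_mul]
      exact (mul_le_of_le_one_left (norm_nonneg _) (norm_charOne_le S)).trans (hb k)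
    have h3 : ‖z * (charOne P S - z ^ k)‖ ≤ k * (16 * a + b) := by
      rw [norm_mul]
      exact (mul_le_of_le_one_left (norm_nonneg _) hz).trans ih
    have e : charOne P (fun ω => S ω + W k ω) - z ^ (k + 1)
        = (charOne P (fun ω => S ω + W k ω) - charOne P S * charOne P (W k))
          + charOne P S * (charOne P (W k) - z) + z * (charOne P S - z ^ k) := by ring
    rw [e]
    refine (norm_add₃_le).trans ?_
    push_cast
    linarith

omit mΩ in
-- For |u| ≤ 1 the cubic remainder is below |u|^{5/2}; for larger |u| all terms are dominated by u²,
-- hence by |u|^{5/2}. The exponent 5/2 is what the condition δ > 1/2 makes available.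
lemma norm_exp_sub_taylor_le (u : ℝ) :
    ‖Complex.exp (Complex.I * u) - (1 + Complex.I * u - (u : ℂ) ^ 2 / 2)‖
      ≤ 4 * |u| ^ (5 / 2 : ℝ) := by
  rcases le_total |u| 1 with hu | hu
  · have hn : ‖Complex.I * (u : ℂ)‖ = |u| := by simp
    have h := Complex.exp_bound (x := Complex.I * u) (hn.trans_le hu) (n := 3) (by norm_num)
    have e : ∑ m ∈ Finset.range 3, (Complex.I * (u : ℂ)) ^ m / (m.factorial : ℂ)
        = 1 + Complex.I * u - (u : ℂ) ^ 2 / 2 := by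
      simp [Finset.sum_range_succ, Nat.factorial, mul_pow]
      ring
    rw [e, hn] at h
    refine h.trans ?_
    have h1 : |u| ^ 3 ≤ |u| ^ (5 / 2 : ℝ) := by
      rcases (abs_nonneg u).eq_or_lt with h0 | h0
      · rw [← h0]; norm_num
      · rw [← Real.rpow_natCast]
        exact Real.rpow_le_rpow_of_exponent_ge h0 hu (by norm_num)
    have h2 : (0 : ℝ) ≤ |u| ^ 3 := by positivity
    norm_num [Nat.factorial]
    linarith
  · have h1 : u ^ 2 ≤ |u| ^ (5 / 2 : ℝ) := by
      rw [← sq_abs, ← Real.rpow_natCast]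
      exact Real.rpow_le_rpow_of_exponent_le hu (by norm_num)
    have h2 : ‖1 + Complex.I * u - (u : ℂ) ^ 2 / 2‖ ≤ 1 + |u| + u ^ 2 / 2 := by
      refine (norm_sub_le _ _).trans (add_le_add ((norm_add_le _ _).trans ?_) ?_)
      · simp
      · simp
    have h3 := norm_sub_le (Complex.exp (Complex.I * u)) (1 + Complex.I * u - (u : ℂ) ^ 2 / 2)
    rw [norm_exp_I_mul] at h3
    have h4 : |u| ≤ u ^ 2 := by rw [← sq_abs]; nlinarith
    linarith

/-- Comparison of a characteristic function with that of the normal law of the same variance. -/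
lemma norm_charOne_sub_exp_le {W : Ω → ℝ} (hW : Measurable W) (h1 : ∫ ω, W ω ∂P = 0)
    (hL : MemLp W 2 P) (h2 : ∫ ω, W ω ^ 2 ∂P ≤ 2)
    (h52 : Integrable (fun ω => |W ω| ^ (5 / 2 : ℝ)) P) :
    ‖charOne P W - (Real.exp (-(∫ ω, W ω ^ 2 ∂P) / 2) : ℝ)‖
      ≤ 4 * ∫ ω, |W ω| ^ (5 / 2 : ℝ) ∂P + (∫ ω, W ω ^ 2 ∂P) ^ 2 := by
  set v := ∫ ω, W ω ^ 2 ∂P with hv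
  have hv0 : 0 ≤ v := integral_nonneg fun ω => sq_nonneg _
  have i1 : Integrable (fun ω => ((W ω : ℝ) : ℂ)) P := (hL.integrable one_le_two).ofReal
  have i2 : Integrable (fun ω => ((W ω ^ 2 : ℝ) : ℂ)) P := hL.integrable_sq.ofReal
  have i3 : Integrable (fun ω => 1 + Complex.I * (W ω : ℂ)) P :=
    (integrable_const _).add (i1.const_mul _)
  have i4 : Integrable (fun ω => ((W ω ^ 2 : ℝ) : ℂ) / 2) P := i2.div_const _
  have e : charOne P W - ((1 - v / 2 : ℝ) : ℂ)
      = ∫ ω, (Complex.exp (Complex.I * W ω) - (1 + Complex.I * W ω - (W ω : ℂ) ^ 2 / 2)) ∂P := by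
    have e0 : ∀ ω, ((W ω : ℝ) : ℂ) ^ 2 = ((W ω ^ 2 : ℝ) : ℂ) := fun ω => by push_cast; rfl
    simp only [e0]
    have i5 : Integrable (fun ω => 1 + Complex.I * (W ω : ℂ) - ((W ω ^ 2 : ℝ) : ℂ) / 2) P :=
      i3.sub i4
    rw [integral_sub (integrable_exp_I_mul hW) i5, integral_sub i3 i4,
      integral_add (integrable_const _) (i1.const_mul _), integral_const_mul, integral_div,
      integral_complex_ofReal, integral_complex_ofReal, h1, ← hv]
    simp [charOne]
  have h3 : ‖charOne P W - ((1 - v / 2 : ℝ) : ℂ)‖ ≤ 4 * ∫ ω, |W ω| ^ (5 / 2 : ℝ) ∂P := by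
    rw [e, ← integral_const_mul]
    exact norm_integral_le_of_norm_le (h52.const_mul 4) (ae_of_all _ fun ω =>
      norm_exp_sub_taylor_le (W ω))
  have h4 : ‖((1 - v / 2 : ℝ) : ℂ) - (Real.exp (-v / 2) : ℝ)‖ ≤ v ^ 2 := by
    rw [← Complex.ofReal_sub, Complex.norm_real, Real.norm_eq_abs, abs_sub_comm]
    have h5 := Real.abs_exp_sub_one_sub_id_le (x := -v / 2)
      (by rw [abs_le]; constructor <;> linarith)
    have e' : Real.exp (-v / 2) - (1 - v / 2) = Real.exp (-v / 2) - 1 - -v / 2 := by ring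
    rw [e']
    refine h5.trans ?_
    nlinarith [sq_nonneg v]
  calc _ = ‖(charOne P W - ((1 - v / 2 : ℝ) : ℂ))
        + (((1 - v / 2 : ℝ) : ℂ) - (Real.exp (-v / 2) : ℝ))‖ := by rw [sub_add_sub_cancel]
    _ ≤ _ := (norm_add_le _ _).trans (add_le_add h3 h4)

/-- The map u ↦ exp(iu) is 1-Lipschitz, so variables close in L² have close characteristic
functions. This disposes of the small blocks. -/
lemma norm_charOne_sub_le {U V : Ω → ℝ} (hU : Measurable U) (hV : Measurable V)
    (hL : MemLp (fun ω => U ω - V ω) 2 P) :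
    ‖charOne P U - charOne P V‖ ≤ √(∫ ω, (U ω - V ω) ^ 2 ∂P) := by
  have h1 : ∀ ω, ‖Complex.exp (Complex.I * U ω) - Complex.exp (Complex.I * V ω)‖
      ≤ |U ω - V ω| := fun ω => by
    have e : Complex.exp (Complex.I * U ω) - Complex.exp (Complex.I * V ω)
        = Complex.exp (Complex.I * V ω)
          * (Complex.exp (Complex.I * ((U ω - V ω : ℝ) : ℂ)) - 1) := by
      rw [mul_sub, ← Complex.exp_add, mul_one]
      congr 2
      push_cast
      ring
    rw [e, norm_mul, norm_exp_I_mul, one_mul]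
    exact Real.norm_exp_I_mul_ofReal_sub_one_le
  rw [charOne, charOne, ← integral_sub (integrable_exp_I_mul hU) (integrable_exp_I_mul hV)]
  refine (norm_integral_le_of_norm_le (hL.integrable one_le_two).abs (ae_of_all _ h1)).trans ?_
  refine Real.le_sqrt_of_sq_le ?_
  have h2 := variance_nonneg (fun ω => |U ω - V ω|) P
  have hA : MemLp (fun ω => |U ω - V ω|) 2 P := hL.abs
  rw [variance_eq_sub hA] at h2
  simp only [Pi.pow_apply, sq_abs] at h2
  linarith

end CharBlocks

/-! ### Central limit theorem for triangular arrays of weighted noise -/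

section ArrayCLT

variable {Ω : Type*} [mΩ : MeasurableSpace Ω] {P : Measure Ω} [IsProbabilityMeasure P] {d : ℕ}
  {X : ℕ → Ω → Fin d → ℝ} {ε : ℕ → Ω → ℝ} {μ : Measure (Fin d → ℝ)} {g : (Fin d → ℝ) → ℝ}

/-- Convexity gives the cardinality to the power 3/2; it is rounded up to 2 to stay with integer
exponents. -/
lemma abs_sum_rpow_le {ι : Type*} (s : Finset ι) (x : ι → ℝ) :
    |∑ i ∈ s, x i| ^ (5 / 2 : ℝ) ≤ (s.card : ℝ) ^ 2 * ∑ i ∈ s, |x i| ^ (5 / 2 : ℝ) := by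
  have h1 : |∑ i ∈ s, x i| ^ (5 / 2 : ℝ) ≤ (∑ i ∈ s, |x i|) ^ (5 / 2 : ℝ) :=
    Real.rpow_le_rpow (abs_nonneg _) (Finset.abs_sum_le_sum_abs _ _) (by norm_num)
  refine h1.trans ((Real.rpow_sum_le_const_mul_sum_rpow s x (by norm_num)).trans ?_)
  have h0 : 0 ≤ ∑ i ∈ s, |x i| ^ (5 / 2 : ℝ) :=
    Finset.sum_nonneg fun i _ => Real.rpow_nonneg (abs_nonneg _) _
  refine mul_le_mul_of_nonneg_right ?_ h0
  rcases s.card.eq_zero_or_pos with hs | hs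
  · rw [hs]; norm_num
  · rw [← Real.rpow_natCast]
    exact Real.rpow_le_rpow_of_exponent_le (by exact_mod_cast hs) (by norm_num)

lemma measurable_noiseTerm (hX : ∀ i, Measurable (X i)) (hε : ∀ i, Measurable (ε i))
    (hg : Measurable g) (i : ℕ) : Measurable fun ω => g (X i ω) * ε i ω :=
  (hg.comp (hX i)).mul (hε i)

lemma integrable_abs_sum_rpow (hX : ∀ i, Measurable (X i)) (hε : ∀ i, Measurable (ε i))
    (hg : Measurable g) (hi : ∀ i, Integrable (fun ω => |g (X i ω) * ε i ω| ^ (5 / 2 : ℝ)) P)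
    (s : Finset ℕ) :
    Integrable (fun ω => |∑ i ∈ s, g (X i ω) * ε i ω| ^ (5 / 2 : ℝ)) P := by
  have hm : Measurable fun ω => |∑ i ∈ s, g (X i ω) * ε i ω| ^ (5 / 2 : ℝ) :=
    (Finset.measurable_fun_sum s fun i _ => measurable_noiseTerm hX hε hg i).abs.pow_const _
  refine Integrable.mono' ((integrable_finsetSum s fun i _ => hi i).const_mul ((s.card : ℝ) ^ 2))
    hm.aestronglyMeasurable (ae_of_all _ fun ω => ?_)
  rw [Real.norm_of_nonneg (Real.rpow_nonneg (abs_nonneg _) _)]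
  exact abs_sum_rpow_le s _

lemma integral_abs_sum_rpow_le (hX : ∀ i, Measurable (X i)) (hε : ∀ i, Measurable (ε i))
    (hg : Measurable g) (hi : ∀ i, Integrable (fun ω => |g (X i ω) * ε i ω| ^ (5 / 2 : ℝ)) P)
    {τ : ℝ} (hτ : ∀ i, ∫ ω, |g (X i ω) * ε i ω| ^ (5 / 2 : ℝ) ∂P ≤ τ) (s : Finset ℕ) :
    ∫ ω, |∑ i ∈ s, g (X i ω) * ε i ω| ^ (5 / 2 : ℝ) ∂P ≤ (s.card : ℝ) ^ 3 * τ := by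
  calc _ ≤ ∫ ω, (s.card : ℝ) ^ 2 * ∑ i ∈ s, |g (X i ω) * ε i ω| ^ (5 / 2 : ℝ) ∂P :=
        integral_mono (integrable_abs_sum_rpow hX hε hg hi s)
          ((integrable_finsetSum s fun i _ => hi i).const_mul _) fun ω => abs_sum_rpow_le s _
    _ = (s.card : ℝ) ^ 2 * ∑ i ∈ s, ∫ ω, |g (X i ω) * ε i ω| ^ (5 / 2 : ℝ) ∂P := by
        rw [integral_const_mul, integral_finsetSum s fun i _ => hi i]
    _ ≤ (s.card : ℝ) ^ 2 * (s.card * τ) := by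
        gcongr
        refine (Finset.sum_le_card_nsmul s _ τ fun i _ => hτ i).trans (by simp)
    _ = _ := by ring

/-- Big blocks of length p separated by gaps of length q: the k blocks factorise by mixing, each is
compared with the normal law of variance p times E g², and the remaining n - kp terms are discarded
in L². -/
lemma SecondOrderNoise.norm_charOne_noiseSum_sub_le (hN : SecondOrderNoise P X μ ε)
    (hX : ∀ i, Measurable (X i)) (hε : ∀ i, Measurable (ε i)) {q : ℕ} {a : ℝ} (ha : 0 ≤ a)
    (hmix : MixBound P (fun i ω => (X i ω, ε i ω)) q a)
    (hg : Measurable g) {M : ℝ} (hM : ∀ x, |g x| ≤ M)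
    (hi : ∀ i, Integrable (fun ω => |g (X i ω) * ε i ω| ^ (5 / 2 : ℝ)) P)
    {τ : ℝ} (hτ : ∀ i, ∫ ω, |g (X i ω) * ε i ω| ^ (5 / 2 : ℝ) ∂P ≤ τ)
    {n p k : ℕ} (hk : k * (p + q) ≤ n) (hp : p * ∫ x, g x ^ 2 ∂μ ≤ 2) :
    ‖charOne P (fun ω => ∑ i ∈ Finset.range n, g (X i ω) * ε i ω)
        - (Real.exp (-(k * p * ∫ x, g x ^ 2 ∂μ) / 2) : ℝ)‖
      ≤ √((n - k * p) * ∫ x, g x ^ 2 ∂μ)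
        + k * (16 * a + (4 * (p ^ 3 * τ) + (p * ∫ x, g x ^ 2 ∂μ) ^ 2)) := by
  set v := ∫ x, g x ^ 2 ∂μ with hv
  have hm := measurable_noiseTerm hX hε hg
  have hL := hN.memLp_mul hX hg hM
  set I : ℕ → Finset ℕ := fun j => Finset.Ico (j * (p + q)) (j * (p + q) + p) with hI
  have hcard : ∀ j, (I j).card = p := fun j => by simp [hI]
  have hdisj : ((Finset.range k : Finset ℕ) : Set ℕ).PairwiseDisjoint I := by
    have key : ∀ j j', j < j' → Disjoint (I j) (I j') := fun j j' hjj => by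
      rw [Finset.disjoint_left]
      intro i h1 h2
      have h1 := (Finset.mem_Ico.1 h1).2
      have h2 := (Finset.mem_Ico.1 h2).1
      have h3 : (j + 1) * (p + q) ≤ j' * (p + q) := Nat.mul_le_mul_right _ hjj
      rw [add_mul] at h3
      omega
    intro j _ j' _ hjj
    rcases lt_or_gt_of_ne hjj with h | h
    · exact key j j' h
    · exact (key j' j h).symm
  set U := (Finset.range k).biUnion I with hU
  have hUc : U.card = k * p := by
    rw [hU, Finset.card_biUnion hdisj]
    simp [hcard]
  have hUn : U ⊆ Finset.range n := by
    intro i hi'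
    obtain ⟨j, hj, hij⟩ := Finset.mem_biUnion.1 hi'
    have h1 := (Finset.mem_Ico.1 hij).2
    have h3 : (j + 1) * (p + q) ≤ k * (p + q) := Nat.mul_le_mul_right _ (Finset.mem_range.1 hj)
    rw [add_mul] at h3
    rw [Finset.mem_range]
    omega
  set W : ℕ → Ω → ℝ := fun j ω => ∑ i ∈ I j, g (X i ω) * ε i ω with hW
  have hWm : ∀ j, Measurable (W j) := fun j => Finset.measurable_fun_sum _ fun i _ => hm i
  have hWL : ∀ j, MemLp (W j) 2 P := fun j => memLp_finsetSum _ fun i _ => hL i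
  have hW0 : ∀ j, ∫ ω, W j ω ∂P = 0 := fun j => by
    simp only [hW]
    rw [integral_finsetSum _ fun i _ => (hL i).integrable one_le_two]
    exact Finset.sum_eq_zero fun i _ => hN.mean i g hg ⟨M, hM⟩
  -- Every block has the same variance by whiteness and the common marginal law, so the product of
  -- block approximations is a genuine power although the process need not be stationary.
  have hW2 : ∀ j, ∫ ω, W j ω ^ 2 ∂P = p * v := fun j => by
    simp only [hW]
    rw [hN.integral_sum_sq hX hg hM, hcard]
  have hsub : ∀ m : MeasurableSpace Ω, ∀ i,
      MeasurableSpace.comap (fun ω => (X i ω, ε i ω)) inferInstance ≤ m →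
      Measurable[m] fun ω => g (X i ω) * ε i ω := fun m i hle => by
    have h1 : Measurable fun z : (Fin d → ℝ) × ℝ => g z.1 * z.2 := by fun_prop
    exact (h1.comp (comap_measurable _)).mono hle le_rfl
  have hz : ‖((Real.exp (-(p * v) / 2) : ℝ) : ℂ)‖ ≤ 1 := by
    rw [Complex.norm_real, Real.norm_of_nonneg (Real.exp_pos _).le, Real.exp_le_one_iff]
    have : 0 ≤ v := integral_nonneg fun _ => sq_nonneg _
    have : 0 ≤ p * v := by positivity
    linarith
  have hb : ∀ j, ‖charOne P (W j) - (Real.exp (-(p * v) / 2) : ℝ)‖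
      ≤ 4 * (p ^ 3 * τ) + (p * v) ^ 2 := fun j => by
    have h1 := norm_charOne_sub_exp_le (hWm j) (hW0 j) (hWL j) (by rw [hW2]; exact hp)
      (integrable_abs_sum_rpow hX hε hg hi (I j))
    rw [hW2] at h1
    refine h1.trans ?_
    have h2 := integral_abs_sum_rpow_le hX hε hg hi hτ (I j)
    rw [hcard] at h2
    gcongr
  have hblock := hmix.norm_charOne_sum_sub_pow_le (fun i => (hX i).prodMk (hε i)) ha (W := W)
    (u := fun j => j * (p + q)) (v := fun j => j * (p + q) + p)
    (fun j j' hjj => Nat.add_le_add_right (Nat.mul_le_mul_right _ hjj) _)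
    (fun j => by rw [add_mul]; omega)
    (fun j => Finset.measurable_fun_sum _ fun i hi' => hsub _ i
      (comap_le_past (fun i ω => (X i ω, ε i ω)) (Finset.mem_Ico.1 hi').2.le))
    (fun j => Finset.measurable_fun_sum _ fun i hi' => hsub _ i
      (comap_le_future (fun i ω => (X i ω, ε i ω)) (Finset.mem_Ico.1 hi').1)) hz hb k
  have hpow : ((Real.exp (-(p * v) / 2) : ℝ) : ℂ) ^ k = (Real.exp (-(k * p * v) / 2) : ℝ) := by
    rw [← Complex.ofReal_pow, ← Real.exp_nat_mul]
    congr 2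
    ring
  rw [hpow] at hblock
  have hrest : ∀ ω, ∑ i ∈ Finset.range n, g (X i ω) * ε i ω
      - ∑ j ∈ Finset.range k, W j ω = ∑ i ∈ Finset.range n \ U, g (X i ω) * ε i ω := fun ω => by
    rw [← Finset.sum_sdiff hUn, ← Finset.sum_biUnion hdisj, add_sub_cancel_right]
  have hdiff := norm_charOne_sub_le (P := P)
    (U := fun ω => ∑ i ∈ Finset.range n, g (X i ω) * ε i ω)
    (V := fun ω => ∑ j ∈ Finset.range k, W j ω)
    (Finset.measurable_fun_sum _ fun i _ => hm i) (Finset.measurable_fun_sum _ fun j _ => hWm j)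
    (by simp only [hrest]; exact memLp_finsetSum _ fun i _ => hL i)
  simp only [hrest] at hdiff
  rw [hN.integral_sum_sq hX hg hM, Finset.card_sdiff_of_subset hUn, hUc, Finset.card_range,
    Nat.cast_sub (by rw [← hUc]; simpa using Finset.card_le_card hUn)] at hdiff
  push_cast at hdiff
  calc _ = ‖(charOne P (fun ω => ∑ i ∈ Finset.range n, g (X i ω) * ε i ω)
        - charOne P (fun ω => ∑ j ∈ Finset.range k, W j ω))
        + (charOne P (fun ω => ∑ j ∈ Finset.range k, W j ω)
          - (Real.exp (-(k * p * v) / 2) : ℝ))‖ := by rw [sub_add_sub_cancel]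
    _ ≤ _ := (norm_add_le _ _).trans (add_le_add hdiff hblock)

/-- Characteristic functions of weighted noise converge to that of a normal law. -/
theorem SecondOrderNoise.tendsto_charOne (hN : SecondOrderNoise P X μ ε)
    (hX : ∀ i, Measurable (X i)) (hε : ∀ i, Measurable (ε i))
    (hmixing : GeometricallyMixing P X ε) {g : ℕ → (Fin d → ℝ) → ℝ}
    (hg : ∀ n, Measurable (g n)) (hM : ∀ n, ∃ M, ∀ x, |g n x| ≤ M)
    (hi : ∀ n i, Integrable (fun ω => |g n (X i ω) * ε i ω| ^ (5 / 2 : ℝ)) P)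
    {τ : ℕ → ℝ} (hτ : ∀ᶠ n in atTop, ∀ i, ∫ ω, |g n (X i ω) * ε i ω| ^ (5 / 2 : ℝ) ∂P ≤ τ n)
    (hτ0 : Tendsto (fun n => rate n ^ 4 * (n * τ n)) atTop (𝓝 0)) {V : ℝ}
    (hV : Tendsto (fun n : ℕ => n * ∫ x, g n x ^ 2 ∂μ) atTop (𝓝 V)) :
    Tendsto (fun n => charOne P (fun ω => ∑ i ∈ Finset.range n, g n (X i ω) * ε i ω)) atTop
      (𝓝 (Real.exp (-V / 2) : ℝ)) := by
  obtain ⟨q, a, hqa⟩ := hmixing.exists_lag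
  set v : ℕ → ℝ := fun n => ∫ x, g n x ^ 2 ∂μ with hv
  have hv0 : ∀ n, 0 ≤ v n := fun n => integral_nonneg fun _ => sq_nonneg _
  -- Blocks longer than the gaps by the factor ⌈rate n⌉: the gaps then carry a vanishing share of
  -- the variance, while p ≤ 2 rate² keeps the moments of a block under control.
  set p : ℕ → ℕ := fun n => q n * ⌈rate n⌉₊ with hp
  set k : ℕ → ℕ := fun n => n / (p n + q n) with hk
  have hn500 : ∀ n : ℕ, (n : ℝ) = rate n ^ 500 := fun n => by rw [rate_pow]; norm_num
  have hpk : ∀ᶠ n in atTop, 1 ≤ rate n ∧ (p n : ℝ) ≤ 2 * rate n ^ 2 ∧ (k n * p n : ℝ) ≤ n ∧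
      (n - k n * p n : ℝ) ≤ n * (rate n)⁻¹ + 4 * rate n ^ 2 ∧ k n * (p n + q n) ≤ n ∧
      (k n : ℝ) ≤ n := by
    filter_upwards [hqa, eventually_ge_atTop 1] with n hn hn1
    have hr := one_le_rate hn1
    have hq1 : (1 : ℝ) ≤ q n := by exact_mod_cast hn.1
    have hc1 := Nat.le_ceil (rate n)
    have hc2 := (Nat.ceil_lt_add_one (rate_nonneg n)).le
    have hpe : (p n : ℝ) = q n * ⌈rate n⌉₊ := by simp [hp]
    have hp2 : (p n : ℝ) ≤ 2 * rate n ^ 2 := by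
      rw [hpe]
      calc (q n : ℝ) * ⌈rate n⌉₊ ≤ rate n * (2 * rate n) :=
            mul_le_mul hn.2.1 (by linarith) (by positivity) (rate_nonneg n)
        _ = _ := by ring
    have hkn : k n * (p n + q n) ≤ n := Nat.div_mul_le_self _ _
    have hkn' : (k n * (p n + q n) : ℝ) ≤ n := by exact_mod_cast hkn
    have hlt : n < (k n + 1) * (p n + q n) := by
      have := Nat.lt_mul_div_succ n (b := p n + q n) (by omega)
      rw [mul_comm] at this
      exact this
    have hlt' : (n : ℝ) ≤ (k n + 1) * (p n + q n) := by exact_mod_cast hlt.le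
    have hkq0 : (0 : ℝ) ≤ k n * q n := by positivity
    have hkp : (k n * p n : ℝ) ≤ n := by linarith [mul_add (k n : ℝ) (p n) (q n)]
    have hqp : (q n : ℝ) ≤ p n * (rate n)⁻¹ := by
      rw [le_mul_inv_iff₀ (by linarith), hpe]
      gcongr
    have hkq : (k n * q n : ℝ) ≤ n * (rate n)⁻¹ := by
      calc (k n * q n : ℝ) ≤ k n * (p n * (rate n)⁻¹) := by gcongr
        _ = (k n * p n) * (rate n)⁻¹ := by ring
        _ ≤ _ := by
            have : 0 ≤ (rate n)⁻¹ := inv_nonneg.2 (rate_nonneg n)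
            gcongr
    have hq2 : (q n : ℝ) ≤ 2 * rate n ^ 2 := by nlinarith [hn.2.1]
    refine ⟨hr, hp2, hkp, by nlinarith, hkn, ?_⟩
    have hk0 : (0 : ℝ) ≤ k n := by positivity
    have hp0 : (0 : ℝ) ≤ p n := by positivity
    nlinarith
  have hinv := tendsto_rate_inv
  have small : ∀ (c : ℝ) (j : ℕ), 1 ≤ j → Tendsto (fun n => c * (rate n)⁻¹ ^ j) atTop (𝓝 0) := by
    intro c j hj
    have := (hinv.pow j).const_mul c
    rwa [zero_pow (by omega), mul_zero] at this
  have hA : Tendsto (fun n : ℕ => (n * v n) * ((rate n)⁻¹ + 4 * (rate n)⁻¹ ^ 498)) atTop (𝓝 0) := by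
    have := hV.mul (hinv.add (small 4 498 (by norm_num)))
    simpa using this
  have hrest : ∀ᶠ n in atTop, 0 ≤ (n - k n * p n) * v n ∧ (n - k n * p n) * v n
      ≤ (n * v n) * ((rate n)⁻¹ + 4 * (rate n)⁻¹ ^ 498) := by
    filter_upwards [hpk] with n hn
    have hr : 0 < rate n := by linarith [hn.1]
    refine ⟨mul_nonneg (by linarith [hn.2.2.1]) (hv0 n), ?_⟩
    -- The incomplete last block has at most 4 rate² terms; with n = rate^500 this is a share
    -- rate^{-498} of the sample.
    have e : (n : ℝ) * (4 * (rate n)⁻¹ ^ 498) = 4 * rate n ^ 2 := by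
      rw [hn500 n]
      field_simp
    calc (n - k n * p n) * v n ≤ (n * (rate n)⁻¹ + 4 * rate n ^ 2) * v n :=
          mul_le_mul_of_nonneg_right hn.2.2.2.1 (hv0 n)
      _ = _ := by rw [← e]; ring
  have hrest0 : Tendsto (fun n : ℕ => (n - k n * p n) * v n) atTop (𝓝 0) :=
    squeeze_zero' (hrest.mono fun n hn => hn.1) (hrest.mono fun n hn => hn.2) hA
  have hkpv : Tendsto (fun n : ℕ => k n * p n * v n) atTop (𝓝 V) := by
    have := hV.sub hrest0
    rw [sub_zero] at this
    exact this.congr fun n => by ring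
  have hpv : Tendsto (fun n : ℕ => (n * v n) * (2 * (rate n)⁻¹ ^ 498)) atTop (𝓝 0) := by
    simpa using hV.mul (small 2 498 (by norm_num))
  have hpv_le : ∀ᶠ n in atTop, p n * v n ≤ (n * v n) * (2 * (rate n)⁻¹ ^ 498) := by
    filter_upwards [hpk] with n hn
    have hr : 0 < rate n := by linarith [hn.1]
    have e : (n : ℝ) * (2 * (rate n)⁻¹ ^ 498) = 2 * rate n ^ 2 := by
      rw [hn500 n]
      field_simp
    calc p n * v n ≤ (2 * rate n ^ 2) * v n := mul_le_mul_of_nonneg_right hn.2.1 (hv0 n)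
      _ = _ := by rw [← e]; ring
  have hmain : Tendsto (fun n : ℕ => √((n * v n) * ((rate n)⁻¹ + 4 * (rate n)⁻¹ ^ 498))
      + (16 * (rate n)⁻¹ ^ 4500 + 16 * (rate n ^ 4 * (n * τ n))
        + (n * v n) * ((n * v n) * (2 * (rate n)⁻¹ ^ 498)))) atTop (𝓝 0) := by
    have h1 := hA.sqrt
    have h2 := hV.mul hpv
    have := h1.add (((small 16 4500 (by norm_num)).add (hτ0.const_mul 16)).add h2)
    simpa using this
  have hbound : ∀ᶠ n in atTop,
      ‖charOne P (fun ω => ∑ i ∈ Finset.range n, g n (X i ω) * ε i ω)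
        - (Real.exp (-(k n * p n * v n) / 2) : ℝ)‖
      ≤ √((n * v n) * ((rate n)⁻¹ + 4 * (rate n)⁻¹ ^ 498))
      + (16 * (rate n)⁻¹ ^ 4500 + 16 * (rate n ^ 4 * (n * τ n))
        + (n * v n) * ((n * v n) * (2 * (rate n)⁻¹ ^ 498))) := by
    filter_upwards [hpk, hqa, hrest, hpv_le, hτ, hpv.eventually_le_const two_pos]
      with n h1 h2 h3 h4 h5 h6
    obtain ⟨M, hM'⟩ := hM n
    have hr : 0 < rate n := by linarith [h1.1]
    have h7 := hN.norm_charOne_noiseSum_sub_le hX hε h2.2.2.1 h2.2.2.2.2 (hg n) hM' (hi n) h5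
      h1.2.2.2.2.1 (h4.trans h6)
    refine h7.trans (add_le_add (Real.sqrt_le_sqrt h3.2) ?_)
    have hτn : 0 ≤ τ n :=
      (integral_nonneg fun ω => Real.rpow_nonneg (abs_nonneg _) _).trans (h5 0)
    have t1 : (k n : ℝ) * (16 * a n) ≤ 16 * (rate n)⁻¹ ^ 4500 := by
      calc (k n : ℝ) * (16 * a n) ≤ rate n ^ 500 * (16 * (rate n)⁻¹ ^ (500 + 4500)) := by
            rw [← hn500 n]
            have := h2.2.2.1
            have := h1.2.2.2.2.2
            gcongr
            exact h2.2.2.2.1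
        _ = 16 * (rate n ^ 500 * (rate n)⁻¹ ^ (500 + 4500)) := by ring
        _ = _ := by rw [mul_pow_inv_pow hr]
    -- A block of p terms has 5/2-moment at most p³ τ. Since kp ≤ n and p² ≤ 4 rate⁴, the sum over
    -- blocks is bounded by the quantity assumed to vanish.
    have t2 : (k n : ℝ) * (4 * (p n ^ 3 * τ n)) ≤ 16 * (rate n ^ 4 * (n * τ n)) := by
      have hp2 : (p n : ℝ) ^ 2 ≤ (2 * rate n ^ 2) ^ 2 := by gcongr; exact h1.2.1
      calc (k n : ℝ) * (4 * (p n ^ 3 * τ n)) = 4 * ((k n * p n) * (p n : ℝ) ^ 2 * τ n) := by ring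
        _ ≤ 4 * (n * (2 * rate n ^ 2) ^ 2 * τ n) := by
            gcongr
            exact h1.2.2.1
        _ = _ := by ring
    have t3 : (k n : ℝ) * (p n * v n) ^ 2
        ≤ (n * v n) * ((n * v n) * (2 * (rate n)⁻¹ ^ 498)) := by
      calc (k n : ℝ) * (p n * v n) ^ 2 = (k n * p n * v n) * (p n * v n) := by ring
        _ ≤ _ := mul_le_mul (mul_le_mul_of_nonneg_right h1.2.2.1 (hv0 n)) h4
            (mul_nonneg (by positivity) (hv0 n)) (mul_nonneg (by positivity) (hv0 n))
    calc (k n : ℝ) * (16 * a n + (4 * (p n ^ 3 * τ n) + (p n * v n) ^ 2))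
        = k n * (16 * a n) + k n * (4 * (p n ^ 3 * τ n)) + k n * (p n * v n) ^ 2 := by ring
      _ ≤ _ := add_le_add (add_le_add t1 t2) t3
  have hexp : Tendsto (fun n : ℕ => ((Real.exp (-(k n * p n * v n) / 2) : ℝ) : ℂ)) atTop
      (𝓝 (Real.exp (-V / 2) : ℝ)) :=
    (Complex.continuous_ofReal.tendsto _).comp
      ((Real.continuous_exp.tendsto _).comp (hkpv.neg.div_const 2))
  have hdiff := squeeze_zero_norm' hbound hmain
  simpa using hdiff.add hexp

end ArrayCLT

/-! ### Convergence in distribution of weighted noise -/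

section NoiseCLT

variable {Ω : Type*} [mΩ : MeasurableSpace Ω] {P : Measure Ω} [IsProbabilityMeasure P] {d : ℕ}
  {X : ℕ → Ω → Fin d → ℝ} {ε : ℕ → Ω → ℝ} {μ : Measure (Fin d → ℝ)}

/-- One half power of |g| is paid by its supremum, leaving g²; and |ε|^{5/2} ≤ 1 + |ε|^{2+δ} because
δ > 1/2. Conditioning on the predictor then gives a multiple of E g², so small weights make the
Lyapunov term vanish. -/
lemma WhiteNoise.exists_moment_bound (h : WhiteNoise P X ε) (hX : ∀ i, Measurable (X i))
    (hε : ∀ i, Measurable (ε i)) (hμ : ∀ i, P.map (X i) = μ) :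
    ∃ M', 0 ≤ M' ∧ ∀ g : (Fin d → ℝ) → ℝ, Measurable g → ∀ A : ℝ, (∀ x, |g x| ≤ A) → ∀ i,
      Integrable (fun ω => |g (X i ω) * ε i ω| ^ (5 / 2 : ℝ)) P ∧
      ∫ ω, |g (X i ω) * ε i ω| ^ (5 / 2 : ℝ) ∂P ≤ √A * (M' * ∫ x, g x ^ 2 ∂μ) := by
  obtain ⟨δ, hδ, M, hM, hmom⟩ := h.moment
  refine ⟨1 + M, by positivity, fun g hg A hA i => ?_⟩
  have hA0 : 0 ≤ A := (abs_nonneg _).trans (hA 0)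
  have hg2m : Measurable fun x => g x ^ 2 := hg.pow_const 2
  have hg2 : ∀ x, |g x ^ 2| ≤ A ^ 2 := fun x => by
    rw [abs_pow]; exact pow_le_pow_left₀ (abs_nonneg _) (hA x) 2
  have i1 : Integrable (fun ω => g (X i ω) ^ 2) P :=
    Integrable.of_bound (hg2m.comp (hX i)).aestronglyMeasurable (A ^ 2)
      (ae_of_all _ fun ω => hg2 _)
  have i2 : Integrable (fun ω => g (X i ω) ^ 2 * |ε i ω| ^ (2 + δ)) P :=
    (hmom i).1.bdd_mul (hg2m.comp (hX i)).aestronglyMeasurable (ae_of_all _ fun ω => hg2 _)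
  have hle : ∀ ω, |g (X i ω) * ε i ω| ^ (5 / 2 : ℝ)
      ≤ √A * (g (X i ω) ^ 2 + g (X i ω) ^ 2 * |ε i ω| ^ (2 + δ)) := fun ω => by
    rw [abs_mul, Real.mul_rpow (abs_nonneg _) (abs_nonneg _)]
    have h1 : |g (X i ω)| ^ (5 / 2 : ℝ) ≤ √A * g (X i ω) ^ 2 := by
      rw [show (5 / 2 : ℝ) = 1 / 2 + (2 : ℕ) by norm_num,
        Real.rpow_add_natCast' (abs_nonneg _) (by norm_num), ← Real.sqrt_eq_rpow, sq_abs]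
      exact mul_le_mul_of_nonneg_right (Real.sqrt_le_sqrt (hA _)) (sq_nonneg _)
    have h2 : |ε i ω| ^ (5 / 2 : ℝ) ≤ 1 + |ε i ω| ^ (2 + δ) := by
      rcases le_total |ε i ω| 1 with h | h
      · exact (Real.rpow_le_one (abs_nonneg _) h (by norm_num)).trans
          (le_add_of_nonneg_right (Real.rpow_nonneg (abs_nonneg _) _))
      · exact (Real.rpow_le_rpow_of_exponent_le h (by linarith)).trans
          (le_add_of_nonneg_left zero_le_one)
    refine (mul_le_mul h1 h2 (Real.rpow_nonneg (abs_nonneg _) _) (by positivity)).trans ?_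
    rw [mul_assoc, mul_add, mul_one]
  have hm : Measurable fun ω => |g (X i ω) * ε i ω| ^ (5 / 2 : ℝ) :=
    (measurable_noiseTerm hX hε hg i).abs.pow_const _
  have i3 : Integrable (fun ω => |g (X i ω) * ε i ω| ^ (5 / 2 : ℝ)) P := by
    refine Integrable.mono' ((i1.add i2).const_mul (√A)) hm.aestronglyMeasurable
      (ae_of_all _ fun ω => ?_)
    rw [Real.norm_of_nonneg (Real.rpow_nonneg (abs_nonneg _) _)]
    exact hle ω
  refine ⟨i3, (integral_mono i3 ((i1.add i2).const_mul (√A)) hle).trans ?_⟩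
  have e : ∫ ω, g (X i ω) ^ 2 ∂P = ∫ x, g x ^ 2 ∂μ := by
    rw [← hμ i, integral_map (hX i).aemeasurable hg2m.aestronglyMeasurable]
  have h3 : ∫ ω, g (X i ω) ^ 2 * |ε i ω| ^ (2 + δ) ∂P ≤ M * ∫ x, g x ^ 2 ∂μ := by
    rw [integral_mul_condExp (hX i) hg2m hg2 (hmom i).1, ← e, ← integral_const_mul]
    refine integral_mono_ae (integrable_condExp.bdd_mul
      (hg2m.comp (hX i)).aestronglyMeasurable (ae_of_all _ fun ω => hg2 _)) (i1.const_mul M) ?_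
    filter_upwards [(hmom i).2] with ω hω
    rw [mul_comm M]
    exact mul_le_mul_of_nonneg_left hω.le (sq_nonneg _)
  rw [integral_const_mul]
  refine mul_le_mul_of_nonneg_left ?_ (Real.sqrt_nonneg _)
  calc _ = ∫ ω, g (X i ω) ^ 2 ∂P + ∫ ω, g (X i ω) ^ 2 * |ε i ω| ^ (2 + δ) ∂P :=
        integral_add i1 i2
    _ ≤ _ := by rw [e]; linarith

/-- Central limit theorem for triangular arrays of weighted noise. -/
theorem WhiteNoise.tendstoInDistribution_sum (h : WhiteNoise P X ε) (hX : ∀ i, Measurable (X i))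
    (hε : ∀ i, Measurable (ε i)) (hμ : ∀ i, P.map (X i) = μ)
    (hmixing : GeometricallyMixing P X ε) {g : ℕ → (Fin d → ℝ) → ℝ}
    (hg : ∀ n, Measurable (g n)) {A : ℕ → ℝ} (hA : ∀ n x, |g n x| ≤ A n)
    (hA0 : Tendsto (fun n => rate n ^ 4 * √(A n)) atTop (𝓝 0)) {V : ℝ≥0}
    (hV : Tendsto (fun n : ℕ => n * ∫ x, g n x ^ 2 ∂μ) atTop (𝓝 V)) :
    TendstoInDistribution (fun n ω => ∑ i ∈ Finset.range n, g n (X i ω) * ε i ω) atTop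
      (id : ℝ → ℝ) (fun _ => P) (gaussianReal 0 V) := by
  have hm : ∀ n, Measurable fun ω => ∑ i ∈ Finset.range n, g n (X i ω) * ε i ω := fun n =>
    Finset.measurable_fun_sum _ fun i _ => measurable_noiseTerm hX hε (hg n) i
  obtain ⟨M', hM', hmom⟩ := h.exists_moment_bound hX hε hμ
  have hN := h.secondOrderNoise hX hε hμ
  refine ⟨fun n => (hm n).aemeasurable, aemeasurable_id, ?_⟩
  refine ProbabilityMeasure.tendsto_iff_tendsto_charFun.2 fun t => ?_
  simp only [ProbabilityMeasure.coe_mk, Measure.map_id, charFun_gaussianReal]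
  -- The characteristic function at t is that at one for the weights t g_n, whose limiting variance
  -- is t² V.
  have key := hN.tendsto_charOne hX hε hmixing (g := fun n x => t * g n x)
    (fun n => (hg n).const_mul t) (fun n => ⟨|t| * A n, fun x => by
      rw [abs_mul]; exact mul_le_mul_of_nonneg_left (hA n x) (abs_nonneg t)⟩)
    (fun n i => (hmom _ ((hg n).const_mul t) (|t| * A n) (fun x => by
      rw [abs_mul]; exact mul_le_mul_of_nonneg_left (hA n x) (abs_nonneg t)) i).1)
    (τ := fun n => √(|t| * A n) * (M' * ∫ x, (t * g n x) ^ 2 ∂μ))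
    (Eventually.of_forall fun n i => (hmom _ ((hg n).const_mul t) (|t| * A n) (fun x => by
      rw [abs_mul]; exact mul_le_mul_of_nonneg_left (hA n x) (abs_nonneg t)) i).2)
    (by
      have h1 := (hA0.mul hV).const_mul (√|t| * M' * t ^ 2)
      rw [zero_mul, mul_zero] at h1
      refine h1.congr fun n => ?_
      simp only [mul_pow, integral_const_mul]
      rw [Real.sqrt_mul (abs_nonneg t)]
      ring)
    (V := t ^ 2 * V)
    (by
      refine (hV.const_mul (t ^ 2)).congr fun n => ?_
      simp only [mul_pow, integral_const_mul]
      ring)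
  have e : ((Real.exp (-(t ^ 2 * V) / 2) : ℝ) : ℂ)
      = Complex.exp (t * (0 : ℝ) * Complex.I - (V : ℝ) * t ^ 2 / 2) := by
    rw [Complex.ofReal_exp]
    congr 1
    push_cast
    ring
  rw [e] at key
  refine key.congr fun n => ?_
  rw [charFun_apply_real, integral_map (hm n).aemeasurable
    (by fun_prop : Measurable fun x : ℝ => Complex.exp (t * x * Complex.I)).aestronglyMeasurable]
  refine integral_congr_ae (ae_of_all _ fun ω => ?_)
  simp only [mul_assoc, ← Finset.mul_sum]
  congr 1
  push_cast
  ring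

end NoiseCLT

/-! ### Kernel averages near an interior point -/

section Section

variable {d : ℕ} [NeZero d]

/-- Integral of `w` over the other coordinates, with all arguments projected on the cube. -/
def sectionInt (w : (Fin d → ℝ) → ℝ) (t : ℝ) : ℝ :=
  ∫ z, w (clamp (Function.update z 0 t)) ∂unif d

variable {w : (Fin d → ℝ) → ℝ}

lemma sectionInt_eq {t : ℝ} (ht : t ∈ Icc (0 : ℝ) 1) :
    sectionInt w t = integrateOthers w 0 t := by
  refine integral_congr_ae ?_
  filter_upwards [ae_unif_mem (d := d)] with z hz
  rw [clamp_eq (update_mem_cube hz 0 ht)]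

lemma exists_bound_clamp (hw : ContinuousOn w (Icc 0 1)) :
    ∃ B, 0 ≤ B ∧ ∀ z, |w (clamp z)| ≤ B := by
  obtain ⟨B, hB⟩ := isCompact_Icc.exists_bound_of_continuousOn hw
  exact ⟨B, (norm_nonneg _).trans (hB _ (clamp_mem 0)), fun z => hB _ (clamp_mem z)⟩

lemma continuous_sectionInt (hw : ContinuousOn w (Icc 0 1)) : Continuous (sectionInt w) := by
  obtain ⟨B, -, hB⟩ := exists_bound_clamp hw
  have hc := continuous_comp_clamp hw
  refine continuous_of_dominated (bound := fun _ => B) (fun t => ?_) (fun t => ?_)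
    (integrable_const _) (ae_of_all _ fun z => ?_)
  · exact (hc.comp (by fun_prop : Continuous fun z : Fin d → ℝ =>
      Function.update z 0 t)).aestronglyMeasurable
  · exact ae_of_all _ fun z => hB _
  · exact hc.comp (by fun_prop : Continuous fun t : ℝ => Function.update z 0 t)

lemma abs_sectionInt_le {B : ℝ} (hB : ∀ z, |w (clamp z)| ≤ B) (t : ℝ) : |sectionInt w t| ≤ B := by
  have h := norm_integral_le_of_norm_le (μ := unif d)
    (f := fun z : Fin d → ℝ => w (clamp (Function.update z 0 t))) (integrable_const B)
    (ae_of_all _ fun z => hB _)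
  simpa [sectionInt] using h

/-- Integrating out the other coordinates first turns kernel expectations into one-dimensional
integrals. The weight w is 1 for the density and the bias, and σ² for the variance. -/
lemma integral_designLaw {f : (Fin d → ℝ) → ℝ} (hf : ContinuousOn f (Icc 0 1))
    (hf0 : ∀ x ∈ Icc (0 : Fin d → ℝ) 1, 0 ≤ f x) (hw : ContinuousOn w (Icc 0 1))
    {ψ : ℝ → ℝ} (hψ : Measurable ψ) {M : ℝ} (hM : ∀ t, |ψ t| ≤ M) :
    ∫ z, ψ (z 0) * w (clamp z) ∂designLaw f
      = ∫ y, ψ y * sectionInt (fun z => w z * f z) y ∂unifOne := by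
  have hfm := (continuous_comp_clamp hf).measurable
  obtain ⟨B, hB0, hB⟩ := exists_bound_clamp (hw.mul hf)
  rw [designLaw, integral_withDensity_eq_integral_toReal_smul hfm.ennreal_ofReal (by simp)]
  have e : ∀ z : Fin d → ℝ, (ENNReal.ofReal (f (clamp z))).toReal • (ψ (z 0) * w (clamp z))
      = ψ (z 0) * (w (clamp z) * f (clamp z)) := fun z => by
    rw [ENNReal.toReal_ofReal (hf0 _ (clamp_mem z)), smul_eq_mul]; ring
  simp only [e]
  have hm : Measurable fun z : Fin d → ℝ => ψ (z 0) * (w (clamp z) * f (clamp z)) :=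
    (hψ.comp (measurable_pi_apply 0)).mul ((continuous_comp_clamp hw).measurable.mul hfm)
  rw [integral_update (F := fun z => ψ (z 0) * (w (clamp z) * f (clamp z)))
    (Integrable.of_bound hm.aestronglyMeasurable (M * B) (ae_of_all _ fun z => ?_)) 0]
  · refine integral_congr_ae (ae_of_all _ fun t => ?_)
    simp only [Function.update_self, integral_const_mul, sectionInt]
  · rw [norm_mul]
    exact mul_le_mul (hM _) (hB z) (norm_nonneg _) ((abs_nonneg _).trans (hM 0))

end Section

/-! ### One-dimensional kernel limits and the smoothing bias. -/

section Window

variable {L : ℝ → ℝ} {B : ℝ}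

lemma integrable_of_supported (hL : Measurable L) (hB : ∀ u, |L u| ≤ B)
    (hs : ∀ u, u ∉ Icc (-1 : ℝ) 1 → L u = 0) : Integrable L := by
  have h1 : IntegrableOn L (Icc (-1) 1) :=
    Measure.integrableOn_of_bounded (M := B) (by simp) hL.aestronglyMeasurable
      (ae_of_all _ hB)
  exact (integrableOn_iff_integrable_of_support_subset fun u hu => by
    by_contra h
    exact hu (hs u h)).1 h1

/-- At distance at least h from both ends the whole window lies in [0, 1], so there is no boundary
correction. -/
lemma integral_unifOne_scaled (hs : ∀ u, u ∉ Icc (-1 : ℝ) 1 → L u = 0) (F : ℝ → ℝ) {h x : ℝ}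
    (hh : 0 < h) (hx : x ∈ Icc h (1 - h)) :
    ∫ y, F y * scaledKernel L h (y - x) ∂unifOne = ∫ v, F (x + h * v) * L v := by
  rw [← KernelBound.integral_mul_scaled F hh x, unifOne]
  refine setIntegral_eq_integral_of_forall_compl_eq_zero fun y hy => ?_
  rw [scaledKernel, hs, zero_div, mul_zero]
  intro hmem
  refine hy ?_
  rw [Set.mem_Icc, le_div_iff₀ hh, div_le_iff₀ hh] at hmem
  have := hx.1
  have := hx.2
  exact ⟨by linarith [hmem.1], by linarith [hmem.2]⟩

lemma tendsto_integral_dilation (hL : Measurable L) (hB : ∀ u, |L u| ≤ B)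
    (hs : ∀ u, u ∉ Icc (-1 : ℝ) 1 → L u = 0) {φ : ℝ → ℝ} (hφ : Continuous φ) {M : ℝ}
    (hM : ∀ y, |φ y| ≤ M) {h : ℕ → ℝ} (hh : Tendsto h atTop (𝓝 0)) (x : ℝ) :
    Tendsto (fun n => ∫ v, φ (x + h n * v) * L v) atTop (𝓝 (φ x * ∫ v, L v)) := by
  rw [← integral_const_mul]
  refine tendsto_integral_of_dominated_convergence (fun v => M * |L v|) (fun n => ?_)
    ((integrable_of_supported hL hB hs).abs.const_mul M) (fun n => ae_of_all _ fun v => ?_)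
    (ae_of_all _ fun v => ?_)
  · exact ((hφ.comp (by fun_prop : Continuous fun v => x + h n * v)).measurable.mul
      hL).aestronglyMeasurable
  · rw [norm_mul]
    exact mul_le_mul_of_nonneg_right (hM _) (norm_nonneg _)
  · refine Tendsto.mul_const _ ?_
    have h1 : Tendsto (fun n => x + h n * v) atTop (𝓝 x) := by
      simpa using (hh.mul_const v).const_add x
    exact (hφ.tendsto x).comp h1

lemma tendsto_integral_window (hL : Measurable L) (hB : ∀ u, |L u| ≤ B)
    (hs : ∀ u, u ∉ Icc (-1 : ℝ) 1 → L u = 0) {φ : ℝ → ℝ} (hφ : Continuous φ) {M : ℝ}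
    (hM : ∀ y, |φ y| ≤ M) {h : ℕ → ℝ} (hh : Tendsto h atTop (𝓝 0)) {x : ℝ}
    (hx : ∀ᶠ n in atTop, 0 < h n ∧ x ∈ Icc (h n) (1 - h n)) :
    Tendsto (fun n => ∫ y, φ y * scaledKernel L (h n) (y - x) ∂unifOne) atTop
      (𝓝 (φ x * ∫ v, L v)) := by
  refine (tendsto_integral_dilation hL hB hs hφ hM hh x).congr' ?_
  filter_upwards [hx] with n hn
  exact (integral_unifOne_scaled hs φ hn.1 hn.2).symm

/-- Leading term of the smoothing bias. -/
lemma KernelBound.tendsto_bias {K : ℝ → ℝ} {C : ℝ} (hK : KernelBound K C) {m F : ℝ → ℝ}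
    (hm : Measurable m) {BF : ℝ} (hF : Continuous F)
    (hBF : ∀ y, |F y| ≤ BF) {x m₁ D b : ℝ}
    (hT : (fun u => (m (x + u) - m x) * F (x + u) - (m₁ * u + D * u ^ 2))
      =o[𝓝 0] fun u => u ^ 2)
    (hb : b * F x = (∫ u, u ^ 2 * K u) * D) {h : ℕ → ℝ} (hpos : ∀ᶠ n in atTop, 0 < h n)
    (hh : Tendsto h atTop (𝓝 0)) :
    Tendsto (fun n => (h n ^ 2)⁻¹
      * ∫ v, (m (x + h n * v) - m x - b * h n ^ 2) * F (x + h n * v) * K v) atTop (𝓝 0) := by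
  set R : ℝ → ℝ := fun u => (m (x + u) - m x) * F (x + u) - (m₁ * u + D * u ^ 2) with hR
  have hKa : ∀ u, |K u| ≤ C := fun u => by rw [abs_of_nonneg (hK.nonneg u)]; exact hK.le u
  have hlim := tendsto_integral_dilation hK.meas hKa hK.support hF hBF hh x
  rw [hK.integral_eq_one, mul_one] at hlim
  -- Symmetry of the kernel removes the first order term of the expansion, leaving a bias of order
  -- h².
  have hodd : ∫ u, u * K u = 0 := by
    have h1 : ∫ u, u * K u = ∫ u, -u * K (-u) := (integral_neg_eq_self (fun u => u * K u) _).symm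
    simp only [hK.symm, neg_mul, integral_neg] at h1
    linarith
  have hsq1 : ∫ u, u ^ 2 * K u ≤ 1 := by
    rw [← hK.integral_eq_one]
    refine integral_mono (hK.integrable_mul (F := fun u => u ^ 2) (by fun_prop) (M := 1) ?_)
      hK.integrable fun u => ?_
    · intro u hu
      rw [abs_pow]
      exact pow_le_one₀ (abs_nonneg _) (abs_le.2 hu)
    · by_cases hu : u ∈ Icc (-1 : ℝ) 1
      · exact mul_le_of_le_one_left (hK.nonneg u) (by
          rw [← sq_abs]; exact pow_le_one₀ (abs_nonneg _) (abs_le.2 hu))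
      · simp [hK.support u hu]
  rw [Metric.tendsto_atTop]
  suffices H : ∀ η > (0 : ℝ), ∀ᶠ n in atTop, |(h n ^ 2)⁻¹
      * ∫ v, (m (x + h n * v) - m x - b * h n ^ 2) * F (x + h n * v) * K v| < η by
    intro η hη
    obtain ⟨n₀, hn₀⟩ := eventually_atTop.1 (H η hη)
    exact ⟨n₀, fun n hn => by rw [Real.dist_eq, sub_zero]; exact hn₀ n hn⟩
  intro η hη
  have hlim2 : ∀ᶠ n in atTop, |b * (F x - ∫ v, F (x + h n * v) * K v)| < η / 2 := by
    have h1 : Tendsto (fun n => |b * (F x - ∫ v, F (x + h n * v) * K v)|) atTop (𝓝 0) := by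
      have := ((hlim.const_sub (F x)).const_mul b).abs
      simpa using this
    exact h1.eventually (gt_mem_nhds (by positivity))
  obtain ⟨r, hr, hRr⟩ := Metric.eventually_nhds_iff.1 (hT.bound (c := η / 2) (by positivity))
  filter_upwards [hlim2, hpos, hh.eventually (gt_mem_nhds hr)] with n h1 h2 h3
  have hRb : ∀ v ∈ Icc (-1 : ℝ) 1, |R (h n * v)| ≤ η / 2 * (h n ^ 2 * v ^ 2) := by
    intro v hv
    have h4 : dist (h n * v) 0 < r := by
      rw [Real.dist_eq, sub_zero, abs_mul, abs_of_pos h2]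
      exact lt_of_le_of_lt (mul_le_of_le_one_right h2.le (abs_le.2 hv)) h3
    have := hRr h4
    simp only [Real.norm_eq_abs, abs_pow, sq_abs] at this
    rwa [mul_pow] at this
  have hRm : Measurable fun v => R (h n * v) := by
    have := hF.measurable
    simp only [hR]
    fun_prop
  have iR : Integrable fun v => R (h n * v) * K v := by
    refine hK.integrable_mul hRm (M := η / 2 * (h n ^ 2 * 1)) fun v hv => (hRb v hv).trans ?_
    gcongr
    rw [← sq_abs]
    exact pow_le_one₀ (abs_nonneg _) (abs_le.2 hv)
  have iV : Integrable fun v : ℝ => v * K v :=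
    hK.integrable_mul (F := fun v => v) measurable_id (M := 1) fun v hv => abs_le.2 hv
  have iV2 : Integrable fun v : ℝ => v ^ 2 * K v :=
    hK.integrable_mul (F := fun v => v ^ 2) (by fun_prop) (M := 1) fun v hv => by
      rw [abs_pow]; exact pow_le_one₀ (abs_nonneg _) (abs_le.2 hv)
  have iF : Integrable fun v : ℝ => F (x + h n * v) * K v :=
    hK.integrable_mul (F := fun v => F (x + h n * v))
      (by have := hF.measurable; fun_prop) (M := BF) fun v _ => hBF _
  -- The quadratic term equals b F(x) h² by the choice of b and cancels against the subtracted b h²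
  -- F(x + hv), up to the modulus of continuity of F.
  have e : ∫ v, (m (x + h n * v) - m x - b * h n ^ 2) * F (x + h n * v) * K v
      = (∫ v, R (h n * v) * K v) + h n ^ 2 * (b * (F x - ∫ v, F (x + h n * v) * K v)) := by
    have e1 : ∀ v, (m (x + h n * v) - m x - b * h n ^ 2) * F (x + h n * v) * K v
        = R (h n * v) * K v + (m₁ * h n) * (v * K v) + (D * h n ^ 2) * (v ^ 2 * K v)
          - (b * h n ^ 2) * (F (x + h n * v) * K v) := fun v => by simp only [hR]; ring
    simp only [e1]
    have j1 : Integrable fun v => R (h n * v) * K v + (m₁ * h n) * (v * K v) :=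
      iR.add (iV.const_mul _)
    have j2 : Integrable fun v => R (h n * v) * K v + (m₁ * h n) * (v * K v)
        + (D * h n ^ 2) * (v ^ 2 * K v) := j1.add (iV2.const_mul _)
    rw [integral_sub j2 (iF.const_mul _), integral_add j1 (iV2.const_mul _),
      integral_add iR (iV.const_mul _), integral_const_mul, integral_const_mul,
      integral_const_mul, hodd]
    linear_combination (-h n ^ 2) * hb
  have h5 : |∫ v, R (h n * v) * K v| ≤ η / 2 * h n ^ 2 := by
    calc |∫ v, R (h n * v) * K v| ≤ ∫ v, η / 2 * h n ^ 2 * (v ^ 2 * K v) := by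
          refine norm_integral_le_of_norm_le (f := fun v => R (h n * v) * K v)
            (iV2.const_mul (η / 2 * h n ^ 2)) (ae_of_all _ fun v => ?_)
          rw [norm_mul, Real.norm_eq_abs, Real.norm_of_nonneg (hK.nonneg v)]
          by_cases hv : v ∈ Icc (-1 : ℝ) 1
          · refine (mul_le_mul_of_nonneg_right (hRb v hv) (hK.nonneg v)).trans (le_of_eq ?_)
            ring
          · simp [hK.support v hv]
      _ ≤ η / 2 * h n ^ 2 * 1 := by
          rw [integral_const_mul]
          gcongr
      _ = _ := mul_one _
  have hh2 : 0 < h n ^ 2 := by positivity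
  rw [abs_mul, abs_of_pos (inv_pos.2 hh2), inv_mul_lt_iff₀ hh2, e]
  refine lt_of_le_of_lt (abs_add_le _ _) ?_
  rw [abs_mul (h n ^ 2), abs_of_pos hh2]
  nlinarith

end Window

/-! ### Second order expansion of the integrand of the bias. -/

section Taylor

open Asymptotics

lemma taylor_two {m : ℝ → ℝ} (hm : ContDiffOn ℝ 2 m (Icc 0 1)) {x : ℝ}
    (hx : x ∈ Ioo (0 : ℝ) 1) :
    (fun u => m (x + u) - m x - deriv m x * u - deriv (deriv m) x / 2 * u ^ 2)
      =o[𝓝 0] fun u => u ^ 2 := by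
  have h1 := taylor_isLittleO (convex_Ioo (0 : ℝ) 1) hx
    (n := 2) (hm.mono Set.Ioo_subset_Icc_self)
  rw [nhdsWithin_eq_nhds.2 (isOpen_Ioo.mem_nhds hx)] at h1
  have ht : Tendsto (fun u : ℝ => x + u) (𝓝 0) (𝓝 x) := by
    have : Continuous fun u : ℝ => x + u := by fun_prop
    simpa using this.tendsto 0
  have h2 := h1.comp_tendsto ht
  refine (h2.congr_left fun u => ?_).congr_right fun u => ?_
  · simp only [Function.comp, taylorWithinEval_succ, taylor_within_zero_eval,
      iteratedDerivWithin_of_isOpen isOpen_Ioo hx, iteratedDeriv_succ, iteratedDeriv_zero,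
      smul_eq_mul, add_sub_cancel_left]
    norm_num
    ring
  · simp

/-- The increment of m is already O(u), so a first order expansion of the density is enough; the
cross term m′ f′ is the design part of the bias. -/
lemma taylor_product {m f : ℝ → ℝ} {x m₁ m₂ f₁ : ℝ}
    (hm : (fun u => m (x + u) - m x - m₁ * u - m₂ / 2 * u ^ 2) =o[𝓝 0] fun u => u ^ 2)
    (hf : HasDerivAt f f₁ x) :
    (fun u => (m (x + u) - m x) * f (x + u) - ((m₁ * f x) * u + (m₂ * f x / 2 + m₁ * f₁) * u ^ 2))
      =o[𝓝 0] fun u => u ^ 2 := by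
  have ht : Tendsto (fun u : ℝ => x + u) (𝓝 0) (𝓝 x) := by
    have : Continuous fun u : ℝ => x + u := by fun_prop
    simpa using this.tendsto 0
  have hfc : Tendsto (fun u => f (x + u)) (𝓝 0) (𝓝 (f x)) := hf.continuousAt.tendsto.comp ht
  have h1 : (fun u => (m (x + u) - m x - m₁ * u - m₂ / 2 * u ^ 2) * f (x + u))
      =o[𝓝 0] fun u => u ^ 2 := by
    simpa using hm.mul_isBigO (hfc.isBigO_one ℝ)
  have hf' : (fun u => f (x + u) - f x - f₁ * u) =o[𝓝 0] fun u => u := by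
    have := hasDerivAt_iff_isLittleO_nhds_zero.1 hf
    simpa [mul_comm] using this
  have h2 : (fun u => m₁ * (u * (f (x + u) - f x - f₁ * u))) =o[𝓝 0] fun u => u ^ 2 := by
    have := (isBigO_refl (fun u : ℝ => u) (𝓝 0)).mul_isLittleO hf'
    simpa [sq] using this.const_mul_left m₁
  have h3 : (fun u => m₂ / 2 * (u ^ 2 * (f (x + u) - f x))) =o[𝓝 0] fun u => u ^ 2 := by
    have h0 : (fun u => f (x + u) - f x) =o[𝓝 0] fun _ => (1 : ℝ) := by
      rw [isLittleO_one_iff]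
      simpa using hfc.sub_const (f x)
    have := (isBigO_refl (fun u : ℝ => u ^ 2) (𝓝 0)).mul_isLittleO h0
    simpa using this.const_mul_left (m₂ / 2)
  refine ((h1.add h2).add h3).congr_left fun u => ?_
  ring

end Taylor

/-! ### Stochastic part of the kernel averages -/

section Local

variable {Ω : Type*} [mΩ : MeasurableSpace Ω] {P : Measure Ω} [IsProbabilityMeasure P] {d : ℕ}
  [NeZero d] {X : ℕ → Ω → Fin d → ℝ} {ε : ℕ → Ω → ℝ} {μ : Measure (Fin d → ℝ)} {cf Cf : ℝ}
  {h : ℕ → ℝ}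

lemma rate_pow_five_hundred (n : ℕ) : rate n ^ 500 = n := by rw [rate_pow]; norm_num

lemma BandwidthOrder.tendsto_zero (hh : BandwidthOrder h) : Tendsto h atTop (𝓝 0) := by
  obtain ⟨κ, -, hb⟩ := hh.eventually_bounds
  refine squeeze_zero' (hb.mono fun n hn => hn.1.le) (hb.mono fun n hn => hn.2.1) ?_
  have := tendsto_rate_inv.pow 99
  rwa [zero_pow (by norm_num)] at this

/-- For h of order n^{-1/5} the normalisation √(nh) balances both h² and n^{-2/5}. Hence errors
o(h²) in the bias and o(n^{-2/5}) in the comparison vanish after scaling. -/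
lemma BandwidthOrder.eventually_upper (hh : BandwidthOrder h) :
    ∃ κ > (0 : ℝ), ∀ᶠ n : ℕ in atTop, √(n * h n) * h n ^ 2 ≤ κ ∧
      √(n * h n) * (n : ℝ) ^ (-(2 / 5) : ℝ) ≤ κ := by
  obtain ⟨κ₀, -, hb⟩ := hh.eventually_bounds
  obtain ⟨ch, -, Ch, hc⟩ := hh
  refine ⟨√(|Ch| ^ 5) + √|Ch| + 1, by positivity, ?_⟩
  filter_upwards [hb, hc, eventually_ge_atTop 1] with n h1 h2 hn
  have hr : 0 < rate n := by linarith [one_le_rate hn]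
  have e1 : (n : ℝ) ^ (-(1 / 5) : ℝ) = (rate n)⁻¹ ^ 100 := by rw [rate_inv_pow]; norm_num
  have e2 : (n : ℝ) ^ (-(2 / 5) : ℝ) = (rate n)⁻¹ ^ 200 := by rw [rate_inv_pow]; norm_num
  have hle : h n ≤ |Ch| * (rate n)⁻¹ ^ 100 := by
    rw [← e1]
    exact h2.2.trans (mul_le_mul_of_nonneg_right (le_abs_self _) (by positivity))
  have hpos := h1.1
  have s1 : √(n * h n) * h n ^ 2 ≤ √(|Ch| ^ 5) := by
    rw [← Real.sqrt_sq (by positivity : 0 ≤ h n ^ 2), ← Real.sqrt_mul (by positivity)]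
    refine Real.sqrt_le_sqrt ?_
    calc n * h n * (h n ^ 2) ^ 2 = rate n ^ 500 * h n ^ 5 := by
          rw [rate_pow_five_hundred]; ring
      _ ≤ rate n ^ 500 * (|Ch| * (rate n)⁻¹ ^ 100) ^ 5 := by gcongr
      _ = |Ch| ^ 5 := by field_simp
  have s2 : √(n * h n) * (rate n)⁻¹ ^ 200 ≤ √|Ch| := by
    rw [← Real.sqrt_sq (by positivity : 0 ≤ (rate n)⁻¹ ^ 200), ← Real.sqrt_mul (by positivity)]
    refine Real.sqrt_le_sqrt ?_
    calc n * h n * ((rate n)⁻¹ ^ 200) ^ 2 = rate n ^ 500 * h n * (rate n)⁻¹ ^ 400 := by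
          rw [rate_pow_five_hundred]; ring
      _ ≤ rate n ^ 500 * (|Ch| * (rate n)⁻¹ ^ 100) * (rate n)⁻¹ ^ 400 := by gcongr
      _ = |Ch| := by field_simp
  rw [e2]
  have := Real.sqrt_nonneg (|Ch| ^ 5)
  have := Real.sqrt_nonneg |Ch|
  exact ⟨by linarith, by linarith⟩

/-- Deviations of bounded local averages vanish at rate `(n h)^{-1/2}`. -/
lemma Design.eventually_dev_small (hd : Design P X μ cf Cf) (hε : ∀ i, Measurable (ε i))
    (hmixing : GeometricallyMixing P X ε) (hh : BandwidthOrder h) {G : ℕ → ℝ → ℝ}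
    (hG : ∀ n, Measurable (G n)) {A x : ℝ} (hA : 0 ≤ A)
    (hGA : ∀ᶠ n in atTop, ∀ t,
      |G n t| ≤ A * (Icc (x - 2 * h n) (x + 2 * h n)).indicator (fun _ => 1) t)
    {η δ : ℝ} (hη : 0 < η) (hδ : 0 < δ) :
    ∀ᶠ n : ℕ in atTop, FailsWithProbLE P δ fun ω =>
      √(n * h n) * |dev X μ n (fun z => G n (z 0)) ω| ≤ η := by
  obtain ⟨q, a, hqa⟩ := hmixing.exists_lag
  obtain ⟨κ, -, hb⟩ := hh.eventually_bounds
  have hCf := zero_le_one.trans hd.one_le_Cf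
  filter_upwards [hqa, hb, hGA, eventually_mul_rate_inv_le (4 * Cf * A ^ 2 + 32 * A ^ 2)
    (by positivity : 0 < δ * η ^ 2), eventually_ge_atTop 1] with n h1 h2 h3 h4 hn
  have hr1 := one_le_rate hn
  have hr : 0 < rate n := by linarith
  have hz1 : (rate n)⁻¹ ≤ 1 := inv_le_one_of_one_le₀ hr1
  have hn0 : (0 : ℝ) < n := by exact_mod_cast hn
  have hpos := h2.1
  have hh1 : h n ≤ 1 := h2.2.1.trans (pow_le_one₀ (by positivity) hz1)
  have hGb : ∀ t, |G n t| ≤ A := fun t =>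
    (h3 t).trans (mul_le_of_le_one_right hA (indicator_one_le _ _))
  have hint := dev_bounded_integrable hd ((hG n).comp (measurable_pi_apply 0))
    (fun z => hGb (z 0)) n 2
  have hsec := hd.integral_dev_window_sq_le hε h1.1 h1.2.2.1 h1.2.2.2.2 (hG n)
    (by positivity : 0 ≤ 2 * h n) hA h3 hn
  -- A bounded function on a window of width of order h has variance O(q² h/n) on average, so n h
  -- times the square is O(q² h²), which vanishes; the mixing remainder is negligible by the choice
  -- of the lag.
  have key : ∫ ω, n * h n * dev X μ n (fun z => G n (z 0)) ω ^ 2 ∂P ≤ δ * η ^ 2 := by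
    rw [integral_const_mul]
    have t1 : rate n ^ 2 * h n ^ 2 ≤ (rate n)⁻¹ := by
      calc rate n ^ 2 * h n ^ 2 ≤ rate n ^ 2 * ((rate n)⁻¹ ^ 99) ^ 2 := by
            gcongr; exact h2.2.1
        _ = (rate n)⁻¹ ^ 196 := by field_simp
        _ ≤ (rate n)⁻¹ ^ 1 := pow_le_pow_of_le_one (by positivity) hz1 (by norm_num)
        _ = _ := pow_one _
    have t2 : rate n ^ 2 * (n * h n) * a n ≤ (rate n)⁻¹ := by
      calc rate n ^ 2 * (n * h n) * a n ≤ rate n ^ 2 * (rate n ^ 500 * 1) * (rate n)⁻¹ ^ 5000 := by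
            rw [rate_pow_five_hundred]
            have := h1.2.2.1
            gcongr
            exact h1.2.2.2.1
        _ = (rate n)⁻¹ ^ 4498 := by field_simp
        _ ≤ (rate n)⁻¹ ^ 1 := pow_le_pow_of_le_one (by positivity) hz1 (by norm_num)
        _ = _ := pow_one _
    have ha0 := h1.2.2.1
    calc n * h n * ∫ ω, dev X μ n (fun z => G n (z 0)) ω ^ 2 ∂P
        ≤ n * h n * (q n ^ 2 * (Cf * (A ^ 2 * (2 * (2 * h n))) / n + 32 * A ^ 2 * a n)) := by
          gcongr
      _ ≤ n * h n * (rate n ^ 2 * (Cf * (A ^ 2 * (2 * (2 * h n))) / n + 32 * A ^ 2 * a n)) := by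
          gcongr
          exact h1.2.1
      _ = 4 * Cf * A ^ 2 * (rate n ^ 2 * h n ^ 2)
          + 32 * A ^ 2 * (rate n ^ 2 * (n * h n) * a n) := by
          field_simp
          ring
      _ ≤ 4 * Cf * A ^ 2 * (rate n)⁻¹ + 32 * A ^ 2 * (rate n)⁻¹ := by gcongr
      _ = (rate n)⁻¹ * (4 * Cf * A ^ 2 + 32 * A ^ 2) := by ring
      _ ≤ _ := h4
  refine (failsWithProbLE_of_integral_le (hint.const_mul (n * h n))
    (fun ω => by positivity) (by positivity : 0 < η ^ 2) key).mono fun ω hω => ?_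
  refine abs_le_of_sq_le_sq' ?_ hη.le |>.2
  rw [mul_pow, Real.sq_sqrt (by positivity), sq_abs]
  exact hω

/-- That n h³ ≥ 1 eventually permits undoing the multiplication by h which makes kernel weights
bounded. -/
lemma tendsto_sqrt_mul_bandwidth (hh : BandwidthOrder h) :
    ∀ᶠ n : ℕ in atTop, 1 ≤ √(n * h n) * h n := by
  obtain ⟨κ, -, hb⟩ := hh.eventually_bounds
  filter_upwards [hb, eventually_ge_atTop 1] with n h2 hn
  have hr1 := one_le_rate hn
  have hr : 0 < rate n := by linarith
  have hpos := h2.1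
  have hge : (rate n)⁻¹ ^ 101 ≤ h n := by
    rw [inv_pow]
    exact inv_le_of_inv_le₀ hpos h2.2.2.1
  rw [← Real.sqrt_sq hpos.le, ← Real.sqrt_mul (by rw [Real.sqrt_sq hpos.le]; positivity),
    Real.one_le_sqrt, Real.sqrt_sq hpos.le]
  calc (1 : ℝ) ≤ rate n ^ 197 := one_le_pow₀ hr1
    _ = rate n ^ 500 * (rate n)⁻¹ ^ 101 * ((rate n)⁻¹ ^ 101) ^ 2 := by field_simp
    _ ≤ n * h n * h n ^ 2 := by rw [rate_pow_five_hundred]; gcongr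

variable {K : ℝ → ℝ} {C : ℝ} {f : (Fin d → ℝ) → ℝ}

/-- A factor of order b on the support of the window cancels the 1/b of the scaled kernel and yields
a bounded local function. -/
lemma KernelBound.abs_scaled_mul_le (hK : KernelBound K C) {b : ℝ} (hb : 0 < b) {x : ℝ}
    {F : ℝ → ℝ} {A : ℝ} (hF : ∀ t, |t - x| ≤ b → |F t| ≤ A * b) (hA : 0 ≤ A) (t : ℝ) :
    |scaledKernel K b (t - x) * F t|
      ≤ C * A * (Icc (x - 2 * b) (x + 2 * b)).indicator (fun _ => 1) t := by
  have hC := zero_le_one.trans hK.one_le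
  rcases le_or_gt |t - x| b with ht | ht
  · have hmem : t ∈ Icc (x - 2 * b) (x + 2 * b) := by
      rw [abs_le] at ht
      exact ⟨by linarith, by linarith⟩
    simp only [hmem, Set.indicator_of_mem, mul_one]
    rw [abs_mul, abs_of_nonneg (hK.scaled_nonneg hb _)]
    calc scaledKernel K b (t - x) * |F t| ≤ C / b * (A * b) := by
          refine mul_le_mul ?_ (hF t ht) (abs_nonneg _) (by positivity)
          unfold scaledKernel
          gcongr
          exact hK.le _
      _ = C * A := by field_simp
  · rw [hK.scaled_eq_zero hb ht, zero_mul, abs_zero]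
    exact mul_nonneg (by positivity) (Set.indicator_nonneg (fun _ _ => zero_le_one) _)

/-- Consistency of the kernel density estimator at an interior point. -/
lemma Design.eventually_density_close (hd : Design P X (designLaw f) cf Cf)
    (hε : ∀ i, Measurable (ε i)) (hmixing : GeometricallyMixing P X ε) (hh : BandwidthOrder h)
    (hf : ContinuousOn f (Icc 0 1)) (hf0 : ∀ x ∈ Icc (0 : Fin d → ℝ) 1, 0 ≤ f x)
    (hK : KernelBound K C) {x : ℝ}
    (hx : ∀ᶠ n in atTop, x ∈ Icc (h n) (1 - h n)) {η δ : ℝ} (hη : 0 < η) (hδ : 0 < δ) :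
    ∀ᶠ n : ℕ in atTop, FailsWithProbLE P δ fun ω =>
      |emp X n (fun z => scaledKernel K (h n) (z 0 - x)) ω - sectionInt f x| ≤ η := by
  obtain ⟨κ, -, hb⟩ := hh.eventually_bounds
  have hC := zero_le_one.trans hK.one_le
  obtain ⟨Bf, -, hBf⟩ := exists_bound_clamp hf
  have hmean : Tendsto (fun n => ∫ z, scaledKernel K (h n) (z 0 - x) ∂designLaw f) atTop
      (𝓝 (sectionInt f x)) := by
    have h1 := tendsto_integral_window hK.meas
      (fun u => (abs_of_nonneg (hK.nonneg u)).trans_le (hK.le u)) hK.support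
      (continuous_sectionInt hf) (abs_sectionInt_le hBf) hh.tendsto_zero
      ((hb.mono fun n hn => hn.1).and hx)
    rw [hK.integral_eq_one, mul_one] at h1
    refine h1.congr' ?_
    filter_upwards [hb] with n hn
    have hpos := hn.1
    have h2 := integral_designLaw hf hf0 (w := fun _ => 1) continuousOn_const
      (hK.measurable_scaled (h n) x) (M := C / h n) fun t => by
        rw [abs_of_nonneg (hK.scaled_nonneg hpos _)]
        unfold scaledKernel
        gcongr
        exact hK.le _
    simp only [mul_one, one_mul] at h2
    rw [h2]
    exact integral_congr_ae (ae_of_all _ fun y => mul_comm _ _)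
  -- The kernel weights are of order 1/h, so they are multiplied by h to become bounded; the
  -- normalisation √(nh) h ≥ 1 compensates for this afterwards.
  have hdev := hd.eventually_dev_small hε hmixing hh
    (G := fun n t => scaledKernel K (h n) (t - x) * h n)
    (fun n => (hK.measurable_scaled _ _).mul_const _) (A := C * 1) (x := x) (by positivity)
    (by
      filter_upwards [hb] with n hn t
      have hpos := hn.1
      refine hK.abs_scaled_mul_le hpos (F := fun _ => h n) (fun t _ => ?_) zero_le_one t
      rw [one_mul, abs_of_pos hpos]) (half_pos hη) hδ
  filter_upwards [hdev, tendsto_sqrt_mul_bandwidth hh, hb,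
    hmean.eventually (Metric.closedBall_mem_nhds _ (half_pos hη))] with n h1 h2 h3 h4
  refine h1.mono fun ω hω => ?_
  have hpos := h3.1
  have e : dev X (designLaw f) n (fun z => scaledKernel K (h n) (z 0 - x) * h n) ω
      = h n * dev X (designLaw f) n (fun z => scaledKernel K (h n) (z 0 - x)) ω := by
    simp only [dev, emp, ← Finset.sum_mul, integral_mul_const]
    ring
  rw [e, abs_mul, abs_of_pos hpos, ← mul_assoc] at hω
  have h5 : |dev X (designLaw f) n (fun z => scaledKernel K (h n) (z 0 - x)) ω| ≤ η / 2 :=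
    (le_mul_of_one_le_left (abs_nonneg _) h2).trans hω
  rw [Real.dist_eq] at h4
  have e2 : emp X n (fun z => scaledKernel K (h n) (z 0 - x)) ω - sectionInt f x
      = dev X (designLaw f) n (fun z => scaledKernel K (h n) (z 0 - x)) ω
        + (∫ z, scaledKernel K (h n) (z 0 - x) ∂designLaw f - sectionInt f x) := by
    simp only [dev]; ring
  rw [e2]
  exact (abs_add_le _ _).trans (by linarith)

/-- The centered bias term is negligible. -/
lemma Design.eventually_bias_small (hd : Design P X (designLaw f) cf Cf)
    (hε : ∀ i, Measurable (ε i)) (hmixing : GeometricallyMixing P X ε) (hh : BandwidthOrder h)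
    (hf : ContinuousOn f (Icc 0 1)) (hf0 : ∀ x ∈ Icc (0 : Fin d → ℝ) 1, 0 ≤ f x)
    (hK : KernelBound K C) {m : ℝ → ℝ} (hm : Measurable m) {Bm Λ : ℝ} (hBm : ∀ t, |m t| ≤ Bm)
    (hΛ : ∀ t t', |m t - m t'| ≤ Λ * |t - t'|) {x m₁ D b : ℝ}
    (hT : (fun u => (m (x + u) - m x) * sectionInt f (x + u) - (m₁ * u + D * u ^ 2))
      =o[𝓝 0] fun u => u ^ 2)
    (hb' : b * sectionInt f x = (∫ u, u ^ 2 * K u) * D)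
    (hx : ∀ᶠ n in atTop, x ∈ Icc (h n) (1 - h n)) {η δ : ℝ} (hη : 0 < η) (hδ : 0 < δ) :
    ∀ᶠ n : ℕ in atTop, FailsWithProbLE P δ fun ω => √(n * h n)
      * |emp X n (fun z => scaledKernel K (h n) (z 0 - x) * (m (z 0) - m x - b * h n ^ 2)) ω|
        ≤ η := by
  obtain ⟨κ₀, -, hb⟩ := hh.eventually_bounds
  obtain ⟨κ, hκ, hu⟩ := hh.eventually_upper
  have hC := zero_le_one.trans hK.one_le
  have hΛ0 : 0 ≤ Λ := by
    have := hΛ 0 1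
    norm_num at this
    exact (abs_nonneg _).trans this
  obtain ⟨Bf, -, hBf⟩ := exists_bound_clamp hf
  have hbias := hK.tendsto_bias hm (continuous_sectionInt hf) (abs_sectionInt_le hBf) hT hb'
    (hb.mono fun n hn => hn.1) hh.tendsto_zero
  have hGm : ∀ n, Measurable fun t => scaledKernel K (h n) (t - x) * (m t - m x - b * h n ^ 2) :=
    fun n => (hK.measurable_scaled _ _).mul ((hm.sub_const _).sub_const _)
  -- By the Lipschitz property the centred integrand is of order h on the window, so it is a bounded
  -- local function and its fluctuation vanishes even after multiplication by √(nh).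
  have hdev := hd.eventually_dev_small hε hmixing hh
    (G := fun n t => scaledKernel K (h n) (t - x) * (m t - m x - b * h n ^ 2)) hGm
    (A := C * (Λ + |b|)) (x := x) (by positivity)
    (by
      filter_upwards [hb, hh.tendsto_zero.eventually (gt_mem_nhds one_pos)] with n hn hn1 t
      have hpos := hn.1
      refine hK.abs_scaled_mul_le hpos (F := fun t => m t - m x - b * h n ^ 2) (fun t ht => ?_)
        (by positivity) t
      calc |m t - m x - b * h n ^ 2| ≤ |m t - m x| + |b * h n ^ 2| := abs_sub _ _
        _ ≤ Λ * h n + |b| * h n := by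
            refine add_le_add ((hΛ t x).trans (by gcongr)) ?_
            rw [abs_mul, abs_of_nonneg (by positivity : 0 ≤ h n ^ 2)]
            gcongr
            nlinarith
        _ = _ := by ring) (half_pos hη) hδ
  filter_upwards [hdev, hb, hu, hx,
    hbias.eventually (Metric.closedBall_mem_nhds _ (by positivity : 0 < η / 2 / κ))]
    with n h1 h2 h3 h4 h5
  refine h1.mono fun ω hω => ?_
  have hpos := h2.1
  set G : (Fin d → ℝ) → ℝ := fun z => scaledKernel K (h n) (z 0 - x) * (m (z 0) - m x - b * h n ^ 2)
    with hG
  have hmean : ∫ z, G z ∂designLaw f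
      = ∫ v, (m (x + h n * v) - m x - b * h n ^ 2) * sectionInt f (x + h n * v) * K v := by
    have hBm0 : 0 ≤ Bm := (abs_nonneg _).trans (hBm 0)
    have e1 := integral_designLaw hf hf0 (w := fun _ => 1) continuousOn_const (hGm n)
      (M := C / h n * (Bm + Bm + |b * h n ^ 2|)) fun t => by
        rw [abs_mul, abs_of_nonneg (hK.scaled_nonneg hpos _)]
        refine mul_le_mul ?_ ?_ (abs_nonneg _) (by positivity)
        · unfold scaledKernel
          gcongr
          exact hK.le _
        · refine (abs_sub _ _).trans ?_
          gcongr
          exact (abs_sub _ _).trans (add_le_add (hBm _) (hBm _))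
    simp only [mul_one, one_mul] at e1
    rw [hG, e1, ← integral_unifOne_scaled hK.support
      (fun y => (m y - m x - b * h n ^ 2) * sectionInt f y) hpos h4]
    exact integral_congr_ae (ae_of_all _ fun y => by simp only; ring)
  rw [Real.dist_eq, sub_zero, ← hmean, abs_mul, abs_inv,
    abs_of_nonneg (by positivity : 0 ≤ h n ^ 2), inv_mul_le_iff₀ (by positivity)] at h5
  have e2 : emp X n G ω = dev X (designLaw f) n G ω + ∫ z, G z ∂designLaw f := by
    simp only [dev]; ring
  have h6 : √(n * h n) * |∫ z, G z ∂designLaw f| ≤ η / 2 := by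
    calc √(n * h n) * |∫ z, G z ∂designLaw f| ≤ √(n * h n) * (h n ^ 2 * (η / 2 / κ)) := by gcongr
      _ = (√(n * h n) * h n ^ 2) * (η / 2 / κ) := by ring
      _ ≤ κ * (η / 2 / κ) := by
          refine mul_le_mul_of_nonneg_right h3.1 (by positivity)
      _ = η / 2 := by field_simp
  rw [e2]
  calc √(n * h n) * |dev X (designLaw f) n G ω + ∫ z, G z ∂designLaw f|
      ≤ √(n * h n) * (|dev X (designLaw f) n G ω| + |∫ z, G z ∂designLaw f|) := by
        gcongr
        exact abs_add_le _ _
    _ ≤ η := by rw [mul_add]; linarith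

end Local

/-! ### Limit distribution of the backfitted estimator -/

section Limit

variable {Ω : Type*} [mΩ : MeasurableSpace Ω] {P : Measure Ω} [IsProbabilityMeasure P] {d : ℕ}
  [NeZero d] {X : ℕ → Ω → Fin d → ℝ} {ε : ℕ → Ω → ℝ} {cf Cf : ℝ}
  {h : ℕ → ℝ} {K : ℝ → ℝ} {C : ℝ} {f s : (Fin d → ℝ) → ℝ}

/-- The oracle responses equal m₁(X_{i1}) plus noise, and the kernel weights, normalised by their
sum, reproduce constants. This isolates noise, bias and density as three separate averages. -/
lemma oracleSmoother_sub_eq {n : ℕ} {ω : Ω} {c b x β : ℝ} {m : Fin d → ℝ → ℝ} {y : ℕ → ℝ}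
    (hy : ∀ i < n, y i = c + ∑ α, m α (X i ω α) + s (X i ω) * ε i ω)
    (hf : emp X n (fun z => scaledKernel K b (z 0 - x)) ω ≠ 0) :
    oracleSmoother K b c m n (fun i => X i ω) y x - m 0 x - β
      = (noiseAvg X ε n (fun z => scaledKernel K b (z 0 - x) * s z) ω
        + emp X n (fun z => scaledKernel K b (z 0 - x) * (m 0 (z 0) - m 0 x - β)) ω)
        / emp X n (fun z => scaledKernel K b (z 0 - x)) ω := by
  have hn : (n : ℝ)⁻¹ ≠ 0 := fun h0 => hf (by simp [emp, h0])
  have hD : ∑ i ∈ Finset.range n, scaledKernel K b (X i ω 0 - x) ≠ 0 := fun h0 =>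
    hf (by simp [emp, h0])
  have hresp : ∀ i ∈ Finset.range n, oracleResponse c m (fun i => X i ω) y i
      = m 0 (X i ω 0) + s (X i ω) * ε i ω := fun i hi => by
    have := Finset.add_sum_erase Finset.univ (fun α => m α (X i ω α)) (Finset.mem_univ 0)
    rw [oracleResponse, hy i (Finset.mem_range.1 hi)]
    linarith
  have hnum : ∑ i ∈ Finset.range n, scaledKernel K b (X i ω 0 - x)
        * oracleResponse c m (fun i => X i ω) y i
      = (m 0 x + β) * ∑ i ∈ Finset.range n, scaledKernel K b (X i ω 0 - x)
        + (∑ i ∈ Finset.range n, scaledKernel K b (X i ω 0 - x) * s (X i ω) * ε i ω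
          + ∑ i ∈ Finset.range n, scaledKernel K b (X i ω 0 - x)
            * (m 0 (X i ω 0) - m 0 x - β)) := by
    rw [Finset.mul_sum, ← Finset.sum_add_distrib, ← Finset.sum_add_distrib]
    refine Finset.sum_congr rfl fun i hi => ?_
    rw [hresp i hi]
    ring
  have hn' : (n : ℝ) ≠ 0 := fun h0 => hn (by rw [h0, inv_zero])
  simp only [oracleSmoother, nadarayaWatson, noiseAvg, emp, hnum]
  generalize (∑ i ∈ Finset.range n, scaledKernel K b (X i ω 0 - x)) = D at hD ⊢
  generalize (∑ i ∈ Finset.range n, scaledKernel K b (X i ω 0 - x) * s (X i ω) * ε i ω) = U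
  generalize (∑ i ∈ Finset.range n, scaledKernel K b (X i ω 0 - x)
    * (m 0 (X i ω 0) - m 0 x - β)) = V
  field_simp
  ring

lemma abs_scaledKernel_le (hK : KernelBound K C) (b u : ℝ) : |scaledKernel K b u| ≤ C / |b| := by
  rw [scaledKernel, abs_div, abs_of_nonneg (hK.nonneg _)]
  exact div_le_div_of_nonneg_right (hK.le _) (abs_nonneg _)

/-- After multiplication by h the squared scaled kernel is again a scaled kernel, built from K², so
the window limit applies and produces ∫ K² as the constant. -/
lemma tendsto_integral_sq_weight (hf : ContinuousOn f (Icc 0 1))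
    (hf0 : ∀ x ∈ Icc (0 : Fin d → ℝ) 1, 0 ≤ f x) (hs : ContinuousOn s (Icc 0 1))
    (hK : KernelBound K C) (hh : BandwidthOrder h) {x : ℝ}
    (hx : ∀ᶠ n in atTop, x ∈ Icc (h n) (1 - h n)) :
    Tendsto (fun n => h n * ∫ z, (scaledKernel K (h n) (z 0 - x) * s (clamp z)) ^ 2 ∂designLaw f)
      atTop (𝓝 (sectionInt (fun z => s z ^ 2 * f z) x * ∫ v, K v ^ 2)) := by
  obtain ⟨κ, -, hb⟩ := hh.eventually_bounds
  have hs2 : ContinuousOn (fun z => s z ^ 2) (Icc 0 1) := hs.pow 2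
  have hsf : ContinuousOn (fun z => s z ^ 2 * f z) (Icc 0 1) := hs2.mul hf
  obtain ⟨Bf, -, hBf⟩ := exists_bound_clamp hsf
  have hK2 : ∀ u, |K u ^ 2| ≤ C ^ 2 := fun u => by
    rw [abs_pow, abs_of_nonneg (hK.nonneg u)]
    exact pow_le_pow_left₀ (hK.nonneg u) (hK.le u) 2
  have h1 := tendsto_integral_window (hK.meas.pow_const 2) hK2
    (fun u hu => by rw [hK.support u hu]; norm_num)
    (continuous_sectionInt hsf) (abs_sectionInt_le hBf) hh.tendsto_zero
    ((hb.mono fun n hn => hn.1).and hx)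
  refine h1.congr' ?_
  filter_upwards [hb] with n hn
  have hpos := hn.1
  have h2 := integral_designLaw hf hf0 hs2 (ψ := fun y => scaledKernel K (h n) (y - x) ^ 2)
    ((hK.measurable_scaled (h n) x).pow_const 2) (M := (C / |h n|) ^ 2) fun t => by
      rw [abs_pow]
      exact pow_le_pow_left₀ (abs_nonneg _) (abs_scaledKernel_le hK _ _) 2
  simp only [mul_pow]
  rw [h2, ← integral_const_mul]
  refine integral_congr_ae (ae_of_all _ fun y => ?_)
  simp only [scaledKernel]
  field_simp

/-- Central limit theorem for the kernel-weighted noise. -/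
lemma WhiteNoise.tendstoInDistribution_kernel (hnoise : WhiteNoise P X ε)
    (hX : ∀ i, Measurable (X i)) (hε : ∀ i, Measurable (ε i))
    (hlaw : ∀ i, P.map (X i) = designLaw f) (hmixing : GeometricallyMixing P X ε)
    (hf : ContinuousOn f (Icc 0 1))
    (hf0 : ∀ x ∈ Icc (0 : Fin d → ℝ) 1, 0 ≤ f x) (hs : ContinuousOn s (Icc 0 1))
    (hK : KernelBound K C) (hh : BandwidthOrder h) {x : ℝ}
    (hx : ∀ᶠ n in atTop, x ∈ Icc (h n) (1 - h n)) (r : ℝ) {V : ℝ≥0}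
    (hV : r ^ 2 * (sectionInt (fun z => s z ^ 2 * f z) x * ∫ v, K v ^ 2) = V) :
    TendstoInDistribution (fun (n : ℕ) ω => √(n * h n)
        * noiseAvg X ε n (fun z => scaledKernel K (h n) (z 0 - x) * s (clamp z)) ω * r) atTop
      (id : ℝ → ℝ) (fun _ => P) (gaussianReal 0 V) := by
  obtain ⟨κ, -, hb⟩ := hh.eventually_bounds
  obtain ⟨S, hS0, hS⟩ := exists_bound_clamp hs
  have hC := zero_le_one.trans hK.one_le
  set g : ℕ → (Fin d → ℝ) → ℝ := fun n z =>
    √(n * h n) * (n : ℝ)⁻¹ * r * (scaledKernel K (h n) (z 0 - x) * s (clamp z)) with hg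
  have hgm : ∀ n, Measurable (g n) := fun n => Measurable.const_mul
    (((hK.measurable_scaled _ _).comp (measurable_pi_apply 0)).mul
      (continuous_comp_clamp hs).measurable) _
  have hgA : ∀ n z, |g n z| ≤ √(n * h n) * (n : ℝ)⁻¹ * |r| * (C / |h n| * S) := fun n z => by
    simp only [hg]
    rw [abs_mul, abs_mul, abs_mul, abs_mul (scaledKernel K _ _), abs_of_nonneg (Real.sqrt_nonneg _),
      abs_of_nonneg (by positivity : 0 ≤ (n : ℝ)⁻¹)]
    refine mul_le_mul_of_nonneg_left ?_ (by positivity)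
    exact mul_le_mul (abs_scaledKernel_le hK _ _) (hS z) (abs_nonneg _) (by positivity)
  -- The weights are of order (nh)^{-1/2}, so √A_n decays like a fixed power of n, far faster than
  -- rate⁴ grows; a weak lower bound for nh suffices.
  have hA0 : Tendsto (fun n : ℕ => rate n ^ 4
      * √(√(n * h n) * (n : ℝ)⁻¹ * |r| * (C / |h n| * S))) atTop (𝓝 0) := by
    have h1 := tendsto_rate_inv.mul_const (√(|r| * C * S))
    rw [zero_mul] at h1
    refine squeeze_zero' (Eventually.of_forall fun n =>
      mul_nonneg (pow_nonneg (rate_nonneg n) 4) (Real.sqrt_nonneg _)) ?_ h1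
    filter_upwards [hb, eventually_ge_atTop 1] with n h2 hn
    have hr1 := one_le_rate hn
    have hr : 0 < rate n := by linarith
    have hn0 : (0 : ℝ) < n := by exact_mod_cast hn
    have hpos := h2.1
    have hge : (rate n)⁻¹ ^ 101 ≤ h n := by
      rw [inv_pow]
      exact inv_le_of_inv_le₀ hpos h2.2.2.1
    have hnh : rate n ^ 20 ≤ √(n * h n) := by
      refine Real.le_sqrt_of_sq_le ?_
      calc (rate n ^ 20) ^ 2 = rate n ^ 40 := by ring
        _ ≤ rate n ^ 399 := pow_le_pow_right₀ hr1 (by norm_num)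
        _ = rate n ^ 500 * (rate n)⁻¹ ^ 101 := by field_simp
        _ ≤ _ := by rw [rate_pow_five_hundred]; gcongr
    have hrc : 0 ≤ |r| * C * S := by positivity
    have e : √(n * h n) * (n : ℝ)⁻¹ * |r| * (C / |h n| * S)
        = (√(n * h n))⁻¹ * (|r| * C * S) := by
      rw [abs_of_pos hpos]
      have h3 : √(n * h n) * √(n * h n) = n * h n := Real.mul_self_sqrt (by positivity)
      have h5 : √(n * h n) * (n : ℝ)⁻¹ * (h n)⁻¹ = (√(n * h n))⁻¹ := by
        refine eq_inv_of_mul_eq_one_left ?_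
        calc √(n * h n) * (n : ℝ)⁻¹ * (h n)⁻¹ * √(n * h n)
            = (√(n * h n) * √(n * h n)) * ((n : ℝ)⁻¹ * (h n)⁻¹) := by ring
          _ = 1 := by rw [h3]; field_simp
      rw [← h5]
      ring
    rw [e, Real.sqrt_mul (by positivity), ← mul_assoc]
    refine mul_le_mul_of_nonneg_right ?_ (Real.sqrt_nonneg _)
    have h5 : √((√(n * h n))⁻¹) ≤ (rate n)⁻¹ ^ 10 := by
      refine Real.sqrt_le_left (by positivity) |>.2 ?_
      calc (√(n * h n))⁻¹ ≤ (rate n ^ 20)⁻¹ := inv_anti₀ (by positivity) hnh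
        _ = ((rate n)⁻¹ ^ 10) ^ 2 := by rw [← inv_pow]; ring
    calc rate n ^ 4 * √((√(n * h n))⁻¹) ≤ rate n ^ 4 * (rate n)⁻¹ ^ 10 := by gcongr
      _ = (rate n)⁻¹ ^ 6 := by field_simp
      _ ≤ (rate n)⁻¹ ^ 1 :=
          pow_le_pow_of_le_one (by positivity) (inv_le_one_of_one_le₀ hr1) (by norm_num)
      _ = _ := pow_one _
  have hlim : Tendsto (fun n : ℕ => n * ∫ z, g n z ^ 2 ∂designLaw f) atTop (𝓝 V) := by
    rw [← hV]
    refine ((tendsto_integral_sq_weight hf hf0 hs hK hh hx).const_mul (r ^ 2)).congr' ?_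
    filter_upwards [hb, eventually_ge_atTop 1] with n h2 hn
    have hn0 : (0 : ℝ) < n := by exact_mod_cast hn
    have hpos := h2.1
    have h3 : √(n * h n) ^ 2 = n * h n := Real.sq_sqrt (by positivity)
    have e : ∀ z, g n z ^ 2
        = (r ^ 2 * h n * (n : ℝ)⁻¹) * (scaledKernel K (h n) (z 0 - x) * s (clamp z)) ^ 2 :=
      fun z => by
      simp only [hg]
      rw [mul_pow, mul_pow, mul_pow, h3]
      field_simp
    simp only [e]
    rw [integral_const_mul]
    field_simp
  have key := hnoise.tendstoInDistribution_sum hX hε hlaw hmixing hgm hgA hA0 hlim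
  have e : (fun (n : ℕ) ω => √(n * h n)
        * noiseAvg X ε n (fun z => scaledKernel K (h n) (z 0 - x) * s (clamp z)) ω * r)
      = fun n ω => ∑ i ∈ Finset.range n, g n (X i ω) * ε i ω := by
    funext n ω
    simp only [noiseAvg, Finset.mul_sum, Finset.sum_mul, hg]
    exact Finset.sum_congr rfl fun i _ => by ring
  rw [e]
  exact key

/-- The kernel-weighted noise is bounded in probability. -/
lemma SecondOrderNoise.exists_bound_kernel (hN : SecondOrderNoise P X (designLaw f) ε)
    (hX : ∀ i, Measurable (X i)) (hf : ContinuousOn f (Icc 0 1))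
    (hf0 : ∀ x ∈ Icc (0 : Fin d → ℝ) 1, 0 ≤ f x) (hs : ContinuousOn s (Icc 0 1))
    (hK : KernelBound K C) (hh : BandwidthOrder h) {x : ℝ}
    (hx : ∀ᶠ n in atTop, x ∈ Icc (h n) (1 - h n)) {δ : ℝ} (hδ : 0 < δ) :
    ∃ T > (0 : ℝ), ∀ᶠ n : ℕ in atTop, FailsWithProbLE P δ fun ω => |√(n * h n)
        * noiseAvg X ε n (fun z => scaledKernel K (h n) (z 0 - x) * s (clamp z)) ω| ≤ T := by
  obtain ⟨κ, -, hb⟩ := hh.eventually_bounds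
  obtain ⟨S, hS0, hS⟩ := exists_bound_clamp hs
  have hC := zero_le_one.trans hK.one_le
  set W := sectionInt (fun z => s z ^ 2 * f z) x * ∫ v, K v ^ 2 with hW
  refine ⟨√((|W| + 1) / δ), by positivity, ?_⟩
  filter_upwards [hb, eventually_ge_atTop 1, (tendsto_integral_sq_weight hf hf0 hs hK hh
    hx).eventually_le_const (lt_of_le_of_lt (le_abs_self W) (lt_add_one _))] with n h2 hn h3
  have hn0 : (0 : ℝ) < n := by exact_mod_cast hn
  have hpos := h2.1
  have hgm : Measurable fun z : Fin d → ℝ => scaledKernel K (h n) (z 0 - x) * s (clamp z) :=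
    ((hK.measurable_scaled _ _).comp (measurable_pi_apply 0)).mul
      (continuous_comp_clamp hs).measurable
  have hgb : ∀ z : Fin d → ℝ, |scaledKernel K (h n) (z 0 - x) * s (clamp z)| ≤ C / |h n| * S :=
    fun z => by
    rw [abs_mul]
    exact mul_le_mul (abs_scaledKernel_le hK _ _) (hS z) (abs_nonneg _) (by positivity)
  have h4 := hN.integral_noiseAvg_sq hX hgm hgb hn
  have hint := (hN.memLp_noiseAvg hX hgm hgb n).integrable_sq
  have hT : 0 < (|W| + 1) / δ := by positivity
  refine (failsWithProbLE_of_integral_le (hint.const_mul (n * h n)) (fun ω => by positivity)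
    hT ?_).mono fun ω hω => ?_
  · rw [integral_const_mul, h4, mul_div_cancel₀ _ hδ.ne']
    calc n * h n * ((∫ z, (scaledKernel K (h n) (z 0 - x) * s (clamp z)) ^ 2 ∂designLaw f) / n)
        = h n * ∫ z, (scaledKernel K (h n) (z 0 - x) * s (clamp z)) ^ 2 ∂designLaw f := by
          field_simp
      _ ≤ _ := h3
  · refine Real.abs_le_sqrt ?_
    rw [mul_pow, Real.sq_sqrt (by positivity)]
    exact hω

/-- Deterministic form of Slutsky's argument: Z is only bounded, not small, so the density estimate
φ must be closer to φ₁ than a multiple of η/T. The errors contribute η, 2η and 2η. -/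
lemma abs_div_sub_div_le {A Z R φ₁ φ T η r : ℝ} (hφ₁ : 0 < φ₁) (hφ : |φ - φ₁| ≤ r)
    (hr : r ≤ φ₁ / 2) (hT : 0 ≤ T) (hZ : |Z| ≤ T) (hrT : T * r ≤ η * φ₁ ^ 2) (hA : |A| ≤ η)
    (hR : |R| ≤ η * φ₁) : |A + (Z + R) / φ - Z * φ₁⁻¹| ≤ 5 * η := by
  have hη : 0 ≤ η := (abs_nonneg _).trans hA
  have hr0 : 0 ≤ r := (abs_nonneg _).trans hφ
  have h1 : φ₁ / 2 ≤ φ := by rw [abs_le] at hφ; linarith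
  have h0 : 0 < φ := by linarith
  have hinv : φ⁻¹ ≤ 2 * φ₁⁻¹ := by
    have := inv_anti₀ (by positivity) h1
    rwa [inv_div, div_eq_mul_inv] at this
  have e : A + (Z + R) / φ - Z * φ₁⁻¹ = A + Z * (φ₁ - φ) * φ₁⁻¹ * φ⁻¹ + R * φ⁻¹ := by
    field_simp
    ring
  have b1 : |Z * (φ₁ - φ) * φ₁⁻¹ * φ⁻¹| ≤ 2 * η := by
    rw [abs_mul, abs_mul, abs_mul, abs_of_pos (inv_pos.2 hφ₁), abs_of_pos (inv_pos.2 h0),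
      abs_sub_comm φ₁]
    calc |Z| * |φ - φ₁| * φ₁⁻¹ * φ⁻¹ ≤ T * r * φ₁⁻¹ * (2 * φ₁⁻¹) := by gcongr
      _ ≤ η * φ₁ ^ 2 * φ₁⁻¹ * (2 * φ₁⁻¹) := by gcongr
      _ = 2 * η := by field_simp
  have b2 : |R * φ⁻¹| ≤ 2 * η := by
    rw [abs_mul, abs_of_pos (inv_pos.2 h0)]
    calc |R| * φ⁻¹ ≤ η * φ₁ * (2 * φ₁⁻¹) := by gcongr
      _ = 2 * η := by field_simp
  rw [e]
  have := abs_add_three A (Z * (φ₁ - φ) * φ₁⁻¹ * φ⁻¹) (R * φ⁻¹)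
  linarith

lemma tendstoInMeasure_of_eventually_fails {D : ℕ → Ω → ℝ}
    (hD : ∀ η > (0 : ℝ), ∀ δ > (0 : ℝ), ∀ᶠ n in atTop, FailsWithProbLE P δ fun ω => |D n ω| ≤ η) :
    TendstoInMeasure P D atTop 0 := by
  rw [tendstoInMeasure_iff_norm]
  intro η hη
  rw [ENNReal.tendsto_nhds_zero]
  intro e he
  obtain ⟨e', he', he'e⟩ : ∃ e' : ℝ, 0 < e' ∧ ENNReal.ofReal e' ≤ e := by
    rcases eq_or_ne e ⊤ with rfl | htop
    · exact ⟨1, one_pos, le_top⟩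
    · exact ⟨e.toReal, ENNReal.toReal_pos he.ne' htop, (ENNReal.ofReal_toReal htop).le⟩
  filter_upwards [hD (η / 2) (by positivity) e' he'] with n hn
  refine (measure_mono fun ω hω => ?_).trans (hn.trans he'e)
  simp only [Set.mem_ofPred_eq, Pi.zero_apply, sub_zero, Real.norm_eq_abs, not_le] at hω ⊢
  linarith

lemma IsLittleOP.eventually_fails {T : ℕ → Ω → ℝ≥0∞} {a : ℕ → ℝ} (hT : IsLittleOP P T a)
    {η δ : ℝ} (hη : 0 < η) (hδ : 0 < δ) :
    ∀ᶠ n in atTop, FailsWithProbLE P δ fun ω => T n ω ≤ ENNReal.ofReal (η * a n) := by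
  filter_upwards [(hT η hη).eventually_le_const (ENNReal.ofReal_pos.2 hδ)] with n hn
  simpa only [FailsWithProbLE, not_le] using hn

end Limit

/-! ### Asymptotic normality of the backfitted estimator. -/

section Assembly

variable {Ω : Type*} [mΩ : MeasurableSpace Ω] {P : Measure Ω} [IsProbabilityMeasure P] {d : ℕ}
  [NeZero d] {X : ℕ → Ω → Fin d → ℝ} {Y ε : ℕ → Ω → ℝ} {f : (Fin d → ℝ) → ℝ}

lemma measurable_splineBasis (ν : Measure ℝ) (N : ℕ) (J : Fin N) :
    Measurable (splineBasis ν N J) := by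
  have h1 := measurable_bin N J
  have h2 := measurable_bin N (J + 1)
  unfold splineBasis centeredSpline
  fun_prop

/-- Convergence in distribution requires measurability of the estimator, and here the measurable
choice of the least squares solution enters; the uniform comparison works with outer probabilities.
-/
lemma measurable_spbk {N : ℕ} {K : ℝ → ℝ} (hK : Measurable K) (b : ℝ)
    {B : Fin d → Fin N → ℝ → ℝ} (hB : ∀ α J, Measurable (B α J)) (n : ℕ)
    (hX : ∀ i, Measurable (X i)) (hY : ∀ i, Measurable (Y i))
    {lam : Ω → ℝ × (Fin d → Fin N → ℝ)} (hlam : Measurable lam) (x : ℝ) :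
    Measurable fun ω => spbk K b B n (fun i => X i ω) (fun i => Y i ω) (lam ω) x := by
  have hXα : ∀ i α, Measurable fun ω => X i ω α := fun i α =>
    (measurable_pi_apply α).comp (hX i)
  have hl : ∀ α J, Measurable fun ω => (lam ω).2 α J := fun α J =>
    (measurable_pi_apply J).comp ((measurable_pi_apply α).comp (measurable_snd.comp hlam))
  have hs : ∀ i α, Measurable fun ω => ∑ J, (lam ω).2 α J * B α J (X i ω α) := fun i α =>
    Finset.measurable_fun_sum _ fun J _ => (hl α J).mul ((hB α J).comp (hXα i α))
  have hw : ∀ i, Measurable fun ω => scaledKernel K b (X i ω 0 - x) := fun i => by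
    unfold scaledKernel
    exact (hK.comp (((hXα i 0).sub_const x).div_const b)).div_const b
  have hp : ∀ i, Measurable fun ω => pseudoResponse B n (fun i => X i ω) (fun i => Y i ω) (lam ω) i :=
    fun i => by
    unfold pseudoResponse pilot
    refine ((hY i).sub ((Finset.measurable_fun_sum _ fun k _ => hY k).const_mul _)).sub
      (Finset.measurable_fun_sum _ fun α _ => (hs i α).sub
        ((Finset.measurable_fun_sum _ fun k _ => hs k α).const_mul _))
  unfold spbk nadarayaWatson
  exact (Finset.measurable_fun_sum _ fun i _ => (hw i).mul (hp i)).div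
    (Finset.measurable_fun_sum _ fun i _ => hw i)

/-- The clamped section agrees with the marginal density only on [0, 1], which at an interior point
is a neighbourhood and hence enough for the derivative. -/
lemma RegularDensity.hasDerivAt_sectionInt (hdensity : RegularDensity P X f) {x : ℝ}
    (hx : x ∈ Ioo (0 : ℝ) 1) :
    HasDerivAt (sectionInt f) (deriv (marginalDensity f 0) x) x := by
  have h1 : DifferentiableAt ℝ (marginalDensity f 0) x :=
    ((hdensity.marginal 0).differentiableOn one_ne_zero).differentiableAt
      (Icc_mem_nhds hx.1 hx.2)
  refine h1.hasDerivAt.congr_of_eventuallyEq ?_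
  filter_upwards [Icc_mem_nhds hx.1 hx.2] with t ht
  exact sectionInt_eq ht

/-- Asymptotic normality of the backfitted estimator. -/
theorem tendstoInDistribution_spbk (hX : ∀ i, Measurable (X i)) (hY : ∀ i, Measurable (Y i))
    (hε : ∀ i, Measurable (ε i)) {c : ℝ} {m : Fin d → ℝ → ℝ} {sig : (Fin d → ℝ) → ℝ} {K : ℝ → ℝ}
    {h : ℕ → ℝ} {N : ℕ → ℕ}
    (hmodel : AdditiveModel P X Y ε c m sig) (hsmooth : SmoothComponents m)
    (hmixing : GeometricallyMixing P X ε)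
    (hnoise : WhiteNoise P X ε) (hscale : RegularScale sig) (hdensity : RegularDensity P X f)
    (hkernel : IsSmoothingKernel K) (hbandwidth : BandwidthOrder h)
    {B : (n : ℕ) → Fin d → Fin (N n) → ℝ → ℝ} (hB : ∀ n α J, Measurable (B n α J))
    {lam : (n : ℕ) → Ω → ℝ × (Fin d → Fin (N n) → ℝ)} (hlam : ∀ n, Measurable (lam n))
    (huniform : IsLittleOP P
      (fun n ω => ⨆ x₁ ∈ Icc (0 : ℝ) 1, ENNReal.ofReal
        |spbk K (h n) (B n) n (fun i => X i ω) (fun i => Y i ω) (lam n ω) x₁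
          - oracleSmoother K (h n) c m n (fun i => X i ω) (fun i => Y i ω) x₁|)
      (fun n => (n : ℝ) ^ (-(2 / 5) : ℝ)))
    {x : ℝ} (hx : ∀ᶠ n in atTop, x ∈ Icc (h n) (1 - h n)) :
    TendstoInDistribution
      (fun (n : ℕ) ω => Real.sqrt (n * h n) *
        (spbk K (h n) (B n) n (fun i => X i ω) (fun i => Y i ω) (lam n ω) x
          - m 0 x - biasCoeff K (m 0) (marginalDensity f 0) x * h n ^ 2))
      atTop (id : ℝ → ℝ) (fun _ => P) (gaussianReal 0 (asympVar K f sig x).toNNReal) := by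
  obtain ⟨cf, Cf, S, Λ, Bm, C, hb, hmar⟩ := exists_boundedModel hX hε hmodel hsmooth hnoise hscale
    hdensity hkernel
  have hd := hb.design
  have hK := hb.kernel
  obtain ⟨κ₀, -, hbw⟩ := hbandwidth.eventually_bounds
  obtain ⟨κ, hκ, hup⟩ := hbandwidth.eventually_upper
  -- A single n with h_n > 0 and x in [h_n, 1 - h_n] already places x in the open interval.
  have hx01 : x ∈ Ioo (0 : ℝ) 1 := by
    obtain ⟨n, h1, h2⟩ := (hbw.and hx).exists
    have := h1.1
    exact ⟨by linarith [h2.1], by linarith [h2.2]⟩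
  have hxI : x ∈ Icc (0 : ℝ) 1 := Set.Ioo_subset_Icc_self hx01
  have hf0 : ∀ z ∈ Icc (0 : Fin d → ℝ) 1, 0 ≤ f z := fun z hz => by
    have := hb.density_nonneg z
    rwa [clamp_eq hz] at this
  set φ₁ := marginalDensity f 0 x with hφ₁
  have hφ₁pos : 0 < φ₁ := lt_of_lt_of_le hd.pos (hmar 0 x hxI).1
  have hsec : sectionInt f x = φ₁ := sectionInt_eq hxI
  set b := biasCoeff K (m 0) (marginalDensity f 0) x with hbdef
  set Z : ℕ → Ω → ℝ := fun n ω => √(n * h n)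
    * noiseAvg X ε n (fun z => scaledKernel K (h n) (z 0 - x) * sig (clamp z)) ω with hZ
  have hV : (φ₁⁻¹) ^ 2 * (sectionInt (fun z => sig z ^ 2 * f z) x * ∫ v, K v ^ 2)
      = ((asympVar K f sig x).toNNReal : ℝ) := by
    have e : (φ₁⁻¹) ^ 2 * (sectionInt (fun z => sig z ^ 2 * f z) x * ∫ v, K v ^ 2)
        = asympVar K f sig x := by
      rw [sectionInt_eq hxI, asympVar, condVariance, ← hφ₁]
      field_simp
    rw [e, Real.coe_toNNReal]
    rw [← e]
    refine mul_nonneg (sq_nonneg _) (mul_nonneg (integral_nonneg fun z => ?_)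
      (integral_nonneg fun v => sq_nonneg _))
    exact mul_nonneg (sq_nonneg _) (hf0 _ (clamp_mem _))
  have hCLT := hnoise.tendstoInDistribution_kernel hX hε hd.law hmixing hdensity.continuousOn hf0
    hscale.continuousOn hK hbandwidth hx φ₁⁻¹ hV
  -- Slutsky: the noise with the limiting density in the denominator carries the limit law, and the
  -- difference from the estimator tends to zero in probability.
  refine tendstoInDistribution_of_tendstoInMeasure_sub _ _ hCLT ?_ fun n => Measurable.aemeasurable
    ((((measurable_spbk hK.meas (h n) (hB n) n hX hY (hlam n) x).sub_const _).sub_const _).const_mul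
      _)
  refine tendstoInMeasure_of_eventually_fails fun η hη δ hδ => ?_
  have hbias : (fun u => (m 0 (clampOne (x + u)) - m 0 (clampOne x)) * sectionInt f (x + u)
      - ((deriv (m 0) x * sectionInt f x) * u + (deriv (deriv (m 0)) x * sectionInt f x / 2
        + deriv (m 0) x * deriv (marginalDensity f 0) x) * u ^ 2)) =o[𝓝 0] fun u => u ^ 2 := by
    refine taylor_product (m := fun t => m 0 (clampOne t)) ?_
      (hdensity.hasDerivAt_sectionInt hx01)
    refine (taylor_two hsmooth.first hx01).congr' ?_ EventuallyEq.rfl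
    have ht : Tendsto (fun u : ℝ => x + u) (𝓝 0) (𝓝 x) := by
      have : Continuous fun u : ℝ => x + u := by fun_prop
      simpa using this.tendsto 0
    filter_upwards [ht (Icc_mem_nhds hx01.1 hx01.2)] with u hu
    rw [clampOne_eq hu, clampOne_eq hxI]
  -- The bias coefficient is defined so that, multiplied by the density, it equals the second moment
  -- of the kernel times the quadratic Taylor coefficient.
  have hbeq : b * sectionInt f x = (∫ u, u ^ 2 * K u) * (deriv (deriv (m 0)) x * sectionInt f x / 2
        + deriv (m 0) x * deriv (marginalDensity f 0) x) := by
    rw [hsec, hbdef, biasCoeff, ← hφ₁]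
    field_simp
  have hΛ0 : 0 ≤ Λ := by
    have := hb.lipschitz 0 0 (by norm_num) 1 (by norm_num)
    norm_num at this
    exact (abs_nonneg _).trans this
  have hLip : ∀ t t', |m 0 (clampOne t) - m 0 (clampOne t')| ≤ Λ * |t - t'| := fun t t' => by
    have h1 := hb.lipschitz 0 (clampOne t) (clampOne_mem t) (clampOne t') (clampOne_mem t')
    simp only [clampOne_eq (clampOne_mem _)] at h1
    refine h1.trans (mul_le_mul_of_nonneg_left ?_ hΛ0)
    unfold clampOne
    refine (abs_max_sub_max_le_max _ _ _ _).trans ?_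
    rw [sub_self, abs_zero, max_eq_right (abs_nonneg _)]
    refine (abs_min_sub_min_le_max _ _ _ _).trans ?_
    rw [sub_self, abs_zero, max_eq_right (abs_nonneg _)]
  have hη5 : 0 < η / 5 := by positivity
  have hδ4 : 0 < δ / 4 := by positivity
  obtain ⟨T, hT, hTn⟩ := hb.noise.exists_bound_kernel hX hdensity.continuousOn hf0
    hscale.continuousOn hK hbandwidth hx hδ4
  -- The accuracy of the density estimate: half of φ₁ keeps the denominator away from zero, and the
  -- second bound makes the product with the noise level T smaller than η/5 times φ₁².
  set r := min (φ₁ / 2) (η / 5 * φ₁ ^ 2 / T) with hr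
  have hr0 : 0 < r := by positivity
  have hrT : T * r ≤ η / 5 * φ₁ ^ 2 := by
    have := min_le_right (φ₁ / 2) (η / 5 * φ₁ ^ 2 / T)
    rw [← hr, le_div_iff₀ hT] at this
    linarith
  have hresp : ∀ᵐ ω ∂P, ∀ i, Y i ω = c + (∑ α, m α (X i ω α)) + sig (X i ω) * ε i ω :=
    ae_all_iff.2 hmodel.response
  have hgood : ∀ᵐ ω ∂P, ∀ i, Y i ω = c + (∑ α, m α (clampOne (X i ω α)))
      + sig (clamp (X i ω)) * ε i ω ∧ ∀ α, clampOne (X i ω α) = X i ω α := by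
    filter_upwards [hresp, hd.ae_mem_Ico] with ω h1 h2 i
    have h3 : ∀ α, clampOne (X i ω α) = X i ω α := fun α =>
      clampOne_eq ⟨(h2 i α).1, (h2 i α).2.le⟩
    refine ⟨?_, h3⟩
    simp only [h3]
    rw [clamp_eq ⟨fun α => (h2 i α).1, fun α => (h2 i α).2.le⟩]
    exact h1 i
  filter_upwards [hTn, hbw, hup,
    hd.eventually_density_close hε hmixing hbandwidth hdensity.continuousOn hf0 hK hx hr0 hδ4,
    hd.eventually_bias_small hε hmixing hbandwidth hdensity.continuousOn hf0 hK
      (hb.comp_meas 0) (hb.comp_le 0) hLip hbias hbeq hx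
      (by positivity : 0 < η / 5 * φ₁) hδ4,
    huniform.eventually_fails (by positivity : 0 < η / 5 / κ) hδ4]
    with n e1 e2 e3 e4 e5 e6
  have e0 := failsWithProbLE_of_ae hgood
  have hall := ((((e1.and hδ4.le hδ4.le e4).and (by positivity) hδ4.le e5).and (by positivity)
    hδ4.le e6).and (by positivity) le_rfl e0)
  rw [show δ / 4 + δ / 4 + δ / 4 + δ / 4 + 0 = δ by ring] at hall
  refine hall.mono ?_
  rintro ω ⟨⟨⟨⟨w1, w2⟩, w3⟩, w4⟩, w5⟩
  rw [hsec] at w2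
  have hc1 : ∀ i α, clampOne (X i ω α) = X i ω α := fun i => (w5 i).2
  have hpos := e2.1
  have hne : emp X n (fun z => scaledKernel K (h n) (z 0 - x)) ω ≠ 0 := by
    have h1 := min_le_left (φ₁ / 2) (η / 5 * φ₁ ^ 2 / T)
    rw [← hr] at h1
    rw [abs_le] at w2
    exact ne_of_gt (by linarith)
  have horacle := oracleSmoother_sub_eq (X := X) (ε := ε) (m := fun α t => m α (clampOne t))
    (s := fun z => sig (clamp z)) (n := n) (b := h n) (x := x) (β := b * h n ^ 2)
    (y := fun i => Y i ω) (fun i _ => (w5 i).1) hne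
  have ho : oracleSmoother K (h n) c (fun α t => m α (clampOne t)) n (fun i => X i ω)
      (fun i => Y i ω) x = oracleSmoother K (h n) c m n (fun i => X i ω) (fun i => Y i ω) x := by
    unfold oracleSmoother oracleResponse
    simp only [hc1]
  rw [ho, clampOne_eq hxI] at horacle
  have hA : |√(n * h n)
      * (spbk K (h n) (B n) n (fun i => X i ω) (fun i => Y i ω) (lam n ω) x
        - oracleSmoother K (h n) c m n (fun i => X i ω) (fun i => Y i ω) x)| ≤ η / 5 := by
    -- The pointwise comparison is read off from the uniform one.
    have h1 := (ENNReal.ofReal_le_ofReal_iff (by positivity)).1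
      ((le_iSup₂ (f := fun x₁ (_ : x₁ ∈ Icc (0 : ℝ) 1) => ENNReal.ofReal
        |spbk K (h n) (B n) n (fun i => X i ω) (fun i => Y i ω) (lam n ω) x₁
          - oracleSmoother K (h n) c m n (fun i => X i ω) (fun i => Y i ω) x₁|) x hxI).trans w4)
    rw [abs_mul, abs_of_nonneg (Real.sqrt_nonneg _)]
    calc _ ≤ √(n * h n) * (η / 5 / κ * (n : ℝ) ^ (-(2 / 5) : ℝ)) := by gcongr
      _ = (√(n * h n) * (n : ℝ) ^ (-(2 / 5) : ℝ)) * (η / 5 / κ) := by ring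
      _ ≤ κ * (η / 5 / κ) := mul_le_mul_of_nonneg_right e3.2 (by positivity)
      _ = _ := by field_simp
  set R := √(n * h n) * emp X n (fun z => scaledKernel K (h n) (z 0 - x)
    * (m 0 (clampOne (z 0)) - m 0 (clampOne x) - b * h n ^ 2)) ω with hR
  have hRle : |R| ≤ η / 5 * φ₁ := by
    rw [hR, abs_mul, abs_of_nonneg (Real.sqrt_nonneg _)]
    exact w3
  have hfin := abs_div_sub_div_le hφ₁pos w2 (min_le_left _ _) hT.le w1 hrT hA hRle
  -- The normalised error is the comparison error plus the quotient of noise and bias by the density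
  -- estimate, the form required by `abs_div_sub_div_le`.
  have e : √(n * h n) * (spbk K (h n) (B n) n (fun i => X i ω) (fun i => Y i ω) (lam n ω) x
        - m 0 x - b * h n ^ 2)
      = √(n * h n) * (spbk K (h n) (B n) n (fun i => X i ω) (fun i => Y i ω) (lam n ω) x
        - oracleSmoother K (h n) c m n (fun i => X i ω) (fun i => Y i ω) x)
        + (Z n ω + R) / emp X n (fun z => scaledKernel K (h n) (z 0 - x)) ω := by
    rw [hR, clampOne_eq hxI, hZ, ← mul_add, mul_div_assoc, ← horacle]
    ring
  simp only [Pi.sub_apply]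
  rw [e]
  calc _ ≤ 5 * (η / 5) := hfin
    _ = η := by ring

end Assembly

end SPBK

end

theorem theorem2p1 {Ω : Type*} [MeasurableSpace Ω] (P : Measure Ω) [IsProbabilityMeasure P]
    {d : ℕ} [NeZero d]
    -- the process of predictors, responses and noise variables
    (X : ℕ → Ω → Fin d → ℝ) (Y ε : ℕ → Ω → ℝ)
    (hX : ∀ i, Measurable (X i)) (hY : ∀ i, Measurable (Y i)) (hε : ∀ i, Measurable (ε i))
    -- constant, component functions, conditional standard deviation, design density
    (c : ℝ) (m : Fin d → ℝ → ℝ) (sig f : (Fin d → ℝ) → ℝ)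
    -- kernel, bandwidths, numbers of interior knots
    (K : ℝ → ℝ) (h : ℕ → ℝ) (N : ℕ → ℕ)
    (hmodel : SPBK.AdditiveModel P X Y ε c m sig)
    (hsmooth : SPBK.SmoothComponents m)
    (hmixing : SPBK.GeometricallyMixing P X ε)
    (hnoise : SPBK.WhiteNoise P X ε)
    (hscale : SPBK.RegularScale sig)
    (hdensity : SPBK.RegularDensity P X f)
    (hkernel : SPBK.IsSmoothingKernel K)
    (hbandwidth : SPBK.BandwidthOrder h)
    (hknots : SPBK.KnotOrder N)
    -- the standardized spline basis of each coordinate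
    (B : (n : ℕ) → Fin d → Fin (N n) → ℝ → ℝ)
    (hB : ∀ n α, B n α = SPBK.splineBasis (P.map (fun ω => X 0 ω α)) (N n))
    -- solutions of the least squares problems
    (lam : (n : ℕ) → Ω → ℝ × (Fin d → Fin (N n) → ℝ))
    (hlam_meas : ∀ n, Measurable (lam n))
    (hlam : ∀ n ω, SPBK.IsLeastSquares (B n) n (fun i => X i ω) (fun i => Y i ω) (lam n ω)) :
    SPBK.IsLittleOP P
        (fun n ω => ⨆ x₁ ∈ Set.Icc (0 : ℝ) 1, ENNReal.ofReal
          |SPBK.spbk K (h n) (B n) n (fun i => X i ω) (fun i => Y i ω) (lam n ω) x₁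
            - SPBK.oracleSmoother K (h n) c m n (fun i => X i ω) (fun i => Y i ω) x₁|)
        (fun n => (n : ℝ) ^ (-(2 / 5) : ℝ)) ∧
      ∀ x₁ : ℝ, (∀ᶠ n in atTop, x₁ ∈ Set.Icc (h n) (1 - h n)) →
        TendstoInDistribution
          (fun (n : ℕ) ω => Real.sqrt (n * h n) *
            (SPBK.spbk K (h n) (B n) n (fun i => X i ω) (fun i => Y i ω) (lam n ω) x₁
              - m 0 x₁
              - SPBK.biasCoeff K (m 0) (SPBK.marginalDensity f 0) x₁ * h n ^ 2))
          atTop (id : ℝ → ℝ) (fun _ => P)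
          (gaussianReal 0 (SPBK.asympVar K f sig x₁).toNNReal) := by
  have hB' : ∀ n, B n = fun α => SPBK.splineBasis (P.map fun ω => X 0 ω α) (N n) := fun n =>
    funext fun α => hB n α
  obtain rfl : B = fun n α => SPBK.splineBasis (P.map fun ω => X 0 ω α) (N n) := funext hB'
  have huniform := SPBK.isLittleOP_spbk_sub_oracleSmoother hX hε hmodel hsmooth hmixing hnoise
    hscale hdensity hkernel hbandwidth hknots hlam
  exact ⟨huniform, fun x hx => SPBK.tendstoInDistribution_spbk hX hY hε hmodel hsmooth hmixing
    hnoise hscale hdensity hkernel hbandwidth (fun n α J => SPBK.measurable_splineBasis _ _ J)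
    hlam_meas huniform hx⟩
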